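/- Consider the Sturm–Liouville problem $$-y''+qy=\lambda y\ \text{ on }(-1,1),\qquad \alpha_L y(-1)+\beta_L y'(-1)=0,\qquad \alpha_R y(1)+\beta_R y'(1)=0,$$ with $(\alpha_L,\beta_L)\ne(0,0)\ne(\alpha_R,\beta_R)$ and $$q(x)=\sum_{i=1}^S\frac{g_i(x)}{(1-x)^{\beta_i}(1+x)^{\gamma_i}},\qquad \beta_i,\gamma_i<1,$$ where each $g_i$ is real-valued on $[-1,1]$ and analytic inside and on a Bernstein ellipse containing $[-1,1]$, and $q$ is unbounded at one endpoint at least. Write $\langle u,v\rangle=\int_{-1}^1uv\,dx$ and $\langle u,v\rangle_{(\beta,\gamma)}=\int_{-1}^1 u\,v\,(1-x)^{-\beta}(1+x)^{-\gamma}dx$. Let $P_n$ be the Legendre polynomials and $R_n=\xi_nP_n+\eta_nP_{n+1}+\theta_nP_{n+2}$ $(n\ge0)$ polynomials that satisfy the boundary conditions, with $\max(|\xi_n|,|\eta_n|,|\theta_n|)=1$, $\xi_n\ge0$, and $\eta_n=0$ if $\alpha_L\beta_R+\alpha_R\beta_L=0$, such that, for all large $N$, $R_0,\dots,R_{N-1}$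 span the space of all polynomials of degree at most $N+1$ that satisfy the boundary conditions. Put $a_{mn}=-\langle R_m,R_n''\rangle$, $b_{mn}=\langle R_m,R_n\rangle$, $q_{mn}=\langle R_m,qR_n\rangle$. Fix $k\ge1$. Let $\lambda$ be the $k$-th smallest eigenvalue of the problem, $y$ an eigenfunction for it, and $y=\sum_{n\ge0}c_nR_n$ its expansion (convergence in $L^2(-1,1)$). For all large $N$, let $\lambda^{(N)}$ be the $k$-th smallest eigenvalue (with multiplicity) of $(A_N+Q_N)\zeta=\lambda^{(N)}B_N\zeta$, where $A_N,Q_N,B_N$ are the $N\times N$ matrices with entries $a_{mn},q_{mn},b_{mn}$ $(0\le m,n<N)$, let $\zeta_N\neq0$ be an eigenvector for it, and $z_N=\sum_{n<N}\zeta_{n,N}R_n$. Below, $u\sim v$ means that $u=(1+o(1))v$ as the index tends to infinity, with $k$ fixed. **(1) Coefficients.** $a_{nn}>0$ for all large $n$. Put $$v_n=-\frac{\langle R_n,qy\rangle}{a_{nn}}=-\sum_{i=1}^S\frac{\langle R_n,g_iy\rangle_{(\beta_i,\gamma_i)}}{a_{nn}}$$ (the two expressions are equal). Then, as $n\to\infty$,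 $$c_n=v_n+o\bigl(|v_n|+|v_{n+1}|\bigr).$$ In particular $c_n\sim v_n$ if $v_{n+1}=O(v_n)$. Moreover $c_n\sim v_n$ if the problem is symmetric, that is, $q$ is even and $\alpha_L\beta_R+\alpha_R\beta_L=0$. **(2) Eigenvalue error.** For all large $N$, $\langle z_N,y\rangle\neq0$ and the series below converge absolutely; and, as $N\to\infty$, $$\lambda-\lambda^{(N)}\sim\frac1{\langle z_N,y\rangle}\sum_{n=N}^\infty c_n\langle R_n,qz_N\rangle,\qquad \lambda-\lambda^{(N)}\sim-\frac1{\langle z_N,y\rangle}\sum_{i,j=1}^S\Delta_{ij},$$ $$\Delta_{ij}=\sum_{n=N}^{\infty}\frac1{a_{nn}}\langle R_n,g_iy\rangle_{(\beta_i,\gamma_i)}\langle R_n,g_jz_N\rangle_{(\beta_j,\gamma_j)}.$$ -/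

import Mathlib

open Filter Topology Polynomial Asymptotics

namespace SturmLiouvilleGalerkin

/-- The closed region bounded by the Bernstein ellipse with foci `1`, `-1` and parameter `ρ`
(sum of the semi-axes), so that the sum of the distances to the foci is at most `ρ + ρ⁻¹`. -/
def bernsteinRegion (ρ : ℝ) : Set ℂ :=
  {z | ‖z - 1‖ + ‖z + 1‖ ≤ ρ + ρ⁻¹}

/-- `g` is analytic inside and on a Bernstein ellipse that contains `[-1, 1]`. -/
def AnalyticOnBernsteinEllipse (g : ℝ → ℝ) : Prop :=
  ∃ ρ : ℝ, 1 < ρ ∧ ∃ G : ℂ → ℂ, AnalyticOnNhd ℂ G (bernsteinRegion ρ) ∧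
    ∀ x ∈ Set.Icc (-1 : ℝ) 1, G (x : ℂ) = ((g x : ℝ) : ℂ)

/-- The data of a Sturm-Liouville problem `-y'' + q y = λ y` on `(-1, 1)` with boundary conditions
`aL y(-1) + bL y'(-1) = 0`, `aR y(1) + bR y'(1) = 0` and potential
`q(x) = ∑ i, g i x / ((1 - x) ^ β i * (1 + x) ^ γ i)`. -/
structure Problem (S : ℕ) where
  aL : ℝ
  bL : ℝ
  aR : ℝ
  bR : ℝ
  β : Fin S → ℝ
  γ : Fin S → ℝ
  g : Fin S → ℝ → ℝ
  left_ne : aL ^ 2 + bL ^ 2 ≠ 0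
  right_ne : aR ^ 2 + bR ^ 2 ≠ 0
  β_lt : ∀ i, β i < 1
  γ_lt : ∀ i, γ i < 1
  g_analytic : ∀ i, AnalyticOnBernsteinEllipse (g i)

/-- The inner product of `L²(-1, 1)`. -/
noncomputable def ip (u v : ℝ → ℝ) : ℝ :=
  ∫ x in (-1 : ℝ)..1, u x * v x

/-- The weighted inner product with weight `(1 - x) ^ (-β) * (1 + x) ^ (-γ)`. -/
noncomputable def wip (β γ : ℝ) (u v : ℝ → ℝ) : ℝ :=
  ∫ x in (-1 : ℝ)..1, u x * v x / ((1 - x) ^ β * (1 + x) ^ γ)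

/-- The Legendre polynomial of degree `n`, through the formula of Rodrigues. -/
noncomputable def legendre (n : ℕ) : ℝ[X] :=
  C ((2 ^ n * (n.factorial : ℝ))⁻¹) * derivative^[n] ((X ^ 2 - 1) ^ n)

namespace Problem

variable {S : ℕ}

/-- The potential (used on the open interval `(-1, 1)` only). -/
noncomputable def q (p : Problem S) (x : ℝ) : ℝ :=
  ∑ i, p.g i x / ((1 - x) ^ p.β i * (1 + x) ^ p.γ i)

/-- The potential is unbounded on `(-1, 1)`. As it is continuous there, this means that it is
unbounded at one endpoint at least. -/
def UnboundedPotential (p : Problem S) : Prop :=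
  ¬ ∃ M : ℝ, ∀ x ∈ Set.Ioo (-1 : ℝ) 1, |p.q x| ≤ M

/-- The boundary conditions are symmetric. -/
def SymmetricBC (p : Problem S) : Prop :=
  p.aL * p.bR + p.aR * p.bL = 0

/-- `y` is an eigenfunction for the eigenvalue `lam`: a function that is not identically zero on
`[-1, 1]`, is continuously differentiable on `[-1, 1]` (one-sided derivatives at the endpoints) and
twice differentiable on `(-1, 1)`, and satisfies the equation and the boundary conditions. -/
structure IsEigenfunction (p : Problem S) (lam : ℝ) (y : ℝ → ℝ) : Prop where
  ne_zero : ∃ x ∈ Set.Icc (-1 : ℝ) 1, y x ≠ 0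
  contDiffOn : ContDiffOn ℝ 1 y (Set.Icc (-1) 1)
  differentiableAt : ∀ x ∈ Set.Ioo (-1 : ℝ) 1,
    DifferentiableAt ℝ (derivWithin y (Set.Icc (-1) 1)) x
  equation : ∀ x ∈ Set.Ioo (-1 : ℝ) 1,
    -deriv (derivWithin y (Set.Icc (-1) 1)) x + p.q x * y x = lam * y x
  left_bc : p.aL * y (-1) + p.bL * derivWithin y (Set.Icc (-1) 1) (-1) = 0
  right_bc : p.aR * y 1 + p.bR * derivWithin y (Set.Icc (-1) 1) 1 = 0

/-- `lam` is an eigenvalue. -/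
def IsEigenvalue (p : Problem S) (lam : ℝ) : Prop :=
  ∃ y, p.IsEigenfunction lam y

/-- `lam` is the eigenvalue of index `k`, in the increasing numbering that starts from `1`
(the eigenvalues are simple). -/
def IsEigenvalueOfIndex (p : Problem S) (k : ℕ) (lam : ℝ) : Prop :=
  p.IsEigenvalue lam ∧ {μ : ℝ | p.IsEigenvalue μ ∧ μ < lam}.encard + 1 = (k : ℕ∞)

/-- A polynomial satisfies the two boundary conditions. -/
def PolyBC (p : Problem S) (r : ℝ[X]) : Prop :=
  p.aL * r.eval (-1) + p.bL * (derivative r).eval (-1) = 0 ∧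
    p.aR * r.eval 1 + p.bR * (derivative r).eval 1 = 0

/-- `R` is a Legendre-Galerkin basis: `R n = ξ n P_n + η n P_{n+1} + θ n P_{n+2}` satisfies the
boundary conditions, with `‖(ξ n, η n, θ n)‖_∞ = 1`, `ξ n ≥ 0`, and `η n = 0` if the boundary
conditions are symmetric; and `R 0, …, R (N-1)` span the space of the polynomials of degree at most
`N + 1` that satisfy the boundary conditions. The spanning is asked for large `N` only, since for
some boundary conditions that space has dimension different from `N` for the smallest values
of `N`. -/
structure IsBasis (p : Problem S) (R : ℕ → ℝ[X]) : Prop where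
  form : ∀ n, ∃ ξ η θ : ℝ,
    R n = C ξ * legendre n + C η * legendre (n + 1) + C θ * legendre (n + 2) ∧
      max |ξ| (max |η| |θ|) = 1 ∧ 0 ≤ ξ ∧ (p.SymmetricBC → η = 0)
  bc : ∀ n, p.PolyBC (R n)
  span : ∀ᶠ N in atTop, (Submodule.span ℝ (R '' Set.Iio N) : Set ℝ[X]) =
    {r : ℝ[X] | r.natDegree ≤ N + 1 ∧ p.PolyBC r}

end Problem

/-- A polynomial as a function. -/
noncomputable def fn (r : ℝ[X]) : ℝ → ℝ := fun x => r.eval x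

/-- `a_{mn} = -⟨R_m, R_n''⟩`. -/
noncomputable def aEntry (R : ℕ → ℝ[X]) (m n : ℕ) : ℝ :=
  -ip (fn (R m)) (fn (derivative (derivative (R n))))

/-- `b_{mn} = ⟨R_m, R_n⟩`. -/
noncomputable def bEntry (R : ℕ → ℝ[X]) (m n : ℕ) : ℝ :=
  ip (fn (R m)) (fn (R n))

namespace Problem

variable {S : ℕ}

/-- `q_{mn} = ⟨R_m, q R_n⟩`. -/
noncomputable def qEntry (p : Problem S) (R : ℕ → ℝ[X]) (m n : ℕ) : ℝ :=
  ip (fn (R m)) (fun x => p.q x * fn (R n) x)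

/-- The matrix pencil `A_N + Q_N - μ B_N`. -/
noncomputable def pencil (p : Problem S) (R : ℕ → ℝ[X]) (N : ℕ) (μ : ℝ) :
    Matrix (Fin N) (Fin N) ℝ :=
  Matrix.of fun m n => aEntry R m n + p.qEntry R m n - μ * bEntry R m n

/-- The eigenspace `{ζ | (A_N + Q_N) ζ = μ B_N ζ}`. -/
noncomputable def numEigenspace (p : Problem S) (R : ℕ → ℝ[X]) (N : ℕ) (μ : ℝ) :
    Submodule ℝ (Fin N → ℝ) :=
  LinearMap.ker (Matrix.toLin' (p.pencil R N μ))

/-- `μ` is the `k`-th smallest numerical eigenvalue, in the numbering that starts from `1` and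
counts multiplicities. -/
def IsNumEigenvalueOfIndex (p : Problem S) (R : ℕ → ℝ[X]) (N k : ℕ) (μ : ℝ) : Prop :=
  Module.finrank ℝ ↥(⨆ ν : Set.Iio μ, p.numEigenspace R N (ν : ℝ)) < k ∧
    k ≤ Module.finrank ℝ ↥(⨆ ν : Set.Iic μ, p.numEigenspace R N (ν : ℝ))

end Problem

/-- The numerical eigenfunction `z_N = ∑ n < N, ζ_n R_n`. -/
noncomputable def zFun (R : ℕ → ℝ[X]) {N : ℕ} (ζ : Fin N → ℝ) : ℝ → ℝ :=
  fun x => ∑ n : Fin N, ζ n * fn (R n) x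

/-- `y = ∑ n, c_n R_n`, with convergence in `L²(-1, 1)`. -/
def HasExpansion (R : ℕ → ℝ[X]) (y : ℝ → ℝ) (c : ℕ → ℝ) : Prop :=
  Tendsto (fun N : ℕ => ∫ x in (-1 : ℝ)..1, (y x - ∑ n ∈ Finset.range N, c n * fn (R n) x) ^ 2)
    atTop (𝓝 0)

/-- The term of index `n` of the series `Δ_{ij}`. -/
noncomputable def Problem.deltaTerm {S : ℕ} (p : Problem S) (R : ℕ → ℝ[X]) (y z : ℝ → ℝ)
    (i j : Fin S) (n : ℕ) : ℝ :=
  1 / aEntry R n n * wip (p.β i) (p.γ i) (fn (R n)) (fun x => p.g i x * y x) *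
    wip (p.β j) (p.γ j) (fn (R n)) (fun x => p.g j x * z x)

/-- `Δ_{ij}`, the sum of the terms of index `n ≥ N`. -/
noncomputable def Problem.delta {S : ℕ} (p : Problem S) (R : ℕ → ℝ[X]) (y z : ℝ → ℝ) (N : ℕ)
    (i j : Fin S) : ℝ :=
  ∑' n : ℕ, p.deltaTerm R y z i j (N + n)

/-- The estimate `-⟨R_n, q y⟩ / a_{nn}` of the coefficient `c_n`. -/
noncomputable def Problem.cApprox {S : ℕ} (p : Problem S) (R : ℕ → ℝ[X]) (y : ℝ → ℝ) (n : ℕ) : ℝ :=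
  -(ip (fn (R n)) (fun x => p.q x * y x) / aEntry R n n)

end SturmLiouvilleGalerkin

/-! The proof rests on two facts about the basis. The stiffness matrix is diagonal: `⟨R m, R n''⟩`
vanishes for `m ≠ n`, by Green's identity and a comparison of degrees (`aEntry_of_ne`). And `R n` is
close to `P_n - P_{n+2}` (`Problem.IsBasis.exists_coeff`).

*Coefficients.* Pairing the expansion of `y` with `-R n''` gives, by the equation for `y`,
`c n * a n = lam * ⟨R n, y⟩ - ⟨R n, q y⟩` (`HasExpansion.mul_aEntry`), where `a n` is the diagonal
entry. So the estimate `-⟨R n, q y⟩ / a n` is off by `lam * ⟨R n, y⟩ / a n`. As the mass matrix is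
banded, `⟨R n, y⟩` is smaller than `⟨R n, q y⟩` by the factor `n ^ (-2)`
(`HasExpansion.isBigO_ip_step`), provided that the latter is bounded from below. This bound is the
analytic part. Near each end, `q y` is a finite sum of non-integer powers of the distance to the end,
a polynomial, and a remainder whose moments are smaller still, by repeated use of the Legendre
operator (`BasisCoeff.ip_le_of_symLR`). The moments of `R n` with the powers are known up to a
convergent factor with a nonzero limit (`tendsto_powCoeff`, `BasisCoeff.tendsto_powers`), so that the
least exponent decides. It exists because `q` is unbounded, and lies in `(-1, 0)` or, if `y` vanishes
where `q` is unbounded, in `(0, 1)`. The contributions of the two ends differ by the sign `(-1) ^ n`;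
they may cancel for one `n`, but not for two consecutive ones (`BasisCoeff.exists_rate`,
`CoeffRate`). This is why the error of the estimate is compared with two consecutive terms. For
symmetric problems every other moment vanishes, and the estimate is good for each single coefficient.

*Convergence.* The numerical eigenvalues tend to the exact ones (`tendsto_numEigenvalue`). From above
this is the minimax principle with polynomials close to the eigenfunctions. From below, normalized
numerical eigenfunctions have limits along ultrafilters, which are very weak solutions and hence
eigenfunctions (`exists_limit_eigenfunction`), and eigenvalues are simple.

*Eigenvalue error.* Let `y = r + t` with a partial sum `r` of the expansion and its tail `t`, and let
`w` be the multiple of the numerical eigenfunction that has the same component along `y` as `r`. The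
same compactness bounds `r - w` by the residual of `r` and the eigenvalue error
(`HasExpansion.exists_diff_bound`). Testing the equations of `r` and `w` with each other gives
`(lam - lamN) * ⟨w, y⟩ = ⟨t, q w⟩ - lamN * ⟨t, w⟩`, whose right side is `-T` up to a negligible part,
where `T` is the sum of `a n * c n ^ 2` over the tail. By the lower bound for consecutive
coefficients, `T` is at least of the order `N ^ (2 - 2 τ)` if the coefficients are of the order
`n ^ (-τ)` (`CoeffRate.lower_tailEnergy`), and all other contributions are smaller. The term
`⟨t, q w⟩` is the first series of the statement; replacing the coefficients in it by their estimates
gives the second (`CoeffRate.errorEstimates`). -/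

namespace SturmLiouvilleGalerkin

/-! ### Legendre polynomials -/

theorem iterate_derivative_X_mul_aux (n : ℕ) (p : ℝ[X]) :
    derivative^[n + 1] (X * p) = X * derivative^[n + 1] p + C ((n : ℝ) + 1) * derivative^[n] p := by
  rw [mul_comm X p, iterate_derivative_mul_X]
  simp [nsmul_eq_mul, mul_comm]

theorem legendre_zero : legendre 0 = 1 := by simp [legendre]

/-- The polynomial `n D^{n-1} (X ^ 2 - 1) ^ n / (2 ^ n n!)`, common to the two recurrences below. -/
theorem legendre_succ_aux (n : ℕ) :
    ∃ v : ℝ[X], legendre (n + 1) = X * legendre n + v ∧ derivative v = C (n : ℝ) * legendre n ∧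
      2 * C ((n : ℝ) + 1) * legendre (n + 1) = (X ^ 2 - 1) * derivative (legendre n) +
        2 * C ((n : ℝ) + 1) * X * legendre n + C ((n : ℝ) + 1) * v := by
  set u : ℝ[X] := (X ^ 2 - 1) ^ n with hu
  set k : ℝ := (2 ^ n * (n.factorial : ℝ))⁻¹ with hk
  have hP : legendre n = C k * derivative^[n] u := rfl
  have hk1 : (2 ^ (n + 1) * ((n + 1).factorial : ℝ))⁻¹ * (2 * ((n : ℝ) + 1)) = k := by
    rw [hk, Nat.factorial_succ]; push_cast
    have : (n.factorial : ℝ) ≠ 0 := by positivity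
    field_simp; ring
  have hPs : legendre (n + 1) =
      C ((2 ^ (n + 1) * ((n + 1).factorial : ℝ))⁻¹) *
        derivative^[n + 1] ((X ^ 2 - 1) * u) := by
    rw [legendre, hu, pow_succ' (X ^ 2 - 1 : ℝ[X]) n]
  obtain ⟨w, hw, hw'⟩ : ∃ w : ℝ[X], derivative^[n] (X * u) = X * derivative^[n] u + w ∧
      derivative w = C (n : ℝ) * derivative^[n] u := by
    rcases n with _ | m
    · exact ⟨0, by simp, by simp⟩
    · refine ⟨C ((m : ℝ) + 1) * derivative^[m] u, iterate_derivative_X_mul_aux m u, ?_⟩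
      rw [derivative_C_mul, ← Function.iterate_succ_apply' derivative m u]; simp
  have hd : derivative ((X ^ 2 - 1 : ℝ[X]) ^ (n + 1)) = C (2 * ((n : ℝ) + 1)) * (X * u) := by
    rw [derivative_pow]
    simp only [derivative_sub, derivative_X_pow, derivative_one, hu, C_mul, C_add, map_natCast,
      map_ofNat, C_1, Nat.add_sub_cancel]
    push_cast; ring
  have hDu : derivative^[n + 1] u = derivative (derivative^[n] u) :=
    Function.iterate_succ_apply' derivative n u
  refine ⟨C k * w, ?_, ?_, ?_⟩
  · rw [legendre, Function.iterate_succ_apply, hd, iterate_derivative_C_mul, hw, ← mul_assoc,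
      ← C_mul, hk1, hP]
    ring
  · rw [derivative_C_mul, hw', hP]; ring
  · have h1 : derivative^[n + 1] ((X ^ 2 - 1) * u) =
        X * (X * derivative^[n + 1] u + C ((n : ℝ) + 1) * derivative^[n] u) +
          C ((n : ℝ) + 1) * (X * derivative^[n] u + w) - derivative^[n + 1] u := by
      rw [show (X ^ 2 - 1) * u = X * (X * u) - u by ring, iterate_derivative_sub,
        iterate_derivative_X_mul_aux, iterate_derivative_X_mul_aux, hw]
    rw [hPs, h1, hP, derivative_C_mul, hDu, ← hk1]
    simp only [C_mul, map_ofNat]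
    ring

/-- `P_{n+1}' = x P_n' + (n + 1) P_n`. -/
theorem derivative_legendre_succ (n : ℕ) : derivative (legendre (n + 1)) =
    X * derivative (legendre n) + C ((n : ℝ) + 1) * legendre n := by
  obtain ⟨v, h1, h2, -⟩ := legendre_succ_aux n
  rw [h1, derivative_add, derivative_mul, h2]; simp [C_add]; ring

/-- `(n + 1) P_{n+1} = (x ^ 2 - 1) P_n' + (n + 1) x P_n`. -/
theorem legendre_succ_eq (n : ℕ) : C ((n : ℝ) + 1) * legendre (n + 1) =
    (X ^ 2 - 1) * derivative (legendre n) + C ((n : ℝ) + 1) * X * legendre n := by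
  obtain ⟨v, h1, -, h3⟩ := legendre_succ_aux n
  have : C ((n : ℝ) + 1) * v = C ((n : ℝ) + 1) * (legendre (n + 1) - X * legendre n) := by
    rw [h1]; ring
  rw [this] at h3
  linear_combination h3

/-- The differential equation `((x ^ 2 - 1) P_n')' = n (n + 1) P_n`. -/
theorem legendre_ode (n : ℕ) : derivative ((X ^ 2 - 1) * derivative (legendre n)) =
    C ((n : ℝ) * (n + 1)) * legendre n := by
  have h : (X ^ 2 - 1) * derivative (legendre n) =
      C ((n : ℝ) + 1) * legendre (n + 1) - C ((n : ℝ) + 1) * (X * legendre n) := by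
    rw [legendre_succ_eq]; ring
  rw [h, derivative_sub, derivative_C_mul, derivative_C_mul, derivative_legendre_succ,
    derivative_mul]
  simp only [derivative_X, C_mul, C_add, C_1]; ring

/-- `x P_{n+1}' - P_n' = (n + 1) P_{n+1}`. -/
theorem X_mul_derivative_legendre_succ (n : ℕ) : X * derivative (legendre (n + 1)) =
    derivative (legendre n) + C ((n : ℝ) + 1) * legendre (n + 1) := by
  rw [legendre_succ_eq, derivative_legendre_succ]; ring

theorem one_sub_X_mul_derivative (n : ℕ) :
    (1 - X) * (derivative (legendre n) + derivative (legendre (n + 1))) =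
      C ((n : ℝ) + 1) * (legendre n - legendre (n + 1)) := by
  have h1 := derivative_legendre_succ n
  have h2 := X_mul_derivative_legendre_succ n
  linear_combination h1 - h2

/-- `(1 - x ^ 2) P_{n+1}'` is a multiple of `P_n - P_{n+2}`. -/
theorem one_sub_sq_mul_derivative (n : ℕ) :
    C (2 * (n : ℝ) + 3) * ((1 - X ^ 2) * derivative (legendre (n + 1))) =
      C (((n : ℝ) + 1) * (n + 2)) * (legendre n - legendre (n + 2)) := by
  have h1 := derivative_legendre_succ n
  have h2 := X_mul_derivative_legendre_succ n
  have h3 := legendre_succ_eq (n + 1)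
  push_cast at h3
  simp only [C_mul, C_add, map_ofNat, C_1] at *
  linear_combination ((C (n : ℝ)) + 2) * (h1 - X * h2) + ((C (n : ℝ)) + 1) * h3

/-- `P_{n+2}' - P_n' = (2 n + 3) P_{n+1}`. -/
theorem derivative_legendre_add_two_sub (n : ℕ) :
    derivative (legendre (n + 2)) - derivative (legendre n) =
      C (2 * (n : ℝ) + 3) * legendre (n + 1) := by
  have h1 := derivative_legendre_succ (n + 1)
  have h2 := X_mul_derivative_legendre_succ n
  push_cast at h1
  simp only [C_mul, C_add, map_ofNat, C_1] at *
  linear_combination h1 + h2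

theorem legendre_eval_one (n : ℕ) : (legendre n).eval 1 = 1 := by
  induction n with
  | zero => simp [legendre_zero]
  | succ n ih =>
    have h := congrArg (eval 1) (legendre_succ_eq n)
    simp [ih] at h
    have : (n : ℝ) + 1 ≠ 0 := by positivity
    simpa [this] using h

theorem legendre_comp_neg (n : ℕ) (x : ℝ) :
    (legendre n).eval (-x) = (-1) ^ n * (legendre n).eval x := by
  suffices h : (legendre n).comp (-X) = (-1) ^ n * legendre n by
    have := congrArg (eval x) h
    simpa using this
  induction n with
  | zero => simp [legendre_zero]
  | succ n ih =>
    have h0 : C ((n : ℝ) + 1) ≠ 0 := by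
      rw [Ne, C_eq_zero]; positivity
    have hd := congrArg derivative ih
    rw [derivative_comp] at hd
    have h := congrArg (fun p => p.comp (-X)) (legendre_succ_eq n)
    have h' := legendre_succ_eq n
    simp only [mul_comp, add_comp, sub_comp, pow_comp, X_comp, C_comp, one_comp] at h
    have hd' : (derivative (legendre n)).comp (-X) = (-1) ^ (n + 1) * derivative (legendre n) := by
      have e : derivative ((-1 : ℝ[X]) ^ n * legendre n) = (-1) ^ n * derivative (legendre n) := by
        rw [show ((-1 : ℝ[X]) ^ n) = C ((-1) ^ n) by simp, derivative_C_mul]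
      rw [e] at hd
      simp at hd
      rw [pow_succ]; linear_combination -hd
    apply mul_left_cancel₀ h0
    rw [h, hd', ih, pow_succ]
    linear_combination ((-1) ^ n) * h'

theorem legendre_eval_neg_one (n : ℕ) : (legendre n).eval (-1) = (-1) ^ n := by
  rw [legendre_comp_neg, legendre_eval_one, mul_one]

theorem derivative_legendre_eval_one (n : ℕ) :
    (derivative (legendre n)).eval 1 = n * (n + 1) / 2 := by
  have h := congrArg (eval 1) (legendre_ode n)
  rw [derivative_mul] at h
  simp [legendre_eval_one] at h
  linarith

theorem derivative_legendre_eval_neg_one (n : ℕ) :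
    (derivative (legendre n)).eval (-1) = -((-1) ^ n * (n * (n + 1) / 2)) := by
  have h := congrArg (eval (-1)) (legendre_ode n)
  rw [derivative_mul] at h
  simp [legendre_eval_neg_one] at h
  linarith

theorem natDegree_legendre_le (n : ℕ) : (legendre n).natDegree ≤ n := by
  unfold legendre
  refine (natDegree_C_mul_le _ _).trans ((natDegree_iterate_derivative _ _).trans ?_)
  have : ((X ^ 2 - 1 : ℝ[X]) ^ n).natDegree ≤ n * 2 := by
    refine (natDegree_pow_le).trans (Nat.mul_le_mul_left _ ?_)
    exact (natDegree_sub_le _ _).trans (by simp)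
  omega

/-! ### Integrals of polynomials over `(-1, 1)` -/

theorem ip_comm (u v : ℝ → ℝ) : ip u v = ip v u := by
  simp only [ip, mul_comm]

theorem continuous_fn (r : ℝ[X]) : Continuous (fn r) := r.continuous

theorem hasDerivAt_fn (r : ℝ[X]) (x : ℝ) : HasDerivAt (fn r) (fn (derivative r) x) x :=
  r.hasDerivAt x

theorem fn_add (r s : ℝ[X]) (x : ℝ) : fn (r + s) x = fn r x + fn s x := eval_add
theorem fn_sub (r s : ℝ[X]) (x : ℝ) : fn (r - s) x = fn r x - fn s x := eval_sub ..
theorem fn_mul (r s : ℝ[X]) (x : ℝ) : fn (r * s) x = fn r x * fn s x := eval_mul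
theorem fn_C (c x : ℝ) : fn (C c) x = c := eval_C

/-- The inner product of two polynomials, as a bilinear form. -/
noncomputable def pip : ℝ[X] →ₗ[ℝ] ℝ[X] →ₗ[ℝ] ℝ :=
  LinearMap.mk₂ ℝ (fun r s => ip (fn r) (fn s))
    (fun a b c => by
      simp only [ip, fn_add, add_mul]
      exact intervalIntegral.integral_add
        (((continuous_fn a).mul (continuous_fn c)).intervalIntegrable _ _)
        (((continuous_fn b).mul (continuous_fn c)).intervalIntegrable _ _))
    (fun k a b => by
      simp only [ip, fn, eval_smul, smul_eq_mul, mul_assoc]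
      exact intervalIntegral.integral_const_mul _ _)
    (fun a b c => by
      simp only [ip, fn_add, mul_add]
      exact intervalIntegral.integral_add
        (((continuous_fn a).mul (continuous_fn b)).intervalIntegrable _ _)
        (((continuous_fn a).mul (continuous_fn c)).intervalIntegrable _ _))
    (fun k a b => by
      simp only [ip, fn, eval_smul, smul_eq_mul, mul_left_comm _ k]
      exact intervalIntegral.integral_const_mul _ _)

theorem pip_apply (r s : ℝ[X]) : pip r s = ip (fn r) (fn s) := rfl

theorem pip_comm (r s : ℝ[X]) : pip r s = pip s r := ip_comm _ _

theorem pip_C_mul_left (k : ℝ) (r s : ℝ[X]) : pip (C k * r) s = k * pip r s := by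
  rw [C_mul', map_smul]; rfl

theorem pip_C_mul_right (k : ℝ) (r s : ℝ[X]) : pip r (C k * s) = k * pip r s := by
  rw [C_mul', map_smul]; rfl

theorem pip_mul_assoc (r s t : ℝ[X]) : pip (r * s) t = pip s (r * t) := by
  simp only [pip_apply, ip, fn_mul]; congr 1; ext x; ring

/-- Integration by parts for polynomials. -/
theorem pip_derivative (r s : ℝ[X]) : pip (derivative r) s =
    (r * s).eval 1 - (r * s).eval (-1) - pip r (derivative s) := by
  have h := intervalIntegral.integral_eq_sub_of_hasDerivAt (a := -1) (b := 1)
    (fun x _ => hasDerivAt_fn (r * s) x) ((continuous_fn _).intervalIntegrable _ _)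
  have h2 : (∫ x in (-1 : ℝ)..1, fn (derivative (r * s)) x) =
      pip (derivative r) s + pip r (derivative s) := by
    refine Eq.trans ?_ (intervalIntegral.integral_add
      (((continuous_fn (derivative r)).mul (continuous_fn s)).intervalIntegrable _ _)
      (((continuous_fn r).mul (continuous_fn (derivative s))).intervalIntegrable _ _))
    congr 1; ext x; simp [derivative_mul, fn_add, fn_mul]
  rw [h2] at h
  simp only [fn] at h
  linarith

theorem pip_self_nonneg (r : ℝ[X]) : 0 ≤ pip r r :=
  intervalIntegral.integral_nonneg (by norm_num) fun x _ => mul_self_nonneg _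

theorem pip_legendre_ode (n : ℕ) (r : ℝ[X]) : (n : ℝ) * (n + 1) * pip (legendre n) r =
    -pip ((X ^ 2 - 1) * derivative (legendre n)) (derivative r) := by
  rw [← pip_C_mul_left, ← legendre_ode, pip_derivative]
  simp

theorem pip_legendre_of_ne {m n : ℕ} (h : m ≠ n) : pip (legendre m) (legendre n) = 0 := by
  have h1 := pip_legendre_ode m (legendre n)
  have h2 := pip_legendre_ode n (legendre m)
  have h3 : pip ((X ^ 2 - 1) * derivative (legendre m)) (derivative (legendre n)) =
      pip ((X ^ 2 - 1) * derivative (legendre n)) (derivative (legendre m)) := by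
    rw [pip_mul_assoc, pip_comm]
  rw [pip_comm (legendre n)] at h2
  have h4 : ((m : ℝ) * (m + 1) - n * (n + 1)) * pip (legendre m) (legendre n) = 0 := by
    linear_combination h1 - h2 - h3
  have h5 : ((m : ℝ) * (m + 1) - n * (n + 1)) = (m - n) * (m + n + 1) := by ring
  rw [h5] at h4
  have h6 : (m : ℝ) - n ≠ 0 := sub_ne_zero.2 (by exact_mod_cast h)
  have h7 : (m : ℝ) + n + 1 ≠ 0 := by positivity
  simpa [h6, h7] using h4

/-- The coefficient of degree `n` of `P_n` does not vanish. -/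
theorem legendre_coeff_ne_zero (n : ℕ) : (legendre n).coeff n ≠ 0 := by
  induction n with
  | zero => simp [legendre_zero]
  | succ n ih =>
    have h := congrArg (fun p => coeff p n) (derivative_legendre_succ n)
    simp only [coeff_add, coeff_C_mul, coeff_derivative] at h
    have h2 : (X * derivative (legendre n)).coeff n = n * (legendre n).coeff n := by
      rcases n with _ | m
      · simp
      · rw [coeff_X_mul, coeff_derivative]; push_cast; ring
    rw [h2] at h
    intro h0
    rw [h0, zero_mul] at h
    have : (2 * (n : ℝ) + 1) * (legendre n).coeff n = 0 := by linarith
    rcases mul_eq_zero.1 this with h3 | h3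
    · have : (0 : ℝ) ≤ n := by positivity
      linarith
    · exact ih h3

/-- Every polynomial of degree less than `n` is a combination of `P_0, …, P_{n-1}`. -/
theorem mem_span_legendre (n : ℕ) (r : ℝ[X]) (h : r.degree < n) :
    r ∈ Submodule.span ℝ (legendre '' Set.Iio n) := by
  induction n generalizing r with
  | zero =>
    have : r = 0 := by
      rw [← degree_eq_bot]
      exact Nat.WithBot.lt_zero_iff.1 (by simpa using h)
    rw [this]; exact Submodule.zero_mem _
  | succ n ih =>
    set k := r.coeff n / (legendre n).coeff n with hk
    have hr : r = (r - k • legendre n) + k • legendre n := by ring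
    rw [hr]
    have hn := legendre_coeff_ne_zero n
    refine Submodule.add_mem _ ?_ (Submodule.smul_mem _ _ (Submodule.subset_span
      ⟨n, by simp, rfl⟩))
    refine Submodule.span_mono (Set.image_mono (Set.Iio_subset_Iio (Nat.le_succ n))) (ih _ ?_)
    rw [degree_lt_iff_coeff_zero]
    intro m hm
    rcases hm.eq_or_lt with rfl | hm
    · simp [hk, hn]
    · have h1 : r.coeff m = 0 := (degree_lt_iff_coeff_zero _ _).1 h m hm
      have h2 : (legendre n).coeff m = 0 :=
        coeff_eq_zero_of_natDegree_lt ((natDegree_legendre_le n).trans_lt hm)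
      simp [h1, h2]

theorem pip_legendre_of_degree_lt {n : ℕ} {r : ℝ[X]} (h : r.degree < n) :
    pip (legendre n) r = 0 := by
  have hr := mem_span_legendre n r h
  clear h
  induction hr using Submodule.span_induction with
  | mem x hx =>
    obtain ⟨m, hm, rfl⟩ := hx
    exact pip_legendre_of_ne (ne_of_gt hm)
  | zero => simp
  | add x y _ _ hx hy => rw [map_add, hx, hy, add_zero]
  | smul a x _ hx => rw [map_smul, hx, smul_zero]

theorem degree_derivative_lt' {n : ℕ} {r : ℝ[X]} (h : r.natDegree ≤ n) :
    (derivative r).degree < n := by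
  by_cases h0 : r = 0
  · simp [h0]
  · exact (degree_derivative_lt h0).trans_le (degree_le_of_natDegree_le h)

theorem pip_legendre_derivative (n m : ℕ) (h : m ≤ n) :
    pip (legendre n) (derivative (legendre m)) = 0 := by
  exact pip_legendre_of_degree_lt (degree_derivative_lt' ((natDegree_legendre_le m).trans h))

theorem pip_legendre_self (n : ℕ) : pip (legendre n) (legendre n) = 2 / (2 * n + 1) := by
  have h1 : pip (legendre n) (X * derivative (legendre n)) = n * pip (legendre n) (legendre n) := by
    rcases n with _ | m
    · simp [legendre_zero]
    · rw [X_mul_derivative_legendre_succ, map_add, pip_legendre_derivative _ _ (Nat.le_succ m),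
        pip_C_mul_right]
      push_cast; ring
  have h2 := pip_derivative (X * legendre n) (legendre n)
  rw [derivative_mul, derivative_X, one_mul, map_add, LinearMap.add_apply] at h2
  have h3 : pip (X * derivative (legendre n)) (legendre n) =
      pip (legendre n) (X * derivative (legendre n)) := pip_comm _ _
  have h4 : pip (X * legendre n) (derivative (legendre n)) =
      pip (legendre n) (X * derivative (legendre n)) := pip_mul_assoc _ _ _
  rw [h3, h4, h1] at h2
  simp only [eval_mul, eval_X, legendre_eval_one, legendre_eval_neg_one] at h2
  have h5 : ((-1 : ℝ) ^ n) * (-1) ^ n = 1 := by rw [← mul_pow]; norm_num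
  rw [eq_div_iff (by positivity)]
  linear_combination h2 + h5

theorem pip_legendre_derivative_succ (n : ℕ) :
    pip (legendre n) (derivative (legendre (n + 1))) = 2 := by
  have h := pip_derivative (legendre (n + 1)) (legendre n)
  rw [pip_legendre_derivative _ _ (Nat.le_succ n), pip_comm] at h
  rw [h]
  simp only [eval_mul, legendre_eval_one, legendre_eval_neg_one, pow_succ]
  have h5 : ((-1 : ℝ) ^ n) * (-1) ^ n = 1 := by rw [← mul_pow]; norm_num
  linear_combination h5

theorem pip_legendre_second_derivative (n : ℕ) :
    pip (legendre n) (derivative (derivative (legendre (n + 2)))) = 2 * (2 * n + 3) := by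
  have h := derivative_legendre_add_two_sub n
  have h1 : derivative (legendre (n + 2)) = derivative (legendre n) +
    C (2 * (n : ℝ) + 3) * legendre (n + 1) := by rw [← h]; ring
  rw [h1, derivative_add, derivative_C_mul, map_add, pip_C_mul_right, pip_legendre_derivative_succ]
  have : pip (legendre n) (derivative (derivative (legendre n))) = 0 := by
    refine pip_legendre_of_degree_lt (degree_derivative_lt' ?_)
    exact (natDegree_derivative_le _).trans ((Nat.sub_le _ _).trans (natDegree_legendre_le n))
  rw [this]; ring

/-! ### Pointwise bounds for Legendre polynomials -/

theorem fn_legendre_ode (n : ℕ) (x : ℝ) :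
    (1 - x ^ 2) * fn (derivative (derivative (legendre n))) x =
      2 * x * fn (derivative (legendre n)) x - n * (n + 1) * fn (legendre n) x := by
  have h := congrArg (eval x) (legendre_ode n)
  rw [derivative_mul] at h
  simp at h
  simp only [fn]
  linarith

/-- The derivative of Sonin's function `n (n + 1) P_n ^ 2 + (1 - x ^ 2) P_n' ^ 2`. -/
theorem hasDerivAt_sonin (n : ℕ) (x : ℝ) :
    HasDerivAt (fun x => n * (n + 1) * fn (legendre n) x ^ 2 +
      (1 - x ^ 2) * fn (derivative (legendre n)) x ^ 2)
      (2 * x * fn (derivative (legendre n)) x ^ 2) x := by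
  have h1 := ((hasDerivAt_fn (legendre n) x).pow 2).const_mul ((n : ℝ) * (n + 1))
  have h2 := ((hasDerivAt_pow 2 x).const_sub 1).mul
    ((hasDerivAt_fn (derivative (legendre n)) x).pow 2)
  convert! h1.add h2 using 1
  have := fn_legendre_ode n x
  simp
  linear_combination -2 * fn (derivative (legendre n)) x * this

theorem fn_legendre_neg_sq (n : ℕ) (x : ℝ) : fn (legendre n) (-x) ^ 2 = fn (legendre n) x ^ 2 := by
  have h : ((-1 : ℝ) ^ n) ^ 2 = 1 := by rw [← pow_mul, mul_comm, pow_mul]; norm_num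
  simp only [fn, legendre_comp_neg, mul_pow, h, one_mul]

theorem abs_fn_legendre_le_one (n : ℕ) {x : ℝ} (hx : x ∈ Set.Icc (-1 : ℝ) 1) :
    |fn (legendre n) x| ≤ 1 := by
  have key : ∀ x ∈ Set.Icc (0 : ℝ) 1, fn (legendre n) x ^ 2 ≤ 1 := by
    intro x hx
    rcases Nat.eq_zero_or_pos n with rfl | hn
    · simp [legendre_zero, fn]
    have hmono := monotoneOn_of_deriv_nonneg (convex_Icc (0 : ℝ) 1)
      (fun y _ => (hasDerivAt_sonin n y).continuousAt.continuousWithinAt)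
      (fun y _ => (hasDerivAt_sonin n y).differentiableAt.differentiableWithinAt)
      (fun y hy => by
        rw [interior_Icc] at hy
        rw [(hasDerivAt_sonin n y).deriv]
        have := hy.1.le
        positivity)
    have := hmono hx (Set.right_mem_Icc.2 zero_le_one) hx.2
    simp only [fn, legendre_eval_one] at this
    have h2 : 0 ≤ (1 - x ^ 2) * eval x (derivative (legendre n)) ^ 2 :=
      mul_nonneg (by nlinarith [hx.1, hx.2]) (sq_nonneg _)
    have h3 : (0 : ℝ) < n * (n + 1) := by positivity
    have h4 : (n : ℝ) * (n + 1) * (eval x (legendre n) ^ 2) ≤ n * (n + 1) * 1 := by linarith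
    exact le_of_mul_le_mul_left h4 h3
  rw [← sq_le_one_iff_abs_le_one]
  rcases le_total 0 x with h | h
  · exact key x ⟨h, hx.2⟩
  · rw [← fn_legendre_neg_sq]; exact key (-x) ⟨by linarith, by linarith [hx.1]⟩

theorem hasDerivAt_weighted_sonin (n : ℕ) (x : ℝ) :
    HasDerivAt (fun x => (1 - x ^ 2) * (n * (n + 1) * fn (legendre n) x ^ 2 +
      (1 - x ^ 2) * fn (derivative (legendre n)) x ^ 2))
      (-(n * (n + 1) * (2 * x * fn (legendre n) x ^ 2))) x := by
  have h := ((hasDerivAt_pow 2 x).const_sub 1).mul (hasDerivAt_sonin n x)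
  convert! h using 1
  simp
  ring

theorem integral_legendre_sq_half_le (n : ℕ) :
    (∫ x in (0 : ℝ)..1, (n : ℝ) * (n + 1) * (2 * x * fn (legendre n) x ^ 2)) ≤ (n : ℝ) + 1 := by
  have hc : Continuous fun x => fn (legendre n) x ^ 2 := (continuous_fn _).pow 2
  have h1 : ∫ x in (-1 : ℝ)..1, fn (legendre n) x ^ 2 = 2 / (2 * n + 1) := by
    rw [← pip_legendre_self, pip_apply, ip]; simp only [sq]
  have h2 : ∫ x in (-1 : ℝ)..0, fn (legendre n) x ^ 2 =
      ∫ x in (0 : ℝ)..1, fn (legendre n) x ^ 2 := by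
    have := intervalIntegral.integral_comp_neg (a := 0) (b := 1) (fun x => fn (legendre n) x ^ 2)
    simp only [fn_legendre_neg_sq, neg_zero] at this
    exact this.symm
  have h3 := intervalIntegral.integral_add_adjacent_intervals
    (hc.intervalIntegrable (μ := MeasureTheory.volume) (-1) 0) (hc.intervalIntegrable 0 1)
  rw [h1, h2] at h3
  have h4 : (∫ x in (0 : ℝ)..1, (n : ℝ) * (n + 1) * (2 * x * fn (legendre n) x ^ 2)) ≤
      ∫ x in (0 : ℝ)..1, (n : ℝ) * (n + 1) * (2 * fn (legendre n) x ^ 2) := by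
    refine intervalIntegral.integral_mono_on zero_le_one
      (Continuous.intervalIntegrable (by fun_prop) _ _)
      (Continuous.intervalIntegrable (by fun_prop) _ _) fun x hx => ?_
    have : x * fn (legendre n) x ^ 2 ≤ 1 * fn (legendre n) x ^ 2 :=
      mul_le_mul_of_nonneg_right hx.2 (sq_nonneg _)
    have h0 : (0 : ℝ) ≤ n * (n + 1) := by positivity
    apply mul_le_mul_of_nonneg_left _ h0
    linarith
  refine h4.trans ?_
  rw [intervalIntegral.integral_const_mul, intervalIntegral.integral_const_mul]
  have h5 : 2 * ∫ x in (0 : ℝ)..1, fn (legendre n) x ^ 2 = 2 / (2 * n + 1) := by linarith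
  rw [h5]
  have : (n : ℝ) * (2 / (2 * n + 1)) ≤ 1 := by
    rw [mul_div_assoc', div_le_one (by positivity)]; linarith
  have hn : (0 : ℝ) ≤ n + 1 := by positivity
  nlinarith

/-- `((1 - x ^ 2) P_n') ^ 2 ≤ n + 1`: the product of `1 - x ^ 2` and Sonin's function decreases on
`[0, 1]`, and the integral of its derivative is controlled by `‖P_n‖ ^ 2`. -/
theorem sq_one_sub_sq_mul_derivative_le (n : ℕ) {x : ℝ} (hx : x ∈ Set.Icc (-1 : ℝ) 1) :
    ((1 - x ^ 2) * fn (derivative (legendre n)) x) ^ 2 ≤ n + 1 := by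
  have hint : Continuous fun x => -(n * (n + 1) * (2 * x * fn (legendre n) x ^ 2)) := by
    have := continuous_fn (legendre n)
    fun_prop
  have key : ∀ x ∈ Set.Icc (0 : ℝ) 1, ((1 - x ^ 2) * fn (derivative (legendre n)) x) ^ 2 ≤
      n + 1 := by
    intro x hx
    have h1 := intervalIntegral.integral_eq_sub_of_hasDerivAt (a := x) (b := 1)
      (fun y _ => hasDerivAt_weighted_sonin n y) (hint.intervalIntegrable _ _)
    have h2 : ∫ y in x..1, -(n * (n + 1) * (2 * y * fn (legendre n) y ^ 2)) =
        -∫ y in x..1, (n * (n + 1) * (2 * y * fn (legendre n) y ^ 2)) :=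
      intervalIntegral.integral_neg
    have h3 : ∫ y in x..1, (n * (n + 1) * (2 * y * fn (legendre n) y ^ 2)) ≤
        ∫ y in (0 : ℝ)..1, (n * (n + 1) * (2 * y * fn (legendre n) y ^ 2)) := by
      refine intervalIntegral.integral_mono_interval hx.1 hx.2 le_rfl ?_ ?_
      · filter_upwards [MeasureTheory.ae_restrict_mem measurableSet_Ioc] with y hy
        have := hy.1.le
        simp only [Pi.zero_apply]; positivity
      · have := continuous_fn (legendre n)
        exact Continuous.intervalIntegrable (by fun_prop) _ _
    have h4 := integral_legendre_sq_half_le n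
    have h5 : 0 ≤ (1 - x ^ 2) * (n * (n + 1) * fn (legendre n) x ^ 2) :=
      mul_nonneg (by nlinarith [hx.1, hx.2]) (by positivity)
    simp only [one_pow, sub_self, zero_mul] at h1
    nlinarith
  rcases le_total 0 x with h | h
  · exact key x ⟨h, hx.2⟩
  · have h1 := key (-x) ⟨by linarith, by linarith [hx.1]⟩
    have h2 : fn (derivative (legendre n)) (-x) ^ 2 = fn (derivative (legendre n)) x ^ 2 := by
      have h3 : (legendre n).comp (-X) = C ((-1) ^ n) * legendre n := by
        apply Polynomial.funext; intro y; simp [legendre_comp_neg]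
      have h4 := congrArg (fun p => eval x (derivative p) ^ 2) h3
      simp only [derivative_comp, derivative_C_mul] at h4
      simp only [eval_mul, eval_comp, mul_pow, eval_C] at h4
      rw [← pow_mul, mul_comm n 2, pow_mul] at h4
      simpa [fn] using h4
    rw [mul_pow, h2, neg_sq, ← mul_pow] at h1
    exact h1

/-- The difference `P_n - P_{n+2}` is a multiple of `(1 - x ^ 2) P_{n+1}'`, which the preceding
estimate bounds; this gains the factor `n ^ (-1 / 2)` over the trivial bound. -/
theorem abs_legendre_sub_le (n : ℕ) {x : ℝ} (hx : x ∈ Set.Icc (-1 : ℝ) 1) :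
    |fn (legendre n) x - fn (legendre (n + 2)) x| ≤ 3 / Real.sqrt (n + 1) := by
  have h := congrArg (eval x) (one_sub_sq_mul_derivative n)
  simp only [eval_mul, eval_C, eval_sub, eval_one, eval_pow, eval_X] at h
  have h1 := sq_one_sub_sq_mul_derivative_le (n + 1) hx
  push_cast at h1
  set A := fn (legendre n) x - fn (legendre (n + 2)) x with hA
  set B := (1 - x ^ 2) * fn (derivative (legendre (n + 1))) x with hB
  have h' : (2 * (n : ℝ) + 3) * B = ((n : ℝ) + 1) * (n + 2) * A := h
  have hn : (0 : ℝ) ≤ n := by positivity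
  have h2 : A ^ 2 ≤ 3 ^ 2 / (n + 1) := by
    rw [le_div_iff₀ (by positivity)]
    have e : (((n : ℝ) + 1) * (n + 2)) ^ 2 * A ^ 2 ≤ (2 * (n : ℝ) + 3) ^ 2 * (n + 2) := by
      rw [← mul_pow, ← h', mul_pow]
      exact mul_le_mul_of_nonneg_left (by linarith) (sq_nonneg _)
    by_contra hcon
    push Not at hcon
    have : (((n : ℝ) + 1) * (n + 2) ^ 2) * 9 < (((n : ℝ) + 1) * (n + 2) ^ 2) * (A ^ 2 * (n + 1)) :=
      mul_lt_mul_of_pos_left (by linarith) (by positivity)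
    nlinarith [sq_nonneg (n : ℝ)]
  have h3 : |A| ≤ Real.sqrt (3 ^ 2 / (n + 1)) := Real.abs_le_sqrt h2
  rwa [Real.sqrt_div (by positivity), Real.sqrt_sq (by norm_num)] at h3

/-! ### The Legendre-Galerkin basis -/

/-- `0` for a Dirichlet end (`b = 0`), `1` for an end with a derivative in its boundary
condition. -/
noncomputable def bcType (b : ℝ) : ℝ := if b = 0 then 0 else 1

theorem bcType_nonneg (b : ℝ) : 0 ≤ bcType b := by unfold bcType; split_ifs <;> norm_num

/-- The boundary condition at one end, applied to `ξ P_n + η P_{n+1} + θ P_{n+2}`, determines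
`n (ξ + η + θ)` up to `o(1)`. -/
theorem tendsto_of_boundary_equation {α β : ℝ} (h : α ^ 2 + β ^ 2 ≠ 0) {ξ η θ : ℕ → ℝ}
    (hη : ∀ n, |η n| ≤ 1) (hθ : ∀ n, |θ n| ≤ 1)
    (heq : ∀ n : ℕ, ξ n * (α + β * (n * (n + 1) / 2)) + η n * (α + β * ((n + 1) * (n + 2) / 2)) +
      θ n * (α + β * ((n + 2) * (n + 3) / 2)) = 0) :
    Tendsto (fun n : ℕ => n * (ξ n + η n + θ n) + bcType β * (2 * η n + 4 * θ n)) atTop (𝓝 0) := by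
  by_cases hβ : β = 0
  · subst hβ
    have hα : α ≠ 0 := by rintro rfl; simp at h
    have : ∀ n, ξ n + η n + θ n = 0 := fun n => by
      have := heq n
      have h2 : α * (ξ n + η n + θ n) = 0 := by linarith
      simpa [hα] using h2
    simp [bcType, this]
  · obtain ⟨r, hr⟩ : ∃ r, α = β * r := ⟨α / β, by field_simp⟩
    have hs : Tendsto (fun n : ℕ => ((n : ℝ) * (n + 1) / 2 + r) / (n : ℝ) ^ 2) atTop
        (𝓝 (1 / 2)) := by
      have h1 : Tendsto (fun n : ℕ => (1 : ℝ) / n) atTop (𝓝 0) :=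
          tendsto_one_div_atTop_nhds_zero_nat
      have : Tendsto (fun n : ℕ => 1 / 2 + (1 : ℝ) / n * (1 / 2) + r * (1 / n * (1 / n))) atTop
          (𝓝 (1 / 2 + 0 * (1 / 2) + r * (0 * 0))) :=
        ((h1.mul_const _).const_add _).add ((h1.mul h1).const_mul r)
      simp only [zero_mul, mul_zero, add_zero] at this
      refine this.congr' ?_
      filter_upwards [eventually_gt_atTop 0] with n hn
      have : (n : ℝ) ≠ 0 := by positivity
      field_simp
    have hne : ∀ᶠ n : ℕ in atTop, (n : ℝ) * (n + 1) / 2 + r ≠ 0 := by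
      have := hs.eventually_ne (show (1 / 2 : ℝ) ≠ 0 by norm_num)
      filter_upwards [this] with n hn h0
      simp [h0] at hn
    have hlim : ∀ k l : ℝ, Tendsto (fun n : ℕ => (n : ℝ) * (k * n + l) / (n * (n + 1) / 2 + r))
        atTop
        (𝓝 (2 * k)) := by
      intro k l
      have h1 : Tendsto (fun n : ℕ => (1 : ℝ) / n) atTop (𝓝 0) :=
          tendsto_one_div_atTop_nhds_zero_nat
      have : Tendsto (fun n : ℕ => (k + l * ((1 : ℝ) / n)) /
          (((n : ℝ) * (n + 1) / 2 + r) / (n : ℝ) ^ 2)) atTop (𝓝 ((k + l * 0) / (1 / 2))) :=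
        ((h1.const_mul l).const_add k).div hs (by norm_num)
      rw [show (k + l * 0) / (1 / 2) = 2 * k by ring] at this
      refine this.congr' ?_
      filter_upwards [eventually_gt_atTop 0, hne] with n hn hn'
      have : (n : ℝ) ≠ 0 := by positivity
      field_simp
    have hb : ∀ {u v : ℕ → ℝ} {L : ℝ}, (∀ n, |u n| ≤ 1) → Tendsto v atTop (𝓝 L) →
        Tendsto (fun n => u n * (L - v n)) atTop (𝓝 0) := by
      intro u v L hu hv
      have : Tendsto (fun n => L - v n) atTop (𝓝 0) := by simpa using hv.const_sub L
      refine squeeze_zero_norm (fun n => ?_) (tendsto_zero_iff_norm_tendsto_zero.1 this)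
      rw [norm_mul]
      exact mul_le_of_le_one_left (norm_nonneg _) (hu n)
    have := (hb hη (hlim 1 1)).add (hb hθ (hlim 2 3))
    simp only [add_zero] at this
    refine this.congr' ?_
    filter_upwards [hne] with n hn
    have e := heq n
    rw [hr] at e
    have e2 : (ξ n + η n + θ n) * ((n : ℝ) * (n + 1) / 2 + r) =
        -(η n * (n + 1) + θ n * (2 * n + 3)) := by
      have : β * ((ξ n + η n + θ n) * ((n : ℝ) * (n + 1) / 2 + r) +
        (η n * (n + 1) + θ n * (2 * n + 3))) = 0 := by linarith
      have := (mul_eq_zero.1 this).resolve_left hβ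
      linarith
    have e3 : ξ n + η n + θ n = -(η n * (n + 1) + θ n * (2 * n + 3)) /
        ((n : ℝ) * (n + 1) / 2 + r) := by
      rw [eq_div_iff hn, e2]
    rw [e3, bcType, if_neg hβ]
    set d := (n : ℝ) * (n + 1) / 2 + r
    field_simp
    ring

/-- The coefficients of a Legendre-Galerkin basis, with their asymptotics. The last two fields are
about the values of `R n` at the endpoints: `ξ n + η n + θ n` is the value at `1`, and
`ξ n - η n + θ n` is, up to sign, that at `-1`. -/
structure BasisCoeff {S : ℕ} (p : Problem S) (R : ℕ → ℝ[X]) (ξ η θ : ℕ → ℝ) : Prop where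
  form : ∀ n, R n = C (ξ n) * legendre n + C (η n) * legendre (n + 1) + C (θ n) * legendre (n + 2)
  abs_ξ : ∀ n, |ξ n| ≤ 1
  abs_η : ∀ n, |η n| ≤ 1
  abs_θ : ∀ n, |θ n| ≤ 1
  symm : p.SymmetricBC → ∀ n, η n = 0
  lim_ξ : Tendsto ξ atTop (𝓝 1)
  lim_η : Tendsto η atTop (𝓝 0)
  lim_θ : Tendsto θ atTop (𝓝 (-1))
  lim_right : Tendsto (fun n : ℕ => n * (ξ n + η n + θ n)) atTop (𝓝 (4 * bcType p.bR))
  lim_left : Tendsto (fun n : ℕ => n * (ξ n - η n + θ n)) atTop (𝓝 (4 * bcType p.bL))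

theorem tendsto_zero_of_mul_nat {u : ℕ → ℝ} {L : ℝ}
    (h : Tendsto (fun n : ℕ => (n : ℝ) * u n) atTop (𝓝 L)) : Tendsto u atTop (𝓝 0) := by
  have := h.mul (tendsto_one_div_atTop_nhds_zero_nat (𝕜 := ℝ))
  rw [mul_zero] at this
  refine this.congr' ?_
  filter_upwards [eventually_gt_atTop 0] with n hn
  have : (n : ℝ) ≠ 0 := by positivity
  field_simp

theorem tendsto_zero_of_mul_nat_add {u v : ℕ → ℝ} {C : ℝ} (hv : ∀ n, |v n| ≤ C)
    (h : Tendsto (fun n : ℕ => (n : ℝ) * u n + v n) atTop (𝓝 0)) : Tendsto u atTop (𝓝 0) := by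
  have h0 := tendsto_one_div_atTop_nhds_zero_nat (𝕜 := ℝ)
  have h1 := h.mul h0
  have h2 : Tendsto (fun n : ℕ => v n * (1 / (n : ℝ))) atTop (𝓝 0) := by
    have := h0.const_mul C
    rw [mul_zero] at this
    refine squeeze_zero_norm (fun n => ?_) this
    rw [norm_mul, Real.norm_of_nonneg (show (0 : ℝ) ≤ 1 / n by positivity)]
    exact mul_le_mul_of_nonneg_right (hv n) (by positivity)
  have := h1.sub h2
  rw [mul_zero, sub_zero] at this
  refine this.congr' ?_
  filter_upwards [eventually_gt_atTop 0] with n hn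
  have : (n : ℝ) ≠ 0 := by positivity
  field_simp
  ring

/-- The boundary conditions make `n (ξ ± η + θ)` bounded, so that `η` and `ξ + θ` tend to zero. The
normalization of the maximum and of the sign of `ξ` then forces `ξ → 1` and `θ → -1`. -/
theorem Problem.IsBasis.exists_coeff {S : ℕ} {p : Problem S} {R : ℕ → ℝ[X]} (hR : p.IsBasis R) :
    ∃ ξ η θ, BasisCoeff p R ξ η θ := by
  choose ξ η θ hform hmax hξ hsymm using hR.form
  have hx : ∀ n, |ξ n| ≤ 1 := fun n => (le_max_left _ _).trans (hmax n).le
  have hy : ∀ n, |η n| ≤ 1 := fun n =>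
    (le_max_left _ _).trans ((le_max_right _ _).trans (hmax n).le)
  have hz : ∀ n, |θ n| ≤ 1 := fun n =>
    (le_max_right _ _).trans ((le_max_right _ _).trans (hmax n).le)
  have hr := tendsto_of_boundary_equation (ξ := ξ) p.right_ne hy hz (fun n => by
    have h := (hR.bc n).2
    rw [hform n] at h
    simp only [derivative_add, derivative_C_mul, eval_add, eval_mul, eval_C, legendre_eval_one,
      derivative_legendre_eval_one] at h
    push_cast at h
    linear_combination h)
  have hl := tendsto_of_boundary_equation (α := p.aL) (β := -p.bL) (ξ := ξ) (η := fun n => -η n)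
    (by rw [neg_sq]; exact p.left_ne) (fun n => by rw [abs_neg]; exact hy n) hz (fun n => by
    have h := (hR.bc n).1
    rw [hform n] at h
    simp only [derivative_add, derivative_C_mul, eval_add, eval_mul, eval_C, legendre_eval_neg_one,
      derivative_legendre_eval_neg_one, pow_succ] at h
    push_cast at h
    have h5 : ((-1 : ℝ) ^ n) ≠ 0 := by positivity
    apply mul_left_cancel₀ h5
    linear_combination h)
  have hbneg : bcType (-p.bL) = bcType p.bL := by simp [bcType]
  rw [hbneg] at hl
  have hbd : ∀ (b : ℝ) {u v : ℝ}, |u| ≤ 1 → |v| ≤ 1 → |bcType b * (2 * u + 4 * v)| ≤ 6 := by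
    intro b u v hu hv
    have h1 : |2 * u + 4 * v| ≤ 6 := by
      rw [abs_le] at *; constructor <;> linarith
    unfold bcType; split_ifs
    · simp
    · simpa using h1
  have hr0 := tendsto_zero_of_mul_nat_add (fun n => hbd p.bR (hy n) (hz n)) hr
  have hl0 := tendsto_zero_of_mul_nat_add
    (fun n => hbd p.bL (show |-η n| ≤ 1 by rw [abs_neg]; exact hy n) (hz n)) hl
  have hη0 : Tendsto η atTop (𝓝 0) := by
    have := (hr0.sub hl0).div_const 2
    rw [sub_zero, zero_div] at this
    exact this.congr fun n => by ring
  have hs0 : Tendsto (fun n => ξ n + θ n) atTop (𝓝 0) := by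
    have := hr0.sub hη0
    rw [sub_zero] at this
    exact this.congr fun n => by ring
  have hξ1 : Tendsto ξ atTop (𝓝 1) := by
    have h : Tendsto (fun n => |η n| + |ξ n + θ n|) atTop (𝓝 0) := by
      simpa using hη0.abs.add hs0.abs
    rw [tendsto_iff_dist_tendsto_zero]
    refine squeeze_zero (fun n => dist_nonneg) (fun n => ?_) h
    have h1 : ξ n ≤ 1 := (le_abs_self _).trans (hx n)
    rw [Real.dist_eq, abs_sub_comm, abs_of_nonneg (by linarith)]
    have h2 : |θ n| ≤ ξ n + |ξ n + θ n| := by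
      have := abs_sub (ξ n + θ n) (ξ n)
      rw [add_sub_cancel_left, abs_of_nonneg (hξ n)] at this
      linarith
    have h3 := hmax n
    have h4 := abs_nonneg (η n)
    have h5 := abs_nonneg (ξ n + θ n)
    have h6 : max |ξ n| (max |η n| |θ n|) ≤ ξ n + (|η n| + |ξ n + θ n|) := by
      rw [abs_of_nonneg (hξ n)]
      refine max_le (by linarith) (max_le ?_ ?_)
      · linarith [hξ n]
      · linarith
    linarith
  have hθ1 : Tendsto θ atTop (𝓝 (-1)) := by
    have := hs0.sub hξ1
    rw [zero_sub] at this
    exact this.congr fun n => by ring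
  refine ⟨ξ, η, θ, hform, hx, hy, hz, fun h n => hsymm n h, hξ1, hη0, hθ1, ?_, ?_⟩
  · have := hr.sub (((hη0.const_mul 2).add (hθ1.const_mul 4)).const_mul (bcType p.bR))
    rw [show 0 - bcType p.bR * (2 * 0 + 4 * -1) = 4 * bcType p.bR by ring] at this
    exact this.congr fun n => by ring
  · have := hl.sub (((hη0.const_mul (-2)).add (hθ1.const_mul 4)).const_mul (bcType p.bL))
    rw [show 0 - bcType p.bL * (-2 * 0 + 4 * -1) = 4 * bcType p.bL by ring] at this
    exact this.congr fun n => by ring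

namespace BasisCoeff

variable {S : ℕ} {p : Problem S} {R : ℕ → ℝ[X]} {ξ η θ : ℕ → ℝ}

theorem exists_bound (h : BasisCoeff p R ξ η θ) :
    ∃ K, 0 < K ∧ ∀ n : ℕ, |η n| ≤ K / (n + 1) ∧ |ξ n + θ n| ≤ K / (n + 1) := by
  have h1 : Tendsto (fun n : ℕ => ((n : ℝ) + 1) * η n) atTop
      (𝓝 ((4 * bcType p.bR - 4 * bcType p.bL) / 2 + 0)) := by
    refine (((h.lim_right.sub h.lim_left).div_const 2).add h.lim_η).congr fun n => ?_
    ring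
  have h2 : Tendsto (fun n : ℕ => ((n : ℝ) + 1) * (ξ n + θ n)) atTop
      (𝓝 ((4 * bcType p.bR + 4 * bcType p.bL) / 2 + (1 + -1))) := by
    refine (((h.lim_right.add h.lim_left).div_const 2).add (h.lim_ξ.add h.lim_θ)).congr fun n => ?_
    ring
  obtain ⟨K1, hK1⟩ := (Metric.isBounded_range_of_tendsto _ h1).exists_norm_le
  obtain ⟨K2, hK2⟩ := (Metric.isBounded_range_of_tendsto _ h2).exists_norm_le
  have aux : ∀ {K u : ℝ} {n : ℕ}, ‖((n : ℝ) + 1) * u‖ ≤ K → |u| ≤ max (max K1 K2) 1 / (n + 1) ∨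
      ¬ K ≤ max K1 K2 := by
    intro K u n hu
    by_cases hK : K ≤ max K1 K2
    · left
      rw [norm_mul, Real.norm_of_nonneg (by positivity), Real.norm_eq_abs] at hu
      rw [le_div_iff₀ (by positivity), mul_comm]
      exact hu.trans (hK.trans (le_max_left _ _))
    · exact Or.inr hK
  refine ⟨max (max K1 K2) 1, lt_of_lt_of_le one_pos (le_max_right _ _), fun n => ⟨?_, ?_⟩⟩
  · exact (aux (hK1 _ ⟨n, rfl⟩)).resolve_right (not_not.2 (le_max_left _ _))
  · exact (aux (hK2 _ ⟨n, rfl⟩)).resolve_right (not_not.2 (le_max_right _ _))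

theorem natDegree_le (h : BasisCoeff p R ξ η θ) (n : ℕ) : (R n).natDegree ≤ n + 2 := by
  rw [h.form]
  have h1 : ∀ (k : ℝ) (m : ℕ), m ≤ n + 2 → (C k * legendre m).natDegree ≤ n + 2 := fun k m hm =>
    (natDegree_C_mul_le _ _).trans ((natDegree_legendre_le m).trans hm)
  exact natDegree_add_le_of_degree_le (natDegree_add_le_of_degree_le (h1 _ _ (by omega))
    (h1 _ _ (by omega))) (h1 _ _ (by omega))

theorem pip_of_degree_lt (h : BasisCoeff p R ξ η θ) {n : ℕ} {r : ℝ[X]} (hr : r.degree < n) :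
    pip (R n) r = 0 := by
  have h1 : ∀ m, n ≤ m → pip (legendre m) r = 0 := fun m hm =>
    pip_legendre_of_degree_lt (hr.trans_le (by exact_mod_cast hm))
  rw [h.form, map_add, map_add, LinearMap.add_apply, LinearMap.add_apply, pip_C_mul_left,
    pip_C_mul_left, pip_C_mul_left, h1 n le_rfl, h1 _ (by omega), h1 _ (by omega)]
  simp

theorem pip_of_natDegree_lt (h : BasisCoeff p R ξ η θ) {n : ℕ} {r : ℝ[X]} (hr : r.natDegree < n) :
    pip (R n) r = 0 :=
  h.pip_of_degree_lt (degree_le_natDegree.trans_lt (by exact_mod_cast hr))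

theorem natDegree_derivative2_le {r : ℝ[X]} {n : ℕ} (hr : r.natDegree ≤ n + 2) :
    (derivative (derivative r)).natDegree ≤ n := by
  have h1 := natDegree_derivative_le (derivative r)
  have h2 := natDegree_derivative_le r
  omega

theorem pip_far (h : BasisCoeff p R ξ η θ) {n m : ℕ} (hnm : n + 2 < m) : pip (R n) (R m) = 0 := by
  rw [pip_comm]; exact h.pip_of_natDegree_lt ((h.natDegree_le n).trans_lt hnm)

theorem aEntry_self (h : BasisCoeff p R ξ η θ) (n : ℕ) :
    aEntry R n n = -(2 * (2 * n + 3) * (ξ n * θ n)) := by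
  have hd : derivative (derivative (R n)) =
      (C (ξ n) * derivative (derivative (legendre n)) +
        C (η n) * derivative (derivative (legendre (n + 1)))) +
      C (θ n) * derivative (derivative (legendre (n + 2))) := by
    rw [h.form]; simp only [derivative_add, derivative_C_mul]
  have h1 : ∀ m ≤ n + 1, pip (R n) (derivative (derivative (legendre m))) = 0 := by
    intro m hm
    apply h.pip_of_degree_lt
    apply degree_derivative_lt'
    have := natDegree_derivative_le (legendre m)
    have := natDegree_legendre_le m
    omega
  have h2 : pip (R n) (derivative (derivative (legendre (n + 2)))) = ξ n * (2 * (2 * n + 3)) := by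
    have h3 : ∀ m, n < m → pip (legendre m) (derivative (derivative (legendre (n + 2)))) = 0 := by
      intro m hm
      apply pip_legendre_of_degree_lt
      refine (degree_le_natDegree).trans_lt ?_
      have := natDegree_derivative2_le (natDegree_legendre_le (n + 2))
      exact_mod_cast this.trans_lt hm
    rw [h.form, map_add, map_add, LinearMap.add_apply, LinearMap.add_apply, pip_C_mul_left,
      pip_C_mul_left, pip_C_mul_left, h3 (n + 1) (by omega), h3 (n + 2) (by omega),
      pip_legendre_second_derivative]
    ring
  rw [aEntry, ← pip_apply, hd, map_add, map_add, pip_C_mul_right, pip_C_mul_right, pip_C_mul_right,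
    h1 _ (by omega), h1 _ le_rfl, h2]
  ring

theorem tendsto_aEntry_div (h : BasisCoeff p R ξ η θ) :
    Tendsto (fun n : ℕ => aEntry R n n / n) atTop (𝓝 4) := by
  have h1 := tendsto_one_div_atTop_nhds_zero_nat (𝕜 := ℝ)
  have := (((h1.const_mul 3).const_add 2).const_mul (-2)).mul (h.lim_ξ.mul h.lim_θ)
  rw [show -2 * (2 + 3 * (0 : ℝ)) * (1 * -1) = 4 by norm_num] at this
  refine this.congr' ?_
  filter_upwards [eventually_gt_atTop 0] with n hn
  have : (n : ℝ) ≠ 0 := by positivity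
  rw [h.aEntry_self]
  field_simp

theorem eventually_aEntry (h : BasisCoeff p R ξ η θ) :
    ∀ᶠ n : ℕ in atTop, (n : ℝ) ≤ aEntry R n n ∧ aEntry R n n ≤ 8 * n ∧ 0 < aEntry R n n := by
  filter_upwards [h.tendsto_aEntry_div.eventually (Icc_mem_nhds (by norm_num : (1 : ℝ) < 4)
    (by norm_num : (4 : ℝ) < 8)), eventually_gt_atTop 0] with n hn h0
  have h0' : (0 : ℝ) < n := by positivity
  have h1 := (le_div_iff₀ h0').1 hn.1
  have h2 := (div_le_iff₀ h0').1 hn.2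
  exact ⟨by linarith, h2, by linarith⟩

/-- Up to coefficients of order `1 / n`, `R n` is `P_n - P_{n+2}`, which is `O(n ^ (-1 / 2))`. -/
theorem exists_sup_bound (h : BasisCoeff p R ξ η θ) :
    ∃ K, 0 < K ∧ ∀ n : ℕ, ∀ x ∈ Set.Icc (-1 : ℝ) 1, |fn (R n) x| ≤ K / Real.sqrt (n + 1) := by
  obtain ⟨K, hK, hb⟩ := h.exists_bound
  refine ⟨3 + K + K, by linarith, fun n x hx => ?_⟩
  have hs : (0 : ℝ) < Real.sqrt (n + 1) := Real.sqrt_pos.2 (by positivity)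
  have hle : K / ((n : ℝ) + 1) ≤ K / Real.sqrt (n + 1) := by
    apply div_le_div_of_nonneg_left hK.le hs
    rw [Real.sqrt_le_left (by positivity)]
    nlinarith [show (0 : ℝ) ≤ n by positivity]
  have e : fn (R n) x = ξ n * (fn (legendre n) x - fn (legendre (n + 2)) x) +
      η n * fn (legendre (n + 1)) x + (ξ n + θ n) * fn (legendre (n + 2)) x := by
    rw [h.form]; simp only [fn_add, fn_mul, fn_C]; ring
  rw [e, add_div, add_div]
  refine (abs_add_le _ _).trans (add_le_add ((abs_add_le _ _).trans (add_le_add ?_ ?_)) ?_)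
  · rw [abs_mul]
    exact (mul_le_of_le_one_left (abs_nonneg _) (h.abs_ξ n)).trans (abs_legendre_sub_le n hx)
  · rw [abs_mul]
    exact (mul_le_of_le_one_right (abs_nonneg _) (abs_fn_legendre_le_one _ hx)).trans
      ((hb n).1.trans hle)
  · rw [abs_mul]
    exact (mul_le_of_le_one_right (abs_nonneg _) (abs_fn_legendre_le_one _ hx)).trans
      ((hb n).2.trans hle)

theorem pip_self_le (h : BasisCoeff p R ξ η θ) (n : ℕ) : pip (R n) (R n) ≤ 6 / (2 * n + 1) := by
  have e : pip (R n) (R n) = ξ n ^ 2 * (2 / (2 * n + 1)) + η n ^ 2 * (2 / (2 * (n + 1 : ℕ) + 1)) +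
      θ n ^ 2 * (2 / (2 * (n + 2 : ℕ) + 1)) := by
    have h1 := pip_legendre_of_ne (show n ≠ n + 1 by omega)
    have h2 := pip_legendre_of_ne (show n ≠ n + 2 by omega)
    have h3 := pip_legendre_of_ne (show n + 1 ≠ n + 2 by omega)
    rw [← pip_legendre_self, ← pip_legendre_self, ← pip_legendre_self, h.form]
    simp only [map_add, LinearMap.add_apply, pip_C_mul_left, pip_C_mul_right, h1, h2, h3,
      pip_comm (legendre (n + 1)) (legendre n), pip_comm (legendre (n + 2)) _]
    ring
  have hn : (0 : ℝ) ≤ n := by positivity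
  have aux : ∀ {u : ℝ} {m : ℕ}, |u| ≤ 1 → n ≤ m → u ^ 2 * (2 / (2 * (m : ℝ) + 1)) ≤
      2 / (2 * n + 1) := by
    intro u m hu hm
    have h1 : u ^ 2 ≤ 1 := by rwa [sq_le_one_iff_abs_le_one]
    have h2 : (2 : ℝ) / (2 * (m : ℝ) + 1) ≤ 2 / (2 * n + 1) := by
      apply div_le_div_of_nonneg_left (by norm_num) (by positivity)
      have : (n : ℝ) ≤ m := by exact_mod_cast hm
      linarith
    exact (mul_le_of_le_one_left (by positivity) h1).trans h2
  rw [e]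
  have := aux (h.abs_ξ n) le_rfl
  have := aux (h.abs_η n) (show n ≤ n + 1 by omega)
  have := aux (h.abs_θ n) (show n ≤ n + 2 by omega)
  have e6 : (6 : ℝ) / (2 * n + 1) = 2 / (2 * n + 1) + 2 / (2 * n + 1) + 2 / (2 * n + 1) := by ring
  rw [e6]; linarith

theorem abs_pip_le_half (r s : ℝ[X]) : |pip r s| ≤ (pip r r + pip s s) / 2 := by
  have h1 := pip_self_nonneg (r + s)
  have h2 := pip_self_nonneg (r - s)
  simp only [map_add, map_sub, LinearMap.add_apply, LinearMap.sub_apply, pip_comm s r] at h1 h2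
  rw [abs_le]; constructor <;> linarith

theorem abs_pip_le (h : BasisCoeff p R ξ η θ) {n m : ℕ} (hm : n ≤ m + 2) :
    |pip (R n) (R m)| ≤ 15 / (n + 1) := by
  have h1 := abs_pip_le_half (R n) (R m)
  have h2 := h.pip_self_le n
  have h3 := h.pip_self_le m
  have hn : (n : ℝ) ≤ m + 2 := by exact_mod_cast hm
  have hn0 : (0 : ℝ) ≤ n := by positivity
  have hm0 : (0 : ℝ) ≤ m := by positivity
  have h4 : (6 : ℝ) / (2 * n + 1) ≤ 6 / (n + 1) :=
    div_le_div_of_nonneg_left (by norm_num) (by positivity) (by linarith)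
  have h5 : (6 : ℝ) / (2 * m + 1) ≤ 24 / (n + 1) := by
    rw [div_le_div_iff₀ (by positivity) (by positivity)]; linarith
  have : (15 : ℝ) / (n + 1) = (6 / (n + 1) + 24 / (n + 1)) / 2 := by ring
  linarith

end BasisCoeff

/-- Green's identity for polynomials that satisfy the boundary conditions. -/
theorem Problem.PolyBC.pip_symm {S : ℕ} {p : Problem S} {r s : ℝ[X]} (hr : p.PolyBC r)
    (hs : p.PolyBC s) : pip r (derivative (derivative s)) = pip (derivative (derivative r)) s := by
  have h1 := pip_derivative (derivative s) r
  have h2 := pip_derivative (derivative r) s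
  have aux : ∀ {a b u u' v v' : ℝ}, a ^ 2 + b ^ 2 ≠ 0 → a * u + b * u' = 0 → a * v + b * v' = 0 →
      u' * v = v' * u := by
    intro a b u u' v v' h h1 h2
    have e1 : a * (u' * v - v' * u) = 0 := by linear_combination u' * h2 - v' * h1
    have e2 : b * (u' * v - v' * u) = 0 := by linear_combination v * h1 - u * h2
    by_contra hne
    have h3 := sub_ne_zero.2 hne
    have ha := (mul_eq_zero.1 e1).resolve_right h3
    have hb := (mul_eq_zero.1 e2).resolve_right h3
    simp [ha, hb] at h
  have e1 := aux p.right_ne hr.2 hs.2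
  have e2 := aux p.left_ne hr.1 hs.1
  simp only [eval_mul] at h1 h2
  rw [pip_comm r, h1, h2, pip_comm (derivative s)]
  linarith

/-- The stiffness matrix is diagonal: by Green's identity one may let the second derivative fall on
the polynomial of lower index, and its degree is then too small to meet the other one. -/
theorem aEntry_of_ne {S : ℕ} {p : Problem S} {R : ℕ → ℝ[X]} {ξ η θ : ℕ → ℝ}
    (h : BasisCoeff p R ξ η θ) (hbc : ∀ n, p.PolyBC (R n)) {m n : ℕ} (hmn : m ≠ n) :
    aEntry R m n = 0 := by
  rw [aEntry, ← pip_apply, neg_eq_zero]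
  rcases lt_or_gt_of_ne hmn with h1 | h1
  · rw [(hbc m).pip_symm (hbc n), pip_comm]
    exact h.pip_of_natDegree_lt
      ((BasisCoeff.natDegree_derivative2_le (h.natDegree_le m)).trans_lt h1)
  · exact h.pip_of_natDegree_lt
      ((BasisCoeff.natDegree_derivative2_le (h.natDegree_le n)).trans_lt h1)

/-- The space of polynomials of degree at most `N + 1` that satisfy the boundary conditions. -/
noncomputable def polySpace {S : ℕ} (p : Problem S) (N : ℕ) : Submodule ℝ ℝ[X] where
  carrier := {r : ℝ[X] | r.natDegree ≤ N + 1 ∧ p.PolyBC r}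
  zero_mem' := by simp [Problem.PolyBC]
  add_mem' := by
    rintro a b ⟨ha, ha1, ha2⟩ ⟨hb, hb1, hb2⟩
    refine ⟨natDegree_add_le_of_degree_le ha hb, ?_, ?_⟩
    · simp only [eval_add, derivative_add]; linarith
    · simp only [eval_add, derivative_add]; linarith
  smul_mem' := by
    rintro c a ⟨ha, ha1, ha2⟩
    refine ⟨(natDegree_smul_le _ _).trans ha, ?_, ?_⟩
    · simp only [derivative_smul, eval_smul, smul_eq_mul]; linear_combination c * ha1
    · simp only [derivative_smul, eval_smul, smul_eq_mul]; linear_combination c * ha2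

theorem mem_polySpace {S : ℕ} {p : Problem S} {N : ℕ} {r : ℝ[X]} :
    r ∈ polySpace p N ↔ r.natDegree ≤ N + 1 ∧ p.PolyBC r := Iff.rfl

theorem polySpace_mono {S : ℕ} (p : Problem S) {M N : ℕ} (h : M ≤ N) :
    polySpace p M ≤ polySpace p N := fun _ hr => ⟨hr.1.trans (by omega), hr.2⟩

theorem Problem.IsBasis.span_eq {S : ℕ} {p : Problem S} {R : ℕ → ℝ[X]} (hR : p.IsBasis R) :
    ∀ᶠ N in atTop, Submodule.span ℝ (R '' Set.Iio N) = polySpace p N := by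
  filter_upwards [hR.span] with N hN
  exact SetLike.coe_injective hN

/-- Two linear conditions cut the dimension by two at most. -/
theorem le_finrank_polySpace {S : ℕ} (p : Problem S) (N : ℕ) :
    N ≤ Module.finrank ℝ (polySpace p N) := by
  have e := degreeLTEquiv ℝ (N + 2)
  let L : ℝ[X] →ₗ[ℝ] ℝ × ℝ := LinearMap.prod
    (p.aL • (Polynomial.leval (-1 : ℝ)) + p.bL • (Polynomial.leval (-1 : ℝ)) ∘ₗ derivative)
    (p.aR • (Polynomial.leval (1 : ℝ)) + p.bR • (Polynomial.leval (1 : ℝ)) ∘ₗ derivative)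
  have hL : ∀ r, L r = 0 ↔ p.PolyBC r := fun r => by
    simp [L, Problem.PolyBC, Polynomial.leval]
  let F := L ∘ₗ (degreeLT ℝ (N + 2)).subtype
  have : FiniteDimensional ℝ (degreeLT ℝ (N + 2)) := Module.Finite.equiv e.symm
  have h1 := LinearMap.finrank_range_add_finrank_ker F
  have h2 : Module.finrank ℝ (degreeLT ℝ (N + 2)) = N + 2 := by
    rw [LinearEquiv.finrank_eq e]; simp
  have h3 : Module.finrank ℝ (LinearMap.range F) ≤ 2 := by
    refine (Submodule.finrank_le _).trans (by simp)
  have h4 : Module.finrank ℝ (LinearMap.ker F) =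
      Module.finrank ℝ ((LinearMap.ker F).map (degreeLT ℝ (N + 2)).subtype) :=
    (LinearEquiv.finrank_eq (Submodule.equivMapOfInjective _ (Submodule.injective_subtype _) _))
  have h5 : (LinearMap.ker F).map (degreeLT ℝ (N + 2)).subtype = polySpace p N := by
    ext r
    simp only [Submodule.mem_map, LinearMap.mem_ker, mem_polySpace]
    constructor
    · rintro ⟨⟨s, hs⟩, h0, rfl⟩
      refine ⟨?_, (hL s).1 h0⟩
      have := mem_degreeLT.1 hs
      exact natDegree_le_iff_coeff_eq_zero.2 fun m hm =>
        (degree_lt_iff_coeff_zero _ _).1 this m (by omega)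
    · rintro ⟨h1, h2⟩
      exact ⟨⟨r, mem_degreeLT.2 ((degree_lt_iff_coeff_zero _ _).2 fun m hm =>
        natDegree_le_iff_coeff_eq_zero.1 h1 m (by omega))⟩, (hL r).2 h2, rfl⟩
  rw [h5] at h4
  omega

/-- For large `M` the span of `R 0, …, R (M - 1)` has at least the dimension `M`, which makes these
polynomials independent; the smaller families inherit this. -/
theorem Problem.IsBasis.linearIndependent {S : ℕ} {p : Problem S} {R : ℕ → ℝ[X]}
    (hR : p.IsBasis R) (N : ℕ) : LinearIndependent ℝ (fun i : Fin N => R i) := by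
  obtain ⟨M, hM, hNM⟩ := (hR.span_eq.and (eventually_ge_atTop N)).exists
  have h1 : LinearIndependent ℝ (fun i : Fin M => R i) := by
    rw [linearIndependent_iff_card_le_finrank_span, Fintype.card_fin, Set.finrank]
    have h2 : Set.range (fun i : Fin M => R i) = R '' Set.Iio M := by
      ext r; constructor
      · rintro ⟨i, rfl⟩; exact ⟨i, i.2, rfl⟩
      · rintro ⟨i, hi, rfl⟩; exact ⟨⟨i, hi⟩, rfl⟩
    rw [h2, hM]
    exact le_finrank_polySpace p M
  exact h1.comp (Fin.castLE hNM) (Fin.castLE_injective hNM)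

open MeasureTheory

/-! ### Inner products with integrable functions -/

theorem intervalIntegrable_mul_of_continuousOn {u v : ℝ → ℝ}
    (hu : ContinuousOn u (Set.Icc (-1) 1)) (hv : IntervalIntegrable v volume (-1) 1) :
    IntervalIntegrable (fun x => u x * v x) volume (-1) 1 :=
  hv.continuousOn_mul (by rwa [Set.uIcc_of_le (by norm_num)])

theorem intervalIntegrable_fn_mul (r : ℝ[X]) {v : ℝ → ℝ}
    (hv : IntervalIntegrable v volume (-1) 1) :
    IntervalIntegrable (fun x => fn r x * v x) volume (-1) 1 :=
  intervalIntegrable_mul_of_continuousOn (continuous_fn r).continuousOn hv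

theorem ip_sub_right {u v w : ℝ → ℝ} (hv : IntervalIntegrable (fun x => u x * v x) volume (-1) 1)
    (hw : IntervalIntegrable (fun x => u x * w x) volume (-1) 1) :
    ip u (fun x => v x - w x) = ip u v - ip u w := by
  simp only [ip, mul_sub]; exact intervalIntegral.integral_sub hv hw

theorem ip_const_mul_right (k : ℝ) (u v : ℝ → ℝ) : ip u (fun x => k * v x) = k * ip u v := by
  simp only [ip, mul_left_comm _ k]; exact intervalIntegral.integral_const_mul _ _

theorem ip_congr {u v u' v' : ℝ → ℝ} (h : ∀ x ∈ Set.Ioo (-1 : ℝ) 1, u x * v x = u' x * v' x) :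
    ip u v = ip u' v' := by
  refine intervalIntegral.integral_congr_ae ?_
  have h1 : ∀ᵐ x : ℝ, x ≠ 1 := by simp [ae_iff]
  filter_upwards [h1] with x hx hx'
  rw [Set.uIoc_of_le (by norm_num)] at hx'
  exact h x ⟨hx'.1, lt_of_le_of_ne hx'.2 hx⟩

/-- The inner product with a fixed integrable function, as a linear form on polynomials. -/
noncomputable def ipForm (v : ℝ → ℝ) (hv : IntervalIntegrable v volume (-1) 1) : ℝ[X] →ₗ[ℝ] ℝ where
  toFun r := ip (fn r) v
  map_add' r s := by
    simp only [ip, fn_add, add_mul]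
    exact intervalIntegral.integral_add (intervalIntegrable_fn_mul r hv)
      (intervalIntegrable_fn_mul s hv)
  map_smul' k r := by
    simp only [ip, fn, eval_smul, smul_eq_mul, mul_assoc, RingHom.id_apply]
    exact intervalIntegral.integral_const_mul _ _

theorem ipForm_C_mul (v : ℝ → ℝ) (hv : IntervalIntegrable v volume (-1) 1) (k : ℝ) (r : ℝ[X]) :
    ipForm v hv (C k * r) = k * ipForm v hv r := by
  rw [C_mul', map_smul]; rfl

theorem abs_ip_le {u v : ℝ → ℝ} {M : ℝ} (hu : ∀ x ∈ Set.Icc (-1 : ℝ) 1, |u x| ≤ M)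
    (hv : IntervalIntegrable v volume (-1) 1) :
    |ip u v| ≤ M * ∫ x in (-1 : ℝ)..1, |v x| := by
  rw [← intervalIntegral.integral_const_mul]
  change ‖∫ x in (-1 : ℝ)..1, u x * v x‖ ≤ _
  refine intervalIntegral.norm_integral_le_of_norm_le (by norm_num) ?_ (hv.abs.const_mul M)
  refine Eventually.of_forall fun x hx => ?_
  rw [Real.norm_eq_abs, abs_mul]
  exact mul_le_mul_of_nonneg_right (hu x ⟨hx.1.le, hx.2⟩) (abs_nonneg _)

/-! ### Symbol classes at an endpoint -/

/-- Membership in the symbol class of order `s` at the endpoint `1`, with `k` derivatives: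
`u` is `k` times differentiable on `(-1, 1)` and its derivative of order `j ≤ k` is
`O((1 - x) ^ (s - j))` on `[0, 1)`. -/
def SymR : ℕ → ℝ → (ℝ → ℝ) → Prop
  | 0, s, u => ContinuousOn u (Set.Ioo (-1) 1) ∧
      ∃ C, ∀ x ∈ Set.Ico (0 : ℝ) 1, |u x| ≤ C * (1 - x) ^ s
  | k + 1, s, u => DifferentiableOn ℝ u (Set.Ioo (-1) 1) ∧
      (∃ C, ∀ x ∈ Set.Ico (0 : ℝ) 1, |u x| ≤ C * (1 - x) ^ s) ∧ SymR k (s - 1) (deriv u)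

namespace SymR

variable {k : ℕ} {s t : ℝ} {u v : ℝ → ℝ}

theorem continuousOn (h : SymR k s u) : ContinuousOn u (Set.Ioo (-1) 1) := by
  cases k with
  | zero => exact h.1
  | succ k => exact h.1.continuousOn

theorem bound (h : SymR k s u) : ∃ C, ∀ x ∈ Set.Ico (0 : ℝ) 1, |u x| ≤ C * (1 - x) ^ s := by
  cases k with
  | zero => exact h.2
  | succ k => exact h.2.1

theorem of_succ (h : SymR (k + 1) s u) : SymR k s u := by
  induction k generalizing s u with
  | zero => exact ⟨h.1.continuousOn, h.2.1⟩
  | succ k ih => exact ⟨h.1, h.2.1, ih h.2.2⟩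

theorem Ico_sub : Set.Ico (0 : ℝ) 1 ⊆ Set.Ioo (-1) 1 := fun _ hx => ⟨by linarith [hx.1], hx.2⟩

theorem congr (h : SymR k s u) (huv : Set.EqOn u v (Set.Ioo (-1) 1)) : SymR k s v := by
  induction k generalizing s u v with
  | zero =>
    refine ⟨h.1.congr huv.symm, ?_⟩
    obtain ⟨C, hC⟩ := h.2
    exact ⟨C, fun x hx => by rw [← huv (Ico_sub hx)]; exact hC x hx⟩
  | succ k ih =>
    refine ⟨h.1.congr huv.symm, ?_, ih h.2.2 fun x hx => ?_⟩
    · obtain ⟨C, hC⟩ := h.2.1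
      exact ⟨C, fun x hx => by rw [← huv (Ico_sub hx)]; exact hC x hx⟩
    · exact (huv.eventuallyEq_of_mem (isOpen_Ioo.mem_nhds hx)).deriv_eq

theorem bound_mono (hst : t ≤ s) (h : ∃ C, ∀ x ∈ Set.Ico (0 : ℝ) 1, |u x| ≤ C * (1 - x) ^ s) :
    ∃ C, ∀ x ∈ Set.Ico (0 : ℝ) 1, |u x| ≤ C * (1 - x) ^ t := by
  obtain ⟨C, hC⟩ := h
  refine ⟨|C|, fun x hx => (hC x hx).trans ?_⟩
  have h1 : (1 - x) ^ s ≤ (1 - x) ^ t :=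
    Real.rpow_le_rpow_of_exponent_ge (by linarith [hx.2]) (by linarith [hx.1]) hst
  have h2 : 0 ≤ (1 - x) ^ s := Real.rpow_nonneg (by linarith [hx.2]) _
  exact (mul_le_mul_of_nonneg_right (le_abs_self C) h2).trans
    (mul_le_mul_of_nonneg_left h1 (abs_nonneg _))

theorem mono (h : SymR k s u) (hst : t ≤ s) : SymR k t u := by
  induction k generalizing s t u with
  | zero => exact ⟨h.1, bound_mono hst h.2⟩
  | succ k ih => exact ⟨h.1, bound_mono hst h.2.1, ih h.2.2 (by linarith)⟩

theorem add (hu : SymR k s u) (hv : SymR k s v) : SymR k s (fun x => u x + v x) := by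
  have hb : ∃ C, ∀ x ∈ Set.Ico (0 : ℝ) 1, |u x + v x| ≤ C * (1 - x) ^ s := by
    obtain ⟨C, hC⟩ := hu.bound
    obtain ⟨D, hD⟩ := hv.bound
    exact ⟨C + D, fun x hx => (abs_add_le _ _).trans
      ((add_le_add (hC x hx) (hD x hx)).trans_eq (add_mul _ _ _).symm)⟩
  induction k generalizing s u v with
  | zero => exact ⟨hu.1.add hv.1, hb⟩
  | succ k ih =>
    refine ⟨hu.1.add hv.1, hb, SymR.congr (ih hu.2.2 hv.2.2 ?_) fun x hx => ?_⟩
    · obtain ⟨C, hC⟩ := hu.2.2.bound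
      obtain ⟨D, hD⟩ := hv.2.2.bound
      exact ⟨C + D, fun x hx => (abs_add_le _ _).trans
        ((add_le_add (hC x hx) (hD x hx)).trans_eq (add_mul _ _ _).symm)⟩
    · exact (deriv_fun_add (hu.1.differentiableAt (isOpen_Ioo.mem_nhds hx))
        (hv.1.differentiableAt (isOpen_Ioo.mem_nhds hx))).symm

theorem mul (hu : SymR k s u) (hv : SymR k t v) : SymR k (s + t) (fun x => u x * v x) := by
  have hb : ∀ {k s t} {u v : ℝ → ℝ}, SymR k s u → SymR k t v →
      ∃ C, ∀ x ∈ Set.Ico (0 : ℝ) 1, |u x * v x| ≤ C * (1 - x) ^ (s + t) := by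
    intro k s t u v hu hv
    obtain ⟨C, hC⟩ := hu.bound
    obtain ⟨D, hD⟩ := hv.bound
    refine ⟨C * D, fun x hx => ?_⟩
    rw [Real.rpow_add (by linarith [hx.2]), abs_mul]
    calc |u x| * |v x| ≤ (C * (1 - x) ^ s) * (D * (1 - x) ^ t) :=
          mul_le_mul (hC x hx) (hD x hx) (abs_nonneg _) ((abs_nonneg _).trans (hC x hx))
      _ = _ := by ring
  induction k generalizing s t u v with
  | zero => exact ⟨hu.1.mul hv.1, hb hu hv⟩
  | succ k ih =>
    refine ⟨hu.1.mul hv.1, hb hu hv, SymR.congr (SymR.add ((ih hu.2.2 hv.of_succ).mono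
      (t := s + t - 1) (by linarith)) ((ih hu.of_succ hv.2.2).mono
      (t := s + t - 1) (by linarith))) fun x hx => ?_⟩
    exact (deriv_fun_mul (hu.1.differentiableAt (isOpen_Ioo.mem_nhds hx))
        (hv.1.differentiableAt (isOpen_Ioo.mem_nhds hx))).symm

theorem rpow (k : ℕ) (a : ℝ) : SymR k a (fun x => (1 - x) ^ a) := by
  have hd : ∀ a : ℝ, ∀ x ∈ Set.Ioo (-1 : ℝ) 1,
      HasDerivAt (fun x : ℝ => (1 - x) ^ a) (-a * (1 - x) ^ (a - 1)) x := by
    intro a x hx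
    have h := ((hasDerivAt_id x).const_sub 1).rpow_const (p := a)
      (Or.inl (by simp; linarith [hx.2]))
    convert! h using 1
    simp
  have hb : ∀ a c : ℝ, ∃ C, ∀ x ∈ Set.Ico (0 : ℝ) 1, |c * (1 - x) ^ a| ≤ C * (1 - x) ^ a :=
    fun a c => ⟨|c|, fun x hx => by
      rw [abs_mul, abs_of_nonneg (Real.rpow_nonneg (show 0 ≤ 1 - x by linarith [hx.2]) a)]⟩
  suffices h : ∀ c : ℝ, SymR k a (fun x => c * (1 - x) ^ a) by simpa using h 1
  induction k generalizing a with
  | zero => exact fun c => ⟨fun x hx =>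
      ((hd a x hx).const_mul c).continuousAt.continuousWithinAt, hb a c⟩
  | succ k ih =>
    intro c
    refine ⟨fun x hx => ((hd a x hx).const_mul c).differentiableAt.differentiableWithinAt, hb a c,
      (ih (a - 1) (c * -a)).congr fun x hx => ?_⟩
    rw [((hd a x hx).const_mul c).deriv]; ring

theorem of_analyticOnNhd (k : ℕ) (h : AnalyticOnNhd ℝ u (Set.Ioc (-1) 1)) : SymR k 0 u := by
  have hb : ∀ {u : ℝ → ℝ}, AnalyticOnNhd ℝ u (Set.Ioc (-1) 1) →
      ∃ C, ∀ x ∈ Set.Ico (0 : ℝ) 1, |u x| ≤ C * (1 - x) ^ (0 : ℝ) := by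
    intro u h
    obtain ⟨C, hC⟩ := (isCompact_Icc (a := (0 : ℝ)) (b := 1)).exists_bound_of_continuousOn
      (h.continuousOn.mono fun x hx => ⟨by linarith [hx.1], hx.2⟩)
    exact ⟨C, fun x hx => by simpa using hC x ⟨hx.1, hx.2.le⟩⟩
  have hsub : Set.Ioo (-1 : ℝ) 1 ⊆ Set.Ioc (-1) 1 := Set.Ioo_subset_Ioc_self
  induction k generalizing u with
  | zero => exact ⟨h.continuousOn.mono hsub, hb h⟩
  | succ k ih => exact ⟨h.differentiableOn.mono hsub, hb h, (ih h.deriv).mono (by norm_num)⟩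

theorem const (k : ℕ) (c : ℝ) : SymR k 0 (fun _ => c) := of_analyticOnNhd k analyticOnNhd_const

theorem const_mul (c : ℝ) (h : SymR k s u) : SymR k s (fun x => c * u x) := by
  simpa using (const k c).mul h

theorem neg (h : SymR k s u) : SymR k s (fun x => -u x) := by
  simpa using h.const_mul (-1)

theorem sub (hu : SymR k s u) (hv : SymR k s v) : SymR k s (fun x => u x - v x) := by
  simpa [sub_eq_add_neg] using hu.add hv.neg

theorem sum {ι : Type*} (A : Finset ι) {w : ι → ℝ → ℝ} (h : ∀ i ∈ A, SymR k s (w i)) :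
    SymR k s (fun x => ∑ i ∈ A, w i x) := by
  classical
  induction A using Finset.induction_on with
  | empty =>
    simp only [Finset.sum_empty]
    have := (rpow k s).const_mul 0
    simpa using this
  | insert i A hi ih =>
    simp only [Finset.sum_insert hi]
    exact (h i (Finset.mem_insert_self _ _)).add (ih fun j hj => h j (Finset.mem_insert_of_mem hj))

/-- Taylor's formula of order two at the endpoint. -/
theorem taylor_of_analyticOnNhd (k : ℕ) (h : AnalyticOnNhd ℝ u (Set.Ioc (-1) 1)) :
    SymR k 2 (fun x => u x - (u 1 + deriv u 1 * (x - 1))) := by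
  have hds : ∀ {w : ℝ → ℝ}, AnalyticOnNhd ℝ w (Set.Ioc (-1) 1) →
      AnalyticOnNhd ℝ (dslope w 1) (Set.Ioc (-1) 1) := by
    intro w hw x hx
    by_cases hx1 : x = 1
    · subst hx1
      obtain ⟨P, hP⟩ := hw 1 hx
      exact hP.has_fpower_series_dslope_fslope.analyticAt
    · have h1 : AnalyticAt ℝ (fun y => (y - 1)⁻¹ * (w y - w 1)) x :=
        ((analyticAt_id.sub analyticAt_const).inv (sub_ne_zero.2 hx1)).mul
          ((hw x hx).sub analyticAt_const)
      refine h1.congr ?_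
      filter_upwards [isOpen_ne.mem_nhds hx1] with y hy
      rw [dslope_of_ne _ hy, slope_def_field]; ring
  have h2 := hds (hds h)
  have h3 : SymR k 2 (fun x => (1 - x) ^ (2 : ℝ) * dslope (dslope u 1) 1 x) := by
    simpa using (rpow k 2).mul (of_analyticOnNhd k h2)
  refine h3.congr fun x hx => ?_
  have e1 := sub_smul_dslope u 1 x
  have e2 := sub_smul_dslope (dslope u 1) 1 x
  rw [dslope_same] at e2
  simp only [smul_eq_mul] at e1 e2
  simp only [Real.rpow_two]
  linear_combination (x - 1) * e2 + e1

/-- Improvement of a bound for the function itself, given the derivative. -/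
theorem of_deriv (hd : DifferentiableOn ℝ u (Set.Ioo (-1) 1))
    (hb : ∃ C, ∀ x ∈ Set.Ico (0 : ℝ) 1, |u x| ≤ C * (1 - x) ^ s) (h : SymR k (s - 1) (deriv u)) :
    SymR (k + 1) s u := ⟨hd, hb, h⟩

end SymR

/-- The functions on `(-1, 1)` of order `s` at both endpoints. -/
def SymLR (s : ℝ) (u : ℝ → ℝ) : Prop := ∀ k, SymR k s u ∧ SymR k s (fun x => u (-x))

namespace SymLR

variable {s t : ℝ} {u v : ℝ → ℝ}

theorem deriv (h : SymLR s u) : SymLR (s - 1) (deriv u) := fun k => by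
  refine ⟨(h (k + 1)).1.2.2, ?_⟩
  have := (h (k + 1)).2.2.2.neg
  refine this.congr fun x _ => ?_
  simp [deriv_comp_neg]

theorem mul (hu : SymLR s u) (hv : SymLR t v) : SymLR (s + t) (fun x => u x * v x) := fun k =>
  ⟨(hu k).1.mul (hv k).1, (hu k).2.mul (hv k).2⟩

theorem one_sub_sq : SymLR 1 (fun x => 1 - x ^ 2) := fun k => by
  have h : SymR k 1 (fun x => 1 - x ^ 2) := by
    have h1 := (SymR.rpow k 1).mul (SymR.of_analyticOnNhd k
      (u := fun x => 1 + x) (analyticOnNhd_const.add analyticOnNhd_id))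
    rw [add_zero] at h1
    refine h1.congr fun x _ => ?_
    simp only [Real.rpow_one]; ring
  exact ⟨h, by simpa using h⟩

theorem differentiableAt (h : SymLR s u) {x : ℝ} (hx : x ∈ Set.Ioo (-1 : ℝ) 1) :
    DifferentiableAt ℝ u x := (h 1).1.1.differentiableAt (isOpen_Ioo.mem_nhds hx)

theorem tendsto_right (h : SymR 0 s u) (hs : 0 < s) : Tendsto u (𝓝[<] 1) (𝓝 0) := by
  obtain ⟨C, hC⟩ := h.bound
  have h1 : Tendsto (fun x : ℝ => C * (1 - x) ^ s) (𝓝[<] 1) (𝓝 (C * (1 - 1) ^ s)) := by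
    have : ContinuousAt (fun x : ℝ => C * (1 - x) ^ s) 1 :=
      ((continuousAt_const.sub continuousAt_id).rpow_const (Or.inr hs.le)).const_mul C
    exact this.tendsto.mono_left nhdsWithin_le_nhds
  rw [sub_self, Real.zero_rpow hs.ne', mul_zero] at h1
  refine squeeze_zero_norm' ?_ h1
  filter_upwards [Ico_mem_nhdsLT (show (0 : ℝ) < 1 by norm_num)] with x hx using hC x hx

theorem tendsto_left (h : SymLR s u) (hs : 0 < s) : Tendsto u (𝓝[>] (-1)) (𝓝 0) := by
  have h1 := tendsto_right (h 0).2 hs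
  have h2 : Tendsto (fun x : ℝ => -x) (𝓝[>] (-1)) (𝓝[<] 1) := by
    refine tendsto_nhdsWithin_iff.2 ⟨?_, ?_⟩
    · have : Tendsto (fun x : ℝ => -x) (𝓝 (-1)) (𝓝 (-(-1))) := tendsto_id.neg
      rw [neg_neg] at this
      exact this.mono_left nhdsWithin_le_nhds
    · filter_upwards [self_mem_nhdsWithin] with x hx
      simp only [Set.mem_Iio, Set.mem_Ioi] at *; linarith
  have := h1.comp h2
  simpa [Function.comp_def] using this

theorem intervalIntegrable_right (h : SymR 0 s u) (hs : -1 < s) :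
    IntervalIntegrable u volume 0 1 := by
  obtain ⟨C, hC⟩ := h.bound
  have h1 : IntervalIntegrable (fun x : ℝ => C * (1 - x) ^ s) volume 0 1 := by
    have := (intervalIntegral.intervalIntegrable_rpow' (a := 0) (b := 1) hs).comp_sub_left 1
    simp only [sub_zero, sub_self] at this
    exact this.symm.const_mul C
  rw [intervalIntegrable_iff_integrableOn_Ioo_of_le (by norm_num)] at h1 ⊢
  refine Integrable.mono' h1 ?_ ?_
  · exact (h.continuousOn.mono fun x hx => ⟨by linarith [hx.1], hx.2⟩).aestronglyMeasurable
      measurableSet_Ioo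
  · filter_upwards [ae_restrict_mem measurableSet_Ioo] with x hx using hC x ⟨hx.1.le, hx.2⟩

theorem _root_.SturmLiouvilleGalerkin.intervalIntegrable_of_halves
    (h1 : IntervalIntegrable u volume 0 1)
    (h2 : IntervalIntegrable (fun x => u (-x)) volume 0 1) :
    IntervalIntegrable u volume (-1) 1 := by
  have h3 : IntervalIntegrable u volume (-1) 0 := by
    have := h2.comp_sub_left 0
    simpa using this.symm
  exact h3.trans h1

theorem intervalIntegrable (h : SymLR s u) (hs : -1 < s) : IntervalIntegrable u volume (-1) 1 :=
  intervalIntegrable_of_halves (intervalIntegrable_right (h 0).1 hs)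
    (intervalIntegrable_right (h 0).2 hs)

end SymLR

theorem tendsto_mul_zero_of_continuous {r w : ℝ → ℝ} {a : ℝ} {l : Filter ℝ} (hl : l ≤ 𝓝 a)
    (hr : Continuous r) (hw : Tendsto w l (𝓝 0)) : Tendsto (fun x => r x * w x) l (𝓝 0) := by
  have := ((hr.tendsto a).mono_left hl).mul hw
  rwa [mul_zero] at this

/-- The Legendre operator `((1 - x ^ 2) u')'`. -/
noncomputable def legendreOp (u : ℝ → ℝ) : ℝ → ℝ := deriv fun x => (1 - x ^ 2) * deriv u x

/-- The operator `((1 - x ^ 2) u)'`. -/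
noncomputable def firstOp (u : ℝ → ℝ) : ℝ → ℝ := deriv fun x => (1 - x ^ 2) * u x

theorem SymLR.legendreOp {s : ℝ} {u : ℝ → ℝ} (h : SymLR s u) : SymLR (s - 1) (legendreOp u) := by
  have := (SymLR.one_sub_sq.mul h.deriv).deriv
  convert! this using 1; ring

theorem SymLR.firstOp {s : ℝ} {u : ℝ → ℝ} (h : SymLR s u) : SymLR s (firstOp u) := by
  have := (SymLR.one_sub_sq.mul h).deriv
  convert! this using 1; ring

/-- Integration by parts; the weight `1 - x ^ 2` removes the boundary terms. -/
theorem ip_firstOp {s : ℝ} {u : ℝ → ℝ} (h : SymLR s u) (hs : -1 < s) (r : ℝ[X]) :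
    ip (fn r) (firstOp u) = -ip (fn ((1 - X ^ 2) * derivative r)) u := by
  have hm := SymLR.one_sub_sq.mul h
  have hi1 := intervalIntegrable_fn_mul r (h.firstOp.intervalIntegrable hs)
  have hi2 := intervalIntegrable_fn_mul ((1 - X ^ 2) * derivative r) (h.intervalIntegrable hs)
  have hF := intervalIntegral.integral_eq_sub_of_hasDerivAt_of_tendsto (a := -1) (b := 1)
    (by norm_num) (f := fun x => fn r x * ((1 - x ^ 2) * u x))
    (f' := fun x => fn r x * firstOp u x + fn ((1 - X ^ 2) * derivative r) x * u x)
    (fun x hx => by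
      have := (hasDerivAt_fn r x).mul (hm.differentiableAt hx).hasDerivAt
      convert! this using 1
      simp [fn, firstOp]; ring)
    (hi1.add hi2)
    (tendsto_mul_zero_of_continuous nhdsWithin_le_nhds (continuous_fn r)
      (hm.tendsto_left (by linarith)))
    (tendsto_mul_zero_of_continuous nhdsWithin_le_nhds (continuous_fn r)
      (SymLR.tendsto_right (hm 0).1 (by linarith)))
  rw [intervalIntegral.integral_add hi1 hi2] at hF
  simp only [ip]; linarith

/-- The Legendre operator is symmetric and has the eigenfunctions `P_n`: the coefficients of `u` are
those of `legendreOp u`, divided by `n (n + 1)` up to sign. -/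
theorem ip_legendreOp {s : ℝ} {u : ℝ → ℝ} (h : SymLR s u) (hs : 0 < s) (n : ℕ) :
    ip (fn (legendre n)) (legendreOp u) = -((n : ℝ) * (n + 1) * ip (fn (legendre n)) u) := by
  have hm := SymLR.one_sub_sq.mul h
  have hm' := SymLR.one_sub_sq.mul h.deriv
  have hi1 := intervalIntegrable_fn_mul (legendre n)
    (h.legendreOp.intervalIntegrable (by linarith))
  have hi2 := intervalIntegrable_fn_mul (C ((n : ℝ) * (n + 1)) * legendre n)
    (h.intervalIntegrable (by linarith))
  have hl := (tendsto_mul_zero_of_continuous nhdsWithin_le_nhds (continuous_fn (legendre n))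
      (hm'.tendsto_left (by linarith))).sub
    (tendsto_mul_zero_of_continuous nhdsWithin_le_nhds (continuous_fn (derivative (legendre n)))
      (hm.tendsto_left (by linarith)))
  have hr := (tendsto_mul_zero_of_continuous nhdsWithin_le_nhds (continuous_fn (legendre n))
      (SymLR.tendsto_right (hm' 0).1 (by linarith))).sub
    (tendsto_mul_zero_of_continuous nhdsWithin_le_nhds (continuous_fn (derivative (legendre n)))
      (SymLR.tendsto_right (hm 0).1 (by linarith)))
  have hF := intervalIntegral.integral_eq_sub_of_hasDerivAt_of_tendsto (a := -1) (b := 1)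
    (by norm_num) (f := fun x => fn (legendre n) x * ((1 - x ^ 2) * deriv u x) -
      fn (derivative (legendre n)) x * ((1 - x ^ 2) * u x))
    (f' := fun x => fn (legendre n) x * legendreOp u x +
      fn (C ((n : ℝ) * (n + 1)) * legendre n) x * u x)
    (fun x hx => by
      have h1 := (hasDerivAt_fn (legendre n) x).mul (hm'.differentiableAt hx).hasDerivAt
      have h2 : HasDerivAt (fun x => (1 - x ^ 2) * u x)
          (-(2 * x) * u x + (1 - x ^ 2) * deriv u x) x := by
        have := ((hasDerivAt_pow 2 x).const_sub 1).mul (h.differentiableAt hx).hasDerivAt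
        convert! this using 1
        simp
      have h3 := (hasDerivAt_fn (derivative (legendre n)) x).mul h2
      convert! h1.sub h3 using 1
      have h4 := fn_legendre_ode n x
      simp only [legendreOp, fn_mul, fn_C]
      linear_combination u x * h4)
    (hi1.add hi2) (by simpa using hl) (by simpa using hr)
  rw [intervalIntegral.integral_add hi1 hi2] at hF
  have e : ∫ x in (-1 : ℝ)..1, fn (C ((n : ℝ) * (n + 1)) * legendre n) x * u x =
      n * (n + 1) * ip (fn (legendre n)) u := by
    rw [ip, ← intervalIntegral.integral_const_mul]
    simp only [fn_mul, fn_C, mul_assoc]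
  rw [e] at hF
  rw [ip]; linarith

/-- Decay of the Legendre coefficients of a function of order more than `m - 1` at the
endpoints. -/
theorem SymLR.ip_legendre_le {s : ℝ} {u : ℝ → ℝ} {m : ℕ} (h : SymLR s u) (hs : (m : ℝ) - 1 < s) :
    ∃ K, 0 ≤ K ∧ ∀ n : ℕ, 1 ≤ n → |ip (fn (legendre n)) u| ≤ K / (n : ℝ) ^ (2 * m) := by
  induction m generalizing s u with
  | zero =>
    refine ⟨∫ x in (-1 : ℝ)..1, |u x|, intervalIntegral.integral_nonneg (by norm_num)
      fun x _ => abs_nonneg _, fun n _ => ?_⟩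
    have := abs_ip_le (fun x hx => abs_fn_legendre_le_one n hx)
      (h.intervalIntegrable (by simpa using hs))
    simpa using this
  | succ m ih =>
    push_cast at hs
    obtain ⟨K, hK, hb⟩ := ih h.legendreOp (by linarith)
    refine ⟨K, hK, fun n hn => ?_⟩
    have hn0 : (0 : ℝ) < n := by positivity
    have hm : (0 : ℝ) ≤ m := by positivity
    have e := ip_legendreOp h (by linarith) n
    have e2 := hb n hn
    rw [e, abs_neg, abs_mul, abs_of_pos (show 0 < (n : ℝ) * (n + 1) by positivity)] at e2
    have e3 : (n : ℝ) ^ 2 * |ip (fn (legendre n)) u| ≤ K / (n : ℝ) ^ (2 * m) :=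
      (mul_le_mul_of_nonneg_right (by nlinarith) (abs_nonneg _)).trans e2
    rw [le_div_iff₀ (by positivity)] at e3 ⊢
    calc _ = (n : ℝ) ^ 2 * |ip (fn (legendre n)) u| * (n : ℝ) ^ (2 * m) := by ring
      _ ≤ K := e3

theorem ip_legendre_sub {s : ℝ} {u : ℝ → ℝ} (h : SymLR s u) (hs : -1 < s) (n : ℕ) :
    ip (fn (legendre n)) u - ip (fn (legendre (n + 2))) u =
      -((2 * n + 3) / ((n + 1) * (n + 2)) * ip (fn (legendre (n + 1))) (firstOp u)) := by
  have hi := h.intervalIntegrable hs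
  have e := congrArg (ipForm u hi) (one_sub_sq_mul_derivative n)
  rw [ipForm_C_mul, ipForm_C_mul, map_sub] at e
  have e2 := ip_firstOp h hs (legendre (n + 1))
  rw [e2]
  have e3 : (2 * (n : ℝ) + 3) * ip (fn ((1 - X ^ 2) * derivative (legendre (n + 1)))) u =
    ((n : ℝ) + 1) * (n + 2) * (ip (fn (legendre n)) u - ip (fn (legendre (n + 2))) u) := e
  field_simp
  linarith

theorem BasisCoeff.ip_expand {S : ℕ} {p : Problem S} {R : ℕ → ℝ[X]} {ξ η θ : ℕ → ℝ}
    (hR : BasisCoeff p R ξ η θ) {u : ℝ → ℝ} (hu : IntervalIntegrable u volume (-1) 1) (n : ℕ) :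
    ip (fn (R n)) u = ξ n * ip (fn (legendre n)) u + η n * ip (fn (legendre (n + 1))) u +
      θ n * ip (fn (legendre (n + 2))) u := by
  have e := congrArg (ipForm u hu) (hR.form n)
  rw [map_add, map_add, ipForm_C_mul, ipForm_C_mul, ipForm_C_mul] at e
  exact e

/-- Decay of the coefficients with respect to the basis: one power more than for `P_n`. -/
theorem BasisCoeff.ip_le_of_symLR {S : ℕ} {p : Problem S} {R : ℕ → ℝ[X]} {ξ η θ : ℕ → ℝ}
    (hR : BasisCoeff p R ξ η θ) {s : ℝ} {u : ℝ → ℝ} {m : ℕ} (hm : 1 ≤ m) (h : SymLR s u)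
    (hs : (m : ℝ) - 1 < s) :
    ∃ K, ∀ n : ℕ, 1 ≤ n → |ip (fn (R n)) u| ≤ K / (n : ℝ) ^ (2 * m + 1) := by
  have hm' : (1 : ℝ) ≤ m := by exact_mod_cast hm
  obtain ⟨K1, hK1, h1⟩ := h.ip_legendre_le hs
  obtain ⟨K2, hK2, h2⟩ := h.firstOp.ip_legendre_le hs
  obtain ⟨K3, hK3, h3⟩ := hR.exists_bound
  refine ⟨2 * K2 + K3 * K1 + K3 * K1, fun n hn => ?_⟩
  have hn0 : (0 : ℝ) < n := by positivity
  have mon : ∀ {K : ℝ} (j : ℕ), 0 ≤ K → K / ((n + j : ℕ) : ℝ) ^ (2 * m) ≤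
      K / (n : ℝ) ^ (2 * m) := by
    intro K j hK
    apply div_le_div_of_nonneg_left hK (by positivity)
    gcongr
    omega
  have hK3' : K3 / ((n : ℝ) + 1) ≤ K3 / n :=
    div_le_div_of_nonneg_left hK3.le hn0 (by linarith)
  have e : ip (fn (R n)) u = ξ n * (ip (fn (legendre n)) u - ip (fn (legendre (n + 2))) u) +
      η n * ip (fn (legendre (n + 1))) u + (ξ n + θ n) * ip (fn (legendre (n + 2))) u := by
    rw [hR.ip_expand (h.intervalIntegrable (by linarith))]; ring
  have t1 : |ξ n * (ip (fn (legendre n)) u - ip (fn (legendre (n + 2))) u)| ≤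
      2 / n * (K2 / (n : ℝ) ^ (2 * m)) := by
    rw [abs_mul]
    refine (mul_le_of_le_one_left (abs_nonneg _) (hR.abs_ξ n)).trans ?_
    rw [ip_legendre_sub h (by linarith), abs_neg, abs_mul, abs_of_nonneg (by positivity)]
    refine mul_le_mul ?_ ((h2 (n + 1) (by omega)).trans (mon 1 hK2)) (abs_nonneg _) (by positivity)
    rw [div_le_div_iff₀ (by positivity) hn0]
    nlinarith
  have t2 : |η n * ip (fn (legendre (n + 1))) u| ≤ K3 / n * (K1 / (n : ℝ) ^ (2 * m)) := by
    rw [abs_mul]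
    exact mul_le_mul ((h3 n).1.trans hK3') ((h1 (n + 1) (by omega)).trans (mon 1 hK1))
      (abs_nonneg _) (by positivity)
  have t3 : |(ξ n + θ n) * ip (fn (legendre (n + 2))) u| ≤ K3 / n * (K1 / (n : ℝ) ^ (2 * m)) := by
    rw [abs_mul]
    exact mul_le_mul ((h3 n).2.trans hK3') ((h1 (n + 2) (by omega)).trans (mon 2 hK1))
      (abs_nonneg _) (by positivity)
  rw [e]
  refine ((abs_add_le _ _).trans (add_le_add ((abs_add_le _ _).trans (add_le_add t1 t2)) t3)).trans
    (le_of_eq ?_)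
  rw [pow_succ]; field_simp

/-! ### Legendre coefficients of powers -/

/-- The Legendre coefficient `⟨P_n, (1 - x) ^ e⟩`. -/
noncomputable def powCoeff (e : ℝ) (n : ℕ) : ℝ := ip (fn (legendre n)) fun x => (1 - x) ^ e

theorem intervalIntegrable_one_sub_rpow {e : ℝ} (he : -1 < e) :
    IntervalIntegrable (fun x : ℝ => (1 - x) ^ e) volume (-1) 1 := by
  have := (intervalIntegral.intervalIntegrable_rpow' (a := 0) (b := 2) he).comp_sub_left 1
  norm_num at this
  exact this.symm

/-- The recurrence comes from `(1 - x) (P_n' + P_{n+1}') = (n + 1) (P_n - P_{n+1})` by integration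
by parts. -/
theorem powCoeff_succ {e : ℝ} (he : -1 < e) (n : ℕ) :
    (n - e) * powCoeff e n = (n + e + 2) * powCoeff e (n + 1) := by
  have hi := intervalIntegrable_one_sub_rpow he
  set A : ℝ[X] := C (-(e + 1)) * (legendre n + legendre (n + 1)) +
    C ((n : ℝ) + 1) * (legendre n - legendre (n + 1)) with hA
  have hF := intervalIntegral.integral_eq_sub_of_hasDerivAt_of_le (a := -1) (b := 1)
    (f := fun x => (1 - x) ^ (e + 1) * fn (legendre n + legendre (n + 1)) x)
    (f' := fun x => fn A x * (1 - x) ^ e) (by norm_num)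
    (ContinuousOn.mul (fun x _ => ((continuousAt_const.sub continuousAt_id).rpow_const
      (Or.inr (by linarith))).continuousWithinAt) (continuous_fn _).continuousOn)
    (fun x hx => by
      have hx1 : 0 < 1 - x := by linarith [hx.2]
      have h1 : HasDerivAt (fun x : ℝ => (1 - x) ^ (e + 1)) (-(e + 1) * (1 - x) ^ e) x := by
        have h := ((hasDerivAt_id x).const_sub 1).rpow_const (p := e + 1)
          (Or.inl (by simp; linarith))
        convert! h using 1
        simp
      convert! h1.mul (hasDerivAt_fn (legendre n + legendre (n + 1)) x) using 1
      have h2 := congrArg (eval x) (one_sub_X_mul_derivative n)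
      have h3 : (1 - x) ^ (e + 1) = (1 - x) ^ e * (1 - x) := by
        rw [Real.rpow_add hx1, Real.rpow_one]
      simp only [eval_mul, eval_sub, eval_one, eval_X, eval_add, eval_C] at h2
      simp only [hA, fn, eval_add, eval_mul, eval_C, eval_sub, derivative_add]
      rw [h3]
      linear_combination -(1 - x) ^ e * h2)
    (intervalIntegrable_fn_mul A hi)
  have e1 : (∫ x in (-1 : ℝ)..1, fn A x * (1 - x) ^ e) =
      -(e + 1) * (powCoeff e n + powCoeff e (n + 1)) +
        (n + 1) * (powCoeff e n - powCoeff e (n + 1)) := by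
    change ipForm _ hi A = _
    rw [hA, map_add, ipForm_C_mul, ipForm_C_mul, map_add, map_sub]
    rfl
  rw [e1] at hF
  have e2 : fn (legendre n + legendre (n + 1)) (-1) = 0 := by
    simp [fn, legendre_eval_neg_one, pow_succ]
  rw [e2, sub_self, Real.zero_rpow (by linarith)] at hF
  linarith

theorem powCoeff_zero_pos {e : ℝ} (he : -1 < e) : 0 < powCoeff e 0 := by
  refine intervalIntegral.intervalIntegral_pos_of_pos_on
    (intervalIntegrable_fn_mul _ (intervalIntegrable_one_sub_rpow he)) (fun x hx => ?_)
        (by norm_num)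
  simp only [legendre_zero, fn, eval_one, one_mul]
  exact Real.rpow_pos_of_pos (by linarith [hx.2]) _

theorem powCoeff_eq_prod {e : ℝ} (he : -1 < e) (n : ℕ) :
    powCoeff e (n + 1) = powCoeff e 0 * ((∏ j ∈ Finset.range (n + 1), (-e + j)) /
      ∏ j ∈ Finset.range (n + 1), (e + 2 + j)) := by
  have hrec : ∀ n : ℕ, powCoeff e (n + 1) = powCoeff e n * ((-e + n) / (e + 2 + n)) := fun n => by
    have := powCoeff_succ he n
    have h0 : e + 2 + n ≠ 0 := by
      have : (0 : ℝ) ≤ n := by positivity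
      linarith
    field_simp
    linarith
  induction n with
  | zero => rw [hrec]; simp
  | succ n ih => rw [hrec, ih, Finset.prod_range_succ _ (n + 1), Finset.prod_range_succ _ (n + 1),
      mul_div_mul_comm]; ring

/-- The limit is `⟨P_0, (1 - x) ^ e⟩ Γ(e + 2) / Γ(-e)`. -/
theorem tendsto_powCoeff {e : ℝ} (he : -1 < e) (hne : ∀ m : ℕ, e ≠ m) :
    ∃ L, L ≠ 0 ∧ Tendsto (fun n : ℕ => (n : ℝ) ^ (2 * e + 2) * powCoeff e n) atTop (𝓝 L) := by
  have hG1 : Real.Gamma (-e) ≠ 0 := Real.Gamma_ne_zero fun m h => hne m (by linarith)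
  have hG2 : Real.Gamma (e + 2) ≠ 0 := (Real.Gamma_pos_of_pos (by linarith)).ne'
  refine ⟨powCoeff e 0 * (Real.Gamma (e + 2) / Real.Gamma (-e)),
    mul_ne_zero (powCoeff_zero_pos he).ne' (div_ne_zero hG2 hG1), ?_⟩
  have h1 := ((Real.GammaSeq_tendsto_Gamma (e + 2)).div (Real.GammaSeq_tendsto_Gamma (-e))
    hG1).const_mul (powCoeff e 0)
  have h2 : Tendsto (fun n : ℕ => (((n + 1 : ℕ) : ℝ) / n) ^ (2 * e + 2)) atTop (𝓝 1) := by
    have : Tendsto (fun n : ℕ => 1 + (1 : ℝ) / n) atTop (𝓝 (1 + 0)) :=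
      (tendsto_one_div_atTop_nhds_zero_nat (𝕜 := ℝ)).const_add 1
    have := this.rpow_const (p := 2 * e + 2) (Or.inl (by norm_num))
    rw [add_zero, Real.one_rpow] at this
    refine this.congr' ?_
    filter_upwards [eventually_gt_atTop 0] with n hn
    have : (n : ℝ) ≠ 0 := by positivity
    congr 1
    push_cast
    field_simp
  rw [← tendsto_add_atTop_iff_nat 1]
  have h3 := h2.mul h1
  rw [one_mul] at h3
  refine h3.congr' ?_
  filter_upwards [eventually_gt_atTop 0] with n hn
  have hn0 : (0 : ℝ) < n := by positivity
  have hp1 : (∏ j ∈ Finset.range (n + 1), (-e + j)) ≠ 0 :=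
    Finset.prod_ne_zero_iff.2 fun j _ h => hne j (by linarith)
  have hp2 : (∏ j ∈ Finset.range (n + 1), (e + 2 + j)) ≠ 0 :=
    Finset.prod_ne_zero_iff.2 fun j _ => by
      have : (0 : ℝ) ≤ j := by positivity
      linarith
  have hf : (n.factorial : ℝ) ≠ 0 := by positivity
  have hr1 : (n : ℝ) ^ (-e) ≠ 0 := (Real.rpow_pos_of_pos hn0 _).ne'
  have hr : (n : ℝ) ^ (e + 2) = (n : ℝ) ^ (2 * e + 2) * (n : ℝ) ^ (-e) := by
    rw [← Real.rpow_add hn0]; congr 1; ring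
  have hr2 : (n : ℝ) ^ (2 * e + 2) ≠ 0 := (Real.rpow_pos_of_pos hn0 _).ne'
  rw [powCoeff_eq_prod he, Pi.div_apply, Real.GammaSeq, Real.GammaSeq, hr,
    Real.div_rpow (by positivity) hn0.le]
  field_simp

/-- Asymptotics of a combination of three consecutive coefficients whose leading terms cancel. -/
theorem tendsto_combination {e w L : ℝ} (he : -1 < e) {ξ η θ : ℕ → ℝ}
    (hη : Tendsto η atTop (𝓝 0)) (hθ : Tendsto θ atTop (𝓝 (-1)))
    (hs : Tendsto (fun n : ℕ => n * (ξ n + η n + θ n)) atTop (𝓝 w))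
    (hL : Tendsto (fun n : ℕ => (n : ℝ) ^ (2 * e + 2) * powCoeff e n) atTop (𝓝 L)) :
    Tendsto (fun n : ℕ => (n : ℝ) ^ (2 * e + 3) * (ξ n * powCoeff e n + η n * powCoeff e (n + 1) +
      θ n * powCoeff e (n + 2))) atTop (𝓝 (L * (w + 4 * e + 4))) := by
  have h0 := tendsto_one_div_atTop_nhds_zero_nat (𝕜 := ℝ)
  have hd : ∀ a : ℝ, Tendsto (fun n : ℕ => (n : ℝ) * ((2 * e + 2) / (n + a))) atTop
      (𝓝 (2 * e + 2)) := by
    intro a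
    have : Tendsto (fun n : ℕ => (2 * e + 2) / (1 + a * (1 / (n : ℝ)))) atTop
        (𝓝 ((2 * e + 2) / (1 + a * 0))) :=
      tendsto_const_nhds.div ((h0.const_mul a).const_add 1) (by norm_num)
    rw [mul_zero, add_zero, div_one] at this
    refine this.congr' ?_
    filter_upwards [eventually_gt_atTop 0, eventually_gt_atTop ⌈-a⌉₊] with n hn hna
    have hn0 : (n : ℝ) ≠ 0 := by positivity
    have : (n : ℝ) + a ≠ 0 := by
      have := Nat.lt_of_ceil_lt hna
      linarith
    field_simp
  have hd1 := hd (e + 2)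
  have hd2 := hd (e + 3)
  have hr : Tendsto (fun n : ℕ => 1 - (2 * e + 2) / ((n : ℝ) + (e + 2))) atTop (𝓝 1) := by
    have := (tendsto_zero_of_mul_nat hd1).const_sub 1
    rwa [sub_zero] at this
  have hb := (hs.sub (hη.mul hd1)).sub (hθ.mul (hd1.add (hr.mul hd2)))
  have := hL.mul hb
  rw [show L * (w - 0 * (2 * e + 2) - -1 * (2 * e + 2 + 1 * (2 * e + 2))) = L * (w + 4 * e + 4) by
    ring] at this
  refine this.congr' ?_
  filter_upwards [eventually_gt_atTop 0] with n hn
  have hn0 : (0 : ℝ) < n := by positivity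
  have e1 := powCoeff_succ he n
  have e2 := powCoeff_succ he (n + 1)
  push_cast at e2
  have hne1 : (n : ℝ) + (e + 2) ≠ 0 := by linarith
  have hne2 : (n : ℝ) + (e + 3) ≠ 0 := by linarith
  have f1 : powCoeff e (n + 1) = powCoeff e n * (1 - (2 * e + 2) / (n + (e + 2))) := by
    field_simp; linarith
  have f2 : powCoeff e (n + 2) = powCoeff e (n + 1) * (1 - (2 * e + 2) / (n + (e + 3))) := by
    field_simp; linarith
  have f3 : (n : ℝ) ^ (2 * e + 3) = (n : ℝ) ^ (2 * e + 2) * n := by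
    rw [show 2 * e + 3 = 2 * e + 2 + 1 by ring, Real.rpow_add hn0, Real.rpow_one]
  rw [f2, f1, f3]
  ring

theorem ip_legendre_one_add (e : ℝ) (n : ℕ) :
    ip (fn (legendre n)) (fun x => (1 + x) ^ e) = (-1) ^ n * powCoeff e n := by
  have := intervalIntegral.integral_comp_neg (a := -1) (b := 1)
    (fun x => fn (legendre n) x * (1 + x) ^ e)
  rw [neg_neg] at this
  rw [ip, ← this, powCoeff, ip, ← intervalIntegral.integral_const_mul]
  congr 1; ext x
  simp only [fn, legendre_comp_neg, ← sub_eq_add_neg, mul_assoc]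

theorem intervalIntegrable_one_add_rpow {e : ℝ} (he : -1 < e) :
    IntervalIntegrable (fun x : ℝ => (1 + x) ^ e) volume (-1) 1 := by
  have := (intervalIntegrable_one_sub_rpow he).comp_sub_left 0
  simpa using this.symm

/-- The moments of the basis with the powers at either end are of the exact order `n ^ (-2 e - 3)`.
The limits do not vanish: they contain the factor `4 * bcType b + 4 * e + 4`, which is positive. -/
theorem BasisCoeff.tendsto_powers {S : ℕ} {p : Problem S} {R : ℕ → ℝ[X]} {ξ η θ : ℕ → ℝ}
    (hR : BasisCoeff p R ξ η θ) {e : ℝ} (he : -1 < e) (hne : ∀ m : ℕ, e ≠ m) :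
    ∃ J J', J ≠ 0 ∧ J' ≠ 0 ∧
      Tendsto (fun n : ℕ => (n : ℝ) ^ (2 * e + 3) * ip (fn (R n)) fun x => (1 - x) ^ e) atTop
        (𝓝 J) ∧
      Tendsto (fun n : ℕ => (n : ℝ) ^ (2 * e + 3) * ((-1) ^ n * ip (fn (R n)) fun x => (1 + x) ^ e))
        atTop (𝓝 J') := by
  obtain ⟨L, hL0, hL⟩ := tendsto_powCoeff he hne
  have hw : ∀ b, 4 * bcType b + 4 * e + 4 ≠ 0 := fun b => by
    have := bcType_nonneg b
    linarith
  refine ⟨_, _, mul_ne_zero hL0 (hw p.bR), mul_ne_zero hL0 (hw p.bL),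
    (tendsto_combination he hR.lim_η hR.lim_θ hR.lim_right hL).congr fun n => ?_,
    (tendsto_combination he (η := fun n => -η n) (by simpa using hR.lim_η.neg) hR.lim_θ
      (by simpa [sub_eq_add_neg] using hR.lim_left) hL).congr fun n => ?_⟩
  · rw [hR.ip_expand (intervalIntegrable_one_sub_rpow he)]; rfl
  · rw [hR.ip_expand (intervalIntegrable_one_add_rpow he), ip_legendre_one_add,
      ip_legendre_one_add, ip_legendre_one_add]
    have h5 : ((-1 : ℝ) ^ n) * (-1) ^ n = 1 := by rw [← mul_pow]; norm_num
    rw [pow_succ, pow_succ]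
    linear_combination (-(n : ℝ) ^ (2 * e + 3) * (ξ n * powCoeff e n - η n * powCoeff e (n + 1) +
      θ n * powCoeff e (n + 2))) * h5

/-! ### The differential equation -/

/-- A potential that is continuous on `(-1, 1)` and integrable. -/
structure IsPotential (Q : ℝ → ℝ) : Prop where
  cont : ContinuousOn Q (Set.Ioo (-1) 1)
  int : IntervalIntegrable Q volume (-1) 1

/-- `y` solves `-y'' + Q y = lam y` on `(-1, 1)`, and `dy` is its derivative; both are continuous up
to the endpoints. -/
structure IsSol (Q : ℝ → ℝ) (lam : ℝ) (y dy : ℝ → ℝ) : Prop where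
  cont : ContinuousOn y (Set.Icc (-1) 1)
  dcont : ContinuousOn dy (Set.Icc (-1) 1)
  der : ∀ x ∈ Set.Ioo (-1 : ℝ) 1, HasDerivAt y (dy x) x
  dder : ∀ x ∈ Set.Ioo (-1 : ℝ) 1, HasDerivAt dy ((Q x - lam) * y x) x

/-- The boundary conditions for a function with the derivative `dy`. -/
def Problem.BC {S : ℕ} (p : Problem S) (y dy : ℝ → ℝ) : Prop :=
  p.aL * y (-1) + p.bL * dy (-1) = 0 ∧ p.aR * y 1 + p.bR * dy 1 = 0

theorem continuousOn_primitive {r : ℝ → ℝ} (hi : IntervalIntegrable r volume (-1) 1) :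
    ContinuousOn (fun x => ∫ t in (-1 : ℝ)..x, r t) (Set.Icc (-1) 1) := by
  have := intervalIntegral.continuousOn_primitive_interval' hi (a := -1) Set.left_mem_uIcc
  rwa [Set.uIcc_of_le (by norm_num)] at this

theorem hasDerivAt_primitive {r : ℝ → ℝ} (hc : ContinuousOn r (Set.Ioo (-1) 1))
    (hi : IntervalIntegrable r volume (-1) 1) {x : ℝ} (hx : x ∈ Set.Ioo (-1 : ℝ) 1) :
    HasDerivAt (fun x => ∫ t in (-1 : ℝ)..x, r t) (r x) x := by
  refine intervalIntegral.integral_hasDerivAt_right ?_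
    (hc.stronglyMeasurableAtFilter isOpen_Ioo x hx) (hc.continuousAt (isOpen_Ioo.mem_nhds hx))
  refine hi.mono_set ?_
  rw [Set.uIcc_of_le hx.1.le, Set.uIcc_of_le (by norm_num)]
  exact Set.Icc_subset_Icc_right hx.2.le

namespace IsSol

variable {Q : ℝ → ℝ} {lam : ℝ} {y dy y₂ dy₂ : ℝ → ℝ}

theorem comb (h : IsSol Q lam y dy) (h₂ : IsSol Q lam y₂ dy₂) (a b : ℝ) :
    IsSol Q lam (fun x => a * y x + b * y₂ x) (fun x => a * dy x + b * dy₂ x) where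
  cont := (h.cont.const_smul a).add (h₂.cont.const_smul b)
  dcont := (h.dcont.const_smul a).add (h₂.dcont.const_smul b)
  der x hx := ((h.der x hx).const_mul a).add ((h₂.der x hx).const_mul b)
  dder x hx := by
    convert! ((h.dder x hx).const_mul a).add ((h₂.dder x hx).const_mul b) using 1; ring

theorem comp_neg (h : IsSol Q lam y dy) :
    IsSol (fun x => Q (-x)) lam (fun x => y (-x)) (fun x => -dy (-x)) := by
  have hm : Set.MapsTo (fun x : ℝ => -x) (Set.Icc (-1) 1) (Set.Icc (-1) 1) :=
    fun x hx => ⟨by linarith [hx.2], by linarith [hx.1]⟩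
  refine ⟨h.cont.comp continuousOn_id.neg hm, (h.dcont.comp continuousOn_id.neg hm).neg,
    fun x hx => ?_, fun x hx => ?_⟩
  · have := (h.der (-x) ⟨by linarith [hx.2], by linarith [hx.1]⟩).comp x (hasDerivAt_neg x)
    convert! this using 1; ring
  · have := ((h.dder (-x) ⟨by linarith [hx.2], by linarith [hx.1]⟩).comp x (hasDerivAt_neg x)).neg
    convert! this using 1; ring

theorem congr_potential {Q' : ℝ → ℝ} (h : IsSol Q lam y dy)
    (hQ : ∀ x ∈ Set.Ioo (-1 : ℝ) 1, Q x = Q' x) : IsSol Q' lam y dy :=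
  ⟨h.cont, h.dcont, h.der, fun x hx => by rw [← hQ x hx]; exact h.dder x hx⟩

theorem intervalIntegrable_potential_mul (hQ : IsPotential Q)
    (hy : ContinuousOn y (Set.Icc (-1) 1)) (lam : ℝ) :
    IntervalIntegrable (fun x => (Q x - lam) * y x) volume (-1) 1 := by
  have := intervalIntegrable_mul_of_continuousOn hy (hQ.int.sub
      (intervalIntegrable_const (c := lam)))
  simpa only [mul_comm] using this

/-- Uniqueness for the initial value problem at the right endpoint, by Gronwall's argument: the
product of `y ^ 2 + y' ^ 2` and `exp ∫ (1 + |Q - lam|)` increases. -/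
theorem eq_zero (h : IsSol Q lam y dy) (hQ : IsPotential Q) (h0 : y 1 = 0) (h1 : dy 1 = 0) :
    ∀ x ∈ Set.Icc (-1 : ℝ) 1, y x = 0 := by
  set r : ℝ → ℝ := fun x => 1 + |Q x - lam| with hr
  have hrc : ContinuousOn r (Set.Ioo (-1) 1) :=
    continuousOn_const.add (hQ.cont.sub continuousOn_const).abs
  have hri : IntervalIntegrable r volume (-1) 1 :=
    (intervalIntegrable_const (c := (1 : ℝ))).add
      (hQ.int.sub (intervalIntegrable_const (c := lam))).abs
  set V : ℝ → ℝ := fun x => ∫ t in (-1 : ℝ)..x, r t with hV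
  have hder : ∀ x ∈ Set.Ioo (-1 : ℝ) 1, HasDerivAt (fun x => (y x ^ 2 + dy x ^ 2) * Real.exp (V x))
      ((2 * y x * dy x * (1 + (Q x - lam)) + (y x ^ 2 + dy x ^ 2) * r x) * Real.exp (V x)) x := by
    intro x hx
    have e1 := ((h.der x hx).pow 2).add ((h.dder x hx).pow 2)
    have e2 := (hasDerivAt_primitive hrc hri hx).exp
    convert! e1.mul e2 using 1
    simp; ring
  have hmono : MonotoneOn (fun x => (y x ^ 2 + dy x ^ 2) * Real.exp (V x)) (Set.Icc (-1) 1) := by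
    refine monotoneOn_of_deriv_nonneg (convex_Icc _ _)
      (((h.cont.pow 2).add (h.dcont.pow 2)).mul (continuousOn_primitive hri).rexp)
      (fun x hx => ?_) (fun x hx => ?_)
    · rw [interior_Icc] at hx
      exact (hder x hx).differentiableAt.differentiableWithinAt
    · rw [interior_Icc] at hx
      rw [(hder x hx).deriv]
      refine mul_nonneg ?_ (Real.exp_pos _).le
      have e1 : |2 * y x * dy x * (1 + (Q x - lam))| ≤ (y x ^ 2 + dy x ^ 2) * r x := by
        rw [abs_mul]
        refine mul_le_mul ?_ ((abs_add_le _ _).trans (by simp [hr])) (abs_nonneg _) (by positivity)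
        rw [abs_le]
        constructor <;> nlinarith [sq_nonneg (y x + dy x), sq_nonneg (y x - dy x)]
      linarith [neg_abs_le (2 * y x * dy x * (1 + (Q x - lam)))]
  intro x hx
  have := hmono hx (Set.right_mem_Icc.2 (by norm_num)) hx.2
  simp only [h0, h1] at this
  have h2 : y x ^ 2 + dy x ^ 2 ≤ 0 := by
    have hp := Real.exp_pos (V x)
    by_contra hcon
    push Not at hcon
    have := mul_pos hcon hp
    norm_num at *
    linarith
  have : y x ^ 2 = 0 := le_antisymm (by nlinarith [sq_nonneg (dy x)]) (sq_nonneg _)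
  simpa using this

/-- Green's identity. -/
theorem green (h : IsSol Q lam y dy) (hQ : IsPotential Q) {v dv ddv : ℝ → ℝ}
    (hv : ContinuousOn v (Set.Icc (-1) 1)) (hdv : ContinuousOn dv (Set.Icc (-1) 1))
    (hv' : ∀ x ∈ Set.Ioo (-1 : ℝ) 1, HasDerivAt v (dv x) x)
    (hv'' : ∀ x ∈ Set.Ioo (-1 : ℝ) 1, HasDerivAt dv (ddv x) x)
    (hi : IntervalIntegrable ddv volume (-1) 1) :
    ip y ddv - ip v (fun x => (Q x - lam) * y x) =
      (y 1 * dv 1 - dy 1 * v 1) - (y (-1) * dv (-1) - dy (-1) * v (-1)) := by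
  have hi1 := intervalIntegrable_mul_of_continuousOn h.cont hi
  have hi2 := intervalIntegrable_mul_of_continuousOn hv
    (intervalIntegrable_potential_mul hQ h.cont lam)
  have := intervalIntegral.integral_eq_sub_of_hasDerivAt_of_le (a := -1) (b := 1) (by norm_num)
    (f := fun x => y x * dv x - dy x * v x)
    (f' := fun x => y x * ddv x - v x * ((Q x - lam) * y x))
    ((h.cont.mul hdv).sub (h.dcont.mul hv)) (fun x hx => by
      convert! ((h.der x hx).mul (hv'' x hx)).sub ((h.dder x hx).mul (hv' x hx)) using 1
      ring) (hi1.sub hi2)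
  rw [intervalIntegral.integral_sub hi1 hi2] at this
  exact this

theorem green_poly (h : IsSol Q lam y dy) (hQ : IsPotential Q) (r : ℝ[X]) :
    ip y (fn (derivative (derivative r))) - ip (fn r) (fun x => (Q x - lam) * y x) =
      (y 1 * r.derivative.eval 1 - dy 1 * r.eval 1) -
        (y (-1) * r.derivative.eval (-1) - dy (-1) * r.eval (-1)) :=
  h.green hQ (continuous_fn r).continuousOn (continuous_fn _).continuousOn
    (fun x _ => hasDerivAt_fn r x) (fun x _ => hasDerivAt_fn _ x)
    ((continuous_fn _).intervalIntegrable _ _)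

end IsSol

/-- Two pairs that satisfy the same boundary condition are proportional. -/
theorem bc_det {a b u u' v v' : ℝ} (h : a ^ 2 + b ^ 2 ≠ 0) (h1 : a * u + b * u' = 0)
    (h2 : a * v + b * v' = 0) : u * v' - u' * v = 0 := by
  have e1 : a * (u' * v - v' * u) = 0 := by linear_combination u' * h2 - v' * h1
  have e2 : b * (u' * v - v' * u) = 0 := by linear_combination v * h1 - u * h2
  by_contra hne
  have h3 : u' * v - v' * u ≠ 0 := fun h => hne (by linarith)
  have ha := (mul_eq_zero.1 e1).resolve_right h3
  have hb := (mul_eq_zero.1 e2).resolve_right h3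
  simp [ha, hb] at h

variable {S : ℕ} {p : Problem S} {Q : ℝ → ℝ} {lam lam₂ : ℝ} {y dy y₂ dy₂ : ℝ → ℝ}

theorem IsSol.green_bc (h : IsSol Q lam y dy) (hQ : IsPotential Q) (hb : p.BC y dy) {r : ℝ[X]}
    (hr : p.PolyBC r) :
    ip y (fn (derivative (derivative r))) = ip (fn r) (fun x => (Q x - lam) * y x) := by
  have h1 := h.green_poly hQ r
  have h2 := bc_det p.right_ne hb.2 hr.2
  have h3 := bc_det p.left_ne hb.1 hr.1
  linarith

theorem intervalIntegrable_mul_of_continuousOn' {u v : ℝ → ℝ}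
    (hu : ContinuousOn u (Set.Icc (-1) 1)) (hv : ContinuousOn v (Set.Icc (-1) 1)) :
    IntervalIntegrable (fun x => u x * v x) volume (-1) 1 :=
  intervalIntegrable_mul_of_continuousOn hu
    (hv.intervalIntegrable_of_Icc (by norm_num))

/-- Eigenfunctions for different eigenvalues are orthogonal. -/
theorem IsSol.orthogonal (h : IsSol Q lam y dy) (h₂ : IsSol Q lam₂ y₂ dy₂) (hQ : IsPotential Q)
    (hb : p.BC y dy) (hb₂ : p.BC y₂ dy₂) (hne : lam ≠ lam₂) : ip y y₂ = 0 := by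
  have hi := IsSol.intervalIntegrable_potential_mul hQ h₂.cont lam₂
  have h1 := h.green hQ h₂.cont h₂.dcont h₂.der h₂.dder hi
  have h2 := bc_det p.right_ne hb.2 hb₂.2
  have h3 := bc_det p.left_ne hb.1 hb₂.1
  have e := ip_sub_right (u := y) (v := fun x => (Q x - lam₂) * y₂ x)
    (w := fun x => (Q x - lam) * y₂ x) (intervalIntegrable_mul_of_continuousOn h.cont hi)
    (intervalIntegrable_mul_of_continuousOn h.cont
      (IsSol.intervalIntegrable_potential_mul hQ h₂.cont lam))
  have e2 : ip y (fun x => (Q x - lam₂) * y₂ x - (Q x - lam) * y₂ x) = (lam - lam₂) * ip y y₂ := by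
    rw [← ip_const_mul_right]; congr 1; ext x; ring
  have e3 : ip y (fun x => (Q x - lam) * y₂ x) = ip y₂ (fun x => (Q x - lam) * y x) :=
    ip_congr fun x _ => by ring
  rw [e2, e3] at e
  have : (lam - lam₂) * ip y y₂ = 0 := by linarith
  exact (mul_eq_zero.1 this).resolve_left (sub_ne_zero.2 hne)

/-- Eigenvalues are simple. -/
theorem IsSol.proportional (h : IsSol Q lam y dy) (h₂ : IsSol Q lam y₂ dy₂) (hQ : IsPotential Q)
    (hb : p.aR * y 1 + p.bR * dy 1 = 0) (hb₂ : p.aR * y₂ 1 + p.bR * dy₂ 1 = 0)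
    (hne : ∃ x ∈ Set.Icc (-1 : ℝ) 1, y x ≠ 0) : ∃ κ, ∀ x ∈ Set.Icc (-1 : ℝ) 1, y₂ x = κ * y x := by
  have hd := bc_det p.right_ne hb hb₂
  have h1 := (h.comb h₂ (-dy₂ 1) (dy 1)).eq_zero hQ (by linarith) (by ring)
  have h2 := (h.comb h₂ (-y₂ 1) (y 1)).eq_zero hQ (by ring) (by linarith)
  by_cases h0 : y 1 = 0
  · have h0' : dy 1 ≠ 0 := fun h0' => by
      obtain ⟨x, hx, hx'⟩ := hne
      exact hx' (h.eq_zero hQ h0 h0' x hx)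
    refine ⟨dy₂ 1 / dy 1, fun x hx => ?_⟩
    have := h1 x hx
    field_simp; linarith
  · refine ⟨y₂ 1 / y 1, fun x hx => ?_⟩
    have := h2 x hx
    field_simp; linarith

theorem Problem.IsEigenfunction.isSol (h : p.IsEigenfunction lam y) :
    IsSol p.q lam y (derivWithin y (Set.Icc (-1) 1)) ∧ p.BC y (derivWithin y (Set.Icc (-1) 1)) := by
  have hu : UniqueDiffOn ℝ (Set.Icc (-1 : ℝ) 1) := uniqueDiffOn_Icc (by norm_num)
  refine ⟨⟨h.contDiffOn.continuousOn, h.contDiffOn.continuousOn_derivWithin hu le_rfl,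
    fun x hx => ?_, fun x hx => ?_⟩, h.left_bc, h.right_bc⟩
  · exact ((h.contDiffOn.differentiableOn one_ne_zero x
      (Set.Ioo_subset_Icc_self hx)).hasDerivWithinAt).hasDerivAt (Icc_mem_nhds hx.1 hx.2)
  · have h1 := (h.differentiableAt x hx).hasDerivAt
    have h2 := h.equation x hx
    convert! h1 using 1
    linarith

theorem IsSol.isEigenfunction (h : IsSol p.q lam y dy) (hb : p.BC y dy)
    (hne : ∃ x ∈ Set.Icc (-1 : ℝ) 1, y x ≠ 0) : p.IsEigenfunction lam y := by
  have hle : (-1 : ℝ) ≤ 1 := by norm_num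
  set E : ℝ → ℝ := Set.IccExtend hle ((Set.Icc (-1) 1).domRestrict dy) with hE
  have hEc : Continuous E := (continuousOn_iff_continuous_domRestrict.1 h.dcont).Icc_extend'
  have hEdy : ∀ x ∈ Set.Icc (-1 : ℝ) 1, E x = dy x := fun x hx => by
    rw [hE, Set.IccExtend_of_mem hle _ hx]; rfl
  set Y : ℝ → ℝ := fun x => y (-1) + ∫ t in (-1 : ℝ)..x, E t with hY
  have hYd : ∀ x, HasDerivAt Y (E x) x := fun x =>
    (intervalIntegral.integral_hasDerivAt_right (hEc.intervalIntegrable _ _)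
      (hEc.stronglyMeasurableAtFilter _ _) hEc.continuousAt).const_add _
  have hyY : Set.EqOn y Y (Set.Icc (-1) 1) := fun x hx => by
    have := intervalIntegral.integral_eq_sub_of_hasDerivAt_of_le (a := -1) (b := x) hx.1
      (h.cont.mono (Set.Icc_subset_Icc_right hx.2)) (f' := E) (fun t ht => by
        have ht' : t ∈ Set.Ioo (-1 : ℝ) 1 := ⟨ht.1, ht.2.trans_le hx.2⟩
        rw [hEdy t (Set.Ioo_subset_Icc_self ht')]
        exact h.der t ht') (hEc.intervalIntegrable _ _)
    simp only [hY, this]; ring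
  have hYc : ContDiff ℝ 1 Y := by
    rw [contDiff_one_iff_deriv]
    refine ⟨fun x => (hYd x).differentiableAt, ?_⟩
    rw [show deriv Y = E from funext fun x => (hYd x).deriv]
    exact hEc
  have hdw : ∀ x ∈ Set.Icc (-1 : ℝ) 1, derivWithin y (Set.Icc (-1) 1) x = dy x := fun x hx => by
    rw [derivWithin_congr hyY (hyY hx), ← hEdy x hx]
    exact (hYd x).hasDerivWithinAt.derivWithin (uniqueDiffOn_Icc (by norm_num) x hx)
  have hdd : ∀ x ∈ Set.Ioo (-1 : ℝ) 1,
      HasDerivAt (derivWithin y (Set.Icc (-1) 1)) ((p.q x - lam) * y x) x := fun x hx =>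
    (h.dder x hx).congr_of_eventuallyEq (by
      filter_upwards [isOpen_Ioo.mem_nhds hx] with t ht using hdw t (Set.Ioo_subset_Icc_self ht))
  refine ⟨hne, hYc.contDiffOn.congr hyY, fun x hx => (hdd x hx).differentiableAt, fun x hx => ?_,
    ?_, ?_⟩
  · rw [(hdd x hx).deriv]; ring
  · rw [hdw _ (by norm_num)]; exact hb.1
  · rw [hdw _ (by norm_num)]; exact hb.2

/-- For a symmetric problem the eigenfunctions are even or odd. -/
theorem IsSol.even_or_odd (h : IsSol Q lam y dy) (hQ : IsPotential Q) (hb : p.BC y dy)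
    (hs : p.SymmetricBC) (hQs : ∀ x ∈ Set.Ioo (-1 : ℝ) 1, Q (-x) = Q x)
    (hne : ∃ x ∈ Set.Icc (-1 : ℝ) 1, y x ≠ 0) :
    ∃ κ : ℝ, κ ^ 2 = 1 ∧ ∀ x ∈ Set.Icc (-1 : ℝ) 1, y (-x) = κ * y x := by
  have h2 : IsSol Q lam _ _ := h.comp_neg.congr_potential hQs
  have hs' : p.aL * p.bR + p.aR * p.bL = 0 := hs
  have hb2 : p.aR * y (-1) + p.bR * (-dy (-1)) = 0 := by
    have h1 := hb.1
    have e1 : p.aL * (p.aR * y (-1) + p.bR * (-dy (-1))) = 0 := by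
      linear_combination p.aR * h1 - dy (-1) * hs'
    have e2 : p.bL * (p.aR * y (-1) + p.bR * (-dy (-1))) = 0 := by
      linear_combination (-p.bR) * h1 + y (-1) * hs'
    by_contra h0
    have ha := (mul_eq_zero.1 e1).resolve_right h0
    have hb := (mul_eq_zero.1 e2).resolve_right h0
    exact p.left_ne (by simp [ha, hb])
  obtain ⟨κ, hκ⟩ := h.proportional h2 hQ hb.2 hb2 hne
  refine ⟨κ, ?_, hκ⟩
  obtain ⟨x, hx, hx0⟩ := hne
  have e1 := hκ x hx
  have e2 := hκ (-x) ⟨by linarith [hx.2], by linarith [hx.1]⟩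
  rw [neg_neg, e1] at e2
  have : (κ ^ 2 - 1) * y x = 0 := by linear_combination -e2
  have := (mul_eq_zero.1 this).resolve_right hx0
  linarith

/-! ### Expansion of the potential at the right endpoint -/

theorem AnalyticOnBernsteinEllipse.exists_analyticOnNhd {g : ℝ → ℝ}
    (h : AnalyticOnBernsteinEllipse g) :
    ∃ f : ℝ → ℝ, AnalyticOnNhd ℝ f (Set.Icc (-1) 1) ∧ ∀ x ∈ Set.Icc (-1 : ℝ) 1, g x = f x := by
  obtain ⟨ρ, hρ, G, hG, hGg⟩ := h
  refine ⟨fun x => (G x).re, fun x hx => (hG x ?_).re_ofReal, fun x hx => by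
    simp [hGg x hx]⟩
  have h1 : ‖(x : ℂ) - 1‖ = 1 - x := by
    rw [← Complex.ofReal_one, ← Complex.ofReal_sub, Complex.norm_real, Real.norm_eq_abs,
      abs_sub_comm, abs_of_nonneg (by linarith [hx.2])]
  have h2 : ‖(x : ℂ) + 1‖ = x + 1 := by
    rw [← Complex.ofReal_one, ← Complex.ofReal_add, Complex.norm_real, Real.norm_eq_abs,
      abs_of_nonneg (by linarith [hx.1])]
  have h3 : 2 ≤ ρ + ρ⁻¹ := by
    have h0 : 0 < ρ := by linarith
    have : ρ + ρ⁻¹ - 2 = (ρ - 1) ^ 2 / ρ := by field_simp; ring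
    have : 0 ≤ (ρ - 1) ^ 2 / ρ := by positivity
    linarith
  simp only [bernsteinRegion, Set.mem_ofPred_eq, h1, h2]
  linarith

theorem analyticOnNhd_one_add_rpow (a : ℝ) :
    AnalyticOnNhd ℝ (fun x : ℝ => (1 + x) ^ a) (Set.Ioc (-1) 1) := by
  intro x hx
  have h0 : 0 < 1 + x := by linarith [hx.1]
  have h1 : AnalyticAt ℝ (fun x : ℝ => Real.exp (Real.log (1 + x) * a)) x :=
    (((analyticAt_const.add analyticAt_id).log h0).mul analyticAt_const).rexp'
  refine h1.congr ?_
  filter_upwards [isOpen_Ioi.mem_nhds hx.1] with y hy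
  rw [Real.rpow_def_of_pos (by linarith [show -1 < y from hy])]

/-- The finite sum `∑ κ_e (1 - x) ^ e` of powers, coded by the finitely supported function `κ`. -/
noncomputable def endSum (κ : ℝ →₀ ℝ) (x : ℝ) : ℝ :=
  Finsupp.linearCombination ℝ (fun e : ℝ => (1 - x) ^ e) κ

theorem endSum_add (κ μ : ℝ →₀ ℝ) (x : ℝ) : endSum (κ + μ) x = endSum κ x + endSum μ x :=
  map_add _ _ _

theorem endSum_smul (c : ℝ) (κ : ℝ →₀ ℝ) (x : ℝ) : endSum (c • κ) x = c * endSum κ x :=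
  map_smul _ _ _

theorem endSum_single (e c x : ℝ) : endSum (Finsupp.single e c) x = c * (1 - x) ^ e :=
  Finsupp.linearCombination_single _ _ _

theorem endSum_eq_sum (κ : ℝ →₀ ℝ) (x : ℝ) :
    endSum κ x = ∑ e ∈ κ.support, κ e * (1 - x) ^ e := rfl

theorem endSum_mapDomain_add_one (κ : ℝ →₀ ℝ) {x : ℝ} (hx : x < 1) :
    endSum (κ.mapDomain (· + 1)) x = (1 - x) * endSum κ x := by
  rw [endSum, Finsupp.linearCombination_mapDomain, Finsupp.linearCombination_apply, endSum_eq_sum,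
    Finsupp.sum, Finset.mul_sum]
  refine Finset.sum_congr rfl fun e _ => ?_
  simp only [Function.comp, smul_eq_mul]
  rw [Real.rpow_add (by linarith), Real.rpow_one]; ring

theorem SymR.endSum {k : ℕ} {t : ℝ} {κ : ℝ →₀ ℝ} (h : ∀ e ∈ κ.support, t ≤ e) :
    SymR k t (endSum κ) := by
  have : SymR k t (fun x => ∑ e ∈ κ.support, κ e * (1 - x) ^ e) :=
    SymR.sum _ fun e he => ((SymR.rpow k e).mono (h e he)).const_mul _
  exact this

theorem exists_gt_forall_le (A : Finset ℝ) {a M : ℝ} (haM : a < M) (h : ∀ e ∈ A, a < e) :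
    ∃ t, a < t ∧ t ≤ M ∧ ∀ e ∈ A, t ≤ e := by
  classical
  induction A using Finset.induction_on with
  | empty => exact ⟨M, haM, le_rfl, by simp⟩
  | insert e A _ ih =>
    obtain ⟨t, h1, h2, h3⟩ := ih fun e he => h e (Finset.mem_insert_of_mem he)
    refine ⟨min t e, lt_min h1 (h e (Finset.mem_insert_self _ _)), (min_le_left _ _).trans h2,
      fun e' he' => ?_⟩
    rcases Finset.mem_insert.1 he' with rfl | h4
    · exact min_le_right _ _
    · exact (min_le_left _ _).trans (h3 _ h4)

/-- `f` is a finite sum of powers of `1 - x` with exponents above `-1`, up to a remainder of order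
above `1`. -/
def HasEndExp (f : ℝ → ℝ) (κ : ℝ →₀ ℝ) : Prop :=
  (∀ e ∈ κ.support, -1 < e) ∧ ∃ s, 1 < s ∧ ∀ k, SymR k s (fun x => f x - endSum κ x)

theorem HasEndExp.add {f g : ℝ → ℝ} {κ μ : ℝ →₀ ℝ} (hf : HasEndExp f κ) (hg : HasEndExp g μ) :
    HasEndExp (fun x => f x + g x) (κ + μ) := by
  obtain ⟨h1, s, hs, h2⟩ := hf
  obtain ⟨h3, t, ht, h4⟩ := hg
  refine ⟨fun e he => ?_, min s t, lt_min hs ht, fun k => ?_⟩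
  · rcases Finset.mem_union.1 (Finsupp.support_add he) with h | h
    · exact h1 e h
    · exact h3 e h
  · refine (((h2 k).mono (min_le_left _ _)).add
      ((h4 k).mono (min_le_right _ _))).congr fun x _ => ?_
    simp only [endSum_add]; ring

/-- An analytic function times a power. -/
theorem hasEndExp_analytic_mul_rpow {φ : ℝ → ℝ} (hφ : AnalyticOnNhd ℝ φ (Set.Ioc (-1) 1)) {a : ℝ}
    (ha : -1 < a) : ∃ κ, HasEndExp (fun x => φ x * (1 - x) ^ a) κ := by
  refine ⟨Finsupp.single a (φ 1) + Finsupp.single (a + 1) (-deriv φ 1), fun e he => ?_, 2 + a,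
    by linarith, fun k => ?_⟩
  · rcases Finset.mem_union.1 (Finsupp.support_add he) with h | h
    · have := Finset.mem_singleton.1 (Finsupp.support_single_subset h); linarith
    · have := Finset.mem_singleton.1 (Finsupp.support_single_subset h); linarith
  · refine ((SymR.taylor_of_analyticOnNhd k hφ).mul (SymR.rpow k a)).congr fun x hx => ?_
    simp only [endSum_add, endSum_single]
    rw [Real.rpow_add (by linarith [hx.2]), Real.rpow_one]
    ring

variable {S : ℕ}

theorem Problem.q_eq (p : Problem S) : ∃ φ : Fin S → ℝ → ℝ,
    (∀ i, AnalyticOnNhd ℝ (φ i) (Set.Ioc (-1) 1)) ∧ (∀ i, ∀ x ∈ Set.Ioo (-1 : ℝ) 1,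
      p.g i x / ((1 - x) ^ p.β i * (1 + x) ^ p.γ i) = φ i x * (1 - x) ^ (-p.β i)) := by
  choose f hf hfg using fun i => (p.g_analytic i).exists_analyticOnNhd
  refine ⟨fun i x => f i x * (1 + x) ^ (-p.γ i), fun i => AnalyticOnNhd.mul
    ((hf i).mono Set.Ioc_subset_Icc_self) (analyticOnNhd_one_add_rpow _), fun i x hx => ?_⟩
  dsimp only
  rw [hfg i x (Set.Ioo_subset_Icc_self hx), Real.rpow_neg (by linarith [hx.1]),
    Real.rpow_neg (by linarith [hx.2])]
  field_simp

/-- Every term of the potential is an analytic function times a power of `1 - x`. -/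
theorem Problem.exists_hasEndExp (p : Problem S) : ∃ κ, HasEndExp p.q κ := by
  obtain ⟨φ, hφ, he⟩ := p.q_eq
  have key : ∀ A : Finset (Fin S), ∃ κ,
      HasEndExp (fun x => ∑ i ∈ A, φ i x * (1 - x) ^ (-p.β i)) κ := by
    classical
    intro A
    induction A using Finset.induction_on with
    | empty =>
      refine ⟨0, by simp, 2, by norm_num, fun k => ?_⟩
      have := (SymR.rpow k 2).const_mul 0
      simpa [endSum] using this
    | insert i A hi ih =>
      obtain ⟨κ, hκ⟩ := ih
      obtain ⟨μ, hμ⟩ := hasEndExp_analytic_mul_rpow (hφ i) (a := -p.β i) (by linarith [p.β_lt i])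
      exact ⟨μ + κ, by simpa only [Finset.sum_insert hi] using hμ.add hκ⟩
  obtain ⟨κ, h1, s, hs, h2⟩ := key Finset.univ
  refine ⟨κ, h1, s, hs, fun k => (h2 k).congr fun x hx => ?_⟩
  simp only [Problem.q]
  congr 1
  exact Finset.sum_congr rfl fun i _ => (he i x hx).symm

/-- The problem reflected at the origin. -/
noncomputable def Problem.reflect (p : Problem S) : Problem S where
  aL := p.aR
  bL := -p.bR
  aR := p.aL
  bR := -p.bL
  β := p.γ
  γ := p.β
  g i x := p.g i (-x)
  left_ne := by rw [neg_sq]; exact p.right_ne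
  right_ne := by rw [neg_sq]; exact p.left_ne
  β_lt := p.γ_lt
  γ_lt := p.β_lt
  g_analytic i := by
    obtain ⟨ρ, hρ, G, hG, hGg⟩ := p.g_analytic i
    refine ⟨ρ, hρ, fun z => G (-z), fun z hz => ?_, fun x hx => ?_⟩
    · have h : -z ∈ bernsteinRegion ρ := by
        simp only [bernsteinRegion, Set.mem_ofPred_eq] at *
        rw [show -z - 1 = -(z + 1) by ring, show -z + 1 = -(z - 1) by ring, norm_neg, norm_neg]
        linarith
      exact (hG _ h).comp (f := fun z => -z) analyticAt_id.neg
    · have := hGg (-x) ⟨by linarith [hx.2], by linarith [hx.1]⟩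
      push_cast at this
      exact this

theorem Problem.reflect_q (p : Problem S) (x : ℝ) : p.reflect.q x = p.q (-x) := by
  simp only [Problem.q, Problem.reflect, sub_neg_eq_add, ← sub_eq_add_neg]
  exact Finset.sum_congr rfl fun i _ => by rw [mul_comm ((1 - x) ^ p.γ i)]

theorem Problem.exists_symR (p : Problem S) : ∃ b, 0 ≤ b ∧ b < 1 ∧ ∀ k, SymR k (-b) p.q := by
  obtain ⟨κ, h1, s, hs, h2⟩ := p.exists_hasEndExp
  obtain ⟨t, ht, ht0, htκ⟩ := exists_gt_forall_le κ.support (show (-1 : ℝ) < 0 by norm_num) h1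
  refine ⟨-t, by linarith, by linarith, fun k => ?_⟩
  rw [neg_neg]
  refine (((h2 k).mono (t := t) (by linarith)).add (SymR.endSum htκ)).congr fun x _ => ?_
  ring

theorem Problem.term_integrable (p : Problem S) (i : Fin S) : IntervalIntegrable
    (fun x => p.g i x / ((1 - x) ^ p.β i * (1 + x) ^ p.γ i)) volume (-1) 1 := by
  have key : ∀ p : Problem S, IntervalIntegrable
      (fun x => p.g i x / ((1 - x) ^ p.β i * (1 + x) ^ p.γ i)) volume 0 1 := by
    intro p
    obtain ⟨φ, hφ, he⟩ := p.q_eq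
    have h := (SymR.of_analyticOnNhd 0 (hφ i)).mul (SymR.rpow 0 (-p.β i))
    exact SymLR.intervalIntegrable_right (h.congr fun x hx => (he i x hx).symm)
      (by linarith [p.β_lt i])
  refine intervalIntegrable_of_halves (key p) ?_
  have := key p.reflect
  simp only [Problem.reflect] at this
  convert! this using 3 with x
  rw [sub_neg_eq_add, ← sub_eq_add_neg, mul_comm]

theorem Problem.isPotential (p : Problem S) : IsPotential p.q := by
  obtain ⟨b, _, _, hb⟩ := p.exists_symR
  refine ⟨(hb 0).continuousOn, ?_⟩
  have := IntervalIntegrable.sum Finset.univ (fun i _ => p.term_integrable i)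
  refine this.congr fun x _ => ?_
  simp [Problem.q]

/-- An unbounded potential has a negative power in its expansion at one endpoint at least. -/
theorem Problem.UnboundedPotential.exists_neg {p : Problem S} (h : p.UnboundedPotential)
    {κ μ : ℝ →₀ ℝ} (hκ : HasEndExp p.q κ) (hμ : HasEndExp p.reflect.q μ) :
    (∃ e < 0, κ e ≠ 0) ∨ ∃ e < 0, μ e ≠ 0 := by
  by_contra! hcon
  have key : ∀ (p : Problem S) {κ : ℝ →₀ ℝ}, HasEndExp p.q κ → (∀ e < 0, κ e = 0) →
      ∃ C, ∀ x ∈ Set.Ico (0 : ℝ) 1, |p.q x| ≤ C := by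
    intro p κ ⟨_, s, hs, h2⟩ h0
    have h3 : SymR 0 0 p.q := by
      refine (((h2 0).mono (t := 0) (by linarith)).add
        (SymR.endSum (κ := κ) fun e he => ?_)).congr fun x _ => sub_add_cancel _ _
      by_contra hlt
      exact Finsupp.mem_support_iff.1 he (h0 e (not_le.1 hlt))
    simpa using h3.bound
  obtain ⟨C, hC⟩ := key p hκ hcon.1
  obtain ⟨D, hD⟩ := key p.reflect hμ hcon.2
  refine h ⟨max C D, fun x hx => ?_⟩
  rcases le_total 0 x with h0 | h0
  · exact (hC x ⟨h0, hx.2⟩).trans (le_max_left _ _)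
  · have := hD (-x) ⟨by linarith, by linarith [hx.1]⟩
    rw [p.reflect_q, neg_neg] at this
    exact this.trans (le_max_right _ _)

/-! ### Regularity of solutions at the right endpoint -/

/-- Integration: a function that vanishes at the endpoint gains one order over its derivative. -/
theorem SymR.of_integral {s : ℝ} (hs : 0 < s) {u u' : ℝ → ℝ} (hc : ContinuousOn u (Set.Icc (-1) 1))
    (h0 : u 1 = 0) (hd : ∀ x ∈ Set.Ioo (-1 : ℝ) 1, HasDerivAt u (u' x) x)
    (h : ∀ k, SymR k (s - 1) u') (k : ℕ) : SymR k s u := by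
  have hb : ∃ C, ∀ x ∈ Set.Ico (0 : ℝ) 1, |u x| ≤ C * (1 - x) ^ s := by
    obtain ⟨C, hC⟩ := (h 0).bound
    refine ⟨C / s, fun x hx => ?_⟩
    have hsub : Set.Icc x 1 ⊆ Set.Icc (-1) 1 := Set.Icc_subset_Icc_left (by linarith [hx.1])
    have hi : IntervalIntegrable u' volume x 1 := by
      refine (SymLR.intervalIntegrable_right (h 0) (by linarith)).mono_set ?_
      rw [Set.uIcc_of_le hx.2.le, Set.uIcc_of_le zero_le_one]
      exact Set.Icc_subset_Icc_left hx.1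
    have e1 := intervalIntegral.integral_eq_sub_of_hasDerivAt_of_le hx.2.le (hc.mono hsub)
      (fun t ht => hd t ⟨by linarith [hx.1, ht.1], ht.2⟩) hi
    have hi2 : IntervalIntegrable (fun t : ℝ => C * (1 - t) ^ (s - 1)) volume x 1 := by
      refine ((intervalIntegrable_one_sub_rpow (e := s - 1) (by linarith)).const_mul C).mono_set ?_
      rw [Set.uIcc_of_le hx.2.le, Set.uIcc_of_le (by norm_num)]
      exact hsub
    have e2 := intervalIntegral.integral_eq_sub_of_hasDerivAt_of_le
      (f := fun t : ℝ => -(C / s) * (1 - t) ^ s) hx.2.le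
      (fun t _ => (((continuousAt_const.sub continuousAt_id).rpow_const
        (Or.inr hs.le)).const_mul _).continuousWithinAt)
      (fun t ht => by
        have h := (((hasDerivAt_id t).const_sub 1).rpow_const (p := s)
          (Or.inl (by simp; linarith [ht.2]))).const_mul (-(C / s))
        convert! h using 1
        simp; field_simp) hi2
    have hne : ∀ᵐ t : ℝ, t ≠ 1 := by simp [ae_iff]
    have e3 := intervalIntegral.norm_integral_le_of_norm_le hx.2.le
      (hne.mono fun t ht1 ht => hC t ⟨by linarith [hx.1, ht.1], lt_of_le_of_ne ht.2 ht1⟩) hi2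
      (f := u') (μ := volume)
    rw [e1, e2, h0, sub_self, Real.zero_rpow hs.ne', zero_sub, norm_neg] at e3
    simpa using e3
  cases k with
  | zero => exact ⟨hc.mono Set.Ioo_subset_Icc_self, hb⟩
  | succ k =>
    exact SymR.of_deriv (fun x hx => (hd x hx).differentiableAt.differentiableWithinAt) hb
      ((h k).congr fun x hx => ((hd x hx).deriv).symm)

section EndRegularity

variable {Q : ℝ → ℝ} {lam b : ℝ} {y dy : ℝ → ℝ}

theorem IsSol.symR_potential (hb : 0 ≤ b) (hQ : ∀ k, SymR k (-b) Q) (lam : ℝ) (k : ℕ) :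
    SymR k (-b) (fun x => Q x - lam) :=
  (hQ k).sub ((SymR.const k lam).mono (by linarith))

/-- A solution is bounded along with its derivative, and the equation passes the bounds on to the
derivatives of higher order. -/
theorem IsSol.symR_zero (h : IsSol Q lam y dy) (hb : 0 ≤ b) (hb1 : b < 1)
    (hQ : ∀ k, SymR k (-b) Q) (k : ℕ) : SymR k 0 y := by
  have bd : ∀ {u : ℝ → ℝ} {s : ℝ}, ContinuousOn u (Set.Icc (-1) 1) → s ≤ 0 →
      ∃ C, ∀ x ∈ Set.Ico (0 : ℝ) 1, |u x| ≤ C * (1 - x) ^ s := by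
    intro u s hu hs
    obtain ⟨C, hC⟩ := (isCompact_Icc (a := (-1 : ℝ)) (b := 1)).exists_bound_of_continuousOn hu
    exact SymR.bound_mono hs ⟨C, fun x hx => by
      simpa using hC x ⟨by linarith [hx.1], hx.2.le⟩⟩
  have hd : DifferentiableOn ℝ y (Set.Ioo (-1) 1) := fun x hx =>
    (h.der x hx).differentiableAt.differentiableWithinAt
  have hdd : DifferentiableOn ℝ dy (Set.Ioo (-1) 1) := fun x hx =>
    (h.dder x hx).differentiableAt.differentiableWithinAt
  have step : ∀ k, SymR k (0 - 1) dy → SymR (k + 1) 0 y := fun k hk =>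
    SymR.of_deriv hd (bd h.cont le_rfl) (hk.congr fun x hx => (h.der x hx).deriv.symm)
  suffices H : ∀ k, SymR k 0 y ∧ SymR (k + 1) 0 y from (H k).1
  intro k
  induction k with
  | zero => exact ⟨⟨h.cont.mono Set.Ioo_subset_Icc_self, bd h.cont le_rfl⟩,
      step 0 ⟨h.dcont.mono Set.Ioo_subset_Icc_self, bd h.dcont (by norm_num)⟩⟩
  | succ k ih =>
    refine ⟨ih.2, step (k + 1) (SymR.of_deriv hdd (bd h.dcont (by norm_num)) ?_)⟩
    refine (((IsSol.symR_potential hb hQ lam k).mul ih.1).mono (by linarith)).congr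
      fun x hx => (h.dder x hx).deriv.symm

/-- A solution is the sum of its Taylor polynomial of degree one at the endpoint and a remainder
whose order depends on that of the potential. -/
theorem IsSol.symR_remainder (h : IsSol Q lam y dy) (hb : 0 ≤ b) (hb1 : b < 1)
    (hQ : ∀ k, SymR k (-b) Q) :
    (∀ k, SymR k 1 (fun x => y x - y 1)) ∧
    (∀ k, SymR k (2 - b) (fun x => y x - (y 1 + dy 1 * (x - 1)))) ∧
    (y 1 = 0 → ∀ k, SymR k (3 - b) (fun x => y x - (y 1 + dy 1 * (x - 1)))) := by
  have hi1 : ∀ {s : ℝ}, 0 < s → (∀ k, SymR k (s - 1) (fun x => (Q x - lam) * y x)) →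
      ∀ k, SymR k s (fun x => dy x - dy 1) := fun hs hk =>
    SymR.of_integral hs (h.dcont.sub continuousOn_const) (sub_self _)
      (fun x hx => (h.dder x hx).sub_const _) hk
  have hi2 : ∀ {s : ℝ}, 0 < s → (∀ k, SymR k (s - 1) (fun x => dy x - dy 1)) →
      ∀ k, SymR k s (fun x => y x - (y 1 + dy 1 * (x - 1))) := fun hs hk =>
    SymR.of_integral hs (h.cont.sub (by fun_prop)) (by simp)
      (fun x hx => by
        have := ((hasDerivAt_id x).sub_const 1).const_mul (dy 1)
        convert! (h.der x hx).sub (this.const_add (y 1)) using 1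
        simp) hk
  have h1 : ∀ k, SymR k (1 - b) (fun x => dy x - dy 1) :=
    hi1 (by linarith) fun k => (((IsSol.symR_potential hb hQ lam k).mul
      (h.symR_zero hb hb1 hQ k))).mono (by linarith)
  have h2 : ∀ k, SymR k 1 (fun x => y x - y 1) := by
    refine SymR.of_integral one_pos (h.cont.sub continuousOn_const) (sub_self _)
      (fun x hx => (h.der x hx).sub_const _) fun k => ?_
    refine (((h1 k).mono (t := 0) (by linarith)).add (SymR.const k (dy 1))).congr
      (fun x _ => sub_add_cancel _ _) |>.mono (by norm_num)
  refine ⟨h2, hi2 (by linarith) fun k => (h1 k).mono (by linarith), fun h0 => ?_⟩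
  refine hi2 (by linarith) fun k => (hi1 (s := 2 - b) (by linarith) (fun k => ?_) k).mono
    (by linarith)
  have := (IsSol.symR_potential hb hQ lam k).mul (h2 k)
  simp only [h0, sub_zero] at this
  exact this.mono (by linarith)

end EndRegularity

/-! ### Expansion of the product of the potential and an eigenfunction -/

/-- `h` is a sum of powers of `1 - x` with exponents in `(m - 2, m - 1)`, a polynomial of degree
one and a remainder of order above `m - 1`. -/
def HasProductExp (m : ℕ) (h : ℝ → ℝ) (κ : ℝ →₀ ℝ) : Prop :=
  (∀ e ∈ κ.support, (m : ℝ) - 2 < e ∧ e < m - 1) ∧ ∃ s, (m : ℝ) - 1 < s ∧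
    ∃ α β : ℝ, ∀ k, SymR k s (fun x => h x - endSum κ x - (α + β * x))

/-- The terms of a finite sum of powers with negative exponents, the constant term, and the terms
with positive exponents. -/
theorem endSum_split (κ : ℝ →₀ ℝ) (x : ℝ) : endSum κ x =
    endSum (κ.filter (· < 0)) x + κ 0 + endSum (κ.filter (0 < ·)) x := by
  have h : κ = κ.filter (· < 0) + Finsupp.single 0 (κ 0) + κ.filter (0 < ·) := by
    ext e
    rcases lt_trichotomy e 0 with h | rfl | h
    · simp [h, h.ne', not_lt.2 h.le]
    · simp
    · simp [h, h.ne, not_lt.2 h.le]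
  conv_lhs => rw [h]
  rw [endSum_add, endSum_add, endSum_single]; simp

section ProductExpansion

variable {Q : ℝ → ℝ} {lam : ℝ} {y dy : ℝ → ℝ} {κ : ℝ →₀ ℝ}

theorem HasEndExp.exists_symR (hQ : HasEndExp Q κ) :
    ∃ b, 0 ≤ b ∧ b < 1 ∧ (∀ k, SymR k (-b) Q) ∧ ((∀ e < 0, κ e = 0) → b = 0) := by
  obtain ⟨h1, s, hs, h2⟩ := hQ
  have key : ∀ t ≤ 0, (∀ e ∈ κ.support, t ≤ e) → ∀ k, SymR k t Q := fun t ht htκ k =>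
    (((h2 k).mono (t := t) (by linarith)).add (SymR.endSum htκ)).congr
      fun x _ => sub_add_cancel _ _
  by_cases h0 : ∀ e < 0, κ e = 0
  · refine ⟨0, le_rfl, one_pos, fun k => ?_, fun _ => rfl⟩
    rw [neg_zero]
    refine key 0 le_rfl (fun e he => ?_) k
    by_contra hlt
    exact Finsupp.mem_support_iff.1 he (h0 e (not_le.1 hlt))
  · obtain ⟨t, ht, ht0, htκ⟩ := exists_gt_forall_le κ.support (show (-1 : ℝ) < 0 by norm_num) h1
    exact ⟨-t, by linarith, by linarith, by rw [neg_neg]; exact key t ht0 htκ, fun h => (h0 h).elim⟩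

theorem exists_symR_filter_pos (κ : ℝ →₀ ℝ) :
    ∃ t, 0 < t ∧ t ≤ 1 ∧ ∀ k, SymR k t (endSum (κ.filter (0 < ·))) := by
  obtain ⟨t, ht, ht1, htκ⟩ := exists_gt_forall_le (κ.filter (0 < ·)).support
    (show (0 : ℝ) < 1 by norm_num) (fun e he => by
      rw [Finsupp.support_filter, Finset.mem_filter] at he; exact he.2)
  exact ⟨t, ht, ht1, fun k => SymR.endSum htκ⟩

/-- Replacing `y` by `y 1` changes `Q y` by a function of order above zero. -/
theorem HasEndExp.product_one (hQ : HasEndExp Q κ) (h : IsSol Q lam y dy) :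
    HasProductExp 1 (fun x => Q x * y x) (y 1 • κ.filter (· < 0)) := by
  obtain ⟨b, hb, hb1, hQb, _⟩ := hQ.exists_symR
  obtain ⟨h1, s, hs, h2⟩ := hQ
  obtain ⟨t, ht, ht1, htκ⟩ := exists_symR_filter_pos κ
  refine ⟨fun e he => ?_, min (1 - b) t, ?_, y 1 * κ 0, 0, fun k => ?_⟩
  · have he := Finsupp.support_smul he
    rw [Finsupp.support_filter, Finset.mem_filter] at he
    have := h1 e he.1
    constructor
    · push_cast; linarith
    · push_cast; linarith [he.2]
  · push_cast
    exact lt_min (by linarith) (by linarith)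
  · have e1 := ((hQb k).mul ((h.symR_remainder hb hb1 hQb).1 k)).mono (t := min (1 - b) t)
      ((min_le_left _ _).trans (by linarith))
    have e2 := ((h2 k).const_mul (y 1)).mono (t := min (1 - b) t)
      ((min_le_right _ _).trans (by linarith))
    have e3 := ((htκ k).const_mul (y 1)).mono (t := min (1 - b) t) (min_le_right _ _)
    refine ((e1.add e2).add e3).congr fun x _ => ?_
    simp only [endSum_smul]
    have := endSum_split κ x
    linear_combination -y 1 * this

/-- If `y` vanishes at the endpoint, then `y` is `dy 1 * (x - 1)` to leading order, and the factor
raises the exponents by one. -/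
theorem HasEndExp.product_two_of_eq_zero (hQ : HasEndExp Q κ) (h : IsSol Q lam y dy)
    (h0 : y 1 = 0) :
    HasProductExp 2 (fun x => Q x * y x) (-dy 1 • (κ.filter (· < 0)).mapDomain (· + 1)) := by
  obtain ⟨b, hb, hb1, hQb, _⟩ := hQ.exists_symR
  obtain ⟨h1, s, hs, h2⟩ := hQ
  obtain ⟨t, ht, ht1, htκ⟩ := exists_symR_filter_pos κ
  classical
  refine ⟨fun e he => ?_, min (3 - 2 * b) (1 + t), ?_, -dy 1 * κ 0, dy 1 * κ 0, fun k => ?_⟩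
  · have he := Finsupp.mapDomain_support (Finsupp.support_smul he)
    obtain ⟨e', he', rfl⟩ := Finset.mem_image.1 he
    rw [Finsupp.support_filter, Finset.mem_filter] at he'
    have := h1 e' he'.1
    constructor
    · push_cast; linarith
    · push_cast; linarith [he'.2]
  · push_cast
    exact lt_min (by linarith) (by linarith)
  · set σ := min (3 - 2 * b) (1 + t)
    have e1 := ((hQb k).mul ((h.symR_remainder hb hb1 hQb).2.2 h0 k)).mono (t := σ)
      ((min_le_left _ _).trans (by linarith))
    have e2 := ((SymR.rpow k 1).mul (((h2 k).mono (t := t) (by linarith)).add (htκ k))).const_mul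
      (-dy 1) |>.mono (t := σ) (min_le_right _ _)
    refine (e1.add e2).congr fun x hx => ?_
    simp only [endSum_smul, endSum_mapDomain_add_one _ hx.2, h0, Real.rpow_one]
    have := endSum_split κ x
    linear_combination dy 1 * (1 - x) * this

/-- If the potential is bounded at the endpoint, then the product is, up to order one, a polynomial
and the powers of the potential with exponents in `(0, 1)`, times `y 1`. -/
theorem HasEndExp.product_two_of_bounded (hQ : HasEndExp Q κ) (h : IsSol Q lam y dy)
    (h0 : ∀ e < 0, κ e = 0) :
    HasProductExp 2 (fun x => Q x * y x) (y 1 • κ.filter fun e => 0 < e ∧ e < 1) := by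
  obtain ⟨b, hb, hb1, hQb, hb0⟩ := hQ.exists_symR
  obtain rfl := hb0 h0
  obtain ⟨h1, s, hs, h2⟩ := hQ
  obtain ⟨t, ht, ht1, htκ⟩ := exists_symR_filter_pos κ
  obtain ⟨t', ht', ht1', htκ'⟩ := exists_gt_forall_le (κ.filter (1 < ·)).support
    (show (1 : ℝ) < 2 by norm_num) (fun e he => by
      rw [Finsupp.support_filter, Finset.mem_filter] at he; exact he.2)
  have hneg : κ.filter (· < 0) = 0 := by
    ext e
    by_cases he : e < 0
    · simp [he, h0 e he]
    · simp [he]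
  have hpos : κ.filter (0 < ·) = (κ.filter fun e => 0 < e ∧ e < 1) + Finsupp.single 1 (κ 1) +
      κ.filter (1 < ·) := by
    ext e
    rcases lt_trichotomy e 1 with h | rfl | h
    · simp only [Finsupp.add_apply, Finsupp.filter_apply, h, and_true, not_lt.2 h.le, if_false,
        add_zero, Finsupp.single_apply, h.ne']
    · simp
    · have : 0 < e := by linarith
      simp [h, h.ne, not_lt.2 h.le, this]
  refine ⟨fun e he => ?_, min (min s t') (1 + t), ?_, y 1 * κ 0 + y 1 * κ 1 - dy 1 * κ 0,
    dy 1 * κ 0 - y 1 * κ 1, fun k => ?_⟩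
  · have he := Finsupp.support_smul he
    rw [Finsupp.support_filter, Finset.mem_filter] at he
    constructor
    · push_cast; linarith [he.2.1]
    · push_cast; linarith [he.2.2]
  · push_cast
    exact lt_min (lt_min (by linarith) (by linarith)) (by linarith)
  · set σ := min (min s t') (1 + t) with hσ
    have hσ1 : σ ≤ s := (min_le_left _ _).trans (min_le_left _ _)
    have hσ2 : σ ≤ t' := (min_le_left _ _).trans (min_le_right _ _)
    have hσ3 : σ ≤ 1 + t := min_le_right _ _
    have e1 := ((hQb k).mul ((h.symR_remainder hb hb1 hQb).2.1 k)).mono (t := σ) (by linarith)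
    have e2 := ((SymR.rpow k 1).mul (((h2 k).mono (t := t) (by linarith)).add (htκ k))).const_mul
      (-dy 1) |>.mono (t := σ) hσ3
    have e3 := ((((h2 k).mono (t := σ) hσ1)).add
      ((SymR.endSum (k := k) htκ').mono (t := σ) hσ2)).const_mul (y 1)
    refine ((e1.add e2).add e3).congr fun x hx => ?_
    simp only [endSum_smul, Real.rpow_one]
    have f1 := endSum_split κ x
    have f2 : endSum (κ.filter (· < 0)) x = 0 := by rw [hneg]; simp [endSum]
    have f3 : endSum (κ.filter (0 < ·)) x = endSum (κ.filter fun e => 0 < e ∧ e < 1) x +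
        κ 1 * (1 - x) + endSum (κ.filter (1 < ·)) x := by
      rw [hpos, endSum_add, endSum_add, endSum_single, Real.rpow_one]
    rw [f2] at f1
    linear_combination (dy 1 * (1 - x) - y 1) * f1 - y 1 * f3

end ProductExpansion

/-! ### Asymptotics of the coefficients of `q y` -/

theorem analyticOnNhd_endSum_neg (μ : ℝ →₀ ℝ) :
    AnalyticOnNhd ℝ (fun x => endSum μ (-x)) (Set.Ioc (-1) 1) := by
  have : AnalyticOnNhd ℝ (fun x => ∑ e ∈ μ.support, μ e * (1 + x) ^ e) (Set.Ioc (-1) 1) :=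
    Finset.analyticOnNhd_fun_sum _ fun e _ =>
      analyticOnNhd_const.mul (analyticOnNhd_one_add_rpow e)
  convert! this using 2 with x
  rw [endSum_eq_sum]
  simp

theorem HasProductExp.sub_endSum_neg {m : ℕ} {h : ℝ → ℝ} {κ : ℝ →₀ ℝ} (hκ : HasProductExp m h κ)
    (hm : m ≤ 2) (μ : ℝ →₀ ℝ) : ∃ s, (m : ℝ) - 1 < s ∧ s ≤ 2 ∧
      ∃ α β : ℝ, ∀ k, SymR k s (fun x => h x - endSum κ x - endSum μ (-x) - (α + β * x)) := by
  have hm' : (m : ℝ) ≤ 2 := by exact_mod_cast hm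
  obtain ⟨_, s, hs, α, β, h1⟩ := hκ
  set v : ℝ → ℝ := fun x => endSum μ (-x) with hv
  refine ⟨min s 2, lt_min hs (by linarith), min_le_right _ _, α - (v 1 - deriv v 1),
    β - deriv v 1, fun k => ?_⟩
  refine (((h1 k).mono (min_le_left s 2)).sub ((SymR.taylor_of_analyticOnNhd k
    (analyticOnNhd_endSum_neg μ)).mono (min_le_right s 2))).congr fun x _ => ?_
  simp only [hv]
  ring

/-- The expansions at both endpoints fit together: the linear parts are joined by Hermite
interpolation with the cubic `(1 - x) ^ 2 (2 + x) / 4`. -/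
theorem HasProductExp.exists_symLR {m : ℕ} {h : ℝ → ℝ} {κ μ : ℝ →₀ ℝ} (hm : m ≤ 2)
    (hκ : HasProductExp m h κ) (hμ : HasProductExp m (fun x => h (-x)) μ) :
    ∃ s, (m : ℝ) - 1 < s ∧ ∃ P : ℝ[X],
      SymLR s (fun x => h x - endSum κ x - endSum μ (-x) - fn P x) := by
  obtain ⟨s1, hs1, hs1', α1, β1, h1⟩ := hκ.sub_endSum_neg hm μ
  obtain ⟨s2, hs2, hs2', α2, β2, h2⟩ := hμ.sub_endSum_neg hm κ
  have hH : ∀ (a b : ℝ) (k : ℕ), SymR k 2 (fun x => (1 - x) ^ 2 * (2 + x) / 4 * (a + b * x)) := by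
    intro a b k
    have : AnalyticOnNhd ℝ (fun x : ℝ => (2 + x) / 4 * (a + b * x)) (Set.Ioc (-1) 1) := by
      intro x _; fun_prop
    have := (SymR.rpow k 2).mul (SymR.of_analyticOnNhd k this)
    rw [add_zero] at this
    refine this.congr fun x _ => ?_
    simp only [Real.rpow_two]; ring
  refine ⟨min s1 s2, lt_min hs1 hs2,
    (C α1 + C β1 * X) * (C (1 / 4) * (1 + X) ^ 2 * (2 - X)) +
      (C α2 - C β2 * X) * (C (1 / 4) * (1 - X) ^ 2 * (2 + X)), fun k => ⟨?_, ?_⟩⟩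
  · refine (((h1 k).mono (min_le_left s1 s2)).add ((hH (α1 - α2) (β1 + β2) k).mono
      ((min_le_left s1 s2).trans hs1'))).congr fun x _ => ?_
    simp [fn]; ring
  · refine (((h2 k).mono (min_le_right s1 s2)).add ((hH (α2 - α1) (β2 + β1) k).mono
      ((min_le_left s1 s2).trans hs1'))).congr fun x _ => ?_
    simp [fn]; ring

theorem tendsto_rpow_neg_nat {a : ℝ} (ha : a < 0) :
    Tendsto (fun n : ℕ => (n : ℝ) ^ a) atTop (𝓝 0) := by
  have := (tendsto_rpow_neg_atTop (y := -a) (by linarith)).comp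
    (tendsto_natCast_atTop_atTop (R := ℝ))
  simpa [Function.comp_def] using this

/-- The powers of least exponent dominate; the sum of two consecutive terms cannot cancel, as the
contributions of the two endpoints differ by the sign `(-1) ^ n`. -/
theorem BasisCoeff.exists_rate {S : ℕ} {p : Problem S} {R : ℕ → ℝ[X]} {ξ η θ : ℕ → ℝ}
    (hR : BasisCoeff p R ξ η θ) {m : ℕ} (hm1 : 1 ≤ m) (hm2 : m ≤ 2) {h : ℝ → ℝ} {κ μ : ℝ →₀ ℝ}
    (hκ : HasProductExp m h κ) (hμ : HasProductExp m (fun x => h (-x)) μ) (hne : κ ≠ 0 ∨ μ ≠ 0) :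
    ∃ ρ : ℝ, 1 < ρ ∧ ρ < 5 ∧ ∃ c > 0, ∃ K, ∀ᶠ n : ℕ in atTop,
      |ip (fn (R n)) h| ≤ K * (n : ℝ) ^ (-ρ) ∧
      c * (n : ℝ) ^ (-ρ) ≤ |ip (fn (R n)) h| + |ip (fn (R (n + 1))) h| := by
  classical
  obtain ⟨s, hs, P, hu⟩ := hκ.exists_symLR hm2 hμ
  set u : ℝ → ℝ := fun x => h x - endSum κ x - endSum μ (-x) - fn P x with hu_def
  have hm1' : (1 : ℝ) ≤ m := by exact_mod_cast hm1
  have hm2' : (m : ℝ) ≤ 2 := by exact_mod_cast hm2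
  have hA : (κ.support ∪ μ.support).Nonempty := by
    rcases hne with h | h
    · exact (Finsupp.support_nonempty_iff.2 h).mono Finset.subset_union_left
    · exact (Finsupp.support_nonempty_iff.2 h).mono Finset.subset_union_right
  set E := (κ.support ∪ μ.support).min' hA with hE
  have hrange : ∀ e ∈ κ.support ∪ μ.support, (m : ℝ) - 2 < e ∧ e < m - 1 := fun e he => by
    rcases Finset.mem_union.1 he with h | h
    · exact hκ.1 e h
    · exact hμ.1 e h
  have hmin : ∀ e ∈ κ.support ∪ μ.support, E ≤ e := fun e he => Finset.min'_le _ _ he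
  have hEr := hrange E (Finset.min'_mem _ _)
  have hgt : ∀ e ∈ κ.support ∪ μ.support, -1 < e := fun e he => by linarith [(hrange e he).1]
  have hnat : ∀ e ∈ κ.support ∪ μ.support, ∀ j : ℕ, e ≠ j := by
    intro e he j hj
    have h1 := hrange e he
    rw [hj] at h1
    have h2 : (m : ℤ) - 2 < j := by exact_mod_cast h1.1
    have h3 : (j : ℤ) < m - 1 := by exact_mod_cast h1.2
    omega
  obtain ⟨J, J', hJ0, hJ'0, hJ, hJ'⟩ : ∃ J J' : ℝ, J ≠ 0 ∧ J' ≠ 0 ∧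
      Tendsto (fun n : ℕ => (n : ℝ) ^ (2 * E + 3) * ip (fn (R n)) fun x => (1 - x) ^ E) atTop
        (𝓝 J) ∧
      Tendsto (fun n : ℕ => (n : ℝ) ^ (2 * E + 3) * ((-1) ^ n * ip (fn (R n)) fun x => (1 + x) ^ E))
        atTop (𝓝 J') :=
    hR.tendsto_powers (hgt E (Finset.min'_mem _ _)) (hnat E (Finset.min'_mem _ _))
  -- after multiplication by `n ^ (2 E + 3)`, only the least exponent `E` contributes in the limit
  have small : ∀ e ∈ κ.support ∪ μ.support, e ≠ E → ∀ {w : ℕ → ℝ} {L : ℝ},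
      Tendsto (fun n : ℕ => (n : ℝ) ^ (2 * e + 3) * w n) atTop (𝓝 L) →
      Tendsto (fun n : ℕ => (n : ℝ) ^ (2 * E + 3) * w n) atTop (𝓝 0) := by
    intro e he hne w L hw
    have hlt : E < e := lt_of_le_of_ne (hmin e he) hne.symm
    have := (tendsto_rpow_neg_nat (a := 2 * (E - e)) (by linarith)).mul hw
    rw [zero_mul] at this
    refine this.congr' ?_
    filter_upwards [eventually_gt_atTop 0] with n hn
    rw [← mul_assoc, ← Real.rpow_add (by positivity)]
    congr 2; ring
  have hX : Tendsto (fun n : ℕ => ∑ e ∈ κ.support,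
      κ e * ((n : ℝ) ^ (2 * E + 3) * ip (fn (R n)) fun x => (1 - x) ^ e)) atTop (𝓝 (κ E * J)) := by
    have : κ E * J = ∑ e ∈ κ.support, κ e * (if e = E then J else 0) := by
      simp only [mul_ite, mul_zero, Finset.sum_ite_eq']
      split_ifs with h
      · rfl
      · rw [Finsupp.notMem_support_iff.1 h, zero_mul]
    rw [this]
    refine tendsto_finsetSum _ fun e he => Tendsto.const_mul _ ?_
    split_ifs with h
    · subst h; exact hJ
    · have he' := Finset.mem_union_left μ.support he
      obtain ⟨_, _, _, _, h1, _⟩ := hR.tendsto_powers (hgt e he') (hnat e he')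
      exact small e he' h h1
  have hY : Tendsto (fun n : ℕ => ∑ e ∈ μ.support,
      μ e * ((n : ℝ) ^ (2 * E + 3) * ((-1) ^ n * ip (fn (R n)) fun x => (1 + x) ^ e)))
      atTop (𝓝 (μ E * J')) := by
    have : μ E * J' = ∑ e ∈ μ.support, μ e * (if e = E then J' else 0) := by
      simp only [mul_ite, mul_zero, Finset.sum_ite_eq']
      split_ifs with h
      · rfl
      · rw [Finsupp.notMem_support_iff.1 h, zero_mul]
    rw [this]
    refine tendsto_finsetSum _ fun e he => Tendsto.const_mul _ ?_
    split_ifs with h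
    · subst h; exact hJ'
    · have he' := Finset.mem_union_right κ.support he
      obtain ⟨_, _, _, _, _, h1⟩ := hR.tendsto_powers (hgt e he') (hnat e he')
      exact small e he' h h1
  have hZ : Tendsto (fun n : ℕ => (n : ℝ) ^ (2 * E + 3) * ip (fn (R n)) u) atTop (𝓝 0) := by
    obtain ⟨K, hK⟩ := hR.ip_le_of_symLR hm1 hu hs
    have h0 := (tendsto_rpow_neg_nat (a := 2 * E + 3 - (2 * m + 1)) (by linarith)).const_mul K
    rw [mul_zero] at h0
    refine squeeze_zero_norm' ?_ h0
    filter_upwards [eventually_ge_atTop 1] with n hn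
    have hn0 : (0 : ℝ) < n := by positivity
    have h1 := hK n hn
    rw [norm_mul, Real.norm_of_nonneg (Real.rpow_nonneg hn0.le _), Real.norm_eq_abs]
    refine (mul_le_mul_of_nonneg_left h1 (Real.rpow_nonneg hn0.le _)).trans (le_of_eq ?_)
    rw [Real.rpow_sub hn0, show (2 * (m : ℝ) + 1) = ((2 * m + 1 : ℕ) : ℝ) by push_cast; ring,
      Real.rpow_natCast]
    ring
  -- the decomposition of the coefficient
  have hf : ∀ᶠ n : ℕ in atTop, (n : ℝ) ^ (2 * E + 3) * ip (fn (R n)) h =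
      (∑ e ∈ κ.support, κ e * ((n : ℝ) ^ (2 * E + 3) * ip (fn (R n)) fun x => (1 - x) ^ e)) +
      (-1) ^ n * (∑ e ∈ μ.support,
        μ e * ((n : ℝ) ^ (2 * E + 3) * ((-1) ^ n * ip (fn (R n)) fun x => (1 + x) ^ e))) +
      (n : ℝ) ^ (2 * E + 3) * ip (fn (R n)) u := by
    filter_upwards [eventually_gt_atTop P.natDegree] with n hn
    have hP : ip (fn (R n)) (fn P) = 0 := hR.pip_of_natDegree_lt hn
    have i1 : ∀ e ∈ κ.support, IntervalIntegrable (fun x => fn (R n) x * (κ e * (1 - x) ^ e))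
        volume (-1) 1 := fun e he => intervalIntegrable_fn_mul _
      ((intervalIntegrable_one_sub_rpow (hgt e (Finset.mem_union_left _ he))).const_mul _)
    have i2 : ∀ e ∈ μ.support, IntervalIntegrable (fun x => fn (R n) x * (μ e * (1 + x) ^ e))
        volume (-1) 1 := fun e he => intervalIntegrable_fn_mul _
      ((intervalIntegrable_one_add_rpow (hgt e (Finset.mem_union_right _ he))).const_mul _)
    have i3 := intervalIntegrable_fn_mul (R n) (hu.intervalIntegrable (by linarith))
    have i4 := intervalIntegrable_fn_mul (R n) ((continuous_fn P).intervalIntegrable (-1) 1)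
    have j1 : IntervalIntegrable (fun x => ∑ e ∈ κ.support, fn (R n) x * (κ e * (1 - x) ^ e))
        volume (-1) 1 := by
      refine (IntervalIntegrable.sum _ i1).congr fun x _ => ?_
      simp
    have j2 : IntervalIntegrable (fun x => ∑ e ∈ μ.support, fn (R n) x * (μ e * (1 + x) ^ e))
        volume (-1) 1 := by
      refine (IntervalIntegrable.sum _ i2).congr fun x _ => ?_
      simp
    have e0 : ip (fn (R n)) h = ∫ x in (-1 : ℝ)..1,
        (((∑ e ∈ κ.support, fn (R n) x * (κ e * (1 - x) ^ e)) +
          ∑ e ∈ μ.support, fn (R n) x * (μ e * (1 + x) ^ e)) + fn (R n) x * fn P x) +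
          fn (R n) x * u x := by
      rw [ip]
      congr 1; ext x
      rw [← Finset.mul_sum, ← Finset.mul_sum, ← endSum_eq_sum]
      have : ∑ e ∈ μ.support, μ e * (1 + x) ^ e = endSum μ (-x) := by
        rw [endSum_eq_sum]; simp
      rw [this]
      simp only [hu_def]; ring
    rw [e0, intervalIntegral.integral_add ((j1.add j2).add i4) i3,
      intervalIntegral.integral_add (j1.add j2) i4, intervalIntegral.integral_add j1 j2,
      intervalIntegral.integral_finsetSum i1, intervalIntegral.integral_finsetSum i2]
    change _ * (_ + _ + ip (fn (R n)) (fn P) + ip (fn (R n)) u) = _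
    rw [hP, add_zero, mul_add, mul_add, Finset.mul_sum, Finset.mul_sum, Finset.mul_sum]
    have h5 : ((-1 : ℝ) ^ n) * (-1) ^ n = 1 := by rw [← mul_pow]; norm_num
    congr 2
    · refine Finset.sum_congr rfl fun e _ => ?_
      have := ip_const_mul_right (κ e) (fn (R n)) (fun x => (1 - x) ^ e)
      simp only [ip] at this ⊢
      rw [this]; ring
    · refine Finset.sum_congr rfl fun e _ => ?_
      have := ip_const_mul_right (μ e) (fn (R n)) (fun x => (1 + x) ^ e)
      simp only [ip] at this ⊢
      rw [this]; linear_combination (-μ e * (n : ℝ) ^ (2 * E + 3) *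
        ∫ x in (-1 : ℝ)..1, fn (R n) x * (1 + x) ^ e) * h5
  set X : ℕ → ℝ := fun n : ℕ => ∑ e ∈ κ.support,
      κ e * ((n : ℝ) ^ (2 * E + 3) * ip (fn (R n)) fun x => (1 - x) ^ e) with hXdef
  set Y : ℕ → ℝ := fun n : ℕ => ∑ e ∈ μ.support,
      μ e * ((n : ℝ) ^ (2 * E + 3) * ((-1) ^ n * ip (fn (R n)) fun x => (1 + x) ^ e)) with hYdef
  set F : ℕ → ℝ := fun n => (n : ℝ) ^ (2 * E + 3) * ip (fn (R n)) h with hF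
  have hFZ : Tendsto (fun n => F n - X n - (-1) ^ n * Y n) atTop (𝓝 0) := by
    refine hZ.congr' ?_
    filter_upwards [hf] with n hn
    simp only [hF, hn]; ring
  have shift : ∀ {w : ℕ → ℝ} {L : ℝ}, Tendsto w atTop (𝓝 L) →
      Tendsto (fun n => w (n + 1)) atTop (𝓝 L) := fun h => (tendsto_add_atTop_iff_nat 1).2 h
  have hYz : Tendsto (fun n => (-1 : ℝ) ^ n * (Y n - Y (n + 1))) atTop (𝓝 0) := by
    have := hY.sub (shift hY)
    rw [sub_self] at this
    refine squeeze_zero_norm (fun n => ?_) (tendsto_zero_iff_norm_tendsto_zero.1 this)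
    rw [norm_mul]; simp
  -- The sum of two consecutive terms isolates the contribution of the right end, their difference
  -- that of the left end.
  have hsum : Tendsto (fun n => F n + F (n + 1)) atTop (𝓝 (2 * (κ E * J))) := by
    have := ((hFZ.add (shift hFZ)).add (hX.add (shift hX))).add hYz
    rw [show (0 : ℝ) + 0 + (κ E * J + κ E * J) + 0 = 2 * (κ E * J) by ring] at this
    refine this.congr fun n => ?_
    rw [pow_succ]; ring
  have hdiff : Tendsto (fun n => (-1) ^ n * (F n - F (n + 1))) atTop (𝓝 (2 * (μ E * J'))) := by
    have h1 : Tendsto (fun n => (-1 : ℝ) ^ n * ((F n - X n - (-1) ^ n * Y n) -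
        (F (n + 1) - X (n + 1) - (-1) ^ (n + 1) * Y (n + 1)) + (X n - X (n + 1)))) atTop (𝓝 0) := by
      have := (hFZ.sub (shift hFZ)).add (hX.sub (shift hX))
      rw [sub_self, sub_self, add_zero] at this
      refine squeeze_zero_norm (fun n => ?_) (tendsto_zero_iff_norm_tendsto_zero.1 this)
      rw [norm_mul]; simp
    have := h1.add (hY.add (shift hY))
    rw [show (0 : ℝ) + (μ E * J' + μ E * J') = 2 * (μ E * J') by ring] at this
    refine this.congr fun n => ?_
    have h5 : ((-1 : ℝ) ^ n) * (-1) ^ n = 1 := by rw [← mul_pow]; norm_num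
    rw [pow_succ]
    linear_combination (-Y n - Y (n + 1)) * h5
  have hEne : κ E ≠ 0 ∨ μ E ≠ 0 := by
    rcases Finset.mem_union.1 (Finset.min'_mem _ hA) with h | h
    · exact Or.inl (Finsupp.mem_support_iff.1 h)
    · exact Or.inr (Finsupp.mem_support_iff.1 h)
  obtain ⟨c, hc, hlow⟩ : ∃ c > 0, ∀ᶠ n in atTop, c ≤ |F n| + |F (n + 1)| := by
    have aux : ∀ {w : ℕ → ℝ} {L : ℝ}, L ≠ 0 → Tendsto w atTop (𝓝 (2 * L)) →
        (∀ n, |w n| ≤ |F n| + |F (n + 1)|) → ∃ c > 0, ∀ᶠ n in atTop, c ≤ |F n| + |F (n + 1)| := by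
      intro w L hL hw hle
      have h0 : 0 < |L| := abs_pos.2 hL
      refine ⟨|L|, h0, ?_⟩
      have h1 : |L| < |2 * L| := by rw [abs_mul, abs_two]; linarith
      filter_upwards [hw.abs.eventually (lt_mem_nhds h1)] with n hn
      exact hn.le.trans (hle n)
    rcases hEne with h | h
    · exact aux (mul_ne_zero h hJ0) hsum fun n => abs_add_le _ _
    · refine aux (mul_ne_zero h hJ'0) hdiff fun n => ?_
      rw [abs_mul]; simpa using abs_sub (F n) (F (n + 1))
  have hup : ∃ K, ∀ᶠ n in atTop, |F n| ≤ K := by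
    refine ⟨1 + (|κ E * J| + 1) + (|μ E * J'| + 1), ?_⟩
    filter_upwards [hFZ.abs.eventually (gt_mem_nhds (show |(0 : ℝ)| < 1 by simp)),
      hX.abs.eventually (gt_mem_nhds (lt_add_one _)),
      hY.abs.eventually (gt_mem_nhds (lt_add_one _))] with n h1 h2 h3
    have : F n = (F n - X n - (-1) ^ n * Y n) + X n + (-1) ^ n * Y n := by ring
    rw [this]
    refine (abs_add_le _ _).trans (add_le_add ((abs_add_le _ _).trans
      (add_le_add h1.le h2.le)) ?_)
    rw [abs_mul]; simpa using h3.le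
  obtain ⟨K, hK⟩ := hup
  set ρ := 2 * E + 3 with hρ
  have hρ0 : 0 < ρ := by linarith
  refine ⟨ρ, by linarith, by linarith, c / 2 ^ ρ, by positivity, K, ?_⟩
  filter_upwards [hK, hlow, eventually_gt_atTop 0] with n h1 h2 hn
  have hn0 : (0 : ℝ) < n := by positivity
  have hpos : 0 < (n : ℝ) ^ ρ := Real.rpow_pos_of_pos hn0 _
  simp only [hF, abs_mul, abs_of_pos hpos] at h1 h2
  rw [Real.rpow_neg hn0.le]
  constructor
  · rw [← div_eq_mul_inv, le_div_iff₀ hpos]; linarith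
  · have h3 : ((n + 1 : ℕ) : ℝ) ^ ρ ≤ 2 ^ ρ * (n : ℝ) ^ ρ := by
      rw [← Real.mul_rpow (by norm_num) hn0.le]
      refine Real.rpow_le_rpow (by positivity) ?_ hρ0.le
      have : (1 : ℝ) ≤ n := by exact_mod_cast hn
      push_cast; linarith
    have h4 : (1 : ℝ) ≤ 2 ^ ρ := Real.one_le_rpow (by norm_num) hρ0.le
    rw [abs_of_nonneg (Real.rpow_nonneg (by positivity) _)] at h2
    have h5 : c ≤ 2 ^ ρ * (n : ℝ) ^ ρ * (|ip (fn (R n)) h| + |ip (fn (R (n + 1))) h|) := by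
      refine h2.trans ?_
      rw [mul_add]
      refine add_le_add ?_ (mul_le_mul_of_nonneg_right h3 (abs_nonneg _))
      exact mul_le_mul_of_nonneg_right (le_mul_of_one_le_left hpos.le h4) (abs_nonneg _)
    have h2p : (0 : ℝ) < 2 ^ ρ := by positivity
    rw [div_mul_eq_mul_div, div_le_iff₀ h2p, ← div_eq_mul_inv, div_le_iff₀ hpos]
    linarith

/-- The rate of the coefficients of `q y`. If `y ≠ 0` at an end where the potential is unbounded,
the powers of exponent in `(-1, 0)` decide; otherwise those of exponent in `(0, 1)`. -/
theorem BasisCoeff.exists_rate_product {S : ℕ} {p : Problem S} {R : ℕ → ℝ[X]} {ξ η θ : ℕ → ℝ}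
    (hR : BasisCoeff p R ξ η θ) (hq : p.UnboundedPotential) {lam : ℝ} {y dy : ℝ → ℝ}
    (h : IsSol p.q lam y dy) (hne : ∃ x ∈ Set.Icc (-1 : ℝ) 1, y x ≠ 0) :
    ∃ ρ : ℝ, 1 < ρ ∧ ρ < 5 ∧ ∃ c > 0, ∃ K, ∀ᶠ n : ℕ in atTop,
      |ip (fn (R n)) (fun x => p.q x * y x)| ≤ K * (n : ℝ) ^ (-ρ) ∧
      c * (n : ℝ) ^ (-ρ) ≤ |ip (fn (R n)) (fun x => p.q x * y x)| +
        |ip (fn (R (n + 1))) (fun x => p.q x * y x)| := by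
  obtain ⟨κ, hκ⟩ := p.exists_hasEndExp
  obtain ⟨μ, hμ⟩ := p.reflect.exists_hasEndExp
  have hrq : p.reflect.q = fun x => p.q (-x) := funext p.reflect_q
  have hunb := hq.exists_neg hκ hμ
  rw [hrq] at hμ
  have h' := h.comp_neg
  have hfilter : ∀ {κ : ℝ →₀ ℝ} {e : ℝ}, e < 0 → κ e ≠ 0 → κ.filter (· < 0) ≠ 0 := by
    intro κ e he h0 hz
    have := DFunLike.congr_fun hz e
    simp [he, h0] at this
  by_cases hA : (y 1 ≠ 0 ∧ ∃ e < 0, κ e ≠ 0) ∨ (y (-1) ≠ 0 ∧ ∃ e < 0, μ e ≠ 0)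
  · refine hR.exists_rate le_rfl (by norm_num) (hκ.product_one h) (hμ.product_one h') ?_
    rcases hA with ⟨h0, e, he, hk⟩ | ⟨h0, e, he, hk⟩
    · exact Or.inl (smul_ne_zero h0 (hfilter he hk))
    · exact Or.inr (smul_ne_zero h0 (hfilter he hk))
  · push Not at hA
    have hend : ∀ {Q : ℝ → ℝ} {κ : ℝ →₀ ℝ} {y dy : ℝ → ℝ}, IsPotential Q → HasEndExp Q κ →
        IsSol Q lam y dy → (∃ x ∈ Set.Icc (-1 : ℝ) 1, y x ≠ 0) →
        (y 1 ≠ 0 → ∀ e < 0, κ e = 0) → ∃ ν, HasProductExp 2 (fun x => Q x * y x) ν ∧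
          ((∃ e < 0, κ e ≠ 0) → ν ≠ 0) := by
      intro Q κ y dy hQ hκ h hne himp
      by_cases h0 : y 1 = 0
      · refine ⟨_, hκ.product_two_of_eq_zero h h0, ?_⟩
        rintro ⟨e, he, hk⟩
        have hdy : dy 1 ≠ 0 := fun hdy => by
          obtain ⟨x, hx, hx0⟩ := hne
          exact hx0 (h.eq_zero hQ h0 hdy x hx)
        refine smul_ne_zero (neg_ne_zero.2 hdy) fun hz => hfilter he hk ?_
        exact Finsupp.mapDomain_injective (add_left_injective 1)
          (hz.trans Finsupp.mapDomain_zero.symm)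
      · exact ⟨_, hκ.product_two_of_bounded h (himp h0), fun ⟨e, he, hk⟩ =>
          (hk (himp h0 e he)).elim⟩
    have hne' : ∃ x ∈ Set.Icc (-1 : ℝ) 1, y (-x) ≠ 0 := by
      obtain ⟨x, hx, hx0⟩ := hne
      exact ⟨-x, ⟨by linarith [hx.2], by linarith [hx.1]⟩, by rwa [neg_neg]⟩
    have hQ' : IsPotential fun x => p.q (-x) := hrq ▸ p.reflect.isPotential
    obtain ⟨ν, hν, hν0⟩ := hend p.isPotential hκ h hne hA.1
    obtain ⟨ν', hν', hν'0⟩ := hend hQ' hμ h' hne' hA.2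
    exact hR.exists_rate (by norm_num) le_rfl hν hν' (hunb.imp hν0 hν'0)

/-! ### The coefficients of the exact eigenfunction -/

theorem intervalIntegrable_of_continuousOn {u : ℝ → ℝ} (hu : ContinuousOn u (Set.Icc (-1) 1)) :
    IntervalIntegrable u volume (-1) 1 :=
  hu.intervalIntegrable_of_Icc (by norm_num)

theorem ip_self_nonneg (u : ℝ → ℝ) : 0 ≤ ip u u :=
  intervalIntegral.integral_nonneg (by norm_num) fun x _ => mul_self_nonneg _

/-- The Cauchy-Schwarz inequality. -/
theorem ip_sq_le {u v : ℝ → ℝ} (hu : ContinuousOn u (Set.Icc (-1) 1))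
    (hv : ContinuousOn v (Set.Icc (-1) 1)) : ip u v ^ 2 ≤ ip u u * ip v v := by
  have huu := intervalIntegrable_mul_of_continuousOn' hu hu
  have huv := intervalIntegrable_mul_of_continuousOn' hu hv
  have hvv := intervalIntegrable_mul_of_continuousOn' hv hv
  have key : ∀ t : ℝ, 0 ≤ ip v v * (t * t) + 2 * ip u v * t + ip u u := by
    intro t
    have h := ip_self_nonneg fun x => u x + t * v x
    have e : ip (fun x => u x + t * v x) (fun x => u x + t * v x) =
        ip v v * (t * t) + 2 * ip u v * t + ip u u := by
      have : (fun x => (u x + t * v x) * (u x + t * v x)) =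
          fun x => ((t * t) * (v x * v x) + (2 * t) * (u x * v x)) + u x * u x := by
        ext x; ring
      simp only [ip]
      rw [this, intervalIntegral.integral_add ((hvv.const_mul _).add (huv.const_mul _)) huu,
        intervalIntegral.integral_add (hvv.const_mul _) (huv.const_mul _),
        intervalIntegral.integral_const_mul, intervalIntegral.integral_const_mul]
      ring
    linarith
  have := discrim_le_zero key
  rw [discrim] at this
  nlinarith

theorem fn_finset_sum {ι : Type*} (s : Finset ι) (r : ι → ℝ[X]) (x : ℝ) :
    fn (∑ i ∈ s, r i) x = ∑ i ∈ s, fn (r i) x := eval_finsetSum ..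

theorem pip_finset_sum_left {ι : Type*} (s : Finset ι) (k : ι → ℝ) (r : ι → ℝ[X]) (t : ℝ[X]) :
    pip (∑ i ∈ s, C (k i) * r i) t = ∑ i ∈ s, k i * pip (r i) t := by
  rw [map_sum, LinearMap.sum_apply]
  exact Finset.sum_congr rfl fun i _ => pip_C_mul_left _ _ _

/-- The partial sum of an expansion. -/
noncomputable def partialSum (R : ℕ → ℝ[X]) (c : ℕ → ℝ) (N : ℕ) : ℝ[X] :=
  ∑ n ∈ Finset.range N, C (c n) * R n

theorem fn_partialSum (R : ℕ → ℝ[X]) (c : ℕ → ℝ) (N : ℕ) (x : ℝ) :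
    fn (partialSum R c N) x = ∑ n ∈ Finset.range N, c n * fn (R n) x := by
  rw [partialSum, fn_finset_sum]
  exact Finset.sum_congr rfl fun i _ => by rw [fn_mul, fn_C]

theorem HasExpansion.tendsto_ip {R : ℕ → ℝ[X]} {y : ℝ → ℝ} {c : ℕ → ℝ} (hc : HasExpansion R y c)
    (hy : ContinuousOn y (Set.Icc (-1) 1)) {v : ℝ → ℝ} (hv : ContinuousOn v (Set.Icc (-1) 1)) :
    Tendsto (fun N => ip (fn (partialSum R c N)) v) atTop (𝓝 (ip y v)) := by
  have hd : ∀ N, ContinuousOn (fun x => y x - fn (partialSum R c N) x) (Set.Icc (-1) 1) :=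
    fun N => hy.sub (continuous_fn _).continuousOn
  have h1 : Tendsto (fun N => ip (fun x => y x - fn (partialSum R c N) x)
      (fun x => y x - fn (partialSum R c N) x) * ip v v) atTop (𝓝 0) := by
    have := Tendsto.mul_const (ip v v) hc
    rw [zero_mul] at this
    refine this.congr fun N => ?_
    simp only [ip, fn_partialSum, sq]
  have h2 : Tendsto (fun N => ip (fun x => y x - fn (partialSum R c N) x) v) atTop (𝓝 0) := by
    have h3 : Tendsto (fun N => ip (fun x => y x - fn (partialSum R c N) x) v ^ 2) atTop (𝓝 0) :=
      squeeze_zero (fun N => sq_nonneg _) (fun N => ip_sq_le (hd N) hv) h1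
    have := h3.sqrt
    simp only [Real.sqrt_sq_eq_abs, Real.sqrt_zero] at this
    exact (tendsto_zero_iff_abs_tendsto_zero _).2 this
  have h4 := (tendsto_const_nhds (x := ip y v)).sub h2
  rw [sub_zero] at h4
  refine h4.congr fun N => ?_
  have := ip_sub_right (intervalIntegrable_mul_of_continuousOn' hv hy)
    (intervalIntegrable_mul_of_continuousOn' hv (continuous_fn (partialSum R c N)).continuousOn)
  rw [ip_comm (fun x => y x - fn (partialSum R c N) x), this, ip_comm v, ip_comm v]
  ring

theorem HasExpansion.ip_eq_of_eventually {R : ℕ → ℝ[X]} {y : ℝ → ℝ} {c : ℕ → ℝ}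
    (hc : HasExpansion R y c) (hy : ContinuousOn y (Set.Icc (-1) 1)) {r : ℝ[X]} {L : ℝ}
    (h : ∀ᶠ N in atTop, ∑ n ∈ Finset.range N, c n * pip (R n) r = L) : ip y (fn r) = L := by
  refine tendsto_nhds_unique (hc.tendsto_ip hy (continuous_fn r).continuousOn) ?_
  refine tendsto_const_nhds.congr' ?_
  filter_upwards [h] with N hN
  rw [← hN, ← pip_apply, partialSum, pip_finset_sum_left]

/-- Powers of `n` and of `n + j` are of the same order. -/
theorem isTheta_rpow_shift (s : ℝ) (j : ℕ) :
    (fun n : ℕ => ((n + j : ℕ) : ℝ) ^ s) =Θ[atTop] fun n : ℕ => (n : ℝ) ^ s := by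
  have h1 : Tendsto (fun n : ℕ => (((n + j : ℕ) : ℝ) / n) ^ s) atTop (𝓝 1) := by
    have : Tendsto (fun n : ℕ => ((n + j : ℕ) : ℝ) / n) atTop (𝓝 1) := by
      have := (tendsto_const_div_atTop_nhds_zero_nat (j : ℝ)).const_add 1
      rw [add_zero] at this
      refine this.congr' ?_
      filter_upwards [eventually_gt_atTop 0] with n hn
      have : (n : ℝ) ≠ 0 := by positivity
      push_cast; field_simp
    have := this.rpow_const (p := s) (Or.inl one_ne_zero)
    rwa [Real.one_rpow] at this
  refine IsEquivalent.isTheta ?_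
  refine (isEquivalent_iff_exists_eq_mul).2 ⟨_, h1, ?_⟩
  filter_upwards [eventually_gt_atTop 0] with n hn
  have h0 : (0 : ℝ) < n := by positivity
  simp only [Pi.mul_apply]
  rw [Real.div_rpow (by positivity) h0.le]
  have := (Real.rpow_pos_of_pos h0 s).ne'
  field_simp

theorem isBigO_rpow_of_le {s t : ℝ} (h : s ≤ t) :
    (fun n : ℕ => (n : ℝ) ^ s) =O[atTop] fun n : ℕ => (n : ℝ) ^ t := by
  refine IsBigO.of_bound 1 ?_
  filter_upwards [eventually_ge_atTop 1] with n hn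
  have h1 : (1 : ℝ) ≤ n := by exact_mod_cast hn
  rw [one_mul, Real.norm_of_nonneg (by positivity), Real.norm_of_nonneg (by positivity)]
  exact Real.rpow_le_rpow_of_exponent_le h1 h

theorem isBigO_shift {u : ℕ → ℝ} {s : ℝ} (h : u =O[atTop] fun n : ℕ => (n : ℝ) ^ s) (j : ℕ) :
    (fun n => u (n + j)) =O[atTop] fun n : ℕ => (n : ℝ) ^ s :=
  (h.comp_tendsto (tendsto_add_atTop_nat j)).trans (isTheta_rpow_shift s j).1

theorem isBigO_of_shift {u : ℕ → ℝ} {s : ℝ} (j : ℕ)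
    (h : (fun n => u (n + j)) =O[atTop] fun n : ℕ => (n : ℝ) ^ s) :
    u =O[atTop] fun n : ℕ => (n : ℝ) ^ s := by
  have h1 : (u ∘ (· + j)) =O[atTop] ((fun n : ℕ => (n : ℝ) ^ s) ∘ (· + j)) :=
    h.trans (isTheta_rpow_shift s j).2
  rwa [← isBigO_map, map_add_atTop_eq_nat] at h1

theorem isBigO_rpow_mul {u v : ℕ → ℝ} {s t : ℝ} (hu : u =O[atTop] fun n : ℕ => (n : ℝ) ^ s)
    (hv : v =O[atTop] fun n : ℕ => (n : ℝ) ^ t) :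
    (fun n => u n * v n) =O[atTop] fun n : ℕ => (n : ℝ) ^ (s + t) := by
  refine (hu.mul hv).congr' EventuallyEq.rfl ?_
  filter_upwards [eventually_gt_atTop 0] with n hn
  rw [Real.rpow_add (by positivity)]

theorem isLittleO_rpow {s t : ℝ} (h : s < t) :
    (fun n : ℕ => (n : ℝ) ^ s) =o[atTop] fun n : ℕ => (n : ℝ) ^ t := by
  refine (isLittleO_iff_tendsto' ?_).2 ?_
  · filter_upwards [eventually_gt_atTop 0] with n hn h0
    exact absurd h0 (by positivity)
  · refine (tendsto_rpow_neg_nat (a := s - t) (by linarith)).congr' ?_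
    filter_upwards [eventually_gt_atTop 0] with n hn
    rw [Real.rpow_sub (by positivity)]

theorem Problem.ip_potential_mul {S : ℕ} (p : Problem S) {y : ℝ → ℝ}
    (hy : ContinuousOn y (Set.Icc (-1) 1)) (r : ℝ[X]) : ip (fn r) (fun x => p.q x * y x) =
      ∑ i, wip (p.β i) (p.γ i) (fn r) (fun x => p.g i x * y x) := by
  have hi : ∀ i ∈ Finset.univ, IntervalIntegrable (fun x => fn r x * (p.g i x * y x) /
      ((1 - x) ^ p.β i * (1 + x) ^ p.γ i)) volume (-1) 1 := by
    intro i _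
    have := intervalIntegrable_mul_of_continuousOn ((continuous_fn r).continuousOn.mul hy)
      (p.term_integrable i)
    refine this.congr fun x _ => ?_
    simp only [Pi.mul_apply]; ring
  simp only [wip]
  rw [← intervalIntegral.integral_finsetSum hi, ip]
  congr 1; ext x
  rw [Problem.q, Finset.sum_mul, Finset.mul_sum]
  exact Finset.sum_congr rfl fun i _ => by ring

section Rates

variable {S : ℕ} {p : Problem S} {R : ℕ → ℝ[X]} {ξ η θ : ℕ → ℝ} {lam : ℝ} {y dy : ℝ → ℝ}
  {c : ℕ → ℝ}

theorem BasisCoeff.isBigO_inv_aEntry (hR : BasisCoeff p R ξ η θ) :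
    (fun n => (aEntry R n n)⁻¹) =O[atTop] fun n : ℕ => (n : ℝ) ^ (-1 : ℝ) := by
  refine IsBigO.of_bound 1 ?_
  filter_upwards [hR.eventually_aEntry, eventually_gt_atTop 0] with n h hn
  have hn' : (0 : ℝ) < n := by positivity
  rw [one_mul, Real.norm_of_nonneg (inv_nonneg.2 h.2.2.le), Real.norm_of_nonneg (by positivity),
    Real.rpow_neg_one]
  exact inv_anti₀ hn' h.1

theorem BasisCoeff.isBigO_aEntry (hR : BasisCoeff p R ξ η θ) :
    (fun n => aEntry R n n) =O[atTop] fun n : ℕ => (n : ℝ) ^ (1 : ℝ) := by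
  refine IsBigO.of_bound 8 ?_
  filter_upwards [hR.eventually_aEntry] with n h
  rw [Real.norm_of_nonneg h.2.2.le, Real.rpow_one, Real.norm_of_nonneg (by positivity)]
  exact h.2.1

/-- As `-⟨R m, R n''⟩` vanishes for `m ≠ n`, pairing the expansion with `-R n''` singles out `c n`;
Green's formula and the equation turn that pairing into a moment of `(lam - q) y`. -/
theorem HasExpansion.mul_aEntry (hc : HasExpansion R y c) (hR : BasisCoeff p R ξ η θ)
    (hbc : ∀ n, p.PolyBC (R n)) (h : IsSol p.q lam y dy) (hb : p.BC y dy) (n : ℕ) :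
    c n * aEntry R n n = lam * ip (fn (R n)) y - ip (fn (R n)) (fun x => p.q x * y x) := by
  have h1 : ip y (fn (derivative (derivative (R n)))) = -(c n * aEntry R n n) := by
    refine hc.ip_eq_of_eventually h.cont ?_
    filter_upwards [eventually_gt_atTop n] with N hN
    rw [Finset.sum_eq_single_of_mem n (Finset.mem_range.2 hN)]
    · rw [aEntry, pip_apply]; ring
    · intro m _ hm
      have := aEntry_of_ne hR hbc hm
      rw [aEntry, neg_eq_zero] at this
      rw [pip_apply, this, mul_zero]
  have h2 := h.green_bc p.isPotential hb (hbc n)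
  have h3 : ip (fn (R n)) (fun x => (p.q x - lam) * y x) =
      ip (fn (R n)) (fun x => p.q x * y x) - lam * ip (fn (R n)) y := by
    have i1 : IntervalIntegrable (fun x => fn (R n) x * (p.q x * y x)) volume (-1) 1 := by
      have := intervalIntegrable_fn_mul (R n)
        (IsSol.intervalIntegrable_potential_mul p.isPotential h.cont 0)
      simpa using this
    have i2 : IntervalIntegrable (fun x => fn (R n) x * (lam * y x)) volume (-1) 1 :=
      intervalIntegrable_fn_mul (R n) ((intervalIntegrable_of_continuousOn h.cont).const_mul _)
    rw [← ip_const_mul_right, ← ip_sub_right i1 i2]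
    congr 1; ext x; ring
  linarith

theorem HasExpansion.ip_shift (hc : HasExpansion R y c) (hR : BasisCoeff p R ξ η θ)
    (hy : ContinuousOn y (Set.Icc (-1) 1)) (n : ℕ) :
    ip (fn (R (n + 2))) y =
      ∑ j ∈ Finset.range 5, c (n + j) * pip (R (n + 2)) (R (n + j)) := by
  rw [ip_comm]
  refine hc.ip_eq_of_eventually hy ?_
  filter_upwards [eventually_ge_atTop (n + 5)] with N hN
  obtain ⟨d, rfl⟩ := Nat.exists_eq_add_of_le hN
  rw [Finset.sum_range_add, Finset.sum_range_add]
  rw [Finset.sum_eq_zero, zero_add]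
  · rw [Finset.sum_eq_zero (s := Finset.range d), add_zero]
    · exact Finset.sum_congr rfl fun j _ => by rw [pip_comm]
    · intro j _
      rw [pip_comm, hR.pip_far (by omega), mul_zero]
  · intro j hj
    rw [hR.pip_far (by have := Finset.mem_range.1 hj; omega), mul_zero]

theorem HasExpansion.isBigO_coeff (hc : HasExpansion R y c) (hR : BasisCoeff p R ξ η θ)
    (hbc : ∀ n, p.PolyBC (R n)) (h : IsSol p.q lam y dy) (hb : p.BC y dy) {κ : ℝ}
    (hf : (fun n => ip (fn (R n)) fun x => p.q x * y x) =O[atTop] fun n : ℕ => (n : ℝ) ^ (-κ))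
    (he : (fun n => ip (fn (R n)) y) =O[atTop] fun n : ℕ => (n : ℝ) ^ (-κ)) :
    c =O[atTop] fun n : ℕ => (n : ℝ) ^ (-(κ + 1)) := by
  have h1 := isBigO_rpow_mul ((he.const_mul_left lam).sub hf) hR.isBigO_inv_aEntry
  refine (h1.congr' ?_ (Eventually.of_forall fun n => by ring_nf))
  filter_upwards [hR.eventually_aEntry] with n hn
  rw [← hc.mul_aEntry hR hbc h hb n]
  exact mul_inv_cancel_right₀ hn.2.2.ne' _

/-- The mass matrix is banded with entries of order `1 / n`: the moments of `y` decay faster than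
those of `q y` by the factor `n ^ (-2)`. -/
theorem HasExpansion.isBigO_ip_step (hc : HasExpansion R y c) (hR : BasisCoeff p R ξ η θ)
    (hbc : ∀ n, p.PolyBC (R n)) (h : IsSol p.q lam y dy) (hb : p.BC y dy) {κ : ℝ}
    (hf : (fun n => ip (fn (R n)) fun x => p.q x * y x) =O[atTop] fun n : ℕ => (n : ℝ) ^ (-κ))
    (he : (fun n => ip (fn (R n)) y) =O[atTop] fun n : ℕ => (n : ℝ) ^ (-κ)) :
    (fun n => ip (fn (R n)) y) =O[atTop] fun n : ℕ => (n : ℝ) ^ (-(κ + 2)) := by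
  have h1 := hc.isBigO_coeff hR hbc h hb hf he
  refine isBigO_of_shift 2 ?_
  simp only [hc.ip_shift hR h.cont]
  have key : ∀ j ∈ Finset.range 5, (fun n => c (n + j) * pip (R (n + 2)) (R (n + j))) =O[atTop]
      fun n : ℕ => (n : ℝ) ^ (-(κ + 2)) := fun j _ => ?_
  · exact IsBigO.fun_sum key
  have h2 : (fun n => pip (R (n + 2)) (R (n + j))) =O[atTop] fun n : ℕ => (n : ℝ) ^ (-1 : ℝ) := by
    refine IsBigO.of_bound 15 ?_
    filter_upwards [eventually_gt_atTop 0] with n hn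
    have hn' : (0 : ℝ) < n := by positivity
    rw [Real.norm_eq_abs, Real.norm_of_nonneg (by positivity), Real.rpow_neg_one,
      ← div_eq_mul_inv]
    by_cases h3 : n + 2 ≤ n + j + 2
    · refine (hR.abs_pip_le h3).trans ?_
      gcongr
      push_cast; linarith
    · omega
  have := isBigO_rpow_mul (isBigO_shift h1 j) h2
  refine this.congr_right fun n => ?_
  ring_nf

/-- The moments of an integrable function; the exponent is that of the sup norm of `R n`. -/
theorem BasisCoeff.isBigO_ip (hR : BasisCoeff p R ξ η θ) {v : ℝ → ℝ}
    (hv : IntervalIntegrable v volume (-1) 1) :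
    ∃ K, ∀ n, |ip (fn (R n)) v| ≤ K * ((n : ℝ) + 1) ^ (-(1 / 2) : ℝ) := by
  obtain ⟨K, hK, h⟩ := hR.exists_sup_bound
  refine ⟨K * ∫ x in (-1 : ℝ)..1, |v x|, fun n => ?_⟩
  refine (abs_ip_le (h n) hv).trans (le_of_eq ?_)
  rw [Real.rpow_neg (by positivity), ← Real.sqrt_eq_rpow]
  ring

/-- The rates of the moments `⟨R n, q y⟩`, `⟨R n, y⟩` and of the coefficients, all in terms of one
exponent `τ`. A single moment `⟨R n, q y⟩` may be small, or vanish by symmetry; the lower bound is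
therefore for two consecutive ones. -/
structure CoeffRate (p : Problem S) (R : ℕ → ℝ[X]) (lam : ℝ) (y : ℝ → ℝ) (c : ℕ → ℝ) (τ : ℝ) :
    Prop where
  two_lt : 2 < τ
  eq : ∀ n, c n * aEntry R n n = lam * ip (fn (R n)) y - ip (fn (R n)) (fun x => p.q x * y x)
  upper : (fun n => ip (fn (R n)) fun x => p.q x * y x) =O[atTop] fun n : ℕ => (n : ℝ) ^ (1 - τ)
  moment : (fun n => ip (fn (R n)) y) =O[atTop] fun n : ℕ => (n : ℝ) ^ (-1 - τ)
  coeff : c =O[atTop] fun n : ℕ => (n : ℝ) ^ (-τ)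
  lower : (fun n : ℕ => (n : ℝ) ^ (1 - τ)) =O[atTop] fun n =>
    |ip (fn (R n)) (fun x => p.q x * y x)| + |ip (fn (R (n + 1))) (fun x => p.q x * y x)|

/-- The moments of `q y` have the rate of the preceding section, and a bootstrap shows that those of
`y` are smaller by the factor `n ^ (-2)`. -/
theorem HasExpansion.exists_coeffRate (hc : HasExpansion R y c) (hR : BasisCoeff p R ξ η θ)
    (hbc : ∀ n, p.PolyBC (R n)) (hq : p.UnboundedPotential) (h : IsSol p.q lam y dy)
    (hb : p.BC y dy) (hne : ∃ x ∈ Set.Icc (-1 : ℝ) 1, y x ≠ 0) :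
    ∃ τ, CoeffRate p R lam y c τ := by
  obtain ⟨ρ, hρ1, hρ5, d, hd, K, hρ⟩ := hR.exists_rate_product hq h hne
  have hf : (fun n => ip (fn (R n)) fun x => p.q x * y x) =O[atTop]
      fun n : ℕ => (n : ℝ) ^ (-ρ) := by
    refine IsBigO.of_bound K ?_
    filter_upwards [hρ] with n hn
    rw [Real.norm_eq_abs, Real.norm_of_nonneg (by positivity)]
    exact hn.1
  have hlow : (fun n : ℕ => (n : ℝ) ^ (-ρ)) =O[atTop] fun n =>
      |ip (fn (R n)) (fun x => p.q x * y x)| + |ip (fn (R (n + 1))) (fun x => p.q x * y x)| := by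
    refine IsBigO.of_bound d⁻¹ ?_
    filter_upwards [hρ] with n hn
    rw [Real.norm_of_nonneg (by positivity), Real.norm_of_nonneg (by positivity), ← div_eq_inv_mul,
      le_div_iff₀ hd]
    linarith [hn.2]
  have h0 : (fun n => ip (fn (R n)) y) =O[atTop] fun n : ℕ => (n : ℝ) ^ (-0 : ℝ) := by
    obtain ⟨K, hK⟩ := hR.isBigO_ip (intervalIntegrable_of_continuousOn h.cont)
    refine IsBigO.of_bound |K| (Eventually.of_forall fun n => ?_)
    simp only [neg_zero, Real.rpow_zero, norm_one, mul_one, Real.norm_eq_abs]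
    refine (hK n).trans ?_
    have h1 : ((n : ℝ) + 1) ^ (-(1 / 2) : ℝ) ≤ 1 :=
      Real.rpow_le_one_of_one_le_of_nonpos (by linarith [n.cast_nonneg (α := ℝ)]) (by norm_num)
    exact (mul_le_mul_of_nonneg_right (le_abs_self K) (by positivity)).trans
      (mul_le_of_le_one_right (abs_nonneg _) h1)
  have step : ∀ {κ : ℝ}, κ ≤ ρ →
      (fun n => ip (fn (R n)) y) =O[atTop] (fun n : ℕ => (n : ℝ) ^ (-κ)) →
      (fun n => ip (fn (R n)) y) =O[atTop] fun n : ℕ => (n : ℝ) ^ (-(κ + 2)) := fun hκ he =>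
    hc.isBigO_ip_step hR hbc h hb (hf.trans (isBigO_rpow_of_le (by linarith))) he
  -- each step improves the exponent by two as long as it is below `ρ`; three steps
  -- suffice as `ρ < 5`
  have he : (fun n => ip (fn (R n)) y) =O[atTop] fun n : ℕ => (n : ℝ) ^ (-ρ) := by
    have h2 := step (by linarith) h0
    rcases le_total ρ 2 with h' | h'
    · exact h2.trans (isBigO_rpow_of_le (by linarith))
    have h4 := step (by linarith) h2
    rcases le_total ρ 4 with h'' | h''
    · exact h4.trans (isBigO_rpow_of_le (by linarith))
    exact (step (by linarith) h4).trans (isBigO_rpow_of_le (by linarith))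
  have e1 : (1 : ℝ) - (ρ + 1) = -ρ := by ring
  have e2 : (-1 : ℝ) - (ρ + 1) = -(ρ + 2) := by ring
  exact ⟨ρ + 1, by linarith, hc.mul_aEntry hR hbc h hb, by rwa [e1], by
    rw [e2]; exact step le_rfl he, hc.isBigO_coeff hR hbc h hb hf he, by rwa [e1]⟩

namespace CoeffRate

variable {τ : ℝ}

theorem eventually_sub_eq (h : CoeffRate p R lam y c τ) (hR : BasisCoeff p R ξ η θ) :
    ∀ᶠ n in atTop, c n - p.cApprox R y n = lam * ip (fn (R n)) y * (aEntry R n n)⁻¹ := by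
  filter_upwards [hR.eventually_aEntry] with n hn
  have h0 := hn.2.2.ne'
  have := h.eq n
  rw [Problem.cApprox]
  field_simp
  linarith

theorem isBigO_sub (h : CoeffRate p R lam y c τ) (hR : BasisCoeff p R ξ η θ) :
    (fun n => c n - p.cApprox R y n) =O[atTop] fun n : ℕ => (n : ℝ) ^ (-τ - 2) := by
  have := isBigO_rpow_mul (h.moment.const_mul_left lam) hR.isBigO_inv_aEntry
  refine (this.congr' ?_ (Eventually.of_forall fun n => by ring_nf))
  filter_upwards [h.eventually_sub_eq hR] with n hn using hn.symm

theorem cApprox_lower (h : CoeffRate p R lam y c τ) (hR : BasisCoeff p R ξ η θ) :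
    (fun n : ℕ => (n : ℝ) ^ (-τ)) =O[atTop]
      fun n => |p.cApprox R y n| + |p.cApprox R y (n + 1)| := by
  have h1 := h.lower.mul (isBigO_refl (fun n : ℕ => (n : ℝ) ^ (-1 : ℝ)) atTop)
  have h2 : (fun n : ℕ => (n : ℝ) ^ (-τ)) =O[atTop] fun n : ℕ =>
      (n : ℝ) ^ (1 - τ) * (n : ℝ) ^ (-1 : ℝ) := by
    refine EventuallyEq.isBigO ?_
    filter_upwards [eventually_gt_atTop 0] with n hn
    rw [← Real.rpow_add (by positivity)]; ring_nf
  refine h2.trans (h1.trans (IsBigO.of_bound 16 ?_))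
  filter_upwards [hR.eventually_aEntry, (tendsto_add_atTop_nat 1).eventually hR.eventually_aEntry,
    eventually_ge_atTop 1] with n ha hb hn
  have hn1 : (1 : ℝ) ≤ n := by exact_mod_cast hn
  have hn' : (0 : ℝ) < n := by positivity
  rw [Real.norm_of_nonneg (by positivity), Real.norm_of_nonneg (by positivity), Real.rpow_neg_one]
  simp only [Problem.cApprox, abs_neg, abs_div, abs_of_pos ha.2.2, abs_of_pos hb.2.2]
  set u := |ip (fn (R n)) fun x => p.q x * y x|
  set v := |ip (fn (R (n + 1))) fun x => p.q x * y x|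
  have hu : 0 ≤ u := abs_nonneg _
  have hv : 0 ≤ v := abs_nonneg _
  have h3 : ∀ {w a : ℝ}, 0 ≤ w → 0 < a → a ≤ 16 * n → w * (n : ℝ)⁻¹ ≤ 16 * (w / a) := by
    intro w a hw ha h
    rw [← div_eq_mul_inv, mul_div_assoc', div_le_div_iff₀ hn' ha]
    nlinarith
  rw [add_mul, mul_add]
  have hb2 := hb.2.1
  push_cast at hb2
  exact add_le_add (h3 hu ha.2.2 (by linarith [ha.2.1])) (h3 hv hb.2.2 (by linarith))

theorem isLittleO_sub (h : CoeffRate p R lam y c τ) (hR : BasisCoeff p R ξ η θ) :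
    (fun n => c n - p.cApprox R y n) =o[atTop]
      fun n => |p.cApprox R y n| + |p.cApprox R y (n + 1)| :=
  ((h.isBigO_sub hR).trans_isLittleO (isLittleO_rpow (by linarith))).trans_isBigO
    (h.cApprox_lower hR)

theorem isEquivalent_of_isBigO (h : CoeffRate p R lam y c τ) (hR : BasisCoeff p R ξ η θ)
    (hO : (fun n => p.cApprox R y (n + 1)) =O[atTop] p.cApprox R y) :
    c ~[atTop] p.cApprox R y :=
  (h.isLittleO_sub hR).trans_isBigO ((isBigO_refl _ _).norm_left.add hO.norm_left)

theorem coeff_lower (h : CoeffRate p R lam y c τ) (hR : BasisCoeff p R ξ η θ) :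
    (fun n : ℕ => (n : ℝ) ^ (-τ)) =O[atTop] fun n => |c n| + |c (n + 1)| := by
  obtain ⟨K, hK0, hK⟩ := (h.cApprox_lower hR).exists_pos
  have h1 := ((h.isBigO_sub hR).norm_left.add (isBigO_shift (h.isBigO_sub hR) 1).norm_left
    ).trans_isLittleO (isLittleO_rpow (show -τ - 2 < -τ by linarith))
  have h2 := h1.bound (show 0 < (2 * K)⁻¹ by positivity)
  refine IsBigO.of_bound (2 * K) ?_
  filter_upwards [hK.bound, h2] with n h3 h4
  have hab : ∀ a b : ℝ, ‖(|a| + |b|)‖ = |a| + |b| := fun a b =>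
    Real.norm_of_nonneg (add_nonneg (abs_nonneg _) (abs_nonneg _))
  simp only [Real.norm_eq_abs] at hab h4
  simp only [Real.norm_eq_abs, abs_of_nonneg (Real.rpow_nonneg n.cast_nonneg (-τ)), hab] at h3 h4 ⊢
  have h5 := abs_sub_abs_le_abs_sub (p.cApprox R y n) (c n)
  have h6 := abs_sub_abs_le_abs_sub (p.cApprox R y (n + 1)) (c (n + 1))
  rw [abs_sub_comm] at h5 h6
  have h7 : (2 * K) * ((2 * K)⁻¹ * (n : ℝ) ^ (-τ)) = (n : ℝ) ^ (-τ) := by field_simp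
  nlinarith

end CoeffRate

/-- In the symmetric case every second coefficient vanishes along with its estimate, and the
little-o bound refers to the others only. -/
theorem CoeffRate.isEquivalent_of_symmetric {τ : ℝ} (h : CoeffRate p R lam y c τ)
    (hR : BasisCoeff p R ξ η θ) (hy : IsSol p.q lam y dy) (hb : p.BC y dy)
    (hne : ∃ x ∈ Set.Icc (-1 : ℝ) 1, y x ≠ 0) (hs : p.SymmetricBC)
    (hqs : ∀ x ∈ Set.Ioo (-1 : ℝ) 1, p.q (-x) = p.q x) : c ~[atTop] p.cApprox R y := by
  obtain ⟨κ, hκ, hpar⟩ := hy.even_or_odd p.isPotential hb hs hqs hne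
  have hneg : ∀ n x, fn (R n) (-x) = (-1) ^ n * fn (R n) x := by
    intro n x
    simp only [fn, hR.form n, hR.symm hs n, eval_add, eval_mul, eval_C, legendre_comp_neg, pow_add]
    ring
  have hrefl : ∀ n (u : ℝ → ℝ), (∀ x ∈ Set.Ioo (-1 : ℝ) 1, u (-x) = κ * u x) →
      ip (fn (R n)) u = (-1) ^ n * κ * ip (fn (R n)) u := by
    intro n u hu
    have h1 : ip (fn (R n)) u = ip (fun x => fn (R n) (-x)) (fun x => u (-x)) := by
      simp only [ip]
      rw [intervalIntegral.integral_comp_neg (fun x => fn (R n) x * u x), neg_neg]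
    conv_lhs => rw [h1]
    rw [← ip_const_mul_right]
    refine ip_congr fun x hx => ?_
    rw [hneg, hu x hx]; ring
  have hf := fun n => hrefl n (fun x => p.q x * y x) fun x hx => by
    rw [hqs x hx, hpar x ⟨hx.1.le, hx.2.le⟩]; ring
  have he := fun n => hrefl n y fun x hx => hpar x ⟨hx.1.le, hx.2.le⟩
  have key : ∀ n, (-1 : ℝ) ^ n * κ = 1 ∨ (-1 : ℝ) ^ n * κ = -1 := fun n => by
    have : ((-1 : ℝ) ^ n * κ) ^ 2 = 1 := by
      rw [mul_pow, hκ, ← pow_mul, mul_comm n, pow_mul]; norm_num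
    exact sq_eq_one_iff.1 this
  refine IsLittleO.of_bound fun ε hε => ?_
  filter_upwards [(h.isLittleO_sub hR).bound hε, h.eventually_sub_eq hR] with n h1 h2
  rcases key n with h3 | h3
  · have h4 : ip (fn (R (n + 1))) (fun x => p.q x * y x) = 0 := by
      have := hf (n + 1)
      rw [show (-1 : ℝ) ^ (n + 1) * κ = -((-1) ^ n * κ) by rw [pow_succ]; ring, h3] at this
      linarith
    have h5 : p.cApprox R y (n + 1) = 0 := by rw [Problem.cApprox, h4, zero_div, neg_zero]
    rw [h5, abs_zero, add_zero, norm_abs_eq_norm] at h1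
    exact h1
  · have h4 : ip (fn (R n)) y = 0 := by
      have := he n
      rw [h3] at this
      linarith
    simp only [Pi.sub_apply]
    rw [h2, h4, mul_zero, zero_mul, norm_zero]
    positivity

/-- The estimate of a coefficient, written with the weighted inner products. -/
theorem Problem.cApprox_eq (p : Problem S) (R : ℕ → ℝ[X]) (hy : ContinuousOn y (Set.Icc (-1) 1))
    (n : ℕ) : p.cApprox R y n =
      -∑ i, wip (p.β i) (p.γ i) (fn (R n)) (fun x => p.g i x * y x) / aEntry R n n := by
  rw [Problem.cApprox, p.ip_potential_mul hy, Finset.sum_div]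

end Rates

/-! ### Very weak solutions -/

/-- By the Weierstrass approximation theorem, polynomials suffice as test functions. -/
theorem eq_zero_of_ip_fn_eq_zero {h : ℝ → ℝ} (hh : ContinuousOn h (Set.Icc (-1) 1))
    (h0 : ∀ r : ℝ[X], ip h (fn r) = 0) : ∀ x ∈ Set.Icc (-1 : ℝ) 1, h x = 0 := by
  have hint := intervalIntegrable_of_continuousOn hh
  have hle : ip h h ≤ 0 := by
    refine le_of_forall_pos_le_add fun ε hε => ?_
    set M := ∫ x in (-1 : ℝ)..1, |h x| with hM
    have hM0 : 0 ≤ M := intervalIntegral.integral_nonneg (by norm_num) fun _ _ => abs_nonneg _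
    obtain ⟨r, hr⟩ := exists_polynomial_near_of_continuousOn (-1) 1 h hh (ε / (M + 1))
      (by positivity)
    have h1 : ip h h = ip (fun x => h x - fn r x) h := by
      have h2 := ip_sub_right (intervalIntegrable_mul_of_continuousOn' hh hh)
        (intervalIntegrable_mul_of_continuousOn' hh (continuous_fn r).continuousOn)
      rw [ip_comm (fun x => h x - fn r x), h2, h0, sub_zero]
    have h2 := abs_ip_le (u := fun x => h x - fn r x) (M := ε / (M + 1)) (fun x hx => by
      rw [abs_sub_comm]; exact (hr x hx).le) hint
    rw [h1, zero_add]
    refine (le_abs_self _).trans (h2.trans ?_)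
    rw [div_mul_eq_mul_div, div_le_iff₀ (by positivity)]
    nlinarith
  by_contra! hcon
  obtain ⟨x, hx, hx0⟩ := hcon
  have : 0 < ip h h := intervalIntegral.integral_pos (by norm_num) (hh.mul hh)
    (fun x _ => mul_self_nonneg _) ⟨x, hx, mul_self_pos.2 hx0⟩
  linarith

theorem ip_fn_eq_zero_of_legendre {h : ℝ → ℝ} (hh : ContinuousOn h (Set.Icc (-1) 1))
    (h0 : ∀ n, ip h (fn (legendre n)) = 0) (r : ℝ[X]) : ip h (fn r) = 0 := by
  have h1 : r ∈ Submodule.span ℝ (legendre '' Set.Iio (r.natDegree + 1)) :=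
    mem_span_legendre _ r (degree_le_natDegree.trans_lt (by exact_mod_cast Nat.lt_succ_self _))
  have h2 : Submodule.span ℝ (legendre '' Set.Iio (r.natDegree + 1)) ≤
      LinearMap.ker (ipForm h (intervalIntegrable_of_continuousOn hh)) := by
    rw [Submodule.span_le]
    rintro _ ⟨n, _, rfl⟩
    change ip (fn (legendre n)) h = 0
    rw [ip_comm, h0]
  have h3 : ip (fn r) h = 0 := h2 h1
  rw [ip_comm, h3]

/-- The second antiderivative of `P_{n+2}` with double zeros at `1` and `-1`. -/
noncomputable def legendreBubble (n : ℕ) : ℝ[X] :=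
  C (1 / (2 * (n : ℝ) + 5)) * (C (1 / (2 * (n : ℝ) + 7)) * (legendre (n + 4) - legendre (n + 2)) -
    C (1 / (2 * (n : ℝ) + 3)) * (legendre (n + 2) - legendre n))

theorem derivative_legendreBubble (n : ℕ) : derivative (legendreBubble n) =
    C (1 / (2 * (n : ℝ) + 5)) * (legendre (n + 3) - legendre (n + 1)) := by
  have h1 := derivative_legendre_add_two_sub n
  have h2 := derivative_legendre_add_two_sub (n + 2)
  have c1 : C (1 / (2 * (n : ℝ) + 3)) * C (2 * (n : ℝ) + 3) = 1 := by
    rw [← C_mul, ← C_1]; congr 1; field_simp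
  have c2 : C (1 / (2 * (n : ℝ) + 7)) * C (2 * ((n + 2 : ℕ) : ℝ) + 3) = 1 := by
    rw [← C_mul, ← C_1]; congr 1; push_cast; field_simp; ring
  rw [legendreBubble, derivative_C_mul, derivative_sub, derivative_C_mul, derivative_C_mul,
    derivative_sub, derivative_sub, h1, h2, ← mul_assoc, ← mul_assoc, c1, c2, one_mul, one_mul]

theorem derivative_derivative_legendreBubble (n : ℕ) :
    derivative (derivative (legendreBubble n)) = legendre (n + 2) := by
  have h1 := derivative_legendre_add_two_sub (n + 1)
  have c1 : C (1 / (2 * (n : ℝ) + 5)) * C (2 * ((n + 1 : ℕ) : ℝ) + 3) = 1 := by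
    rw [← C_mul, ← C_1]; congr 1; push_cast; field_simp; ring
  rw [derivative_legendreBubble, derivative_C_mul, derivative_sub, h1, ← mul_assoc, c1, one_mul]

theorem legendreBubble_eval (n : ℕ) : (legendreBubble n).eval 1 = 0 ∧
    (legendreBubble n).eval (-1) = 0 ∧ (derivative (legendreBubble n)).eval 1 = 0 ∧
    (derivative (legendreBubble n)).eval (-1) = 0 := by
  rw [derivative_legendreBubble, legendreBubble]
  simp [legendre_eval_one, legendre_eval_neg_one, pow_add]
  norm_num

/-- The cubic with a double zero at `-1`, the value `a` and the derivative `b` at `1`. -/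
noncomputable def rightCubic (a b : ℝ) : ℝ[X] :=
  (X + 1) ^ 2 * (C (a / 4) + C ((b - a) / 4) * (X - 1))

theorem rightCubic_eval (a b : ℝ) : (rightCubic a b).eval 1 = a ∧
    (derivative (rightCubic a b)).eval 1 = b ∧ (rightCubic a b).eval (-1) = 0 ∧
    (derivative (rightCubic a b)).eval (-1) = 0 := by
  refine ⟨?_, ?_, ?_, ?_⟩ <;> simp [rightCubic, derivative_pow] <;> ring

/-- The cubic with a double zero at `1`, the value `a` and the derivative `b` at `-1`. -/
noncomputable def leftCubic (a b : ℝ) : ℝ[X] :=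
  (X - 1) ^ 2 * (C (a / 4) + C ((b + a) / 4) * (X + 1))

theorem leftCubic_eval (a b : ℝ) : (leftCubic a b).eval 1 = 0 ∧
    (derivative (leftCubic a b)).eval 1 = 0 ∧ (leftCubic a b).eval (-1) = a ∧
    (derivative (leftCubic a b)).eval (-1) = b := by
  refine ⟨?_, ?_, ?_, ?_⟩ <;> simp [leftCubic, derivative_pow] <;> ring

/-- A continuous function that satisfies the equation and the boundary conditions in the very weak
sense, tested with polynomials only, is a solution. -/
theorem exists_isSol_of_very_weak {S : ℕ} {p : Problem S} {Q : ℝ → ℝ} (hQ : IsPotential Q) {lam : ℝ}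
    {u : ℝ → ℝ} (hu : ContinuousOn u (Set.Icc (-1) 1))
    (h : ∀ r : ℝ[X], p.PolyBC r →
      ip u (fn (derivative (derivative r))) = ip (fn r) (fun x => (Q x - lam) * u x)) :
    ∃ du, IsSol Q lam u du ∧ p.BC u du := by
  set w : ℝ → ℝ := fun x => (Q x - lam) * u x with hw
  have hwi : IntervalIntegrable w volume (-1) 1 :=
    IsSol.intervalIntegrable_potential_mul hQ hu lam
  have hwc : ContinuousOn w (Set.Ioo (-1) 1) :=
    (hQ.cont.sub continuousOn_const).mul (hu.mono Set.Ioo_subset_Icc_self)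
  set W : ℝ → ℝ := fun x => ∫ t in (-1 : ℝ)..x, w t with hW
  have hWc : ContinuousOn W (Set.Icc (-1) 1) := continuousOn_primitive hwi
  have hWd : ∀ x ∈ Set.Ioo (-1 : ℝ) 1, HasDerivAt W (w x) x := fun x hx =>
    hasDerivAt_primitive hwc hwi hx
  set Y : ℝ → ℝ := fun x => ∫ t in (-1 : ℝ)..x, W t with hY
  have hWi := intervalIntegrable_of_continuousOn hWc
  have hYc : ContinuousOn Y (Set.Icc (-1) 1) := continuousOn_primitive hWi
  have hYd : ∀ x ∈ Set.Ioo (-1 : ℝ) 1, HasDerivAt Y (W x) x := fun x hx =>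
    hasDerivAt_primitive (hWc.mono Set.Ioo_subset_Icc_self) hWi hx
  -- `Y'' = w`, and `u - Y` is orthogonal to the second derivatives of the bubbles
  have hYsol : ∀ r : ℝ[X], r.eval 1 = 0 → r.eval (-1) = 0 → (derivative r).eval 1 = 0 →
      (derivative r).eval (-1) = 0 → ip Y (fn (derivative (derivative r))) = ip (fn r) w := by
    intro r h1 h2 h3 h4
    have i1 : IntervalIntegrable (fun x => Y x * fn (derivative (derivative r)) x) volume (-1) 1 :=
      intervalIntegrable_mul_of_continuousOn' hYc (continuous_fn _).continuousOn
    have i2 := intervalIntegrable_fn_mul r hwi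
    have key := intervalIntegral.integral_eq_sub_of_hasDerivAt_of_le (a := -1) (b := 1)
      (by norm_num) (f := fun x => Y x * fn (derivative r) x - W x * fn r x)
      (f' := fun x => Y x * fn (derivative (derivative r)) x - fn r x * w x)
      ((hYc.mul (continuous_fn _).continuousOn).sub (hWc.mul (continuous_fn _).continuousOn))
      (fun x hx => by
        convert! ((hYd x hx).mul (hasDerivAt_fn (derivative r) x)).sub
          ((hWd x hx).mul (hasDerivAt_fn r x)) using 1
        ring) (i1.sub i2)
    rw [intervalIntegral.integral_sub i1 i2] at key
    simp only [fn, h1, h2, h3, h4, mul_zero, sub_zero] at key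
    exact sub_eq_zero.1 key
  -- The bubbles have the second derivatives `P_n`, `n ≥ 2`, so `u - Y` is a combination `L`
  -- of `P_0` and `P_1`.
  set α : ℝ := (ip u (fn (legendre 0)) - ip Y (fn (legendre 0))) / 2 with hα
  set β : ℝ := (ip u (fn (legendre 1)) - ip Y (fn (legendre 1))) * 3 / 2 with hβ
  set L : ℝ[X] := C α * legendre 0 + C β * legendre 1 with hL
  have hL2 : derivative (derivative L) = 0 := by
    have : L.natDegree < 2 := by
      refine (natDegree_add_le_of_degree_le (n := 1) ?_ ?_).trans_lt one_lt_two
      · exact (natDegree_C_mul_le _ _).trans ((natDegree_legendre_le 0).trans zero_le_one)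
      · exact (natDegree_C_mul_le _ _).trans (natDegree_legendre_le 1)
    exact iterate_derivative_eq_zero this
  have hLi : ∀ n, ip (fn L) (fn (legendre n)) =
      α * pip (legendre 0) (legendre n) + β * pip (legendre 1) (legendre n) := by
    intro n
    rw [← pip_apply, hL, map_add, LinearMap.add_apply, pip_C_mul_left, pip_C_mul_left]
  have hzero : ∀ x ∈ Set.Icc (-1 : ℝ) 1, u x - Y x - fn L x = 0 := by
    have hc : ContinuousOn (fun x => u x - Y x - fn L x) (Set.Icc (-1) 1) :=
      (hu.sub hYc).sub (continuous_fn L).continuousOn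
    refine eq_zero_of_ip_fn_eq_zero hc (ip_fn_eq_zero_of_legendre hc fun n => ?_)
    have e : ip (fun x => u x - Y x - fn L x) (fn (legendre n)) =
        ip u (fn (legendre n)) - ip Y (fn (legendre n)) - ip (fn L) (fn (legendre n)) := by
      have c0 := (continuous_fn (legendre n)).continuousOn (s := Set.Icc (-1) 1)
      have j1 := intervalIntegrable_mul_of_continuousOn' c0 hu
      have j2 := intervalIntegrable_mul_of_continuousOn' c0 hYc
      have j3 := intervalIntegrable_mul_of_continuousOn' c0
        ((continuous_fn L).continuousOn (s := Set.Icc (-1) 1))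
      have j12 : IntervalIntegrable (fun x => fn (legendre n) x * (u x - Y x)) volume (-1) 1 :=
        intervalIntegrable_mul_of_continuousOn' c0 (hu.sub hYc)
      rw [ip_comm, ip_sub_right j12 j3, ip_sub_right j1 j2, ip_comm u, ip_comm Y, ip_comm (fn L)]
    rw [e, hLi]
    rcases n with _ | _ | n
    · rw [pip_legendre_self, pip_legendre_of_ne (by norm_num : (1 : ℕ) ≠ 0), hα]
      push_cast; ring
    · rw [zero_add, pip_legendre_self, pip_legendre_of_ne (by norm_num : (0 : ℕ) ≠ 1), hβ]
      push_cast; ring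
    · rw [pip_legendre_of_ne (by omega), pip_legendre_of_ne (by omega)]
      obtain ⟨b1, b2, b3, b4⟩ := legendreBubble_eval n
      have h1 := h (legendreBubble n) ⟨by rw [b2, b4]; ring, by rw [b1, b3]; ring⟩
      have h2 := hYsol (legendreBubble n) b1 b2 b3 b4
      rw [derivative_derivative_legendreBubble] at h1 h2
      change ip u (fn (legendre (n + 2))) - ip Y (fn (legendre (n + 2))) - _ = 0
      rw [h1, h2]; ring
  have huY : ∀ x ∈ Set.Icc (-1 : ℝ) 1, u x = Y x + fn L x := fun x hx => by
    linarith [hzero x hx]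
  have hsol : IsSol Q lam u (fun x => W x + fn (derivative L) x) := by
    refine ⟨hu, hWc.add (continuous_fn _).continuousOn, fun x hx => ?_, fun x hx => ?_⟩
    · refine ((hYd x hx).add (hasDerivAt_fn L x)).congr_of_eventuallyEq ?_
      filter_upwards [Icc_mem_nhds hx.1 hx.2] with z hz using huY z hz
    · have := (hWd x hx).add (hasDerivAt_fn (derivative L) x)
      rw [hL2] at this
      convert! this using 1
      simp [fn, hw]
  refine ⟨_, hsol, ?_⟩
  set du := fun x => W x + fn (derivative L) x with hdu
  -- Green's identity for `u` and the weak equation leave only the boundary terms; cubics with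
  -- prescribed boundary values separate the two ends.
  have hbd : ∀ r : ℝ[X], p.PolyBC r → (u 1 * (derivative r).eval 1 - du 1 * r.eval 1) -
      (u (-1) * (derivative r).eval (-1) - du (-1) * r.eval (-1)) = 0 := fun r hr => by
    rw [← hsol.green_poly hQ, h r hr, sub_self]
  constructor
  · obtain ⟨e1, e2, e3, e4⟩ := leftCubic_eval p.bL (-p.aL)
    have := hbd (leftCubic p.bL (-p.aL)) ⟨by rw [e3, e4]; ring, by rw [e1, e2]; ring⟩
    rw [e1, e2, e3, e4] at this
    linarith
  · obtain ⟨e1, e2, e3, e4⟩ := rightCubic_eval p.bR (-p.aR)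
    have := hbd (rightCubic p.bR (-p.aR)) ⟨by rw [e3, e4]; ring, by rw [e1, e2]; ring⟩
    rw [e1, e2, e3, e4] at this
    linarith

/-! ### The energy form and compactness -/

section Sobolev

theorem abs_integral_le_of_abs_le {v w : ℝ → ℝ} (hv : Continuous v) (hw : Continuous w)
    (h : ∀ x, |v x| ≤ w x) {x z : ℝ} (hx : x ∈ Set.Icc (-1 : ℝ) 1) (hz : z ∈ Set.Icc (-1 : ℝ) 1) :
    |∫ t in z..x, v t| ≤ ∫ t in (-1 : ℝ)..1, w t := by
  have key : ∀ {x z : ℝ}, x ∈ Set.Icc (-1 : ℝ) 1 → z ∈ Set.Icc (-1 : ℝ) 1 → z ≤ x →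
      |∫ t in z..x, v t| ≤ ∫ t in (-1 : ℝ)..1, w t := by
    intro x z hx hz hzx
    refine (intervalIntegral.abs_integral_le_integral_abs hzx).trans ?_
    refine (intervalIntegral.integral_mono_on hzx (hv.abs.intervalIntegrable _ _)
      (hw.intervalIntegrable _ _) fun t _ => h t).trans ?_
    exact intervalIntegral.integral_mono_interval hz.1 hzx hx.2
      (Eventually.of_forall fun t => (abs_nonneg _).trans (h t)) (hw.intervalIntegrable _ _)
  rcases le_total z x with hzx | hzx
  · exact key hx hz hzx
  · rw [intervalIntegral.integral_symm, abs_neg]; exact key hz hx hzx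

theorem integral_fn_derivative (r : ℝ[X]) (x z : ℝ) :
    ∫ t in z..x, fn (derivative r) t = fn r x - fn r z :=
  intervalIntegral.integral_eq_sub_of_hasDerivAt (fun t _ => hasDerivAt_fn r t)
    ((continuous_fn _).intervalIntegrable _ _)

/-- The modulus of continuity of a polynomial in terms of the `L²` norm of its derivative. -/
theorem abs_fn_sub_le (r : ℝ[X]) {δ : ℝ} (hδ : 0 < δ) {x z : ℝ} (hx : x ∈ Set.Icc (-1 : ℝ) 1)
    (hz : z ∈ Set.Icc (-1 : ℝ) 1) :
    |fn r x - fn r z| ≤ δ * pip (derivative r) (derivative r) + |x - z| / δ := by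
  have key : ∀ {x z : ℝ}, x ∈ Set.Icc (-1 : ℝ) 1 → z ∈ Set.Icc (-1 : ℝ) 1 → z ≤ x →
      |fn r x - fn r z| ≤ δ * pip (derivative r) (derivative r) + |x - z| / δ := by
    intro x z hx hz hzx
    have c1 : Continuous fun t => δ * (fn (derivative r) t * fn (derivative r) t) :=
      continuous_const.mul ((continuous_fn _).mul (continuous_fn _))
    rw [← integral_fn_derivative]
    refine (intervalIntegral.abs_integral_le_integral_abs hzx).trans ?_
    refine (intervalIntegral.integral_mono_on hzx ((continuous_fn _).abs.intervalIntegrable _ _)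
      ((c1.add continuous_const).intervalIntegrable _ _)
      (g := fun t => δ * (fn (derivative r) t * fn (derivative r) t) + 1 / δ)
        fun t _ => ?_).trans ?_
    · set a := fn (derivative r) t
      rw [← abs_mul_abs_self a]
      have h1 : |a| = (δ * |a|) * (1 / δ) := by field_simp
      have h2 : δ * (|a| * |a|) + 1 / δ - |a| =
          (1 / δ) * ((δ * |a| - 1 / 2) ^ 2 + 3 / 4) := by field_simp; ring
      have : 0 ≤ (1 / δ) * ((δ * |a| - 1 / 2) ^ 2 + 3 / 4) := by positivity
      linarith
    · rw [intervalIntegral.integral_add (c1.intervalIntegrable _ _)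
        (continuous_const.intervalIntegrable _ _), intervalIntegral.integral_const, smul_eq_mul,
        abs_of_nonneg (sub_nonneg.2 hzx), mul_one_div]
      refine add_le_add_left ?_ _
      refine (intervalIntegral.integral_mono_interval hz.1 hzx hx.2 (Eventually.of_forall fun t =>
        mul_nonneg hδ.le (mul_self_nonneg _)) (c1.intervalIntegrable _ _)).trans (le_of_eq ?_)
      rw [intervalIntegral.integral_const_mul]; rfl
  rcases le_total z x with hzx | hzx
  · exact key hx hz hzx
  · rw [abs_sub_comm, abs_sub_comm x]; exact key hz hx hzx

/-- An interpolation inequality: the sup norm is controlled with a small multiple of the norm of the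
derivative. -/
theorem fn_sq_le (r : ℝ[X]) {δ : ℝ} (hδ : 0 < δ) {x : ℝ} (hx : x ∈ Set.Icc (-1 : ℝ) 1) :
    fn r x ^ 2 ≤ δ * pip (derivative r) (derivative r) + (1 + 1 / δ) * pip r r := by
  set w : ℝ → ℝ := fun t => δ * (fn (derivative r) t * fn (derivative r) t) +
    (1 / δ) * (fn r t * fn r t) with hw
  have c1 : Continuous fun t => fn (derivative r) t * fn (derivative r) t :=
    (continuous_fn _).mul (continuous_fn _)
  have c2 : Continuous fun t => fn r t * fn r t := (continuous_fn _).mul (continuous_fn _)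
  have hwc : Continuous w := (continuous_const.mul c1).add (continuous_const.mul c2)
  have hwi : ∫ t in (-1 : ℝ)..1, w t =
      δ * pip (derivative r) (derivative r) + (1 / δ) * pip r r := by
    rw [hw, intervalIntegral.integral_add ((c1.intervalIntegrable _ _).const_mul _)
      ((c2.intervalIntegrable _ _).const_mul _), intervalIntegral.integral_const_mul,
      intervalIntegral.integral_const_mul]; rfl
  have h1 : ∀ z ∈ Set.Icc (-1 : ℝ) 1,
      fn r x ^ 2 - ∫ t in (-1 : ℝ)..1, w t ≤ fn r z * fn r z := by
    intro z hz
    have := abs_integral_le_of_abs_le (continuous_fn (derivative (r * r))) hwc (fun t => ?_) hx hz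
    · rw [integral_fn_derivative, fn_mul, fn_mul] at this
      nlinarith [le_abs_self (fn r x * fn r x - fn r z * fn r z)]
    · rw [derivative_mul, fn_add, fn_mul, fn_mul]
      simp only [hw]
      set a := fn (derivative r) t
      set b := fn r t
      have e1 : δ * (a * a) + 1 / δ * (b * b) - (a * b + b * a) = (1 / δ) * (δ * a - b) ^ 2 := by
        field_simp; ring
      have e2 : δ * (a * a) + 1 / δ * (b * b) + (a * b + b * a) = (1 / δ) * (δ * a + b) ^ 2 := by
        field_simp; ring
      have p1 : 0 ≤ (1 / δ) * (δ * a - b) ^ 2 := by positivity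
      have p2 : 0 ≤ (1 / δ) * (δ * a + b) ^ 2 := by positivity
      rw [abs_le]; constructor <;> linarith
  have h2 := intervalIntegral.integral_mono_on (a := -1) (b := 1) (μ := volume) (by norm_num)
    (continuous_const.intervalIntegrable _ _) (c2.intervalIntegrable _ _) h1
  rw [intervalIntegral.integral_const, hwi, smul_eq_mul] at h2
  change _ ≤ pip r r at h2
  have := pip_self_nonneg r
  linarith

/-- The square of the norm of the Sobolev space `H¹`, for polynomials. -/
noncomputable def hsq (r : ℝ[X]) : ℝ := pip (derivative r) (derivative r) + pip r r

theorem abs_fn_le_hsq (r : ℝ[X]) {x : ℝ} (hx : x ∈ Set.Icc (-1 : ℝ) 1) :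
    |fn r x| ≤ Real.sqrt (2 * hsq r) := by
  refine Real.abs_le_sqrt ?_
  have := fn_sq_le r one_pos hx
  have := pip_self_nonneg (derivative r)
  unfold hsq
  linarith

end Sobolev

/-- Pointwise convergence of an equicontinuous family on `[-1, 1]` is uniform. -/
theorem tendstoUniformlyOn_of_equicontinuous {l : Filter ℕ} [l.NeBot] {F : ℕ → ℝ → ℝ} {u : ℝ → ℝ}
    (hpt : ∀ x ∈ Set.Icc (-1 : ℝ) 1, Tendsto (fun n => F n x) l (𝓝 (u x)))
    (heq : ∀ ε > 0, ∃ δ > 0, ∀ᶠ n in l, ∀ x ∈ Set.Icc (-1 : ℝ) 1, ∀ z ∈ Set.Icc (-1 : ℝ) 1,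
      |x - z| < δ → |F n x - F n z| ≤ ε) : TendstoUniformlyOn F u l (Set.Icc (-1) 1) := by
  rw [Metric.tendstoUniformlyOn_iff]
  intro ε hε
  obtain ⟨δ, hδ, h1⟩ := heq (ε / 4) (by positivity)
  obtain ⟨t, hts, htf, hcov⟩ := (isCompact_Icc (a := (-1 : ℝ)) (b := 1)).finite_cover_balls hδ
  have h2 : ∀ᶠ n in l, ∀ z ∈ t, |F n z - u z| < ε / 4 := by
    rw [htf.eventually_all]
    intro z hz
    exact (Metric.tendsto_nhds.1 (hpt z (hts hz))) (ε / 4) (by positivity)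
  filter_upwards [h1, h2] with n hn1 hn2 x hx
  obtain ⟨z, hz, hxz⟩ := Set.mem_iUnion₂.1 (hcov hx)
  have hz' := hts hz
  have h3 : |u x - u z| ≤ ε / 4 := by
    refine le_of_tendsto ((hpt x hx).sub (hpt z hz')).abs ?_
    filter_upwards [h1] with m hm using hm x hx z hz' hxz
  have h4 := hn1 x hx z hz' hxz
  have h5 := hn2 z hz
  rw [Real.dist_eq]
  have e : u x - F n x = (u x - u z) - (F n z - u z) - (F n x - F n z) := by ring
  rw [e]
  have := abs_sub ((u x - u z) - (F n z - u z)) (F n x - F n z)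
  have := abs_sub (u x - u z) (F n z - u z)
  linarith

section Energy

variable {S : ℕ} {p : Problem S}

/-- The bilinear form `-⟨r, s''⟩ + ⟨r, q s⟩`. -/
noncomputable def Problem.energy (p : Problem S) (r s : ℝ[X]) : ℝ :=
  -pip r (derivative (derivative s)) + ip (fn r) (fun x => p.q x * fn s x)

theorem Problem.intervalIntegrable_q_mul (p : Problem S) {u : ℝ → ℝ}
    (hu : ContinuousOn u (Set.Icc (-1) 1)) :
    IntervalIntegrable (fun x => p.q x * u x) volume (-1) 1 := by
  simpa using IsSol.intervalIntegrable_potential_mul p.isPotential hu 0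

theorem Problem.PolyBC.exists_boundary_bound (p : Problem S) : ∃ K, 0 ≤ K ∧ ∀ r : ℝ[X], p.PolyBC r →
    |r.eval 1 * (derivative r).eval 1 - r.eval (-1) * (derivative r).eval (-1)| ≤
      K * (r.eval 1 ^ 2 + r.eval (-1) ^ 2) := by
  have key : ∀ {a b u v : ℝ}, a ^ 2 + b ^ 2 ≠ 0 → a * u + b * v = 0 →
      |u * v| ≤ |a / b| * u ^ 2 := by
    intro a b u v hab h
    by_cases hb : b = 0
    · subst hb
      have ha : a ≠ 0 := by rintro rfl; simp at hab
      have : u = 0 := by simpa [ha] using h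
      simp [this]
    · have : v = -(a / b) * u := by field_simp; linarith
      rw [this, show u * (-(a / b) * u) = -(a / b * u ^ 2) by ring, abs_neg, abs_mul,
        abs_of_nonneg (sq_nonneg u)]
  refine ⟨|p.aR / p.bR| + |p.aL / p.bL|, by positivity, fun r hr => ?_⟩
  have h1 := key p.right_ne hr.2
  have h2 := key p.left_ne hr.1
  refine (abs_sub _ _).trans ?_
  nlinarith [abs_nonneg (p.aR / p.bR), abs_nonneg (p.aL / p.bL), sq_nonneg (r.eval 1),
    sq_nonneg (r.eval (-1))]

/-- The difference between the energy and the Dirichlet integral is controlled by the sup norm. -/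
theorem Problem.exists_energy_bound (p : Problem S) : ∃ K, 0 ≤ K ∧ ∀ (r : ℝ[X]) (M : ℝ), 0 ≤ M →
    p.PolyBC r → (∀ x ∈ Set.Icc (-1 : ℝ) 1, fn r x ^ 2 ≤ M) →
    |p.energy r r - pip (derivative r) (derivative r)| ≤ K * M := by
  obtain ⟨K, hK, hbd⟩ := Problem.PolyBC.exists_boundary_bound p
  set q1 := ∫ x in (-1 : ℝ)..1, |p.q x| with hq1
  have hq0 : 0 ≤ q1 := intervalIntegral.integral_nonneg (by norm_num) fun _ _ => abs_nonneg _
  refine ⟨2 * K + q1, by positivity, fun r M hM hr h => ?_⟩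
  have h1 := hbd r hr
  have h2 := h 1 (by norm_num)
  have h3 := h (-1) (by norm_num)
  simp only [fn] at h2 h3
  have h4 : |ip (fn r) (fun x => p.q x * fn r x)| ≤ M * q1 := by
    have : ip (fn r) (fun x => p.q x * fn r x) = ip (fun x => fn r x ^ 2) p.q :=
      ip_congr fun x _ => by ring
    rw [this]
    exact abs_ip_le (fun x hx => by rw [abs_of_nonneg (sq_nonneg _)]; exact h x hx)
      p.isPotential.int
  have h5 := pip_derivative (derivative r) r
  rw [eval_mul, eval_mul, pip_comm] at h5
  have h6 : p.energy r r - pip (derivative r) (derivative r) =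
      ip (fn r) (fun x => p.q x * fn r x) -
        (r.eval 1 * (derivative r).eval 1 - r.eval (-1) * (derivative r).eval (-1)) := by
    rw [Problem.energy, h5]; ring
  rw [h6]
  refine (abs_sub _ _).trans ?_
  nlinarith

/-- Coercivity of the energy. -/
theorem Problem.exists_coercive (p : Problem S) : ∃ K, 0 ≤ K ∧ ∀ r : ℝ[X], p.PolyBC r →
    hsq r ≤ 2 * p.energy r r + K * pip r r := by
  obtain ⟨K, hK, h⟩ := p.exists_energy_bound
  set δ : ℝ := 1 / (2 * (K + 1)) with hδ
  have hδ0 : 0 < δ := by positivity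
  refine ⟨1 + 2 * K * (1 + 1 / δ), by positivity, fun r hr => ?_⟩
  have hA := pip_self_nonneg (derivative r)
  have hB := pip_self_nonneg r
  have h1 := h r (δ * pip (derivative r) (derivative r) + (1 + 1 / δ) * pip r r) (by positivity) hr
    fun x hx => fn_sq_le r hδ0 hx
  have h2 : K * δ ≤ 1 / 2 := by
    rw [hδ, mul_one_div, div_le_div_iff₀ (by positivity) (by norm_num)]; linarith
  have h3 := (abs_le.1 h1).1
  unfold hsq
  nlinarith

theorem pip_self_le_of_sq_le {r : ℝ[X]} {M : ℝ} (h : ∀ x ∈ Set.Icc (-1 : ℝ) 1, fn r x ^ 2 ≤ M) :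
    pip r r ≤ 2 * M := by
  have h1 : pip r r = ip (fun x => fn r x ^ 2) (fun _ => 1) := by
    rw [pip_apply]; exact ip_congr fun x _ => by ring
  have h2 := abs_ip_le (u := fun x => fn r x ^ 2) (M := M) (v := fun _ => 1) (fun x hx => by
    rw [abs_of_nonneg (sq_nonneg _)]; exact h x hx) (continuous_const.intervalIntegrable _ _)
  rw [h1]
  refine (le_abs_self _).trans (h2.trans (le_of_eq ?_))
  norm_num
  ring

theorem tendsto_ip_of_uniformly {l : Filter ℕ} {F : ℕ → ℝ → ℝ} {u : ℝ → ℝ}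
    (hF : ∀ n, ContinuousOn (F n) (Set.Icc (-1) 1)) (hu : ContinuousOn u (Set.Icc (-1) 1))
    (h : TendstoUniformlyOn F u l (Set.Icc (-1) 1)) {v : ℝ → ℝ}
    (hv : IntervalIntegrable v volume (-1) 1) :
    Tendsto (fun n => ip (F n) v) l (𝓝 (ip u v)) := by
  rw [Metric.tendsto_nhds]
  intro ε hε
  set M := ∫ x in (-1 : ℝ)..1, |v x| with hM
  have hM0 : 0 ≤ M := intervalIntegral.integral_nonneg (by norm_num) fun _ _ => abs_nonneg _
  filter_upwards [Metric.tendstoUniformlyOn_iff.1 h (ε / (M + 1)) (by positivity)] with n hn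
  have h1 : ip (F n) v - ip u v = ip (fun x => F n x - u x) v := by
    have hc : ∀ {w : ℝ → ℝ}, ContinuousOn w (Set.Icc (-1) 1) →
        IntervalIntegrable (fun x => v x * w x) volume (-1) 1 := fun hw => by
      simpa only [mul_comm] using intervalIntegrable_mul_of_continuousOn hw hv
    rw [ip_comm (fun x => F n x - u x), ip_sub_right (hc (hF n)) (hc hu), ip_comm v, ip_comm v]
  rw [Real.dist_eq, h1]
  refine (abs_ip_le (M := ε / (M + 1)) (fun x hx => ?_) hv).trans_lt ?_
  · have := hn x hx
    rw [dist_comm, Real.dist_eq] at this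
    exact this.le
  · rw [div_mul_eq_mul_div, div_lt_iff₀ (by positivity)]
    nlinarith

/-- Compactness: along an ultrafilter, normalized approximate solutions of the Galerkin equations
converge uniformly, and the limit is an eigenfunction. -/
theorem exists_limit_eigenfunction {U : Ultrafilter ℕ} (hU : (U : Filter ℕ) ≤ atTop)
    {φ : ℕ → ℝ[X]} {μ ε : ℕ → ℝ} {μ₀ : ℝ} (hφ : ∀ᶠ N in U, φ N ∈ polySpace p N)
    (hn : ∀ᶠ N in U, hsq (φ N) = 1) (hμ : Tendsto μ U (𝓝 μ₀)) (hε : Tendsto ε U (𝓝 0))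
    (h : ∀ᶠ N in U, ∀ ψ ∈ polySpace p N,
      |p.energy (φ N) ψ - μ N * pip (φ N) ψ| ≤ ε N * Real.sqrt (hsq ψ)) :
    ∃ u, TendstoUniformlyOn (fun N => fn (φ N)) u U (Set.Icc (-1) 1) ∧ p.IsEigenfunction μ₀ u := by
  have hbd : ∀ᶠ N in U, ∀ x ∈ Set.Icc (-1 : ℝ) 1, |fn (φ N) x| ≤ Real.sqrt 2 := by
    filter_upwards [hn] with N hN x hx
    have := abs_fn_le_hsq (φ N) hx
    rwa [hN, mul_one] at this
  have hex : ∀ x : ℝ, ∃ l, x ∈ Set.Icc (-1 : ℝ) 1 → Tendsto (fun N => fn (φ N) x) U (𝓝 l) := by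
    intro x
    by_cases hx : x ∈ Set.Icc (-1 : ℝ) 1
    · obtain ⟨l, _, hl⟩ := (isCompact_Icc (a := -Real.sqrt 2)
          (b := Real.sqrt 2)).ultrafilter_le_nhds
        (U.map fun N => fn (φ N) x) (by
          rw [Ultrafilter.coe_map, le_principal_iff, Filter.mem_map]
          filter_upwards [hbd] with N hN using abs_le.1 (hN x hx))
      exact ⟨l, fun _ => hl⟩
    · exact ⟨0, fun h => absurd h hx⟩
  choose u hu using hex
  have hunif : TendstoUniformlyOn (fun N => fn (φ N)) u U (Set.Icc (-1) 1) := by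
    refine tendstoUniformlyOn_of_equicontinuous hu fun ε hε => ⟨ε / 2 * (ε / 2), by positivity, ?_⟩
    filter_upwards [hn] with N hN x hx z hz hxz
    refine (abs_fn_sub_le (φ N) (half_pos hε) hx hz).trans ?_
    have h1 : pip (derivative (φ N)) (derivative (φ N)) ≤ 1 := by
      rw [← hN, hsq]; linarith [pip_self_nonneg (φ N)]
    have h2 : |x - z| / (ε / 2) ≤ ε / 2 := by
      rw [div_le_iff₀ (half_pos hε)]; exact hxz.le
    nlinarith
  have hcF : ∀ N, ContinuousOn (fn (φ N)) (Set.Icc (-1) 1) := fun N =>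
    (continuous_fn _).continuousOn
  have huc : ContinuousOn u (Set.Icc (-1) 1) :=
    hunif.continuousOn (Frequently.of_forall hcF)
  have hlim : ∀ {v : ℝ → ℝ}, IntervalIntegrable v volume (-1) 1 →
      Tendsto (fun N => ip (fn (φ N)) v) U (𝓝 (ip u v)) := fun hv =>
    tendsto_ip_of_uniformly hcF huc hunif hv
  refine ⟨u, hunif, ?_⟩
  -- a fixed polynomial is an admissible test function for all large `N`
  have hweak : ∀ r : ℝ[X], p.PolyBC r →
      ip u (fn (derivative (derivative r))) = ip (fn r) (fun x => (p.q x - μ₀) * u x) := by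
    intro r hr
    have i1 : ∀ s : ℝ[X], IntervalIntegrable (fn s) volume (-1) 1 := fun s =>
      (continuous_fn s).intervalIntegrable _ _
    have i2 := p.intervalIntegrable_q_mul (continuous_fn r).continuousOn
    have hL := ((hlim (i1 (derivative (derivative r)))).neg.add (hlim i2)).sub
      (hμ.mul (hlim (i1 r)))
    have hR : Tendsto (fun N => -ip (fn (φ N)) (fn (derivative (derivative r))) +
        ip (fn (φ N)) (fun x => p.q x * fn r x) - μ N * ip (fn (φ N)) (fn r)) U (𝓝 0) := by
      have h0 := hε.mul_const (Real.sqrt (hsq r))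
      rw [zero_mul] at h0
      refine squeeze_zero_norm' ?_ h0
      filter_upwards [h, hU (eventually_ge_atTop r.natDegree)] with N hN hdeg
      exact hN r ⟨hdeg.trans (Nat.le_succ N), hr⟩
    have h1 := tendsto_nhds_unique hL hR
    have j1 : IntervalIntegrable (fun x => u x * (p.q x * fn r x)) volume (-1) 1 :=
      intervalIntegrable_mul_of_continuousOn huc i2
    have j2 : IntervalIntegrable (fun x => u x * (μ₀ * fn r x)) volume (-1) 1 :=
      intervalIntegrable_mul_of_continuousOn huc ((i1 r).const_mul _)
    have h2 : ip (fn r) (fun x => (p.q x - μ₀) * u x) =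
        ip u (fun x => p.q x * fn r x) - μ₀ * ip u (fn r) := by
      rw [← ip_const_mul_right, ← ip_sub_right j1 j2]
      exact ip_congr fun x _ => by ring
    rw [h2]; linarith
  obtain ⟨du, hsol, hbc⟩ := exists_isSol_of_very_weak p.isPotential huc hweak
  refine hsol.isEigenfunction hbc ?_
  -- if the limit vanished, the energy identity would force the norms to tend to zero
  by_contra! hcon
  obtain ⟨K, hK, hen⟩ := p.exists_energy_bound
  set δ : ℝ := 1 / (4 * (K + 2 + 2 * (|μ₀| + 1))) with hδ
  have hδ0 : 0 < δ := by positivity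
  have hsmall : ∀ᶠ N in U, ∀ x ∈ Set.Icc (-1 : ℝ) 1, fn (φ N) x ^ 2 ≤ δ := by
    filter_upwards [Metric.tendstoUniformlyOn_iff.1 hunif (Real.sqrt δ) (Real.sqrt_pos.2 hδ0)]
      with N hN x hx
    have := hN x hx
    rw [hcon x hx, Real.dist_eq, zero_sub, abs_neg] at this
    rw [← sq_abs, ← Real.sq_sqrt hδ0.le]
    exact pow_le_pow_left₀ (abs_nonneg _) this.le 2
  have hμb : ∀ᶠ N in U, |μ N| < |μ₀| + 1 := hμ.abs.eventually (gt_mem_nhds (lt_add_one _))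
  have hεb : ∀ᶠ N in U, ε N < 1 / 4 := hε.eventually (gt_mem_nhds (by norm_num))
  obtain ⟨N, h1, h2, h3, h4, h5, h6⟩ :=
    (hsmall.and (hμb.and (hεb.and (hn.and (hφ.and h))))).exists
  have e1 := (abs_le.1 (hen (φ N) δ hδ0.le h5.2 h1)).1
  have e2 := (abs_le.1 (h6 _ h5)).2
  have e3 := pip_self_le_of_sq_le h1
  have e4 := pip_self_nonneg (φ N)
  rw [h4, Real.sqrt_one, mul_one] at e2
  have e5 : μ N * pip (φ N) (φ N) ≤ (|μ₀| + 1) * (2 * δ) :=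
    mul_le_mul ((le_abs_self _).trans h2.le) e3 e4 (by positivity)
  have e6 : (K + 2 + 2 * (|μ₀| + 1)) * δ = 1 / 4 := by rw [hδ]; field_simp
  unfold hsq at h4
  nlinarith

end Energy

/-! ### The numerical eigenvalues -/

/-- Simultaneous diagonalization of a symmetric form and a positive definite one. -/
theorem exists_simultaneous_diagonalization {V : Type*} [AddCommGroup V] [Module ℝ V]
    [FiniteDimensional ℝ V] {n : ℕ} (hn : Module.finrank ℝ V = n) (M B : V →ₗ[ℝ] V →ₗ[ℝ] ℝ)
    (hM : ∀ x y, M x y = M y x) (hBs : ∀ x y, B x y = B y x) (hB : ∀ x, x ≠ 0 → 0 < B x x) :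
    ∃ (b : Module.Basis (Fin n) ℝ V) (ν : Fin n → ℝ),
      (∀ i j, B (b i) (b j) = if i = j then 1 else 0) ∧ ∀ i w, M (b i) w = ν i * B (b i) w := by
  let core : InnerProductSpace.Core ℝ V :=
    { inner := fun x y => B x y
      conj_inner_symm := fun x y => hBs y x
      re_inner_nonneg := fun x => by
        by_cases hx : x = 0
        · subst hx; simp
        · exact (hB x hx).le
      add_left := fun x y z => by simp
      smul_left := fun x y r => by simp
      definite := fun x hx => by
        by_contra h
        exact (hB x h).ne' hx }
  let _ : NormedAddCommGroup V := @InnerProductSpace.Core.toNormedAddCommGroup ℝ V _ _ _ core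
  let _ : InnerProductSpace ℝ V := InnerProductSpace.ofCore core.toCore
  have hinner : ∀ x y : V, inner ℝ x y = B x y := fun _ _ => rfl
  have hinj : Function.Injective B := by
    rw [← LinearMap.ker_eq_bot, LinearMap.ker_eq_bot']
    intro x hx
    by_contra h
    have := hB x h
    rw [hx] at this
    simp at this
  let e := LinearEquiv.ofInjectiveOfFinrankEq B hinj Subspace.dual_finrank_eq.symm
  let T : V →ₗ[ℝ] V := e.symm.toLinearMap ∘ₗ M
  have hT : ∀ x y, B (T x) y = M x y := fun x y => by
    have : e (T x) = M x := e.apply_symm_apply _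
    exact LinearMap.congr_fun this y
  have hsymm : T.IsSymmetric := fun x y => by
    rw [hinner, hinner, hT, hM, ← hT, hBs]
  refine ⟨(hsymm.eigenvectorBasis hn).toBasis, hsymm.eigenvalues hn, fun i j => ?_, fun i w => ?_⟩
  · have := (hsymm.eigenvectorBasis hn).orthonormal
    rw [orthonormal_iff_ite] at this
    simpa [hinner] using this i j
  · rw [← hT, OrthonormalBasis.coe_toBasis, hsymm.apply_eigenvectorBasis hn i]
    simp

theorem pip_self_pos {r : ℝ[X]} (hr : r ≠ 0) : 0 < pip r r := by
  refine lt_of_le_of_ne (pip_self_nonneg r) fun h0 => hr ?_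
  have hc := (continuous_fn r).continuousOn (s := Set.Icc (-1) 1)
  have h1 := eq_zero_of_ip_fn_eq_zero hc fun s => by
    have := ip_sq_le hc ((continuous_fn s).continuousOn (s := Set.Icc (-1) 1))
    rw [← pip_apply r r, ← h0, zero_mul] at this
    exact pow_eq_zero_iff two_ne_zero |>.1 (le_antisymm this (sq_nonneg _))
  refine eq_zero_of_infinite_isRoot r (Set.Infinite.mono (s := Set.Icc (-1 : ℝ) 1) h1 ?_)
  exact Set.Icc_infinite (by norm_num)

section

variable {S : ℕ} {p : Problem S} {R : ℕ → ℝ[X]}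

theorem Problem.ip_q_comm (p : Problem S) (r s : ℝ[X]) :
    ip (fn r) (fun x => p.q x * fn s x) = ip (fn s) (fun x => p.q x * fn r x) :=
  ip_congr fun x _ => by ring

/-- The energy as a bilinear form. -/
noncomputable def Problem.energyForm (p : Problem S) : ℝ[X] →ₗ[ℝ] ℝ[X] →ₗ[ℝ] ℝ :=
  have hleft : ∀ (r r' s : ℝ[X]), ip (fn (r + r')) (fun x => p.q x * fn s x) =
      ip (fn r) (fun x => p.q x * fn s x) + ip (fn r') (fun x => p.q x * fn s x) := fun r r' s =>
    (ipForm _ (p.intervalIntegrable_q_mul (continuous_fn s).continuousOn)).map_add r r'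
  have hsmul : ∀ (k : ℝ) (r s : ℝ[X]), ip (fn (k • r)) (fun x => p.q x * fn s x) =
      k * ip (fn r) (fun x => p.q x * fn s x) := fun k r s =>
    (ipForm _ (p.intervalIntegrable_q_mul (continuous_fn s).continuousOn)).map_smul k r
  LinearMap.mk₂ ℝ p.energy
    (fun r r' s => by
      simp only [Problem.energy, hleft, map_add, LinearMap.add_apply]; ring)
    (fun k r s => by
      simp only [Problem.energy, hsmul, map_smul, LinearMap.smul_apply, smul_eq_mul]; ring)
    (fun r s s' => by
      rw [Problem.energy, p.ip_q_comm, hleft, derivative_add, derivative_add, map_add,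
        Problem.energy, Problem.energy, p.ip_q_comm r s, p.ip_q_comm r s']; ring)
    (fun k r s => by
      rw [Problem.energy, p.ip_q_comm, hsmul, derivative_smul, derivative_smul, map_smul,
        Problem.energy, p.ip_q_comm r s, smul_eq_mul, smul_eq_mul]; ring)

theorem Problem.energyForm_apply (p : Problem S) (r s : ℝ[X]) : p.energyForm r s = p.energy r s :=
  rfl

theorem Problem.PolyBC.energy_comm {r s : ℝ[X]} (hr : p.PolyBC r) (hs : p.PolyBC s) :
    p.energy r s = p.energy s r := by
  rw [Problem.energy, Problem.energy, hr.pip_symm hs, pip_comm, p.ip_q_comm]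

/-- The polynomial with the coordinate vector `ζ`. -/
noncomputable def comb (R : ℕ → ℝ[X]) (N : ℕ) : (Fin N → ℝ) →ₗ[ℝ] ℝ[X] :=
  Fintype.linearCombination ℝ fun i : Fin N => R i

theorem comb_apply (R : ℕ → ℝ[X]) (N : ℕ) (ζ : Fin N → ℝ) : comb R N ζ = ∑ i, ζ i • R i := rfl

theorem zFun_eq (R : ℕ → ℝ[X]) {N : ℕ} (ζ : Fin N → ℝ) : zFun R ζ = fn (comb R N ζ) := by
  ext x
  simp [zFun, comb_apply, fn, eval_finsetSum]

theorem range_comb (R : ℕ → ℝ[X]) (N : ℕ) :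
    LinearMap.range (comb R N) = Submodule.span ℝ (R '' Set.Iio N) := by
  rw [comb, Fintype.range_linearCombination]
  congr 1
  ext r
  constructor
  · rintro ⟨i, rfl⟩; exact ⟨i, i.2, rfl⟩
  · rintro ⟨i, hi, rfl⟩; exact ⟨⟨i, hi⟩, rfl⟩

theorem Problem.IsBasis.comb_injective (hR : p.IsBasis R) (N : ℕ) :
    Function.Injective (comb R N) :=
  linearIndependent_iff_injective_fintypeLinearCombination.1 (hR.linearIndependent N)

theorem Problem.IsBasis.comb_bc (hR : p.IsBasis R) {N : ℕ} (ζ : Fin N → ℝ) :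
    p.PolyBC (comb R N ζ) := by
  have h0 : ∀ n, R n ∈ polySpace p (R n).natDegree := fun n => ⟨Nat.le_succ _, hR.bc n⟩
  have h1 : ∀ i : Fin N, R i ∈ polySpace p (∑ j : Fin N, (R j).natDegree) := fun i =>
    polySpace_mono p (Finset.single_le_sum (f := fun j : Fin N => (R j).natDegree)
      (fun _ _ => Nat.zero_le _) (Finset.mem_univ i)) (h0 i)
  have h2 : comb R N ζ ∈ polySpace p (∑ j : Fin N, (R j).natDegree) := by
    rw [comb_apply]
    exact Submodule.sum_mem _ fun i _ => Submodule.smul_mem _ (ζ i) (h1 i)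
  exact h2.2

/-- The matrix eigenvalue problem is the Galerkin equation tested with all combinations of the
basis. -/
theorem mem_numEigenspace {N : ℕ} {μ : ℝ} {ζ : Fin N → ℝ} : ζ ∈ p.numEigenspace R N μ ↔
    ∀ ζ', p.energy (comb R N ζ') (comb R N ζ) = μ * pip (comb R N ζ') (comb R N ζ) := by
  have hrow : ∀ m : Fin N, (p.pencil R N μ).mulVec ζ m =
      p.energyForm (R m) (comb R N ζ) - μ * pip (R m) (comb R N ζ) := by
    intro m
    rw [comb_apply, map_sum, map_sum, Matrix.mulVec, dotProduct, Finset.mul_sum,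
      ← Finset.sum_sub_distrib]
    refine Finset.sum_congr rfl fun n _ => ?_
    rw [map_smul, map_smul, Problem.energyForm_apply]
    simp only [Problem.pencil, Matrix.of_apply, aEntry, Problem.qEntry, bEntry, Problem.energy,
      smul_eq_mul, pip_apply]
    ring
  rw [Problem.numEigenspace, LinearMap.mem_ker, Matrix.toLin'_apply]
  constructor
  · intro h ζ'
    rw [← Problem.energyForm_apply, comb_apply R N ζ', map_sum, map_sum, LinearMap.sum_apply,
      LinearMap.sum_apply, Finset.mul_sum]
    refine Finset.sum_congr rfl fun m _ => ?_
    have := (hrow m).symm.trans (congrFun h m)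
    simp only [map_smul, LinearMap.smul_apply, smul_eq_mul]
    simp only [Pi.zero_apply] at this
    linear_combination ζ' m * this
  · intro h
    ext m
    rw [hrow]
    have := h (Pi.single m 1)
    have e : comb R N (Pi.single m 1) = R m := by
      rw [comb, Fintype.linearCombination_apply_single, one_smul]
    rw [e] at this
    rw [Problem.energyForm_apply, this, sub_self]; rfl

/-- An eigenbasis of the numerical problem, orthonormal for the mass matrix. -/
structure NumEigenbasis (p : Problem S) (R : ℕ → ℝ[X]) (N : ℕ) where
  b : Module.Basis (Fin N) ℝ (Fin N → ℝ)
  ν : Fin N → ℝ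
  orthonormal : ∀ i j, pip (comb R N (b i)) (comb R N (b j)) = if i = j then 1 else 0
  energy_eq : ∀ i ζ, p.energy (comb R N (b i)) (comb R N ζ) =
    ν i * pip (comb R N (b i)) (comb R N ζ)

/-- The stiffness matrix is symmetric by the boundary conditions, and the mass matrix is positive
definite by the independence of the basis. -/
theorem Problem.IsBasis.nonempty_numEigenbasis (hR : p.IsBasis R) (N : ℕ) :
    Nonempty (NumEigenbasis p R N) := by
  obtain ⟨b, ν, h1, h2⟩ := exists_simultaneous_diagonalization (n := N) (by simp)
    (p.energyForm.compl₁₂ (comb R N) (comb R N)) (pip.compl₁₂ (comb R N) (comb R N))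
    (fun x y => (hR.comb_bc x).energy_comm (hR.comb_bc y)) (fun x y => pip_comm _ _)
    (fun x hx => pip_self_pos fun h => hx (hR.comb_injective N (h.trans (map_zero _).symm)))
  exact ⟨⟨b, ν, h1, h2⟩⟩

namespace NumEigenbasis

variable {N : ℕ}

theorem pip_right (E : NumEigenbasis p R N) (i : Fin N) (ζ : Fin N → ℝ) :
    pip (comb R N (E.b i)) (comb R N ζ) = E.b.repr ζ i := by
  conv_lhs => rw [← E.b.sum_repr ζ]
  rw [map_sum, map_sum, Finset.sum_eq_single i]
  · rw [map_smul, map_smul, E.orthonormal, if_pos rfl, smul_eq_mul, mul_one]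
  · intro j _ hj
    rw [map_smul, map_smul, E.orthonormal, if_neg hj.symm, smul_zero]
  · simp

theorem mem_numEigenspace_iff (E : NumEigenbasis p R N) {μ : ℝ}
    {ζ : Fin N → ℝ} : ζ ∈ p.numEigenspace R N μ ↔ ∀ i, E.ν i ≠ μ → E.b.repr ζ i = 0 := by
  rw [mem_numEigenspace]
  constructor
  · intro h i hi
    have := h (E.b i)
    rw [E.energy_eq, E.pip_right] at this
    have h1 : (E.ν i - μ) * E.b.repr ζ i = 0 := by linarith
    exact (mul_eq_zero.1 h1).resolve_left (sub_ne_zero.2 hi)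
  · intro h ζ'
    rw [← Problem.energyForm_apply]
    conv_lhs => rw [← E.b.sum_repr ζ']
    conv_rhs => rw [← E.b.sum_repr ζ']
    simp only [map_sum, LinearMap.sum_apply, Finset.mul_sum, map_smul, LinearMap.smul_apply]
    refine Finset.sum_congr rfl fun i _ => ?_
    rw [Problem.energyForm_apply, E.energy_eq, E.pip_right]
    by_cases hi : E.ν i = μ
    · rw [hi, smul_eq_mul, smul_eq_mul]; ring
    · rw [h i hi]; simp

theorem energy_self (E : NumEigenbasis p R N) (ζ : Fin N → ℝ) :
    p.energy (comb R N ζ) (comb R N ζ) = ∑ i, E.ν i * E.b.repr ζ i ^ 2 := by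
  rw [← Problem.energyForm_apply]
  conv_lhs => enter [1]; rw [← E.b.sum_repr ζ]
  simp only [map_sum, LinearMap.sum_apply, map_smul, LinearMap.smul_apply, smul_eq_mul]
  refine Finset.sum_congr rfl fun i _ => ?_
  rw [Problem.energyForm_apply, E.energy_eq, E.pip_right]; ring

theorem pip_self (E : NumEigenbasis p R N) (ζ : Fin N → ℝ) :
    pip (comb R N ζ) (comb R N ζ) = ∑ i, E.b.repr ζ i ^ 2 := by
  conv_lhs => enter [1]; rw [← E.b.sum_repr ζ]
  simp only [map_sum, LinearMap.sum_apply, map_smul, LinearMap.smul_apply, smul_eq_mul]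
  refine Finset.sum_congr rfl fun i _ => ?_
  rw [E.pip_right]; ring

/-- The definition of the eigenvalue of index `k` speaks of dimensions of sums of eigenspaces; here
they are counted by the members of an eigenbasis. -/
theorem card_lt (E : NumEigenbasis p R N) {k : ℕ} {μ : ℝ}
    (h : p.IsNumEigenvalueOfIndex R N k μ) : (Finset.univ.filter fun i => E.ν i < μ).card < k := by
  refine lt_of_le_of_lt ?_ h.1
  have hli : LinearIndependent ℝ fun i : {i // i ∈ Finset.univ.filter fun i => E.ν i < μ} =>
      E.b i := E.b.linearIndependent.comp _ Subtype.val_injective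
  rw [← Fintype.card_coe, ← finrank_span_eq_card hli]
  refine Submodule.finrank_mono (Submodule.span_le.2 ?_)
  rintro _ ⟨⟨i, hi⟩, rfl⟩
  have hi' : E.ν i < μ := by simpa using hi
  refine Submodule.mem_iSup_of_mem (⟨E.ν i, hi'⟩ : Set.Iio μ) ?_
  rw [E.mem_numEigenspace_iff]
  intro j hj
  rw [Module.Basis.repr_self, Finsupp.single_apply, if_neg]
  rintro rfl
  exact hj rfl

theorem le_card (E : NumEigenbasis p R N) {k : ℕ} {μ : ℝ}
    (h : p.IsNumEigenvalueOfIndex R N k μ) : k ≤ (Finset.univ.filter fun i => E.ν i ≤ μ).card := by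
  refine h.2.trans ?_
  have hle : (⨆ ν : Set.Iic μ, p.numEigenspace R N (ν : ℝ)) ≤
      Submodule.span ℝ (Set.range fun i : {i // i ∈ Finset.univ.filter fun i => E.ν i ≤ μ} =>
        E.b i) := by
    refine iSup_le fun ⟨ν, hν⟩ ζ hζ => ?_
    rw [E.mem_numEigenspace_iff] at hζ
    rw [← E.b.sum_repr ζ]
    refine Submodule.sum_mem _ fun i _ => ?_
    by_cases hi : E.ν i = ν
    · refine Submodule.smul_mem _ _ (Submodule.subset_span ⟨⟨i, ?_⟩, rfl⟩)
      simpa [hi] using hν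
    · rw [hζ i hi, zero_smul]; exact Submodule.zero_mem _
  refine (Submodule.finrank_mono hle).trans ((finrank_range_le_card _).trans ?_)
  rw [Fintype.card_coe]

/-- The minimax principle, in the form of an upper bound: if the form `energy - μ * pip` is negative
definite on a `k`-dimensional family, then the eigenvalue of index `k` is less than `μ`. -/
theorem lt_of_forall_energy_lt (E : NumEigenbasis p R N) {k : ℕ} {lam μ : ℝ}
    (h : p.IsNumEigenvalueOfIndex R N k lam) {ι : Type*} [Fintype ι] (hι : Fintype.card ι = k)
    (f : (ι → ℝ) →ₗ[ℝ] ℝ[X]) (hf : ∀ t, f t ∈ LinearMap.range (comb R N))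
    (hlt : ∀ t, t ≠ 0 → p.energy (f t) (f t) < μ * pip (f t) (f t)) : lam < μ := by
  by_contra! hcon
  set s := Finset.univ.filter fun i => E.ν i < lam with hs
  let G : (ι → ℝ) →ₗ[ℝ] (s → ℝ) :=
    LinearMap.pi fun i => (pip (comb R N (E.b i))) ∘ₗ f
  have hker : LinearMap.ker G ≠ ⊥ := by
    refine LinearMap.ker_ne_bot_of_finrank_lt ?_
    rw [Module.finrank_fintype_fun_eq_card, Module.finrank_fintype_fun_eq_card, Fintype.card_coe,
        hι]
    exact E.card_lt h
  obtain ⟨t, ht, ht0⟩ := Submodule.exists_mem_ne_zero_of_ne_bot hker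
  obtain ⟨ζ, hζ⟩ := hf t
  have hz : ∀ i, E.ν i < lam → E.b.repr ζ i = 0 := by
    intro i hi
    have h1 : G t = 0 := ht
    have h2 := congrFun h1 ⟨i, by simpa [hs] using hi⟩
    rw [← E.pip_right, hζ]
    exact h2
  have h3 := hlt t ht0
  rw [← hζ, E.energy_self, E.pip_self, Finset.mul_sum] at h3
  refine absurd h3 (not_lt.2 (Finset.sum_le_sum fun i _ => ?_))
  by_cases hi : E.ν i < lam
  · rw [hz i hi]; simp
  · exact mul_le_mul_of_nonneg_right (hcon.trans (not_lt.1 hi)) (sq_nonneg _)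

end NumEigenbasis

end

/-! ### Convergence of the numerical eigenvalues -/

theorem exists_derivative_eq (s : ℝ[X]) : ∃ r : ℝ[X], derivative r = s := by
  induction s using Polynomial.induction_on' with
  | add s t hs ht =>
    obtain ⟨a, rfl⟩ := hs
    obtain ⟨b, rfl⟩ := ht
    exact ⟨a + b, derivative_add⟩
  | monomial n k =>
    refine ⟨monomial (n + 1) (k / (n + 1)), ?_⟩
    rw [derivative_monomial]
    congr 1
    push_cast
    field_simp

theorem rightCubic_bound {a b δ x : ℝ} (ha : |a| ≤ δ) (hb : |b| ≤ δ)
    (hx : x ∈ Set.Icc (-1 : ℝ) 1) :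
    |fn (rightCubic a b) x| ≤ 8 * δ ∧ |fn (derivative (rightCubic a b)) x| ≤ 8 * δ := by
  have e1 : fn (rightCubic a b) x =
      a * ((x + 1) ^ 2 * (2 - x) / 4) + b * ((x + 1) ^ 2 * (x - 1) / 4) := by
    simp [fn, rightCubic]; ring
  have e2 : fn (derivative (rightCubic a b)) x =
      a * (3 * (x + 1) * (1 - x) / 4) + b * ((x + 1) * (3 * x - 1) / 4) := by
    simp [fn, rightCubic, derivative_pow]; ring
  have key : ∀ {A B : ℝ}, |A| ≤ 4 → |B| ≤ 4 → |a * A + b * B| ≤ 8 * δ := by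
    intro A B hA hB
    refine (abs_add_le _ _).trans ?_
    rw [abs_mul, abs_mul]
    have h0 := abs_nonneg a
    have := mul_le_mul ha hA (abs_nonneg _) (h0.trans ha)
    have := mul_le_mul hb hB (abs_nonneg _) (h0.trans ha)
    linarith
  have h1 : 0 ≤ x + 1 := by linarith [hx.1]
  have h2 : 0 ≤ 1 - x := by linarith [hx.2]
  rw [e1, e2]
  constructor <;> refine key ?_ ?_ <;> rw [abs_le] <;> constructor <;>
    nlinarith [mul_nonneg h1 h2, mul_nonneg h1 h1, mul_nonneg (mul_nonneg h1 h1) h2]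

theorem leftCubic_bound {a b δ x : ℝ} (ha : |a| ≤ δ) (hb : |b| ≤ δ)
    (hx : x ∈ Set.Icc (-1 : ℝ) 1) :
    |fn (leftCubic a b) x| ≤ 8 * δ ∧ |fn (derivative (leftCubic a b)) x| ≤ 8 * δ := by
  have h := rightCubic_bound ha (b := -b) (by rwa [abs_neg]) (x := -x)
    ⟨by linarith [hx.2], by linarith [hx.1]⟩
  have e1 : fn (leftCubic a b) x = fn (rightCubic a (-b)) (-x) := by
    simp [fn, leftCubic, rightCubic]; ring
  have e2 : fn (derivative (leftCubic a b)) x = -fn (derivative (rightCubic a (-b))) (-x) := by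
    simp [fn, leftCubic, rightCubic, derivative_pow]; ring
  rw [e1, e2, abs_neg]
  exact h

section

variable {S : ℕ} {p : Problem S} {R : ℕ → ℝ[X]}

/-- Polynomials that satisfy the boundary conditions approximate the eigenfunctions in `C¹`. -/
theorem IsSol.exists_poly_near {Q : ℝ → ℝ} {lam : ℝ} {y dy : ℝ → ℝ} (h : IsSol Q lam y dy)
    (hb : p.BC y dy) {ε : ℝ} (hε : 0 < ε) : ∃ r : ℝ[X], p.PolyBC r ∧
      ∀ x ∈ Set.Icc (-1 : ℝ) 1, |fn r x - y x| ≤ ε ∧ |fn (derivative r) x - dy x| ≤ ε := by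
  set δ := ε / 34 with hδ
  have hδ0 : 0 < δ := by positivity
  obtain ⟨s, hs⟩ := exists_polynomial_near_of_continuousOn (-1) 1 dy h.dcont δ hδ0
  obtain ⟨r₁, hr₁⟩ := exists_derivative_eq s
  set r₀ : ℝ[X] := r₁ + C (y (-1) - r₁.eval (-1)) with hr₀
  have hd : derivative r₀ = s := by rw [hr₀, derivative_add, derivative_C, add_zero, hr₁]
  have hdn : ∀ x ∈ Set.Icc (-1 : ℝ) 1, |fn (derivative r₀) x - dy x| ≤ δ := fun x hx => by
    rw [hd]; exact (hs x hx).le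
  have hleft : fn r₀ (-1) = y (-1) := by simp [fn, hr₀]
  have hn : ∀ x ∈ Set.Icc (-1 : ℝ) 1, |fn r₀ x - y x| ≤ 2 * δ := by
    intro x hx
    have hsub : Set.Icc (-1) x ⊆ Set.Icc (-1 : ℝ) 1 := Set.Icc_subset_Icc_right hx.2
    have hc : ContinuousOn (fun t => fn (derivative r₀) t - dy t) (Set.Icc (-1) x) :=
      (continuous_fn _).continuousOn.sub (h.dcont.mono hsub)
    have h1 := intervalIntegral.integral_eq_sub_of_hasDerivAt_of_le hx.1
      (f := fun t => fn r₀ t - y t) (f' := fun t => fn (derivative r₀) t - dy t)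
      ((continuous_fn _).continuousOn.sub (h.cont.mono hsub))
      (fun t ht => (hasDerivAt_fn r₀ t).sub (h.der t ⟨ht.1, ht.2.trans_le hx.2⟩))
      (hc.intervalIntegrable_of_Icc hx.1)
    have h2 := intervalIntegral.norm_integral_le_of_norm_le_const (a := -1) (b := x) (C := δ)
      (f := fun t => fn (derivative r₀) t - dy t) fun t ht => by
        rw [Set.uIoc_of_le hx.1] at ht
        exact hdn t (hsub ⟨ht.1.le, ht.2⟩)
    rw [h1, hleft, sub_self, sub_zero, Real.norm_eq_abs,
      abs_of_nonneg (show 0 ≤ x - -1 by linarith [hx.1])] at h2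
    nlinarith [hx.2]
  set r : ℝ[X] := r₀ + rightCubic (y 1 - r₀.eval 1) (dy 1 - (derivative r₀).eval 1) +
    leftCubic (y (-1) - r₀.eval (-1)) (dy (-1) - (derivative r₀).eval (-1)) with hr
  have m1 : (1 : ℝ) ∈ Set.Icc (-1 : ℝ) 1 := by norm_num
  have m2 : (-1 : ℝ) ∈ Set.Icc (-1 : ℝ) 1 := by norm_num
  refine ⟨r, ?_, fun x hx => ?_⟩
  · obtain ⟨e1, e2, e3, e4⟩ := rightCubic_eval (y 1 - r₀.eval 1) (dy 1 - (derivative r₀).eval 1)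
    obtain ⟨f1, f2, f3, f4⟩ := leftCubic_eval (y (-1) - r₀.eval (-1))
      (dy (-1) - (derivative r₀).eval (-1))
    have g1 : r.eval 1 = y 1 := by rw [hr, eval_add, eval_add, e1, f1]; ring
    have g2 : (derivative r).eval 1 = dy 1 := by
      rw [hr, derivative_add, derivative_add, eval_add, eval_add, e2, f2]; ring
    have g3 : r.eval (-1) = y (-1) := by rw [hr, eval_add, eval_add, e3, f3]; ring
    have g4 : (derivative r).eval (-1) = dy (-1) := by
      rw [hr, derivative_add, derivative_add, eval_add, eval_add, e4, f4]; ring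
    exact ⟨by rw [g3, g4]; exact hb.1, by rw [g1, g2]; exact hb.2⟩
  · have b1 := rightCubic_bound (δ := 2 * δ) (a := y 1 - r₀.eval 1)
      (b := dy 1 - (derivative r₀).eval 1) (by rw [abs_sub_comm]; exact hn 1 m1)
      (by rw [abs_sub_comm]; exact (hdn 1 m1).trans (by linarith)) hx
    have b2 := leftCubic_bound (δ := 2 * δ) (a := y (-1) - r₀.eval (-1))
      (b := dy (-1) - (derivative r₀).eval (-1)) (by rw [abs_sub_comm]; exact hn (-1) m2)
      (by rw [abs_sub_comm]; exact (hdn (-1) m2).trans (by linarith)) hx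
    have key : ∀ {u v w z : ℝ}, |u - z| ≤ 2 * δ → |v| ≤ 8 * (2 * δ) → |w| ≤ 8 * (2 * δ) →
        |u + v + w - z| ≤ ε := by
      intro u v w z h1 h2 h3
      rw [abs_le] at *
      constructor <;> linarith [h1.1, h1.2, h2.1, h2.2, h3.1, h3.2]
    refine ⟨?_, ?_⟩
    · rw [hr, fn_add, fn_add]
      exact key (hn x hx) b1.1 b2.1
    · rw [hr, derivative_add, derivative_add, fn_add, fn_add]
      exact key ((hdn x hx).trans (by linarith)) b1.2 b2.2

theorem tendstoUniformlyOn_mul {l : Filter ℕ} {F G : ℕ → ℝ → ℝ} {u v : ℝ → ℝ}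
    (hu : ContinuousOn u (Set.Icc (-1) 1)) (hv : ContinuousOn v (Set.Icc (-1) 1))
    (hF : TendstoUniformlyOn F u l (Set.Icc (-1) 1))
    (hG : TendstoUniformlyOn G v l (Set.Icc (-1) 1)) :
    TendstoUniformlyOn (fun n x => F n x * G n x) (fun x => u x * v x) l (Set.Icc (-1) 1) := by
  obtain ⟨A, hA⟩ := isCompact_Icc.exists_bound_of_continuousOn hu
  obtain ⟨B, hB⟩ := isCompact_Icc.exists_bound_of_continuousOn hv
  have hA0 : 0 ≤ A := (norm_nonneg _).trans (hA 0 (by norm_num))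
  have hB0 : 0 ≤ B := (norm_nonneg _).trans (hB 0 (by norm_num))
  rw [Metric.tendstoUniformlyOn_iff] at *
  intro ε hε
  set δ := min 1 (ε / (A + B + 2)) with hδ
  have hδ0 : 0 < δ := lt_min one_pos (by positivity)
  have hδ1 : δ ≤ 1 := min_le_left _ _
  have hδ2 : δ * (A + B + 2) ≤ ε := by
    rw [← le_div_iff₀ (by positivity)]; exact min_le_right _ _
  filter_upwards [hF δ hδ0, hG δ hδ0] with n h1 h2 x hx
  have a1 := h1 x hx
  have a2 := h2 x hx
  have a3 := hA x hx
  have a4 := hB x hx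
  rw [Real.dist_eq] at *
  rw [Real.norm_eq_abs] at a3 a4
  have e : u x * v x - F n x * G n x =
      (u x - F n x) * v x + u x * (v x - G n x) - (u x - F n x) * (v x - G n x) := by ring
  rw [e]
  have c1 := abs_sub ((u x - F n x) * v x + u x * (v x - G n x))
    ((u x - F n x) * (v x - G n x))
  have c2 := abs_add_le ((u x - F n x) * v x) (u x * (v x - G n x))
  rw [abs_mul] at c1
  rw [abs_mul, abs_mul] at c2
  have d1 : |u x - F n x| * |v x| ≤ δ * B := mul_le_mul a1.le a4 (abs_nonneg _) hδ0.le
  have d2 : |u x| * |v x - G n x| ≤ A * δ := mul_le_mul a3 a2.le (abs_nonneg _) hA0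
  have d3 : |u x - F n x| * |v x - G n x| ≤ δ * 1 :=
    mul_le_mul a1.le (a2.le.trans hδ1) (abs_nonneg _) hδ0.le
  nlinarith

theorem tendsto_ip_mul_of_uniformly {l : Filter ℕ} {F G : ℕ → ℝ → ℝ} {u v : ℝ → ℝ}
    (hFc : ∀ n, ContinuousOn (F n) (Set.Icc (-1) 1))
    (hGc : ∀ n, ContinuousOn (G n) (Set.Icc (-1) 1))
    (hu : ContinuousOn u (Set.Icc (-1) 1)) (hv : ContinuousOn v (Set.Icc (-1) 1))
    (hF : TendstoUniformlyOn F u l (Set.Icc (-1) 1))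
    (hG : TendstoUniformlyOn G v l (Set.Icc (-1) 1)) {w : ℝ → ℝ}
    (hw : IntervalIntegrable w volume (-1) 1) :
    Tendsto (fun n => ip (F n) (fun x => w x * G n x)) l (𝓝 (ip u (fun x => w x * v x))) := by
  have h := tendsto_ip_of_uniformly (fun n => (hFc n).mul (hGc n)) (hu.mul hv)
    (tendstoUniformlyOn_mul hu hv hF hG) hw
  have e : ip u (fun x => w x * v x) = ip (fun x => u x * v x) w := ip_congr fun x _ => by ring
  rw [e]
  refine h.congr fun n => ip_congr fun x _ => by simp only [Pi.mul_apply]; ring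

theorem tendsto_pip_of_uniformly {l : Filter ℕ} {r s : ℕ → ℝ[X]} {u v : ℝ → ℝ}
    (hu : ContinuousOn u (Set.Icc (-1) 1)) (hv : ContinuousOn v (Set.Icc (-1) 1))
    (hF : TendstoUniformlyOn (fun n => fn (r n)) u l (Set.Icc (-1) 1))
    (hG : TendstoUniformlyOn (fun n => fn (s n)) v l (Set.Icc (-1) 1)) :
    Tendsto (fun n => pip (r n) (s n)) l (𝓝 (ip u v)) := by
  have := tendsto_ip_mul_of_uniformly (fun n => (continuous_fn (r n)).continuousOn)
    (fun n => (continuous_fn (s n)).continuousOn) hu hv hF hG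
    (w := fun _ => 1) (continuous_const.intervalIntegrable _ _)
  simpa only [one_mul, ← pip_apply] using this

/-- After one integration by parts the energy contains first derivatives and boundary values only,
so that `C¹` convergence suffices; the limit is evaluated by the equation for `y₂`. -/
theorem tendsto_energy {lam lam₂ : ℝ} {y dy y₂ dy₂ : ℝ → ℝ} (h : IsSol p.q lam y dy)
    (h₂ : IsSol p.q lam₂ y₂ dy₂) {r s : ℕ → ℝ[X]}
    (hr : TendstoUniformlyOn (fun n => fn (r n)) y atTop (Set.Icc (-1) 1))
    (hr' : TendstoUniformlyOn (fun n => fn (derivative (r n))) dy atTop (Set.Icc (-1) 1))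
    (hs : TendstoUniformlyOn (fun n => fn (s n)) y₂ atTop (Set.Icc (-1) 1))
    (hs' : TendstoUniformlyOn (fun n => fn (derivative (s n))) dy₂ atTop (Set.Icc (-1) 1)) :
    Tendsto (fun n => p.energy (r n) (s n)) atTop (𝓝 (lam₂ * ip y y₂)) := by
  have m1 : (1 : ℝ) ∈ Set.Icc (-1 : ℝ) 1 := by norm_num
  have m2 : (-1 : ℝ) ∈ Set.Icc (-1 : ℝ) 1 := by norm_num
  have h1 := tendsto_pip_of_uniformly h₂.dcont h.dcont hs' hr'
  have h2 := tendsto_ip_mul_of_uniformly (fun n => (continuous_fn (r n)).continuousOn)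
    (fun n => (continuous_fn (s n)).continuousOn) h.cont h₂.cont hr hs p.isPotential.int
  have h3 := ((hs'.tendsto_at m1).mul (hr.tendsto_at m1)).sub
    ((hs'.tendsto_at m2).mul (hr.tendsto_at m2))
  have h4 := (h3.sub h1).neg.add h2
  have key : -(dy₂ 1 * y 1 - dy₂ (-1) * y (-1) - ip dy₂ dy) + ip y (fun x => p.q x * y₂ x) =
      lam₂ * ip y y₂ := by
    have i1 := intervalIntegrable_mul_of_continuousOn' h₂.dcont h.dcont
    have i2 : IntervalIntegrable (fun x => y x * ((p.q x - lam₂) * y₂ x)) volume (-1) 1 :=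
      intervalIntegrable_mul_of_continuousOn h.cont
        (IsSol.intervalIntegrable_potential_mul p.isPotential h₂.cont lam₂)
    have e := intervalIntegral.integral_eq_sub_of_hasDerivAt_of_le (a := -1) (b := 1)
      (by norm_num) (f := fun x => dy₂ x * y x)
      (f' := fun x => dy₂ x * dy x + y x * ((p.q x - lam₂) * y₂ x)) (h₂.dcont.mul h.cont)
      (fun x hx => by
        convert! (h₂.dder x hx).mul (h.der x hx) using 1
        ring) (i1.add i2)
    rw [intervalIntegral.integral_add i1 i2] at e
    have i3 : IntervalIntegrable (fun x => y x * (p.q x * y₂ x)) volume (-1) 1 :=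
      intervalIntegrable_mul_of_continuousOn h.cont (p.intervalIntegrable_q_mul h₂.cont)
    have i4 : IntervalIntegrable (fun x => y x * (lam₂ * y₂ x)) volume (-1) 1 :=
      intervalIntegrable_mul_of_continuousOn h.cont
        ((intervalIntegrable_of_continuousOn h₂.cont).const_mul _)
    have e2 := ip_sub_right i3 i4
    rw [ip_const_mul_right] at e2
    have e3 : ip y (fun x => p.q x * y₂ x - lam₂ * y₂ x) =
        ∫ x in (-1 : ℝ)..1, y x * ((p.q x - lam₂) * y₂ x) := by
      simp only [ip]; congr 1; ext x; ring
    rw [← e3, e2] at e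
    change ip dy₂ dy + _ = _ at e
    linarith
  rw [key] at h4
  refine h4.congr fun n => ?_
  have := pip_derivative (derivative (s n)) (r n)
  rw [eval_mul, eval_mul, pip_comm] at this
  rw [Problem.energy, this]
  simp only [fn]

theorem Problem.IsEigenvalueOfIndex.encard_le {k : ℕ} {lam : ℝ} (h : p.IsEigenvalueOfIndex k lam) :
    {μ : ℝ | p.IsEigenvalue μ ∧ μ ≤ lam}.encard = k := by
  have : {μ : ℝ | p.IsEigenvalue μ ∧ μ ≤ lam} =
      insert lam {μ : ℝ | p.IsEigenvalue μ ∧ μ < lam} := by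
    ext μ
    simp only [Set.mem_ofPred_eq, Set.mem_insert_iff, le_iff_lt_or_eq]
    constructor
    · rintro ⟨h1, h2 | h2⟩
      · exact Or.inr ⟨h1, h2⟩
      · exact Or.inl h2
    · rintro (rfl | h1)
      · exact ⟨h.1, Or.inr rfl⟩
      · exact ⟨h1.1, Or.inl h1.2⟩
  rw [this, Set.encard_insert_of_notMem (by simp), h.2]

/-- The upper bound: the approximations of the first `k` eigenfunctions are trial functions. -/
theorem eventually_numEigenvalue_lt (hR : p.IsBasis R) {k : ℕ} {lam : ℝ}
    (hlam : p.IsEigenvalueOfIndex k lam) {lamN : ℕ → ℝ}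
    (hlamN : ∀ᶠ N in atTop, p.IsNumEigenvalueOfIndex R N k (lamN N)) {μ : ℝ} (hμ : lam < μ) :
    ∀ᶠ N in atTop, lamN N < μ := by
  set T := {ν : ℝ | p.IsEigenvalue ν ∧ ν ≤ lam} with hT
  have hcard : T.encard = k := hlam.encard_le
  have hfin : T.Finite := Set.finite_of_encard_eq_coe hcard
  let _ : Fintype T := hfin.fintype
  have hk : Fintype.card T = k := by
    have := Set.encard_eq_coe_toFinset_card T
    rw [hcard, Set.toFinset_card] at this
    exact_mod_cast this.symm
  choose y hy using fun i : T => i.2.1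
  choose hsol hbc using fun i : T => (hy i).isSol
  set dy : T → ℝ → ℝ := fun i => derivWithin (y i) (Set.Icc (-1) 1) with hdy
  choose r hr1 hr2 using fun (i : T) (m : ℕ) =>
    (hsol i).exists_poly_near (hbc i) (ε := 1 / ((m : ℝ) + 1)) (by positivity)
  have hsmall : ∀ ε > (0 : ℝ), ∀ᶠ m : ℕ in atTop, 1 / ((m : ℝ) + 1) < ε := fun ε hε =>
    tendsto_one_div_add_atTop_nhds_zero_nat.eventually (gt_mem_nhds hε)
  have hu : ∀ i, TendstoUniformlyOn (fun m => fn (r i m)) (y i) atTop (Set.Icc (-1) 1) := by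
    intro i
    rw [Metric.tendstoUniformlyOn_iff]
    intro ε hε
    filter_upwards [hsmall ε hε] with m hm x hx
    rw [dist_comm, Real.dist_eq]
    exact (hr2 i m x hx).1.trans_lt hm
  have hu' : ∀ i, TendstoUniformlyOn (fun m => fn (derivative (r i m))) (dy i) atTop
      (Set.Icc (-1) 1) := by
    intro i
    rw [Metric.tendstoUniformlyOn_iff]
    intro ε hε
    filter_upwards [hsmall ε hε] with m hm x hx
    rw [dist_comm, Real.dist_eq]
    exact (hr2 i m x hx).2.trans_lt hm
  -- The matrix of `μ * pip - energy` tends to the diagonal matrix with the entries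
  -- `(μ - i) * ⟨y i, y i⟩`, which is positive definite.
  set D : T → T → ℕ → ℝ := fun i j m => μ * pip (r i m) (r j m) - p.energy (r i m) (r j m) with hD
  have hlim : ∀ i j, Tendsto (D i j) atTop (𝓝 ((μ - j) * ip (y i) (y j))) := by
    intro i j
    have := ((tendsto_pip_of_uniformly (hsol i).cont (hsol j).cont (hu i) (hu j)).const_mul μ).sub
      (tendsto_energy (hsol i) (hsol j) (hu i) (hu' i) (hu j) (hu' j))
    rwa [← sub_mul] at this
  have hpos : ∀ i, 0 < (μ - i) * ip (y i) (y i) := by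
    intro i
    have h1 := i.2.2
    obtain ⟨x, hx, hx0⟩ := (hy i).ne_zero
    refine mul_pos (by linarith) ?_
    exact intervalIntegral.integral_pos (by norm_num) ((hsol i).cont.mul (hsol i).cont)
      (fun x _ => mul_self_nonneg _) ⟨x, hx, mul_self_pos.2 hx0⟩
  obtain ⟨d, hd⟩ : ∃ d : ℝ, 0 < d ∧ ∀ i, d ≤ (μ - i) * ip (y i) (y i) := by
    have : ∀ᶠ d : ℝ in 𝓝[>] 0, 0 < d ∧ ∀ i, d ≤ (μ - i) * ip (y i) (y i) := by
      refine Eventually.and self_mem_nhdsWithin (eventually_all.2 fun i => ?_)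
      exact mem_nhdsWithin_of_mem_nhds (Iic_mem_nhds (hpos i))
    exact this.exists
  obtain ⟨hd0, hd⟩ := hd
  -- errors below `δ` in the entries change the quadratic form by at most half its lower bound `d`
  set δ := d / (2 * (k + 1)) with hδ
  have hδ0 : 0 < δ := by positivity
  obtain ⟨m, hm⟩ : ∃ m, ∀ i j, |D i j m - (μ - j) * ip (y i) (y j)| < δ := by
    have : ∀ᶠ m in atTop, ∀ i j, |D i j m - (μ - j) * ip (y i) (y j)| < δ :=
      eventually_all.2 fun i => eventually_all.2 fun j =>
        (Metric.tendsto_nhds.1 (hlim i j)) δ hδ0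
    exact this.exists
  set f : (T → ℝ) →ₗ[ℝ] ℝ[X] := Fintype.linearCombination ℝ fun i => r i m with hf
  have hform : ∀ t, t ≠ 0 → p.energy (f t) (f t) < μ * pip (f t) (f t) := by
    intro t ht
    have e1 : μ * pip (f t) (f t) - p.energy (f t) (f t) = ∑ i, ∑ j, t i * t j * D i j m := by
      rw [← Problem.energyForm_apply, hf, Fintype.linearCombination_apply]
      simp only [map_sum, LinearMap.sum_apply, map_smul, LinearMap.smul_apply, smul_eq_mul, hD,
        Problem.energyForm_apply, Finset.mul_sum]
      rw [← Finset.sum_sub_distrib]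
      rw [Finset.sum_comm]
      refine Finset.sum_congr rfl fun i _ => ?_
      rw [← Finset.sum_sub_distrib]
      refine Finset.sum_congr rfl fun j _ => ?_
      ring
    have e2 : ∀ i, ∑ j, t i * t j * D i j m ≥ d * t i ^ 2 - δ * ∑ j, |t i| * |t j| := by
      intro i
      have e3 : ∑ j, t i * t j * ((μ - j) * ip (y i) (y j)) =
          t i ^ 2 * ((μ - i) * ip (y i) (y i)) := by
        rw [Finset.sum_eq_single i]
        · ring
        · intro j _ hj
          rw [(hsol i).orthogonal (hsol j) p.isPotential (hbc i) (hbc j)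
            (fun h => hj (Subtype.ext h.symm))]
          ring
        · simp
      have e4 : ∑ j, t i * t j * D i j m ≥
          ∑ j, (t i * t j * ((μ - j) * ip (y i) (y j)) - δ * (|t i| * |t j|)) := by
        refine Finset.sum_le_sum fun j _ => ?_
        have h1 : |t i * t j * (D i j m - (μ - j) * ip (y i) (y j))| ≤ |t i| * |t j| * δ := by
          rw [abs_mul, abs_mul]
          exact mul_le_mul_of_nonneg_left (hm i j).le (by positivity)
        have := (abs_le.1 h1).1
        linarith
      rw [Finset.sum_sub_distrib, e3, ← Finset.mul_sum] at e4
      have := mul_le_mul_of_nonneg_left (hd i) (sq_nonneg (t i))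
      linarith
    have e5 : ∑ i, ∑ j, t i * t j * D i j m ≥
        d * ∑ i, t i ^ 2 - δ * (∑ i, |t i|) ^ 2 := by
      refine le_trans (le_of_eq ?_) (Finset.sum_le_sum fun i _ => e2 i)
      rw [Finset.sum_sub_distrib, ← Finset.mul_sum, ← Finset.mul_sum, sq, Finset.sum_mul_sum]
    have e6 : (∑ i, |t i|) ^ 2 ≤ k * ∑ i, t i ^ 2 := by
      have := sq_sum_le_card_mul_sum_sq (s := Finset.univ) (f := fun i => |t i|)
      rw [Finset.card_univ, hk] at this
      simpa using this
    have e7 : 0 < ∑ i, t i ^ 2 := by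
      obtain ⟨i, hi⟩ := Function.ne_iff.1 ht
      exact Finset.sum_pos' (fun i _ => sq_nonneg _) ⟨i, Finset.mem_univ _, by
        have : t i ≠ 0 := hi
        positivity⟩
    have e8 : δ * k ≤ d / 2 := by
      rw [hδ, div_mul_eq_mul_div, div_le_div_iff₀ (by positivity) (by norm_num)]
      nlinarith
    have e9 : δ * (∑ i, |t i|) ^ 2 ≤ d / 2 * ∑ i, t i ^ 2 := by
      refine (mul_le_mul_of_nonneg_left e6 hδ0.le).trans ?_
      rw [← mul_assoc]
      exact mul_le_mul_of_nonneg_right e8 e7.le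
    have : 0 < d * ∑ i, t i ^ 2 := mul_pos hd0 e7
    linarith
  filter_upwards [hlamN, hR.span_eq, eventually_ge_atTop (∑ i, (r i m).natDegree)] with N h1 h2 h3
  obtain ⟨E⟩ := hR.nonempty_numEigenbasis N
  refine E.lt_of_forall_energy_lt h1 hk f (fun t => ?_) hform
  rw [range_comb, h2, hf, Fintype.linearCombination_apply]
  refine Submodule.sum_mem _ fun i _ => Submodule.smul_mem _ _ ⟨?_, hr1 i m⟩
  have := Finset.single_le_sum (f := fun i => (r i m).natDegree) (fun _ _ => Nat.zero_le _)
    (Finset.mem_univ i)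
  omega

theorem hsq_smul (κ : ℝ) (r : ℝ[X]) : hsq (κ • r) = κ ^ 2 * hsq r := by
  rw [hsq, smul_eq_C_mul, derivative_C_mul, pip_C_mul_left, pip_C_mul_right, pip_C_mul_left,
    pip_C_mul_right, hsq]
  ring

/-- Normalized, mutually orthogonal numerical eigenfunctions. -/
theorem NumEigenbasis.exists_family {N : ℕ} (E : NumEigenbasis p R N) {k : ℕ}
    {μ : ℝ} (h : p.IsNumEigenvalueOfIndex R N k μ) : ∃ (φ : Fin k → ℝ[X]) (ν : Fin k → ℝ),
      (∀ j, φ j ∈ LinearMap.range (comb R N)) ∧ (∀ j, hsq (φ j) = 1) ∧ (∀ j, ν j ≤ μ) ∧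
      (∀ j, ∀ ψ ∈ LinearMap.range (comb R N), p.energy (φ j) ψ = ν j * pip (φ j) ψ) ∧
      ∀ i j, i ≠ j → pip (φ i) (φ j) = 0 := by
  have hle := E.le_card h
  rw [← Fintype.card_coe] at hle
  nth_rw 1 [← Fintype.card_fin k] at hle
  obtain ⟨g⟩ := Function.Embedding.nonempty_of_card_le hle
  have hg : ∀ j, E.ν (g j) ≤ μ := fun j => (Finset.mem_filter.1 (g j).2).2
  set r : Fin k → ℝ[X] := fun j => comb R N (E.b (g j)) with hr
  have hone : ∀ j, pip (r j) (r j) = 1 := fun j => by rw [hr, E.orthonormal, if_pos rfl]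
  have hpos : ∀ j, 0 < hsq (r j) := fun j => by
    rw [hsq, hone]; linarith [pip_self_nonneg (derivative (r j))]
  set κ : Fin k → ℝ := fun j => (Real.sqrt (hsq (r j)))⁻¹ with hκ
  refine ⟨fun j => κ j • r j, fun j => E.ν (g j), fun j => ?_, fun j => ?_, hg, ?_, ?_⟩
  · exact Submodule.smul_mem _ _ ⟨_, rfl⟩
  · rw [hsq_smul, hκ, inv_pow, Real.sq_sqrt (hpos j).le, inv_mul_cancel₀ (hpos j).ne']
  · rintro j _ ⟨ζ, rfl⟩
    rw [← Problem.energyForm_apply, map_smul, map_smul, LinearMap.smul_apply, LinearMap.smul_apply,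
      Problem.energyForm_apply, E.energy_eq, smul_eq_mul, smul_eq_mul]
    ring
  · intro i j hij
    rw [map_smul, map_smul, LinearMap.smul_apply, hr, E.orthonormal, if_neg, smul_zero, smul_zero]
    exact fun h => hij (g.injective (Subtype.ext h))

theorem Problem.IsEigenfunction.ip_self_pos {lam : ℝ} {y : ℝ → ℝ} (h : p.IsEigenfunction lam y) :
    0 < ip y y := by
  obtain ⟨x, hx, hx0⟩ := h.ne_zero
  exact intervalIntegral.integral_pos (by norm_num) (h.isSol.1.cont.mul h.isSol.1.cont)
    (fun x _ => mul_self_nonneg _) ⟨x, hx, mul_self_pos.2 hx0⟩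

theorem Problem.IsEigenfunction.exists_eq_mul {lam : ℝ} {y u : ℝ → ℝ} (h : p.IsEigenfunction lam y)
    (hu : p.IsEigenfunction lam u) : ∃ κ ≠ 0, ∀ x ∈ Set.Icc (-1 : ℝ) 1, u x = κ * y x := by
  obtain ⟨κ, hκ⟩ := h.isSol.1.proportional hu.isSol.1 p.isPotential h.isSol.2.2 hu.isSol.2.2
      h.ne_zero
  refine ⟨κ, ?_, hκ⟩
  rintro rfl
  obtain ⟨x, hx, hx0⟩ := hu.ne_zero
  exact hx0 (by rw [hκ x hx, zero_mul])

theorem Problem.IsEigenfunction.ip_ne_zero {lam : ℝ} {y u : ℝ → ℝ} (h : p.IsEigenfunction lam y)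
    (hu : p.IsEigenfunction lam u) : ip u y ≠ 0 := by
  obtain ⟨κ, hκ0, hκ⟩ := h.exists_eq_mul hu
  have : ip u y = κ * ip y y := by
    rw [← ip_const_mul_right]
    exact ip_congr fun x hx => by rw [hκ x ⟨hx.1.le, hx.2.le⟩]; ring
  rw [this]
  exact mul_ne_zero hκ0 h.ip_self_pos.ne'

/-- The lower bound: `k` numerical eigenvalues below a number less than `lam` would produce, in the
limit, `k` orthogonal eigenfunctions for eigenvalues less than `lam`. -/
theorem eventually_lt_numEigenvalue (hR : p.IsBasis R) {k : ℕ} {lam : ℝ}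
    (hlam : p.IsEigenvalueOfIndex k lam) {lamN : ℕ → ℝ}
    (hlamN : ∀ᶠ N in atTop, p.IsNumEigenvalueOfIndex R N k (lamN N)) {μ : ℝ} (hμ : μ < lam) :
    ∀ᶠ N in atTop, μ < lamN N := by
  by_contra hcon
  have hfreq : ∃ᶠ N in atTop, lamN N ≤ μ := by
    simpa only [Filter.Frequently, not_le] using hcon
  have hne : (atTop ⊓ 𝓟 {N | lamN N ≤ μ}).NeBot := frequently_mem_iff_neBot.1 hfreq
  obtain ⟨U, hU⟩ := Ultrafilter.exists_le (atTop ⊓ 𝓟 {N | lamN N ≤ μ})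
  have hUtop : (U : Filter ℕ) ≤ atTop := hU.trans inf_le_left
  have hUle : ∀ᶠ N in U, lamN N ≤ μ := hU.trans inf_le_right (mem_principal_self _)
  have hex : ∀ N, ∃ (φ : Fin k → ℝ[X]) (ν : Fin k → ℝ), p.IsNumEigenvalueOfIndex R N k (lamN N) →
      (∀ j, φ j ∈ LinearMap.range (comb R N)) ∧ (∀ j, hsq (φ j) = 1) ∧ (∀ j, ν j ≤ lamN N) ∧
      (∀ j, ∀ ψ ∈ LinearMap.range (comb R N), p.energy (φ j) ψ = ν j * pip (φ j) ψ) ∧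
      ∀ i j, i ≠ j → pip (φ i) (φ j) = 0 := by
    intro N
    by_cases h : p.IsNumEigenvalueOfIndex R N k (lamN N)
    · obtain ⟨E⟩ := hR.nonempty_numEigenbasis N
      obtain ⟨φ, ν, h1⟩ := E.exists_family h
      exact ⟨φ, ν, fun _ => h1⟩
    · exact ⟨0, 0, fun h' => absurd h' h⟩
  choose φ ν hφ using hex
  have hgood := hUtop hlamN
  have hspan : ∀ᶠ N in U, LinearMap.range (comb R N) = polySpace p N := by
    filter_upwards [hUtop hR.span_eq] with N hN
    rw [range_comb, hN]
  obtain ⟨K, hK, hcoer⟩ := p.exists_coercive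
  -- the energy is bounded from below, hence so are the numerical eigenvalues
  have hνbd : ∀ j, ∀ᶠ N in U, ν N j ∈ Set.Icc (-(K / 2)) μ := by
    intro j
    filter_upwards [hgood, hUle, hspan] with N h1 h2 h3
    obtain ⟨a1, a2, a3, a4, _⟩ := hφ N h1
    refine ⟨?_, (a3 j).trans h2⟩
    have b1 := hcoer (φ N j) (h3 ▸ a1 j : φ N j ∈ polySpace p N).2
    rw [a2, a4 j _ (a1 j)] at b1
    by_contra! hlt
    nlinarith [pip_self_nonneg (φ N j)]
  have hlimν : ∀ j, ∃ ν₀ ∈ Set.Icc (-(K / 2)) μ, Tendsto (fun N => ν N j) U (𝓝 ν₀) := by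
    intro j
    obtain ⟨l, hl, hl'⟩ := (isCompact_Icc (a := -(K / 2)) (b := μ)).ultrafilter_le_nhds
      (U.map fun N => ν N j) (by
        rw [Ultrafilter.coe_map, le_principal_iff, Filter.mem_map]
        exact hνbd j)
    exact ⟨l, hl, hl'⟩
  choose ν₀ hν₀ hν₀' using hlimν
  have hlimφ : ∀ j, ∃ u, TendstoUniformlyOn (fun N => fn (φ N j)) u U (Set.Icc (-1) 1) ∧
      p.IsEigenfunction (ν₀ j) u := by
    intro j
    refine exists_limit_eigenfunction hUtop (ε := fun _ => 0) ?_ ?_ (hν₀' j) tendsto_const_nhds ?_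
    · filter_upwards [hgood, hspan] with N h1 h2 using h2 ▸ (hφ N h1).1 j
    · filter_upwards [hgood] with N h1 using (hφ N h1).2.1 j
    · filter_upwards [hgood, hspan] with N h1 h2 ψ hψ
      rw [(hφ N h1).2.2.2.1 j ψ (h2 ▸ hψ), sub_self, abs_zero, zero_mul]
  choose u hu hu' using hlimφ
  have horth : ∀ i j, i ≠ j → ip (u i) (u j) = 0 := by
    intro i j hij
    refine tendsto_nhds_unique (tendsto_pip_of_uniformly (hu' i).isSol.1.cont (hu' j).isSol.1.cont
      (hu i) (hu j)) (tendsto_const_nhds.congr' ?_)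
    filter_upwards [hgood] with N h1 using ((hφ N h1).2.2.2.2 i j hij).symm
  -- eigenvalues are simple, so orthogonal eigenfunctions belong to different ones
  have hinj : Function.Injective ν₀ := by
    intro i j hij
    by_contra hne
    exact (hu' j).ip_ne_zero (hij ▸ hu' i) (horth i j hne)
  have hsub : Set.range ν₀ ⊆ {ν | p.IsEigenvalue ν ∧ ν < lam} := by
    rintro _ ⟨j, rfl⟩
    exact ⟨⟨u j, hu' j⟩, (hν₀ j).2.trans_lt hμ⟩
  have h1 := Set.encard_le_encard hsub
  rw [← Set.image_univ, hinj.encard_image, Set.encard_univ, ENat.card_eq_coe_fintype_card,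
    Fintype.card_fin, ← hlam.2] at h1
  have hfin : {ν : ℝ | p.IsEigenvalue ν ∧ ν < lam}.encard ≠ ⊤ := fun h => by
    have := hlam.2
    rw [h] at this
    exact ENat.natCast_ne_top k this.symm
  exact absurd h1 (not_le.2 ((ENat.lt_add_one_iff hfin).2 le_rfl))

theorem tendsto_numEigenvalue (hR : p.IsBasis R) {k : ℕ} {lam : ℝ}
    (hlam : p.IsEigenvalueOfIndex k lam) {lamN : ℕ → ℝ}
    (hlamN : ∀ᶠ N in atTop, p.IsNumEigenvalueOfIndex R N k (lamN N)) :
    Tendsto lamN atTop (𝓝 lam) :=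
  tendsto_order.2 ⟨fun _ h => eventually_lt_numEigenvalue hR hlam hlamN h,
    fun _ h => eventually_numEigenvalue_lt hR hlam hlamN h⟩

end

/-! ### Tails of the expansion -/

/-- Tails of series with terms of order `n ^ s`. The exponent `s + 5 / 4` instead of the optimal
`s + 1` is good enough for all applications. -/
theorem isBigO_tsum_tail {u : ℕ → ℝ} {s : ℝ} (hu : u =O[atTop] fun n : ℕ => (n : ℝ) ^ s)
    (hs : s ≤ -(5 / 4)) : (Summable fun n => |u n|) ∧
      (fun N => ∑' n, |u (N + n)|) =O[atTop] fun N : ℕ => (N : ℝ) ^ (s + 5 / 4) := by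
  have hz : Summable fun n : ℕ => (n : ℝ) ^ (-(5 / 4) : ℝ) :=
    Real.summable_nat_rpow.2 (by norm_num)
  have hsum : Summable fun n => |u n| :=
    summable_of_isBigO_nat hz (hu.norm_left.trans (isBigO_rpow_of_le hs))
  refine ⟨hsum, ?_⟩
  obtain ⟨K, hK0, hK⟩ := hu.exists_pos
  obtain ⟨N₀, hN₀⟩ := eventually_atTop.1 hK.bound
  refine IsBigO.of_bound (K * ∑' n : ℕ, (n : ℝ) ^ (-(5 / 4) : ℝ)) ?_
  filter_upwards [eventually_ge_atTop N₀, eventually_gt_atTop 0] with N h1 h2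
  have hN : (0 : ℝ) < N := by exact_mod_cast h2
  have hshift : ∀ {v : ℕ → ℝ}, Summable v → Summable fun n => v (N + n) := fun hv => by
    simpa only [add_comm] using (summable_nat_add_iff N).2 hv
  have hz' := hshift hz
  rw [Real.norm_of_nonneg (tsum_nonneg fun _ => abs_nonneg _), Real.norm_of_nonneg (by positivity)]
  have hle : ∀ n : ℕ, |u (N + n)| ≤
      K * (N : ℝ) ^ (s + 5 / 4) * ((N + n : ℕ) : ℝ) ^ (-(5 / 4) : ℝ) := by
    intro n
    have h3 := hN₀ (N + n) (by omega)
    have h4 : (0 : ℝ) < ((N + n : ℕ) : ℝ) := by positivity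
    rw [Real.norm_eq_abs, Real.norm_of_nonneg (by positivity)] at h3
    refine h3.trans ?_
    rw [mul_assoc]
    refine mul_le_mul_of_nonneg_left ?_ hK0.le
    have e : ((N + n : ℕ) : ℝ) ^ s =
        ((N + n : ℕ) : ℝ) ^ (s + 5 / 4) * ((N + n : ℕ) : ℝ) ^ (-(5 / 4) : ℝ) := by
      rw [← Real.rpow_add h4]; ring_nf
    rw [e]
    refine mul_le_mul_of_nonneg_right ?_ (by positivity)
    exact Real.rpow_le_rpow_of_nonpos hN (by push_cast; linarith [n.cast_nonneg (α := ℝ)])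
      (by linarith)
  refine (Summable.tsum_le_tsum hle (hshift hsum) (hz'.mul_left _)).trans ?_
  rw [tsum_mul_left]
  have h5 : ∑' n : ℕ, ((N + n : ℕ) : ℝ) ^ (-(5 / 4) : ℝ) ≤ ∑' n : ℕ, (n : ℝ) ^ (-(5 / 4) : ℝ) := by
    have := hz.sum_add_tsum_nat_add N
    rw [← this]
    simp only [add_comm N]
    exact le_add_of_nonneg_left (Finset.sum_nonneg fun _ _ => by positivity)
  calc _ ≤ K * (N : ℝ) ^ (s + 5 / 4) * ∑' n : ℕ, (n : ℝ) ^ (-(5 / 4) : ℝ) :=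
        mul_le_mul_of_nonneg_left h5 (by positivity)
    _ = _ := by ring

theorem abs_ip_mul_le {u v w : ℝ → ℝ} {A B : ℝ} (hu : ∀ x ∈ Set.Icc (-1 : ℝ) 1, |u x| ≤ A)
    (hv : ∀ x ∈ Set.Icc (-1 : ℝ) 1, |v x| ≤ B) (hw : IntervalIntegrable w volume (-1) 1) :
    |ip u (fun x => w x * v x)| ≤ A * B * ∫ x in (-1 : ℝ)..1, |w x| := by
  have e : ip u (fun x => w x * v x) = ip (fun x => u x * v x) w := ip_congr fun x _ => by ring
  rw [e]
  refine abs_ip_le (fun x hx => ?_) hw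
  rw [abs_mul]
  exact mul_le_mul (hu x hx) (hv x hx) (abs_nonneg _) ((abs_nonneg _).trans (hu x hx))

section

variable {S : ℕ} {p : Problem S} {R : ℕ → ℝ[X]} {ξ η θ : ℕ → ℝ} {lam : ℝ} {y dy : ℝ → ℝ}
  {c : ℕ → ℝ} {τ : ℝ}

/-- The tail of the expansion. -/
noncomputable def tailFun (R : ℕ → ℝ[X]) (c : ℕ → ℝ) (y : ℝ → ℝ) (N : ℕ) : ℝ → ℝ :=
  fun x => y x - fn (partialSum R c N) x

theorem continuousOn_tailFun (hy : ContinuousOn y (Set.Icc (-1) 1)) (N : ℕ) :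
    ContinuousOn (tailFun R c y N) (Set.Icc (-1) 1) :=
  hy.sub (continuous_fn _).continuousOn

theorem partialSum_add (R : ℕ → ℝ[X]) (c : ℕ → ℝ) (N M : ℕ) : partialSum R c (N + M) =
    partialSum R c N + ∑ n ∈ Finset.range M, C (c (N + n)) * R (N + n) :=
  Finset.sum_range_add _ _ _

namespace CoeffRate

/-- The sup norms of the terms decay like `n ^ (-τ - 1 / 2)`. So the expansion converges uniformly,
and the limit is `y`, having the same moments with polynomials. -/
theorem tailFun_le (h : CoeffRate p R lam y c τ) (hR : BasisCoeff p R ξ η θ)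
    (hc : HasExpansion R y c) (hy : ContinuousOn y (Set.Icc (-1) 1)) :
    ∃ b : ℕ → ℝ, (∀ N, 0 ≤ b N) ∧ (b =O[atTop] fun N : ℕ => (N : ℝ) ^ (3 / 4 - τ)) ∧
      ∀ N, ∀ x ∈ Set.Icc (-1 : ℝ) 1, |tailFun R c y N x| ≤ b N := by
  obtain ⟨K, hK, hsup⟩ := hR.exists_sup_bound
  set u : ℕ → ℝ := fun n => c n * (K / Real.sqrt (n + 1)) with hu
  have hτ := h.two_lt
  have hsq : (fun n : ℕ => K / Real.sqrt ((n : ℝ) + 1)) =O[atTop]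
      fun n : ℕ => (n : ℝ) ^ (-(1 / 2) : ℝ) := by
    refine IsBigO.of_bound K ?_
    filter_upwards [eventually_gt_atTop 0] with n hn
    have hn' : (0 : ℝ) < n := by exact_mod_cast hn
    rw [Real.norm_of_nonneg (by positivity), Real.norm_of_nonneg (by positivity),
      Real.rpow_neg hn'.le, ← Real.sqrt_eq_rpow, ← div_eq_mul_inv]
    gcongr
    linarith
  obtain ⟨hs, hb⟩ := isBigO_tsum_tail (isBigO_rpow_mul h.coeff hsq) (by linarith)
  have hsh : ∀ N, Summable fun n => |u (N + n)| := fun N => by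
    simpa only [add_comm] using (summable_nat_add_iff N).2 hs
  set b : ℕ → ℝ := fun N => ∑' n, |u (N + n)| with hbdef
  have hb' : b =O[atTop] fun N : ℕ => (N : ℝ) ^ (3 / 4 - τ) := by
    refine hb.congr_right fun N => ?_
    congr 1; ring
  have hb0 : Tendsto b atTop (𝓝 0) := hb'.trans_tendsto (tendsto_rpow_neg_nat (by linarith))
  have hterm : ∀ n, ∀ x ∈ Set.Icc (-1 : ℝ) 1, |c n * fn (R n) x| ≤ |u n| := by
    intro n x hx
    rw [hu, abs_mul, abs_mul, abs_of_nonneg (show 0 ≤ K / Real.sqrt ((n : ℝ) + 1) by positivity)]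
    exact mul_le_mul_of_nonneg_left (hsup n x hx) (abs_nonneg _)
  have hxs : ∀ x ∈ Set.Icc (-1 : ℝ) 1, Summable fun n => c n * fn (R n) x := fun x hx =>
    Summable.of_norm_bounded hs fun n => hterm n x hx
  set g : ℝ → ℝ := fun x => ∑' n, c n * fn (R n) x with hg
  have hgb : ∀ N, ∀ x ∈ Set.Icc (-1 : ℝ) 1, |g x - fn (partialSum R c N) x| ≤ b N := by
    intro N x hx
    have e : g x - fn (partialSum R c N) x = ∑' n, c (N + n) * fn (R (N + n)) x := by
      have := (hxs x hx).sum_add_tsum_nat_add N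
      rw [fn_partialSum]
      change (∑' n, c n * fn (R n) x) - _ = _
      rw [← this]
      simp only [add_comm N]; ring
    rw [e, hbdef, ← Real.norm_eq_abs]
    exact tsum_of_norm_bounded (hsh N).hasSum fun n => hterm (N + n) x hx
  have hunif : TendstoUniformlyOn (fun N => fn (partialSum R c N)) g atTop (Set.Icc (-1) 1) := by
    rw [Metric.tendstoUniformlyOn_iff]
    intro ε hε
    filter_upwards [hb0.eventually (gt_mem_nhds hε)] with N hN x hx
    rw [Real.dist_eq]
    exact (hgb N x hx).trans_lt hN
  have hcF : ∀ N, ContinuousOn (fn (partialSum R c N)) (Set.Icc (-1) 1) := fun N =>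
    (continuous_fn _).continuousOn
  have hgc : ContinuousOn g (Set.Icc (-1) 1) := hunif.continuousOn (Frequently.of_forall hcF)
  have hgy : ∀ x ∈ Set.Icc (-1 : ℝ) 1, y x - g x = 0 := by
    refine eq_zero_of_ip_fn_eq_zero (hy.sub hgc) fun r => ?_
    have hr := (continuous_fn r).continuousOn (s := Set.Icc (-1) 1)
    have h1 := hc.tendsto_ip hy hr
    have h2 := tendsto_ip_of_uniformly hcF hgc hunif (intervalIntegrable_of_continuousOn hr)
    have h3 := ip_sub_right (intervalIntegrable_mul_of_continuousOn' hr hy)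
      (intervalIntegrable_mul_of_continuousOn' hr hgc)
    rw [ip_comm (fun x => y x - g x), h3, ip_comm _ y, ip_comm _ g, tendsto_nhds_unique h1 h2,
      sub_self]
  refine ⟨b, fun N => tsum_nonneg fun _ => abs_nonneg _, hb', fun N x hx => ?_⟩
  rw [tailFun, sub_eq_zero.1 (hgy x hx)]
  exact hgb N x hx

theorem summable_mul_ip (h : CoeffRate p R lam y c τ) (hR : BasisCoeff p R ξ η θ) {v : ℝ → ℝ}
    (hv : IntervalIntegrable v volume (-1) 1) (N : ℕ) :
    Summable fun n => c (N + n) * ip (fn (R (N + n))) v := by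
  obtain ⟨K, hK⟩ := hR.isBigO_ip hv
  have h1 : (fun n => ip (fn (R n)) v) =O[atTop] fun n : ℕ => (n : ℝ) ^ (0 : ℝ) := by
    refine IsBigO.of_bound |K| (Eventually.of_forall fun n => ?_)
    rw [Real.rpow_zero, norm_one, mul_one]
    refine (hK n).trans ((mul_le_mul_of_nonneg_right (le_abs_self K) (by positivity)).trans
      (mul_le_of_le_one_right (abs_nonneg _) ?_))
    exact Real.rpow_le_one_of_one_le_of_nonpos (by linarith [n.cast_nonneg (α := ℝ)]) (by norm_num)
  have h2 := (isBigO_tsum_tail (isBigO_rpow_mul h.coeff h1) (by linarith [h.two_lt])).1.of_abs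
  simpa only [add_comm] using (summable_nat_add_iff N).2 h2

theorem ip_tailFun (h : CoeffRate p R lam y c τ) (hR : BasisCoeff p R ξ η θ)
    (hc : HasExpansion R y c) (hy : ContinuousOn y (Set.Icc (-1) 1)) {v : ℝ → ℝ}
    (hv : IntervalIntegrable v volume (-1) 1) (N : ℕ) :
    ip (tailFun R c y N) v = ∑' n, c (N + n) * ip (fn (R (N + n))) v := by
  obtain ⟨b, hb0, hb, hle⟩ := h.tailFun_le hR hc hy
  have hlim : Tendsto b atTop (𝓝 0) :=
    hb.trans_tendsto (tendsto_rpow_neg_nat (by linarith [h.two_lt]))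
  have hint : ∀ {u : ℝ → ℝ}, ContinuousOn u (Set.Icc (-1) 1) →
      IntervalIntegrable (fun x => v x * u x) volume (-1) 1 := fun hu => by
    simpa only [mul_comm] using intervalIntegrable_mul_of_continuousOn hu hv
  have hsplit : ∀ M, ip (tailFun R c y N) v - ∑ n ∈ Finset.range M, c (N + n) *
      ip (fn (R (N + n))) v = ip (tailFun R c y (N + M)) v := by
    intro M
    have h1 : ∀ K, ip (tailFun R c y K) v = ip y v - ip (fn (partialSum R c K)) v := fun K => by
      have := ip_sub_right (hint hy) (hint (continuous_fn (partialSum R c K)).continuousOn)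
      rw [ip_comm, ip_comm y, ip_comm (fn _)]
      exact this
    have h2 := congrArg (ipForm v hv) (partialSum_add R c N M)
    rw [map_add, map_sum] at h2
    simp only [ipForm_C_mul] at h2
    change ip (fn (partialSum R c (N + M))) v = ip (fn (partialSum R c N)) v +
      ∑ n ∈ Finset.range M, c (N + n) * ip (fn (R (N + n))) v at h2
    rw [h1, h1, h2]; ring
  have h3 : Tendsto (fun M => ip (tailFun R c y (N + M)) v) atTop (𝓝 0) := by
    have h4 := (hlim.comp (tendsto_add_atTop_nat N)).mul_const (∫ x in (-1 : ℝ)..1, |v x|)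
    rw [zero_mul] at h4
    refine squeeze_zero_norm (fun M => ?_) h4
    rw [Function.comp_apply, add_comm M]
    exact abs_ip_le (hle (N + M)) hv
  have h5 := (h.summable_mul_ip hR hv N).hasSum.tendsto_sum_nat
  have h6 := (tendsto_const_nhds (x := ip (tailFun R c y N) v)).sub h5
  simp only [hsplit] at h6
  linarith [tendsto_nhds_unique h6 h3]

/-- The sum `∑ a n * c n ^ 2` over `n ≥ N`, the leading term of
`(lamN - lam) * ⟨w, y⟩` for numerical eigenfunctions `w` close to `y`. -/
noncomputable def tailEnergy (R : ℕ → ℝ[X]) (c : ℕ → ℝ) (N : ℕ) : ℝ :=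
  ∑' n, aEntry R (N + n) (N + n) * c (N + n) ^ 2

theorem isBigO_energyTerm (h : CoeffRate p R lam y c τ) (hR : BasisCoeff p R ξ η θ) :
    (fun n => aEntry R n n * c n ^ 2) =O[atTop] fun n : ℕ => (n : ℝ) ^ (1 - 2 * τ) := by
  have := isBigO_rpow_mul hR.isBigO_aEntry (isBigO_rpow_mul h.coeff h.coeff)
  refine (this.congr_left fun n => by rw [sq]).congr_right fun n => ?_
  congr 1; ring

theorem isBigO_tailEnergy (h : CoeffRate p R lam y c τ) (hR : BasisCoeff p R ξ η θ) :
    tailEnergy R c =O[atTop] fun N : ℕ => (N : ℝ) ^ (9 / 4 - 2 * τ) := by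
  obtain ⟨h1, h2⟩ := isBigO_tsum_tail (h.isBigO_energyTerm hR) (by linarith [h.two_lt])
  refine IsBigO.trans (IsBigO.of_bound 1 (Eventually.of_forall fun N => ?_))
    (h2.congr_right fun N => by congr 1; ring)
  rw [one_mul, Real.norm_of_nonneg (tsum_nonneg fun _ => abs_nonneg _)]
  refine norm_tsum_le_tsum_norm ?_
  simpa only [add_comm, Real.norm_eq_abs] using (summable_nat_add_iff N).2 h1

/-- Of any two consecutive coefficients one is of the full order `n ^ (-τ)`; it suffices to count
the terms with index in `[N, 2 N]`. -/
theorem lower_tailEnergy (h : CoeffRate p R lam y c τ) (hR : BasisCoeff p R ξ η θ) :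
    (fun N : ℕ => (N : ℝ) ^ (2 - 2 * τ)) =O[atTop] tailEnergy R c := by
  obtain ⟨K, hK0, hK⟩ := (h.coeff_lower hR).exists_pos
  have hs := (isBigO_tsum_tail (h.isBigO_energyTerm hR) (by linarith [h.two_lt])).1.of_abs
  set t : ℕ → ℝ := fun n => aEntry R n n * c n ^ 2 with ht
  obtain ⟨N₀, hN₀⟩ := eventually_atTop.1 (hK.bound.and hR.eventually_aEntry)
  set d : ℝ := (4 * K ^ 2 * 2 ^ (2 * τ - 1))⁻¹ with hd
  have hd0 : 0 < d := by positivity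
  refine IsBigO.of_bound d⁻¹ ?_
  filter_upwards [eventually_ge_atTop N₀, eventually_gt_atTop 0] with N hN hN0
  have hNpos : (0 : ℝ) < N := by exact_mod_cast hN0
  have hsN : Summable fun n => t (N + n) := by
    simpa only [add_comm] using (summable_nat_add_iff N).2 hs
  have htpos : ∀ n, 0 ≤ t (N + n) := fun n =>
    mul_nonneg (hN₀ (N + n) (by omega)).2.2.2.le (sq_nonneg _)
  have hT0 : 0 ≤ tailEnergy R c N := tsum_nonneg htpos
  rw [Real.norm_of_nonneg (by positivity), Real.norm_of_nonneg hT0, ← div_eq_inv_mul,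
    le_div_iff₀ hd0]
  have h1 : ∑ n ∈ Finset.range N, t (N + n) ≤ tailEnergy R c N :=
    hsN.sum_le_tsum _ fun n _ => htpos n
  have h2 : ∑ n ∈ Finset.range N, t (N + (n + 1)) ≤ tailEnergy R c N := by
    have h3 := hsN.sum_le_tsum (Finset.range (N + 1)) fun n _ => htpos n
    rw [Finset.sum_range_succ'] at h3
    have := htpos 0
    exact (le_add_of_nonneg_right this).trans h3
  -- two consecutive terms with index in `[N, 2 N]` add up to at least `const * N ^ (1 - 2 τ)`
  have h4 : ∀ n ∈ Finset.range N,
      (2 * K ^ 2)⁻¹ * (2 * (N : ℝ)) ^ (1 - 2 * τ) ≤ t (N + n) + t (N + (n + 1)) := by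
    intro n hn
    have hn' := Finset.mem_range.1 hn
    obtain ⟨a1, a2, -, -⟩ := hN₀ (N + n) (by omega)
    obtain ⟨-, b2, -, -⟩ := hN₀ (N + (n + 1)) (by omega)
    set m : ℝ := ((N + n : ℕ) : ℝ) with hm
    have hm0 : 0 < m := by rw [hm]; positivity
    have hm2 : m ≤ 2 * N := by
      rw [hm]; push_cast
      have : (n : ℝ) ≤ N := by exact_mod_cast hn'.le
      linarith
    rw [Real.norm_of_nonneg (by positivity), Real.norm_of_nonneg (by positivity)] at a1
    have e1 : m ^ (-τ) * m ^ (-τ) = m ^ (-(2 * τ)) := by rw [← Real.rpow_add hm0]; ring_nf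
    have e2 : m ^ (-(2 * τ)) ≤ 2 * K ^ 2 * (c (N + n) ^ 2 + c (N + n + 1) ^ 2) := by
      rw [← e1]
      have e3 := mul_le_mul a1 a1 (by positivity) (by positivity)
      refine e3.trans ?_
      have := sq_abs (c (N + n))
      have := sq_abs (c (N + n + 1))
      nlinarith [mul_nonneg (sq_nonneg K) (sq_nonneg (|c (N + n)| - |c (N + n + 1)|))]
    have e4 : m * m ^ (-(2 * τ)) = m ^ (1 - 2 * τ) := by
      conv_lhs => enter [1]; rw [← Real.rpow_one m]
      rw [← Real.rpow_add hm0]; ring_nf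
    have e5 : (2 * (N : ℝ)) ^ (1 - 2 * τ) ≤ m ^ (1 - 2 * τ) :=
      Real.rpow_le_rpow_of_nonpos hm0 hm2 (by linarith [h.two_lt])
    have e6 : m * (c (N + n) ^ 2 + c (N + n + 1) ^ 2) ≤ t (N + n) + t (N + (n + 1)) := by
      rw [mul_add]
      refine add_le_add (mul_le_mul_of_nonneg_right a2 (sq_nonneg _))
        (mul_le_mul_of_nonneg_right (le_trans ?_ b2) (sq_nonneg _))
      rw [hm]; push_cast; linarith
    rw [inv_mul_le_iff₀ (by positivity)]
    refine e5.trans ?_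
    rw [← e4]
    calc m * m ^ (-(2 * τ)) ≤ m * (2 * K ^ 2 * (c (N + n) ^ 2 + c (N + n + 1) ^ 2)) :=
          mul_le_mul_of_nonneg_left e2 hm0.le
      _ = 2 * K ^ 2 * (m * (c (N + n) ^ 2 + c (N + n + 1) ^ 2)) := by ring
      _ ≤ _ := mul_le_mul_of_nonneg_left e6 (by positivity)
  have h5 := Finset.sum_le_sum h4
  rw [Finset.sum_const, Finset.card_range, nsmul_eq_mul, Finset.sum_add_distrib] at h5
  have h6 : (N : ℝ) * ((2 * K ^ 2)⁻¹ * (2 * (N : ℝ)) ^ (1 - 2 * τ)) =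
      2 * ((N : ℝ) ^ (2 - 2 * τ) * d) := by
    have e1 : (N : ℝ) ^ (2 - 2 * τ) = N * (N : ℝ) ^ (1 - 2 * τ) := by
      conv_rhs => enter [1]; rw [← Real.rpow_one (N : ℝ)]
      rw [← Real.rpow_add hNpos]; ring_nf
    have e2 : (2 : ℝ) ^ (1 - 2 * τ) = (2 ^ (2 * τ - 1))⁻¹ := by
      rw [← Real.rpow_neg (by norm_num)]; ring_nf
    rw [e1, Real.mul_rpow (by norm_num) hNpos.le, e2, hd]
    field_simp
    ring
  linarith

/-- The identity `c n * a n = lam * ⟨R n, y⟩ - ⟨R n, q y⟩`, multiplied by `c n` and summed over the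
tail. -/
theorem ip_tailFun_q_sub (h : CoeffRate p R lam y c τ) (hR : BasisCoeff p R ξ η θ)
    (hc : HasExpansion R y c) (hy : ContinuousOn y (Set.Icc (-1) 1)) (N : ℕ) :
    ip (tailFun R c y N) (fun x => p.q x * y x) - lam * ip (tailFun R c y N) y =
      -tailEnergy R c N := by
  have h1 := p.intervalIntegrable_q_mul hy
  have h2 := intervalIntegrable_of_continuousOn hy
  have s1 := h.summable_mul_ip hR h1 N
  have s2 := h.summable_mul_ip hR h2 N
  rw [h.ip_tailFun hR hc hy h1, h.ip_tailFun hR hc hy h2, ← tsum_mul_left,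
    ← s1.tsum_sub (s2.mul_left lam), tailEnergy, ← tsum_neg]
  refine tsum_congr fun n => ?_
  have := h.eq (N + n)
  linear_combination c (N + n) * this

theorem isBigO_ip_tailFun (h : CoeffRate p R lam y c τ) (hR : BasisCoeff p R ξ η θ)
    (hc : HasExpansion R y c) (hy : ContinuousOn y (Set.Icc (-1) 1)) :
    (fun N => ip (tailFun R c y N) y) =O[atTop] fun N : ℕ => (N : ℝ) ^ (1 / 4 - 2 * τ) := by
  obtain ⟨h1, h2⟩ := isBigO_tsum_tail (isBigO_rpow_mul h.coeff h.moment) (by linarith [h.two_lt])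
  refine IsBigO.trans (IsBigO.of_bound 1 (Eventually.of_forall fun N => ?_))
    (h2.congr_right fun N => by congr 1; ring)
  rw [one_mul, Real.norm_of_nonneg (tsum_nonneg fun _ => abs_nonneg _),
    h.ip_tailFun hR hc hy (intervalIntegrable_of_continuousOn hy)]
  refine norm_tsum_le_tsum_norm ?_
  simpa only [add_comm, Real.norm_eq_abs] using (summable_nat_add_iff N).2 h1

end CoeffRate

end

/-! ### The error of the numerical eigenvalue -/

section

variable {S : ℕ} {p : Problem S} {R : ℕ → ℝ[X]} {ξ η θ : ℕ → ℝ} {lam : ℝ} {y dy : ℝ → ℝ}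
  {c : ℕ → ℝ} {τ : ℝ} {lamN : ℕ → ℝ}

/-- Approximate numerical eigenfunctions orthogonal to `y` cannot have small residuals. -/
theorem not_orthogonal_of_small_residual {U : Ultrafilter ℕ} (hU : (U : Filter ℕ) ≤ atTop)
    (hy : p.IsEigenfunction lam y) {r : ℕ → ℝ[X]} {σ : ℕ → ℝ} (hlam : Tendsto lamN U (𝓝 lam))
    (hr : ∀ᶠ N in U, r N ∈ polySpace p N) (hr0 : ∀ᶠ N in U, 0 < hsq (r N))
    (horth : ∀ᶠ N in U, ip (fn (r N)) y = 0)
    (hσ : Tendsto (fun N => σ N / Real.sqrt (hsq (r N))) U (𝓝 0))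
    (hres : ∀ᶠ N in U, ∀ ψ ∈ polySpace p N,
      |p.energy (r N) ψ - lamN N * pip (r N) ψ| ≤ σ N * Real.sqrt (hsq ψ)) : False := by
  set κ : ℕ → ℝ := fun N => (Real.sqrt (hsq (r N)))⁻¹ with hκ
  obtain ⟨u, hu, hu'⟩ := exists_limit_eigenfunction hU (p := p) (φ := fun N => κ N • r N)
    (hr.mono fun N h => Submodule.smul_mem _ _ h)
    (hr0.mono fun N h => by
      rw [hsq_smul, hκ, inv_pow, Real.sq_sqrt h.le, inv_mul_cancel₀ h.ne']) hlam hσ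
    (by
      filter_upwards [hres] with N h ψ hψ
      rw [← Problem.energyForm_apply, map_smul, map_smul, LinearMap.smul_apply,
        LinearMap.smul_apply, smul_eq_mul, smul_eq_mul, Problem.energyForm_apply,
        mul_left_comm, ← mul_sub, abs_mul, abs_of_nonneg (inv_nonneg.2 (Real.sqrt_nonneg _))]
      refine (mul_le_mul_of_nonneg_left (h ψ hψ) (inv_nonneg.2 (Real.sqrt_nonneg _))).trans
        (le_of_eq ?_)
      rw [div_eq_mul_inv]; ring)
  refine hy.ip_ne_zero hu' (tendsto_nhds_unique (tendsto_ip_of_uniformly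
    (fun N => (continuous_fn _).continuousOn) hu'.isSol.1.cont hu
    (intervalIntegrable_of_continuousOn hy.isSol.1.cont)) (tendsto_const_nhds.congr' ?_))
  filter_upwards [horth] with N h
  have : fn (κ N • r N) = fun x => κ N * fn (r N) x := by
    ext x; simp [fn]
  rw [this, ip_comm, ip_const_mul_right, ip_comm, h, mul_zero]

theorem hsq_pos {r : ℝ[X]} (hr : r ≠ 0) : 0 < hsq r :=
  add_pos_of_nonneg_of_pos (pip_self_nonneg _) (pip_self_pos hr)

/-- The Galerkin equations for the pair `w N`, `lamN N`. -/
def IsGalerkin (p : Problem S) (lamN : ℕ → ℝ) (w : ℕ → ℝ[X]) : Prop :=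
  ∀ᶠ N in atTop, w N ∈ polySpace p N ∧
    ∀ ψ ∈ polySpace p N, p.energy (w N) ψ = lamN N * pip (w N) ψ

theorem IsGalerkin.eventually_ip_ne_zero {z : ℕ → ℝ[X]} (hz : IsGalerkin p lamN z)
    (hz0 : ∀ᶠ N in atTop, z N ≠ 0) (hy : p.IsEigenfunction lam y)
    (hlam : Tendsto lamN atTop (𝓝 lam)) : ∀ᶠ N in atTop, ip (fn (z N)) y ≠ 0 := by
  by_contra hcon
  have hfreq : ∃ᶠ N in atTop, ip (fn (z N)) y = 0 := by
    simpa only [Filter.Frequently, ne_eq] using hcon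
  have hne : (atTop ⊓ 𝓟 {N | ip (fn (z N)) y = 0}).NeBot := frequently_mem_iff_neBot.1 hfreq
  obtain ⟨U, hU⟩ := Ultrafilter.exists_le (atTop ⊓ 𝓟 {N | ip (fn (z N)) y = 0})
  have hUtop : (U : Filter ℕ) ≤ atTop := hU.trans inf_le_left
  refine not_orthogonal_of_small_residual hUtop hy (σ := fun _ => 0) (hlam.mono_left hUtop)
    ((hz.filter_mono hUtop).mono fun N h => h.1) ((hz0.filter_mono hUtop).mono fun N h => hsq_pos h)
    (hU.trans inf_le_right (mem_principal_self _)) (by simp) ?_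
  filter_upwards [hz.filter_mono hUtop] with N h ψ hψ
  rw [h.2 ψ hψ, sub_self, abs_zero, zero_mul]

/-- The numerical problem is stable on the complement of `y`: there the norm of `H¹` is controlled
by the residual `σ`. Otherwise a subsequence would have residuals small against its norms. -/
theorem isBigO_of_residual (hy : p.IsEigenfunction lam y) {r : ℕ → ℝ[X]} {σ : ℕ → ℝ}
    (hlam : Tendsto lamN atTop (𝓝 lam)) (hr : ∀ᶠ N in atTop, r N ∈ polySpace p N)
    (horth : ∀ᶠ N in atTop, ip (fn (r N)) y = 0)
    (hres : ∀ᶠ N in atTop, ∀ ψ ∈ polySpace p N,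
      |p.energy (r N) ψ - lamN N * pip (r N) ψ| ≤ σ N * Real.sqrt (hsq ψ)) :
    (fun N => Real.sqrt (hsq (r N))) =O[atTop] σ := by
  by_contra hcon
  have hfreq : ∀ n : ℕ, ∃ᶠ N in atTop, n * |σ N| < Real.sqrt (hsq (r N)) := by
    intro n hev
    refine hcon (IsBigO.of_bound n (hev.mono fun N hN => ?_))
    rw [Real.norm_of_nonneg (Real.sqrt_nonneg _)]
    exact not_lt.1 hN
  obtain ⟨φ, hφ, hlt⟩ := extraction_forall_of_frequently hfreq
  obtain ⟨U, hU⟩ := Ultrafilter.exists_le (map φ atTop)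
  have hUtop : (U : Filter ℕ) ≤ atTop := hU.trans hφ.tendsto_atTop
  have hpos : ∀ n, 0 < Real.sqrt (hsq (r (φ n))) := fun n =>
    lt_of_le_of_lt (by positivity) (hlt n)
  refine not_orthogonal_of_small_residual hUtop hy (σ := σ) (hlam.mono_left hUtop) (hUtop hr)
    (hU ?_) (hUtop horth) (Tendsto.mono_left ?_ hU) (hUtop hres)
  · exact Filter.mem_map.2 (Eventually.of_forall fun n => Real.sqrt_pos.1 (hpos n))
  · rw [tendsto_map'_iff]
    refine squeeze_zero_norm' ?_ tendsto_one_div_atTop_nhds_zero_nat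
    filter_upwards [eventually_gt_atTop 0] with n hn
    have hn' : (0 : ℝ) < n := by exact_mod_cast hn
    rw [Function.comp_apply, norm_div, Real.norm_of_nonneg (Real.sqrt_nonneg _), Real.norm_eq_abs,
      div_le_div_iff₀ (hpos n) hn', one_mul, mul_comm]
    exact (hlt n).le

theorem Problem.IsBasis.partialSum_mem (hR : p.IsBasis R) (c : ℕ → ℝ) :
    ∀ᶠ N in atTop, partialSum R c N ∈ polySpace p N := by
  filter_upwards [hR.span_eq] with N hN
  rw [← hN]
  refine Submodule.sum_mem _ fun n hn => ?_
  rw [C_mul']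
  exact Submodule.smul_mem _ _ (Submodule.subset_span ⟨n, Finset.mem_range.1 hn, rfl⟩)

/-- The partial sums of the expansion satisfy the Galerkin equations up to the moment of the tail
with `q ψ`. -/
theorem HasExpansion.energy_partialSum (hc : HasExpansion R y c) (hB : BasisCoeff p R ξ η θ)
    (h : IsSol p.q lam y dy) (hb : p.BC y dy) {N : ℕ} (hN : 1 ≤ N) {ψ : ℝ[X]}
    (hψ : ψ ∈ polySpace p N) : p.energy (partialSum R c N) ψ =
      lam * ip y (fn ψ) - ip (tailFun R c y N) (fun x => p.q x * fn ψ x) := by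
  have hψc := (continuous_fn ψ).continuousOn (s := Set.Icc (-1) 1)
  have hqψ := p.intervalIntegrable_q_mul hψc
  have hdeg : (derivative (derivative ψ)).natDegree < N := by
    have := BasisCoeff.natDegree_derivative2_le (n := N - 1) (hψ.1.trans (by omega))
    omega
  have h1 : ip y (fn (derivative (derivative ψ))) =
      pip (partialSum R c N) (derivative (derivative ψ)) := by
    refine hc.ip_eq_of_eventually h.cont ?_
    filter_upwards [eventually_ge_atTop N] with M hM
    obtain ⟨d, rfl⟩ := Nat.exists_eq_add_of_le hM
    rw [Finset.sum_range_add, partialSum, pip_finset_sum_left, Finset.sum_eq_zero (s := .range d),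
      add_zero]
    intro n _
    rw [hB.pip_of_natDegree_lt (by omega), mul_zero]
  have h2 := h.green_bc p.isPotential hb hψ.2
  have i1 : IntervalIntegrable (fun x => fn ψ x * (p.q x * y x)) volume (-1) 1 :=
    intervalIntegrable_fn_mul ψ (p.intervalIntegrable_q_mul h.cont)
  have i2 : IntervalIntegrable (fun x => fn ψ x * (lam * y x)) volume (-1) 1 :=
    intervalIntegrable_fn_mul ψ ((intervalIntegrable_of_continuousOn h.cont).const_mul _)
  have h3 := ip_sub_right i1 i2
  rw [ip_const_mul_right] at h3
  have h4 : ip (fn ψ) (fun x => (p.q x - lam) * y x) =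
      ip (fn ψ) (fun x => p.q x * y x - lam * y x) := ip_congr fun x _ => by ring
  have hint : ∀ {u : ℝ → ℝ}, ContinuousOn u (Set.Icc (-1) 1) →
      IntervalIntegrable (fun x => (p.q x * fn ψ x) * u x) volume (-1) 1 := fun hu => by
    simpa only [mul_comm] using intervalIntegrable_mul_of_continuousOn hu hqψ
  have h5 := ip_sub_right (hint h.cont) (hint (continuous_fn (partialSum R c N)).continuousOn)
  have h6 : ip (fn ψ) (fun x => p.q x * y x) = ip (fun x => p.q x * fn ψ x) y :=
    ip_congr fun x _ => by ring
  change ip (fun x => p.q x * fn ψ x) (tailFun R c y N) = _ at h5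
  rw [Problem.energy, ← h1, h2, h4, h3, h6, ip_comm (tailFun R c y N), h5, ip_comm y,
    ip_comm (fn (partialSum R c N))]
  ring

theorem ip_fn_partialSum (hy : ContinuousOn y (Set.Icc (-1) 1)) (N : ℕ) {v : ℝ → ℝ}
    (hv : ContinuousOn v (Set.Icc (-1) 1)) :
    ip (fn (partialSum R c N)) v = ip y v - ip (tailFun R c y N) v := by
  have h := ip_sub_right (intervalIntegrable_mul_of_continuousOn' hv hy)
    (intervalIntegrable_mul_of_continuousOn' hv (continuous_fn (partialSum R c N)).continuousOn)
  change ip v (tailFun R c y N) = _ at h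
  rw [ip_comm (tailFun R c y N), h, ip_comm v, ip_comm v]
  ring

theorem abs_tsum_le {u : ℕ → ℝ} (h : Summable fun n => |u n|) : |∑' n, u n| ≤ ∑' n, |u n| := by
  simpa only [Real.norm_eq_abs] using norm_tsum_le_tsum_norm (f := u) h

/-- If `D = -T` up to a small part of both, then `D = -T` up to a small part of `T` alone. -/
theorem isLittleO_of_add {D T : ℕ → ℝ} (h : (fun N => D N + T N) =o[atTop] fun N => |T N| + |D N|) :
    (fun N => D N + T N) =o[atTop] T := by
  refine h.trans_isBigO (IsBigO.of_bound 4 ?_)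
  filter_upwards [h.bound (show (0 : ℝ) < 1 / 2 by norm_num)] with N hN
  rw [Real.norm_eq_abs, Real.norm_eq_abs, abs_of_nonneg (by positivity : 0 ≤ |T N| + |D N|)] at hN
  rw [Real.norm_of_nonneg (by positivity), Real.norm_eq_abs]
  have := abs_sub_abs_le_abs_sub (D N) (-T N)
  rw [abs_neg, sub_neg_eq_add] at this
  linarith

/-- The outcome of the analysis for the numerical eigenfunctions `w N` that have the same component
along `y` as the partial sums of the expansion. -/
structure ErrorEstimates (p : Problem S) (R : ℕ → ℝ[X]) (lam : ℝ) (y : ℝ → ℝ) (c : ℕ → ℝ)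
    (lamN : ℕ → ℝ) (w : ℕ → ℝ[X]) : Prop where
  equiv_exact : (fun N => (lam - lamN N) * ip (fn (w N)) y) ~[atTop] fun N =>
    ∑' n, c (N + n) * ip (fn (R (N + n))) (fun x => p.q x * fn (w N) x)
  equiv_approx : (fun N => (lam - lamN N) * ip (fn (w N)) y) ~[atTop] fun N =>
    ∑' n, p.cApprox R y (N + n) * ip (fn (R (N + n))) (fun x => p.q x * fn (w N) x)

/-- A Galerkin solution with the same component along `y` as the partial sums of the expansion
differs from them by no more than its eigenvalue error and the size `b` of the tail allow. -/
theorem HasExpansion.exists_diff_bound (hc : HasExpansion R y c) (hR : p.IsBasis R)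
    (hB : BasisCoeff p R ξ η θ) (hy : p.IsEigenfunction lam y)
    (hlam : Tendsto lamN atTop (𝓝 lam)) {w : ℕ → ℝ[X]} (hw : IsGalerkin p lamN w)
    (hwy : ∀ᶠ N in atTop, ip (fn (w N)) y = ip (fn (partialSum R c N)) y) {b : ℕ → ℝ}
    (hb0 : ∀ N, 0 ≤ b N)
    (hle : ∀ N, ∀ x ∈ Set.Icc (-1 : ℝ) 1, |tailFun R c y N x| ≤ b N) :
    ∃ s : ℕ → ℝ, (∀ N, 0 ≤ s N) ∧ (s =O[atTop] fun N => |lam - lamN N| + b N) ∧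
      ∀ N, ∀ x ∈ Set.Icc (-1 : ℝ) 1, |fn (partialSum R c N - w N) x| ≤ s N := by
  obtain ⟨hsol, hbc⟩ := hy.isSol
  have hyc := hsol.cont
  set e : ℕ → ℝ[X] := fun N => partialSum R c N - w N with he
  set s : ℕ → ℝ := fun N => Real.sqrt (2 * hsq (e N)) with hs
  set q1 := ∫ x in (-1 : ℝ)..1, |p.q x| with hq1
  have hqi := p.isPotential.int
  have hone : IntervalIntegrable (fun _ : ℝ => (1 : ℝ)) volume (-1) 1 :=
    continuous_const.intervalIntegrable _ _
  obtain ⟨Y, hY⟩ := isCompact_Icc.exists_bound_of_continuousOn hyc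
  have hY0 : 0 ≤ Y := (norm_nonneg _).trans (hY 0 (by norm_num))
  have hYsup : ∀ x ∈ Set.Icc (-1 : ℝ) 1, |y x| ≤ Y := hY
  have hip1 : ∀ {u v : ℝ → ℝ} {A B : ℝ}, (∀ x ∈ Set.Icc (-1 : ℝ) 1, |u x| ≤ A) →
      (∀ x ∈ Set.Icc (-1 : ℝ) 1, |v x| ≤ B) → |ip u v| ≤ A * B * 2 := by
    intro u v A B hu hv
    have := abs_ip_mul_le hu hv hone
    norm_num at this
    exact this
  have hsup : ∀ r : ℝ[X], ∀ x ∈ Set.Icc (-1 : ℝ) 1, |fn r x| ≤ Real.sqrt 2 * Real.sqrt (hsq r) :=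
    fun r x hx => by
      rw [← Real.sqrt_mul (by norm_num)]; exact abs_fn_le_hsq r hx
  have hq10 : 0 ≤ q1 := intervalIntegral.integral_nonneg (by norm_num) fun _ _ => abs_nonneg _
  set K₁ := Real.sqrt 2 * (2 * Y + q1 + 2 * (|lam| + 1)) with hK₁
  have hK₁0 : 0 ≤ K₁ := by positivity
  have hlamb : ∀ᶠ N in atTop, |lamN N| ≤ |lam| + 1 :=
    (hlam.abs.eventually (gt_mem_nhds (lt_add_one _))).mono fun _ h => h.le
  have hemem : ∀ᶠ N in atTop, e N ∈ polySpace p N := by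
    filter_upwards [hR.partialSum_mem c, hw] with N h1 h2 using Submodule.sub_mem _ h1 h2.1
  have hres : ∀ᶠ N in atTop, ∀ ψ ∈ polySpace p N, |p.energy (e N) ψ - lamN N * pip (e N) ψ| ≤
      (K₁ * (|lam - lamN N| + b N)) * Real.sqrt (hsq ψ) := by
    filter_upwards [hw, hlamb, eventually_ge_atTop 1] with N h1 h2 h3 ψ hψ
    have a1 := hc.energy_partialSum hB hsol hbc h3 hψ
    have a2 := h1.2 ψ hψ
    have a3 := ip_fn_partialSum (R := R) (c := c) hyc N
      ((continuous_fn ψ).continuousOn (s := Set.Icc (-1) 1))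
    have a4 : p.energy (e N) ψ - lamN N * pip (e N) ψ = (lam - lamN N) * ip y (fn ψ) -
        ip (tailFun R c y N) (fun x => p.q x * fn ψ x) + lamN N * ip (tailFun R c y N) (fn ψ) := by
      rw [← Problem.energyForm_apply, he, map_sub, map_sub, LinearMap.sub_apply,
        LinearMap.sub_apply, Problem.energyForm_apply, Problem.energyForm_apply, a1, a2,
        pip_apply (partialSum R c N), a3]
      ring
    set m := Real.sqrt (hsq ψ) with hm
    have hm0 : 0 ≤ m := Real.sqrt_nonneg _
    have c1 := hip1 hYsup (hsup ψ)
    have c2 := abs_ip_mul_le (hle N) (hsup ψ) hqi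
    have c3 := hip1 (hle N) (hsup ψ)
    rw [a4]
    refine (abs_add_le _ _).trans ((add_le_add_left (abs_sub _ _) _).trans ?_)
    rw [abs_mul, abs_mul]
    have d1 := mul_le_mul_of_nonneg_left c1 (abs_nonneg (lam - lamN N))
    have d3 := mul_le_mul h2 c3 (abs_nonneg _) (by positivity)
    have hbN := hb0 N
    have habs := abs_nonneg (lam - lamN N)
    have hlam0 := abs_nonneg lam
    have hq2 := Real.sqrt_nonneg 2
    have e1 : 0 ≤ Real.sqrt 2 * m * ((q1 + 2 * (|lam| + 1)) * |lam - lamN N| + 2 * Y * b N) := by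
      positivity
    rw [hK₁]
    nlinarith
  have horth : ∀ᶠ N in atTop, ip (fn (e N)) y = 0 := by
    filter_upwards [hwy] with N h1
    have : fn (e N) = fun x => fn (partialSum R c N) x - fn (w N) x := by
      ext x; rw [he, fn_sub]
    have h2 := ip_sub_right (intervalIntegrable_mul_of_continuousOn' hyc
      (continuous_fn (partialSum R c N)).continuousOn)
      (intervalIntegrable_mul_of_continuousOn' hyc (continuous_fn (w N)).continuousOn)
    rw [this, ip_comm, h2, ip_comm y, ip_comm y, h1, sub_self]
  have hsO : s =O[atTop] fun N => |lam - lamN N| + b N := by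
    have h1 := isBigO_of_residual hy hlam hemem horth hres
    have h2 : s =O[atTop] fun N => Real.sqrt (hsq (e N)) := by
      refine IsBigO.of_bound (Real.sqrt 2) (Eventually.of_forall fun N => ?_)
      rw [Real.norm_of_nonneg (Real.sqrt_nonneg _), Real.norm_of_nonneg (Real.sqrt_nonneg _),
        ← Real.sqrt_mul (by norm_num)]
    exact h2.trans (h1.trans (isBigO_const_mul_self K₁ _ _))
  exact ⟨s, fun N => Real.sqrt_nonneg _, hsO, fun N x hx => abs_fn_le_hsq (e N) hx⟩

/-- With the tail `t` and the partial sum `w + e` of the expansion, testing the equations of `w` and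
of the partial sum with each other gives `(lam - lamN) * ⟨w, y⟩ = ⟨t, q w⟩ - lamN * ⟨t, w⟩`. As
`w = y - t - e`, the linear terms in `t` amount to minus the tail energy up to a negligible part,
and the terms quadratic in `t` and `e` are negligible. -/
theorem CoeffRate.errorEstimates (h : CoeffRate p R lam y c τ) (hR : p.IsBasis R)
    (hB : BasisCoeff p R ξ η θ) (hc : HasExpansion R y c) (hy : p.IsEigenfunction lam y)
    (hlam : Tendsto lamN atTop (𝓝 lam)) {w : ℕ → ℝ[X]} (hw : IsGalerkin p lamN w)
    (hwy : ∀ᶠ N in atTop, ip (fn (w N)) y = ip (fn (partialSum R c N)) y) :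
    ErrorEstimates p R lam y c lamN w := by
  have hτ := h.two_lt
  obtain ⟨hsol, hbc⟩ := hy.isSol
  have hyc := hsol.cont
  obtain ⟨b, hb0, hb, hle⟩ := h.tailFun_le hB hc hyc
  have htc : ∀ N, ContinuousOn (tailFun R c y N) (Set.Icc (-1) 1) := continuousOn_tailFun hyc
  set T := tailEnergy R c with hT
  obtain ⟨s, hs0, hsO, hesup⟩ := hc.exists_diff_bound hR hB hy hlam hw hwy hb0 hle
  set e : ℕ → ℝ[X] := fun N => partialSum R c N - w N with he
  set q1 := ∫ x in (-1 : ℝ)..1, |p.q x| with hq1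
  have hqi := p.isPotential.int
  have hone : IntervalIntegrable (fun _ : ℝ => (1 : ℝ)) volume (-1) 1 :=
    continuous_const.intervalIntegrable _ _
  have hip1 : ∀ {u v : ℝ → ℝ} {A B : ℝ}, (∀ x ∈ Set.Icc (-1 : ℝ) 1, |u x| ≤ A) →
      (∀ x ∈ Set.Icc (-1 : ℝ) 1, |v x| ≤ B) → |ip u v| ≤ A * B * 2 := by
    intro u v A B hu hv
    have := abs_ip_mul_le hu hv hone
    norm_num at this
    exact this
  -- `w = y - t - e`, with the tail `t` of the expansion
  have hwfn : ∀ N x, fn (w N) x = y x - tailFun R c y N x - fn (e N) x := fun N x => by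
    rw [he, fn_sub, tailFun]; ring
  have hsplit : ∀ {u v : ℝ → ℝ} (N : ℕ), ContinuousOn u (Set.Icc (-1) 1) →
      IntervalIntegrable v volume (-1) 1 → ip u (fun x => v x * fn (w N) x) =
        ip u (fun x => v x * y x) - ip u (fun x => v x * tailFun R c y N x) -
          ip u (fun x => v x * fn (e N) x) := by
    intro u v N hu hv
    have hi : ∀ {f : ℝ → ℝ}, ContinuousOn f (Set.Icc (-1) 1) →
        IntervalIntegrable (fun x => u x * (v x * f x)) volume (-1) 1 := fun hf => by
      refine intervalIntegrable_mul_of_continuousOn hu ?_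
      simpa only [mul_comm] using intervalIntegrable_mul_of_continuousOn hf hv
    have hi' : IntervalIntegrable (fun x => u x * (v x * y x - v x * tailFun R c y N x))
        volume (-1) 1 := by
      simpa only [mul_sub] using (hi hyc).sub (hi (htc N))
    rw [← ip_sub_right (hi hyc) (hi (htc N)),
      ← ip_sub_right hi' (hi (continuous_fn (e N)).continuousOn)]
    exact ip_congr fun x _ => by rw [hwfn]; ring
  set D : ℕ → ℝ := fun N => (lam - lamN N) * ip (fn (w N)) y with hD
  -- the energy of `w` and the partial sum, from the equation of either one
  have hDeq : ∀ᶠ N in atTop, D N = ip (tailFun R c y N) (fun x => p.q x * fn (w N) x) -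
      lamN N * ip (tailFun R c y N) (fn (w N)) := by
    filter_upwards [hw, hR.partialSum_mem c, eventually_ge_atTop 1] with N h1 h2 h3
    have a1 := hc.energy_partialSum hB hsol hbc h3 h1.1
    have a2 := h1.2 _ h2
    have a3 := ip_fn_partialSum (R := R) (c := c) hyc N
      ((continuous_fn (w N)).continuousOn (s := Set.Icc (-1) 1))
    rw [h2.2.energy_comm h1.1.2, a2, pip_comm, pip_apply, a3] at a1
    rw [hD]
    simp only
    rw [ip_comm (fn (w N))]
    linear_combination -a1
  -- the quadratic terms
  have hqt : (fun N => ip (tailFun R c y N) (fun x => p.q x * tailFun R c y N x)) =O[atTop]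
      fun N => b N * b N := by
    refine IsBigO.of_bound q1 (Eventually.of_forall fun N => ?_)
    rw [Real.norm_of_nonneg (mul_nonneg (hb0 N) (hb0 N)), mul_comm]
    exact abs_ip_mul_le (hle N) (hle N) hqi
  have hqe : (fun N => ip (tailFun R c y N) (fun x => p.q x * fn (e N) x)) =O[atTop]
      fun N => b N * s N := by
    refine IsBigO.of_bound q1 (Eventually.of_forall fun N => ?_)
    rw [Real.norm_of_nonneg (mul_nonneg (hb0 N) (hs0 N)), mul_comm]
    exact abs_ip_mul_le (hle N) (hesup N) hqi
  have htt : (fun N => ip (tailFun R c y N) (tailFun R c y N)) =O[atTop] fun N => b N * b N := by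
    refine IsBigO.of_bound 2 (Eventually.of_forall fun N => ?_)
    rw [Real.norm_of_nonneg (mul_nonneg (hb0 N) (hb0 N)), mul_comm]
    exact hip1 (hle N) (hle N)
  have hte : (fun N => ip (tailFun R c y N) (fn (e N))) =O[atTop] fun N => b N * s N := by
    refine IsBigO.of_bound 2 (Eventually.of_forall fun N => ?_)
    rw [Real.norm_of_nonneg (mul_nonneg (hb0 N) (hs0 N)), mul_comm]
    exact hip1 (hle N) (hesup N)
  have hlam1 : lamN =O[atTop] fun _ => (1 : ℝ) := hlam.isBigO_one ℝ
  have hbT : (fun N => b N * b N) =o[atTop] T := by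
    refine ((isBigO_rpow_mul hb hb).trans_isLittleO (isLittleO_rpow ?_)).trans_isBigO
      (h.lower_tailEnergy hB)
    linarith
  have hbzero : b =o[atTop] fun _ => (1 : ℝ) :=
    (isLittleO_one_iff ℝ).2 (hb.trans_tendsto (tendsto_rpow_neg_nat (by linarith)))
  have htw1 : ∀ N, ip (tailFun R c y N) (fn (w N)) = ip (tailFun R c y N) y -
      ip (tailFun R c y N) (tailFun R c y N) - ip (tailFun R c y N) (fn (e N)) := fun N => by
    simpa only [one_mul] using hsplit N (htc N) hone
  have hty := h.isBigO_ip_tailFun hB hc hyc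
  have htyT : (fun N => ip (tailFun R c y N) y) =o[atTop] T :=
    (hty.trans_isLittleO (isLittleO_rpow (by linarith))).trans_isBigO (h.lower_tailEnergy hB)
  -- the component of `w` along `y` tends to `⟨y, y⟩`
  have hwlim : Tendsto (fun N => ip (fn (w N)) y) atTop (𝓝 (ip y y)) :=
    (hc.tendsto_ip hyc hyc).congr' (hwy.mono fun N h => h.symm)
  have hn0 := hy.ip_self_pos
  have hlamD : (fun N => |lam - lamN N|) =O[atTop] D := by
    refine IsBigO.of_bound (2 / ip y y) ?_
    filter_upwards [hwlim.eventually (lt_mem_nhds (show ip y y / 2 < ip y y by linarith))] with N h1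
    rw [Real.norm_of_nonneg (abs_nonneg _), hD, norm_mul, Real.norm_eq_abs,
      Real.norm_of_nonneg (by linarith), div_mul_eq_mul_div, le_div_iff₀ hn0]
    nlinarith [abs_nonneg (lam - lamN N)]
  have hTD : ∀ N, ‖|T N| + |D N|‖ = |T N| + |D N| := fun N =>
    Real.norm_of_nonneg (add_nonneg (abs_nonneg _) (abs_nonneg _))
  have hTle : T =O[atTop] fun N => |T N| + |D N| := by
    refine IsBigO.of_bound 1 (Eventually.of_forall fun N => ?_)
    rw [one_mul, hTD, Real.norm_eq_abs]
    exact le_add_of_nonneg_right (abs_nonneg _)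
  have hDle : D =O[atTop] fun N => |T N| + |D N| := by
    refine IsBigO.of_bound 1 (Eventually.of_forall fun N => ?_)
    rw [one_mul, hTD, Real.norm_eq_abs]
    exact le_add_of_nonneg_left (abs_nonneg _)
  have hbs : (fun N => b N * s N) =o[atTop] fun N => |T N| + |D N| := by
    have h1 : (fun N => b N * |lam - lamN N|) =o[atTop] D := by
      simpa using hbzero.mul_isBigO hlamD
    exact ((isBigO_refl b _).mul hsO |>.congr_right fun N => mul_add _ _ _).trans_isLittleO
      ((h1.trans_isBigO hDle).add (hbT.trans_isBigO hTle))
  have hDT : (fun N => D N + T N) =o[atTop] T := by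
    refine isLittleO_of_add ?_
    have h1 : (fun N => (lam - lamN N) * ip (tailFun R c y N) y) =o[atTop]
        fun N => |T N| + |D N| := by
      have : (fun N => lam - lamN N) =O[atTop] fun _ => (1 : ℝ) :=
        (tendsto_const_nhds.sub hlam).isBigO_one ℝ
      have h2 := this.mul_isLittleO (htyT.trans_isBigO hTle)
      simpa using h2
    have h2 := (hqt.trans_isLittleO (hbT.trans_isBigO hTle)).add (hqe.trans_isLittleO hbs)
    have h3 := hlam1.mul_isLittleO
      ((htt.trans_isLittleO (hbT.trans_isBigO hTle)).add (hte.trans_isLittleO hbs))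
    simp only [one_mul] at h3
    refine ((h1.sub h2).add h3).congr' ?_ EventuallyEq.rfl
    filter_upwards [hDeq] with N h4
    have h5 := h.ip_tailFun_q_sub hB hc hyc N
    rw [h4, htw1, hsplit N (htc N) hqi]
    linear_combination -h5
  have hDO : D =O[atTop] T := by
    have := hDT.isBigO.sub (isBigO_refl T atTop)
    simpa using this
  have hTDO : (fun N => |T N| + |D N|) =O[atTop] T :=
    ((isBigO_refl T _).norm_left).add hDO.norm_left
  have hbsT : (fun N => b N * s N) =o[atTop] T := hbs.trans_isBigO hTDO
  have htwT : (fun N => ip (tailFun R c y N) (fn (w N))) =o[atTop] T :=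
    ((htyT.sub (htt.trans_isLittleO hbT)).sub (hte.trans_isLittleO hbsT)).congr_left
      fun N => (htw1 N).symm
  have hqw : ∀ N, IntervalIntegrable (fun x => p.q x * fn (w N) x) volume (-1) 1 := fun N =>
    p.intervalIntegrable_q_mul (continuous_fn (w N)).continuousOn
  -- the series is `⟨t, q w⟩`, which differs from `D` by the negligible `lamN * ⟨t, w⟩`
  set E : ℕ → ℝ := fun N => ∑' n, c (N + n) * ip (fn (R (N + n))) (fun x => p.q x * fn (w N) x)
    with hE
  have hET : (fun N => E N - D N) =o[atTop] T := by
    have h1 := hlam1.mul_isLittleO htwT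
    simp only [one_mul] at h1
    refine h1.congr' ?_ EventuallyEq.rfl
    filter_upwards [hDeq] with N h2
    rw [h2, hE]
    simp only
    rw [← h.ip_tailFun hB hc hyc (hqw N) N]
    ring
  have hTD' : T =O[atTop] D := by
    have h1 : (fun N => -T N) ~[atTop] D := by
      refine IsEquivalent.symm (IsLittleO.isEquivalent ?_)
      exact (hDT.neg_right.congr_left fun N => by simp)
    simpa using h1.isBigO
  have hsδ : s =O[atTop] fun N : ℕ => (N : ℝ) ^ (3 / 4 - τ) := by
    refine hsO.trans (IsBigO.add ?_ hb)
    refine (hlamD.trans (hDO.trans (h.isBigO_tailEnergy hB))).trans (isBigO_rpow_of_le ?_)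
    linarith
  have hexact : D ~[atTop] E := by
    refine IsEquivalent.symm (IsLittleO.isEquivalent (hET.trans_isBigO hTD'))
  refine ⟨hexact, ?_⟩
  -- replacing `c` by its approximation changes the series by a negligible amount
  set d : ℕ → ℝ := fun n => c n - p.cApprox R y n with hd
  set f : ℕ → ℝ := fun n => ip (fn (R n)) fun x => p.q x * y x with hf
  obtain ⟨K, hK0, hK⟩ := hB.exists_sup_bound
  have hK' : ∀ n, ∀ x ∈ Set.Icc (-1 : ℝ) 1, |fn (R n) x| ≤ K := fun n x hx =>
    (hK n x hx).trans (div_le_self hK0.le (Real.one_le_sqrt.2 (by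
      linarith [n.cast_nonneg (α := ℝ)])))
  have hdO := h.isBigO_sub hB
  obtain ⟨d1, d2⟩ := isBigO_tsum_tail hdO (by linarith)
  obtain ⟨g1, g2⟩ := isBigO_tsum_tail (isBigO_rpow_mul hdO h.upper) (by linarith)
  have hFle : ∀ N n, |d n * ip (fn (R n)) (fun x => p.q x * fn (w N) x)| ≤
      |d n * f n| + K * q1 * (b N + s N) * |d n| := by
    intro N n
    have c1 := abs_ip_mul_le (hK' n) (hle N) hqi
    have c2 := abs_ip_mul_le (hK' n) (hesup N) hqi
    rw [hsplit N (continuous_fn (R n)).continuousOn hqi, abs_mul, abs_mul, mul_comm _ |d n|,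
      ← mul_add]
    refine mul_le_mul_of_nonneg_left ?_ (abs_nonneg _)
    refine (abs_sub _ _).trans ?_
    refine (add_le_add_left (abs_sub _ _) _).trans ?_
    rw [hf]
    simp only
    linarith
  have hsh : ∀ {u : ℕ → ℝ}, (Summable fun n => |u n|) → ∀ N, Summable fun n => |u (N + n)| :=
    fun hu N => by simpa only [add_comm] using (summable_nat_add_iff N).2 hu
  have hSum : ∀ N, Summable fun n =>
      |d (N + n) * ip (fn (R (N + n))) (fun x => p.q x * fn (w N) x)| := fun N =>
    Summable.of_nonneg_of_le (fun _ => abs_nonneg _) (fun n => hFle N (N + n))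
      ((hsh g1 N).add ((hsh d1 N).mul_left _))
  have hdiff : (fun N => ∑' n, d (N + n) * ip (fn (R (N + n))) (fun x => p.q x * fn (w N) x))
      =o[atTop] T := by
    have h1 : (fun N => ∑' n, |d (N + n) * f (N + n)|) =o[atTop] T :=
      (g2.trans_isLittleO (isLittleO_rpow (by linarith))).trans_isBigO (h.lower_tailEnergy hB)
    have h2 : (fun N => K * q1 * ((b N + s N) * ∑' n, |d (N + n)|)) =o[atTop] T := by
      refine IsLittleO.const_mul_left ?_ _
      exact ((isBigO_rpow_mul (hb.add hsδ) d2).trans_isLittleO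
        (isLittleO_rpow (by linarith))).trans_isBigO (h.lower_tailEnergy hB)
    have h3 : ∀ N, |∑' n, d (N + n) * ip (fn (R (N + n))) (fun x => p.q x * fn (w N) x)| ≤
        ∑' n, |d (N + n) * f (N + n)| + K * q1 * ((b N + s N) * ∑' n, |d (N + n)|) := by
      intro N
      have i1 := (hsh d1 N).mul_left (K * q1 * (b N + s N))
      have i2 := Summable.tsum_le_tsum (fun n => hFle N (N + n)) (hSum N) ((hsh g1 N).add i1)
      rw [Summable.tsum_add (hsh g1 N) i1, tsum_mul_left, mul_assoc (K * q1)] at i2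
      exact (abs_tsum_le (hSum N)).trans i2
    refine IsBigO.trans_isLittleO (IsBigO.of_bound' (Eventually.of_forall fun N => ?_)) (h1.add h2)
    rw [Real.norm_eq_abs, Real.norm_eq_abs]
    exact (h3 N).trans (le_abs_self _)
  have happrox : ∀ N, ∑' n, p.cApprox R y (N + n) *
      ip (fn (R (N + n))) (fun x => p.q x * fn (w N) x) =
        E N - ∑' n, d (N + n) * ip (fn (R (N + n))) (fun x => p.q x * fn (w N) x) := by
    intro N
    rw [hE]
    simp only
    rw [← Summable.tsum_sub (h.summable_mul_ip hB (hqw N) N) (hSum N).of_abs]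
    refine tsum_congr fun n => ?_
    rw [hd]; ring
  refine IsEquivalent.symm (IsLittleO.isEquivalent ?_)
  refine ((hET.sub hdiff).trans_isBigO hTD').congr_left fun N => ?_
  rw [Pi.sub_apply, happrox]
  ring

end

/-! ### The series for the eigenvalue error -/

section

variable {S : ℕ} {p : Problem S} {R : ℕ → ℝ[X]} {ξ η θ : ℕ → ℝ} {lam : ℝ} {y dy : ℝ → ℝ}
  {c : ℕ → ℝ} {τ : ℝ} {lamN : ℕ → ℝ}

/-- The numerical eigenfunctions satisfy the Galerkin equations for all polynomials of the space. -/
theorem Problem.IsBasis.isGalerkin_comb (hR : p.IsBasis R) {ζ : (N : ℕ) → Fin N → ℝ}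
    (hζ : ∀ᶠ N in atTop, ζ N ≠ 0 ∧ ζ N ∈ p.numEigenspace R N (lamN N)) :
    IsGalerkin p lamN fun N => comb R N (ζ N) := by
  filter_upwards [hζ, hR.span_eq] with N h hN
  refine ⟨by rw [← hN, ← range_comb]; exact LinearMap.mem_range_self _ _, fun ψ hψ => ?_⟩
  rw [← hN, ← range_comb] at hψ
  obtain ⟨ζ', rfl⟩ := hψ
  rw [(hR.comb_bc _).energy_comm (hR.comb_bc _), mem_numEigenspace.1 h.2, pip_comm]

theorem IsGalerkin.smul {z : ℕ → ℝ[X]} (hz : IsGalerkin p lamN z) (κ : ℕ → ℝ) :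
    IsGalerkin p lamN fun N => κ N • z N := by
  filter_upwards [hz] with N h
  refine ⟨Submodule.smul_mem _ _ h.1, fun ψ hψ => ?_⟩
  rw [← Problem.energyForm_apply, map_smul, map_smul, LinearMap.smul_apply, LinearMap.smul_apply,
    smul_eq_mul, smul_eq_mul, Problem.energyForm_apply, h.2 ψ hψ]
  ring

theorem fn_smul (κ : ℝ) (r : ℝ[X]) : fn (κ • r) = fun x => κ * fn r x := by
  ext x; simp [fn]

/-- Each of the two weighted moments is `O(n ^ (-1 / 2))` and `1 / a n` is `O(1 / n)`, whatever the
exponents of the weights. -/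
theorem BasisCoeff.summable_deltaTerm (hB : BasisCoeff p R ξ η θ) {z : ℝ → ℝ}
    (hy : ContinuousOn y (Set.Icc (-1) 1)) (hz : ContinuousOn z (Set.Icc (-1) 1)) (i j : Fin S)
    (N : ℕ) : Summable fun n => p.deltaTerm R y z i j (N + n) := by
  have hw : ∀ {u : ℝ → ℝ}, ContinuousOn u (Set.Icc (-1) 1) → ∀ i,
      (fun n => wip (p.β i) (p.γ i) (fn (R n)) fun x => p.g i x * u x) =O[atTop]
        fun n : ℕ => (n : ℝ) ^ (-(1 / 2) : ℝ) := by
    intro u hu i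
    have hint := intervalIntegrable_mul_of_continuousOn hu (p.term_integrable i)
    obtain ⟨K, hK⟩ := hB.isBigO_ip hint
    have h1 : ∀ n, wip (p.β i) (p.γ i) (fn (R n)) (fun x => p.g i x * u x) = ip (fn (R n))
        (fun x => u x * (p.g i x / ((1 - x) ^ p.β i * (1 + x) ^ p.γ i))) := fun n =>
      intervalIntegral.integral_congr fun x _ => by ring
    refine IsBigO.trans (IsBigO.of_bound K (Eventually.of_forall fun n => ?_))
      (isTheta_rpow_shift _ 1).1
    rw [h1, Real.norm_eq_abs, Nat.cast_add, Nat.cast_one, Real.norm_of_nonneg (by positivity)]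
    exact hK n
  have h := isBigO_rpow_mul (isBigO_rpow_mul hB.isBigO_inv_aEntry (hw hy i)) (hw hz j)
  have h2 := (isBigO_tsum_tail h (by norm_num)).1.of_abs
  have h3 := (summable_nat_add_iff N).2 h2
  refine h3.congr fun n => ?_
  rw [Problem.deltaTerm, add_comm N n, one_div]

/-- The double sum of the series `Δ_{ij}` is the series with the approximate coefficients. -/
theorem BasisCoeff.sum_delta (hB : BasisCoeff p R ξ η θ) {z : ℝ → ℝ}
    (hy : ContinuousOn y (Set.Icc (-1) 1)) (hz : ContinuousOn z (Set.Icc (-1) 1)) (N : ℕ) :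
    ∑ i, ∑ j, p.delta R y z N i j =
      -∑' n, p.cApprox R y (N + n) * ip (fn (R (N + n))) (fun x => p.q x * z x) := by
  have hs := hB.summable_deltaTerm (p := p) hy hz
  simp only [Problem.delta]
  simp_rw [← Summable.tsum_finsetSum (fun j _ => hs _ j N)]
  rw [← Summable.tsum_finsetSum fun i _ => summable_sum fun j _ => hs i j N, ← tsum_neg]
  refine tsum_congr fun n => ?_
  rw [Problem.cApprox, p.ip_potential_mul hy, p.ip_potential_mul hz, ← neg_mul, neg_neg,
    Finset.sum_div, Finset.sum_mul_sum]
  refine Finset.sum_congr rfl fun i _ => Finset.sum_congr rfl fun j _ => ?_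
  rw [Problem.deltaTerm]
  ring

end

end SturmLiouvilleGalerkin

open SturmLiouvilleGalerkin in
theorem theorem1 {S : ℕ} (p : Problem S) (hq : p.UnboundedPotential)
    (R : ℕ → ℝ[X]) (hR : p.IsBasis R)
    (k : ℕ) (lam : ℝ) (hlam : p.IsEigenvalueOfIndex k lam)
    (y : ℝ → ℝ) (hy : p.IsEigenfunction lam y)
    (c : ℕ → ℝ) (hc : HasExpansion R y c)
    (lamN : ℕ → ℝ) (ζ : (N : ℕ) → Fin N → ℝ)
    (hlamN : ∀ᶠ N in atTop, p.IsNumEigenvalueOfIndex R N k (lamN N))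
    (hζ : ∀ᶠ N in atTop, ζ N ≠ 0 ∧ ζ N ∈ p.numEigenspace R N (lamN N)) :
    -- the coefficients of the exact eigenfunction
    ((∀ᶠ n in atTop, 0 < aEntry R n n) ∧
      (∀ n, p.cApprox R y n =
        -∑ i, wip (p.β i) (p.γ i) (fn (R n)) (fun x => p.g i x * y x) / aEntry R n n) ∧
      ((fun n => c n - p.cApprox R y n) =o[atTop]
        fun n => |p.cApprox R y n| + |p.cApprox R y (n + 1)|) ∧
      ((fun n => p.cApprox R y (n + 1)) =O[atTop] p.cApprox R y →
        c ~[atTop] p.cApprox R y) ∧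
      (p.SymmetricBC → (∀ x ∈ Set.Ioo (-1 : ℝ) 1, p.q (-x) = p.q x) →
        c ~[atTop] p.cApprox R y)) ∧
    -- the error of the numerical eigenvalue
    ((∀ᶠ N in atTop, ip (zFun R (ζ N)) y ≠ 0) ∧
      (∀ᶠ N in atTop, Summable fun n : ℕ =>
        c (N + n) * ip (fn (R (N + n))) (fun x => p.q x * zFun R (ζ N) x)) ∧
      ((fun N => lam - lamN N) ~[atTop] fun N =>
        1 / ip (zFun R (ζ N)) y *
          ∑' n : ℕ, c (N + n) * ip (fn (R (N + n))) (fun x => p.q x * zFun R (ζ N) x)) ∧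
      (∀ᶠ N in atTop, ∀ i j, Summable fun n : ℕ =>
        p.deltaTerm R y (zFun R (ζ N)) i j (N + n)) ∧
      ((fun N => lam - lamN N) ~[atTop] fun N =>
        -(1 / ip (zFun R (ζ N)) y * ∑ i, ∑ j, p.delta R y (zFun R (ζ N)) N i j))) := by
  obtain ⟨ξ, η, θ, hB⟩ := hR.exists_coeff
  obtain ⟨hsol, hbc⟩ := hy.isSol
  obtain ⟨τ, h⟩ := hc.exists_coeffRate hB hR.bc hq hsol hbc hy.ne_zero
  have hyc := hsol.cont
  refine ⟨⟨hB.eventually_aEntry.mono fun n h => h.2.2, p.cApprox_eq R hyc, h.isLittleO_sub hB,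
    h.isEquivalent_of_isBigO hB, h.isEquivalent_of_symmetric hB hsol hbc hy.ne_zero⟩, ?_⟩
  simp only [zFun_eq]
  have hlim := tendsto_numEigenvalue hR hlam hlamN
  set z : ℕ → ℝ[X] := fun N => comb R N (ζ N) with hz
  have hzG : IsGalerkin p lamN z := hR.isGalerkin_comb hζ
  have hzc : ∀ N, ContinuousOn (fn (z N)) (Set.Icc (-1) 1) := fun N =>
    (continuous_fn _).continuousOn
  have hne : ∀ᶠ N in atTop, ip (fn (z N)) y ≠ 0 :=
    hzG.eventually_ip_ne_zero (hζ.mono fun N hN => (map_ne_zero_iff _ (hR.comb_injective N)).2 hN.1)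
      hy hlim
  -- the multiple of `z` with the same component along `y` as the partial sum of the expansion
  set κ : ℕ → ℝ := fun N => ip (fn (partialSum R c N)) y / ip (fn (z N)) y with hκ
  have hκ0 : ∀ᶠ N in atTop, κ N ≠ 0 := by
    filter_upwards [hne, (hc.tendsto_ip hyc hyc).eventually_ne hy.ip_self_pos.ne'] with N h1 h2
    exact div_ne_zero h2 h1
  have hwy : ∀ N, ip (fn (κ N • z N)) y = κ N * ip (fn (z N)) y := fun N => by
    rw [fn_smul, ip_comm, ip_const_mul_right, ip_comm]
  have hwF : ∀ N n, ip (fn (R n)) (fun x => p.q x * fn (κ N • z N) x) =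
      κ N * ip (fn (R n)) (fun x => p.q x * fn (z N) x) := fun N n => by
    rw [← ip_const_mul_right]
    refine ip_congr fun x _ => ?_
    rw [fn_smul]; ring
  have hE := h.errorEstimates hR hB hc hy hlim (hzG.smul κ) (by
    filter_upwards [hne] with N h1
    rw [hwy, hκ]
    exact div_mul_cancel₀ _ h1)
  have hscale : ∀ {b : ℕ → ℝ}, ((fun N => (lam - lamN N) * ip (fn (κ N • z N)) y) ~[atTop]
      fun N => ∑' n, b (N + n) * ip (fn (R (N + n))) (fun x => p.q x * fn (κ N • z N) x)) →
      (fun N => lam - lamN N) ~[atTop] fun N => 1 / ip (fn (z N)) y *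
        ∑' n, b (N + n) * ip (fn (R (N + n))) (fun x => p.q x * fn (z N) x) := by
    intro b hb
    refine ((IsEquivalent.refl (u := fun N => 1 / (κ N * ip (fn (z N)) y))).mul hb).congr_left ?_
      |>.congr_right ?_
    · filter_upwards [hne, hκ0] with N h1 h2
      rw [Pi.mul_apply, hwy]
      field_simp
    · filter_upwards [hne, hκ0] with N h1 h2
      simp only [Pi.mul_apply, hwF, mul_left_comm _ (κ N)]
      rw [tsum_mul_left]
      field_simp
  refine ⟨hne, Eventually.of_forall fun N =>
    h.summable_mul_ip hB (p.intervalIntegrable_q_mul (hzc N)) N, hscale hE.equiv_exact,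
    Eventually.of_forall fun N i j => hB.summable_deltaTerm hyc (hzc N) i j N, ?_⟩
  refine (hscale hE.equiv_approx).congr_right (Eventually.of_forall fun N => ?_)
  simp only
  rw [hB.sum_delta hyc (hzc N), mul_neg, neg_neg]
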